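/- Definitions. For $\alpha,\rho>0$, a probability distribution on $\mathbb R^d$ is $(\alpha,\rho)$-semi-product if for $\eta$ drawn from it: (1) each coordinate $\eta_j$ is symmetric about $0$; (2) $\mathbb P(|\eta_j|\le\rho)\ge\alpha$ for each $j$; (3) the random vectors $(\operatorname{sign}\eta_j)_{j\le d}$ and $(|\eta_j|)_{j\le d}$ are independent, and $\operatorname{sign}\eta_1,\dots,\operatorname{sign}\eta_d$ are mutually independent (with $\operatorname{sign}0=0$). It has location $\mu^*\in\mathbb R^d$ if instead the samples have the form $\mu^*+\eta$ with $\mu^*$ deterministic and $\eta$ as above. Points $z_1,\dots,z_n$ are an $\varepsilon$-corruption of $x_1,\dots,x_n$ if $z_i=x_i$ for at least $(1-\varepsilon)n$ indices $i$; the other points are arbitrary and may be chosen with full knowledge of $x_1,\dots,x_n$, of the distribution and of the algorithm. Theorem. There are absolute constants $C,K>0$ and $k\in\mathbb N$ and a single deterministic algorithm (a real-RAM program, with unit-cost real arithmetic $+,-,\times,\div$, comparisons, and integer addressing), whose only inputs are $n$, $d$, the $n$ data points in $\mathbb R^d$, and $\alpha$, such that the following holds. Let $d\ge1$, $\mu^*\in\mathbb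 R^d$, $\alpha,\rho,\varepsilon>0$, $\delta\in(0,1)$, with $\delta\le 1/2$ in case $d=1$, and let $\mathcal D$ be an $(\alpha,\rho)$-semi-product distribution on $\mathbb R^d$ with location $\mu^*$. Assume that $$\sqrt[3]{\varepsilon}\le\frac{\alpha}{C}\qquad\text{and}\qquad n\ \ge\ C\cdot\frac{d\log d+\log(1/\delta)}{\alpha^4\varepsilon^2\log(1/\varepsilon)} .$$ Then on every data set of $n$ points in $\mathbb R^d$ the algorithm halts within $n^{k}$ steps, and with probability at least $1-\delta$ over $n$ i.i.d. samples $x_1,\dots,x_n$ from $\mathcal D$, for every $\varepsilon$-corruption $z_1,\dots,z_n$ of $x_1,\dots,x_n$ the output $\hat\mu$ of the algorithm on $z_1,\dots,z_n$ and $\alpha$ satisfies $$\|\hat\mu-\mu^*\|\ \le\ K\rho\left[\sqrt{\frac{d\log d+\log(1/\delta)}{\alpha^4 n}}+\frac{\varepsilon}{\alpha^3}\sqrt{\log(1/\varepsilon)}\right].$$ -/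

import Mathlib

open MeasureTheory ProbabilityTheory

/-! ### Real random access machine

Programs run on a real RAM: a memory of integer registers `int x` (holding natural numbers) and a
memory of real cells `real a i j` (array number `a`, row `i`, column `j`). Integers may be added,
subtracted (truncated at `0`), compared, and used as addresses; reals may be added, subtracted,
multiplied, divided and compared. The only constants are natural numbers, there is no rounding of
reals to integers, and every elementary operation costs one unit of time. -/

/-- Contents of the two memories. -/
structure RAMState where
  int : ℕ → ℕ
  real : ℕ → ℕ → ℕ → ℝ

/-- Integer expressions. -/
inductive IntExp where
  | lit (k : ℕ)
  | var (x : ℕ)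
  | plus (e₁ e₂ : IntExp)
  | minus (e₁ e₂ : IntExp)

namespace IntExp

/-- Value of an integer expression. -/
def eval (s : RAMState) : IntExp → ℕ
  | lit k => k
  | var x => s.int x
  | plus e₁ e₂ => e₁.eval s + e₂.eval s
  | minus e₁ e₂ => e₁.eval s - e₂.eval s

/-- Evaluation time: the number of nodes of the expression. -/
def cost : IntExp → ℕ
  | lit _ => 1
  | var _ => 1
  | plus e₁ e₂ => e₁.cost + e₂.cost + 1
  | minus e₁ e₂ => e₁.cost + e₂.cost + 1

end IntExp

/-- Real expressions: `ofInt e` is an integer read as a real number, `cell a i j` is a memory cell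
(`i` and `j` are computed addresses). -/
inductive RealExp where
  | ofInt (e : IntExp)
  | cell (a : ℕ) (i j : IntExp)
  | plus (r₁ r₂ : RealExp)
  | minus (r₁ r₂ : RealExp)
  | times (r₁ r₂ : RealExp)
  | divide (r₁ r₂ : RealExp)

namespace RealExp

/-- Value of a real expression; division by zero returns zero. -/
noncomputable def eval (s : RAMState) : RealExp → ℝ
  | ofInt e => (e.eval s : ℝ)
  | cell a i j => s.real a (i.eval s) (j.eval s)
  | plus r₁ r₂ => r₁.eval s + r₂.eval s
  | minus r₁ r₂ => r₁.eval s - r₂.eval s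
  | times r₁ r₂ => r₁.eval s * r₂.eval s
  | divide r₁ r₂ => r₁.eval s / r₂.eval s

/-- Evaluation time: the number of nodes of the expression. -/
def cost : RealExp → ℕ
  | ofInt e => e.cost + 1
  | cell _ i j => i.cost + j.cost + 1
  | plus r₁ r₂ => r₁.cost + r₂.cost + 1
  | minus r₁ r₂ => r₁.cost + r₂.cost + 1
  | times r₁ r₂ => r₁.cost + r₂.cost + 1
  | divide r₁ r₂ => r₁.cost + r₂.cost + 1

end RealExp

/-- Tests: comparisons of integers or of reals, and their Boolean combinations. -/
inductive TestExp where
  | ltInt (e₁ e₂ : IntExp)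
  | ltReal (r₁ r₂ : RealExp)
  | neg (t : TestExp)
  | both (t₁ t₂ : TestExp)

namespace TestExp

/-- Truth of a test. -/
def Holds (s : RAMState) : TestExp → Prop
  | ltInt e₁ e₂ => e₁.eval s < e₂.eval s
  | ltReal r₁ r₂ => r₁.eval s < r₂.eval s
  | neg t => ¬ t.Holds s
  | both t₁ t₂ => t₁.Holds s ∧ t₂.Holds s

/-- Evaluation time: the number of nodes of the test. -/
def cost : TestExp → ℕ
  | ltInt e₁ e₂ => e₁.cost + e₂.cost + 1
  | ltReal r₁ r₂ => r₁.cost + r₂.cost + 1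
  | neg t => t.cost + 1
  | both t₁ t₂ => t₁.cost + t₂.cost + 1

end TestExp

/-- Programs: assignments to integer registers and real cells, sequencing, branching, while loops. -/
inductive RAMProgram where
  | skip
  | setInt (x : ℕ) (e : IntExp)
  | setReal (a : ℕ) (i j : IntExp) (r : RealExp)
  | seq (p q : RAMProgram)
  | branch (t : TestExp) (p q : RAMProgram)
  | loop (t : TestExp) (p : RAMProgram)

namespace RAMState

/-- Overwrite one integer register. -/
def writeInt (s : RAMState) (x v : ℕ) : RAMState where
  int := fun x' => if x' = x then v else s.int x'
  real := s.real

/-- Overwrite one real cell. -/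
noncomputable def writeReal (s : RAMState) (a i j : ℕ) (v : ℝ) : RAMState where
  int := s.int
  real := fun a' i' j' => if a' = a ∧ i' = i ∧ j' = j then v else s.real a' i' j'

end RAMState

/-- `RAMProgram.Runs p s T s'`: started in the state `s`, the program `p` halts after exactly `T`
units of time in the state `s'`. -/
inductive RAMProgram.Runs : RAMProgram → RAMState → ℕ → RAMState → Prop
  | skip (s : RAMState) : Runs .skip s 1 s
  | setInt (s : RAMState) (x : ℕ) (e : IntExp) :
      Runs (.setInt x e) s (e.cost + 1) (s.writeInt x (e.eval s))
  | setReal (s : RAMState) (a : ℕ) (i j : IntExp) (r : RealExp) :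
      Runs (.setReal a i j r) s (i.cost + j.cost + r.cost + 1)
        (s.writeReal a (i.eval s) (j.eval s) (r.eval s))
  | seq {s s₁ s₂ : RAMState} {T₁ T₂ : ℕ} {p q : RAMProgram}
      (hp : Runs p s T₁ s₁) (hq : Runs q s₁ T₂ s₂) : Runs (.seq p q) s (T₁ + T₂) s₂
  | branchTrue {s s₁ : RAMState} {T : ℕ} {t : TestExp} {p : RAMProgram} (q : RAMProgram)
      (ht : t.Holds s) (hp : Runs p s T s₁) : Runs (.branch t p q) s (t.cost + T + 1) s₁
  | branchFalse {s s₁ : RAMState} {T : ℕ} {t : TestExp} (p : RAMProgram) {q : RAMProgram}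
      (ht : ¬ t.Holds s) (hq : Runs q s T s₁) : Runs (.branch t p q) s (t.cost + T + 1) s₁
  | loopTrue {s s₁ s₂ : RAMState} {T₁ T₂ : ℕ} {t : TestExp} {p : RAMProgram}
      (ht : t.Holds s) (hp : Runs p s T₁ s₁) (hl : Runs (.loop t p) s₁ T₂ s₂) :
      Runs (.loop t p) s (t.cost + T₁ + T₂ + 1) s₂
  | loopFalse {s : RAMState} {t : TestExp} (p : RAMProgram)
      (ht : ¬ t.Holds s) : Runs (.loop t p) s (t.cost + 1) s

/-- Programs are deterministic: running time and final state are determined by the start. -/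
theorem RAMProgram.Runs.deterministic {p : RAMProgram} {s s₁ s₂ : RAMState} {T₁ T₂ : ℕ}
    (h₁ : p.Runs s T₁ s₁) (h₂ : p.Runs s T₂ s₂) : T₁ = T₂ ∧ s₁ = s₂ := by
  induction h₁ generalizing T₂ s₂ with
  | skip s => cases h₂; exact ⟨rfl, rfl⟩
  | setInt s x e => cases h₂; exact ⟨rfl, rfl⟩
  | setReal s a i j r => cases h₂; exact ⟨rfl, rfl⟩
  | seq hp hq ihp ihq =>
    cases h₂ with
    | seq hp' hq' =>
      obtain ⟨rfl, rfl⟩ := ihp hp'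
      obtain ⟨rfl, rfl⟩ := ihq hq'
      exact ⟨rfl, rfl⟩
  | branchTrue q ht hp ih =>
    cases h₂ with
    | branchTrue _ _ hp' => obtain ⟨rfl, rfl⟩ := ih hp'; exact ⟨rfl, rfl⟩
    | branchFalse _ ht' _ => exact absurd ht ht'
  | branchFalse p ht hq ih =>
    cases h₂ with
    | branchTrue _ ht' _ => exact absurd ht' ht
    | branchFalse _ _ hq' => obtain ⟨rfl, rfl⟩ := ih hq'; exact ⟨rfl, rfl⟩
  | loopTrue ht hp hl ihp ihl =>
    cases h₂ with
    | loopTrue _ hp' hl' =>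
      obtain ⟨rfl, rfl⟩ := ihp hp'
      obtain ⟨rfl, rfl⟩ := ihl hl'
      exact ⟨rfl, rfl⟩
    | loopFalse _ ht' => exact absurd ht ht'
  | loopFalse p ht =>
    cases h₂ with
    | loopTrue ht' _ _ => exact absurd ht' ht
    | loopFalse _ _ => exact ⟨rfl, rfl⟩

/-! ### Estimators as programs -/

/-- Start state for a data set `z` of `n` points in `ℝ^d` and a real parameter `α`: the integer
registers `0` and `1` hold `n` and `d`, array `0` holds the data (point `i` in row `i`), cell
`(0, 0)` of array `1` holds `α`, and everything else is zero. -/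
noncomputable def inputState {n d : ℕ} (α : ℝ) (z : Fin n → EuclideanSpace ℝ (Fin d)) :
    RAMState where
  int := fun x => if x = 0 then n else if x = 1 then d else 0
  real := fun a i j =>
    if a = 0 then (if h : i < n ∧ j < d then z ⟨i, h.1⟩ ⟨j, h.2⟩ else 0)
    else if a = 1 ∧ i = 0 ∧ j = 0 then α else 0

/-- The output vector: the first `d` cells of row `0` of array `2`. -/
noncomputable def outputVector (d : ℕ) (s : RAMState) : EuclideanSpace ℝ (Fin d) :=
  WithLp.toLp 2 fun j : Fin d => s.real 2 0 j

/-- `EstimatesTo p α z T v`: on the input `z`, `α`, the program `p` halts after `T` units of time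
with the output vector `v`. -/
def RAMProgram.EstimatesTo (p : RAMProgram) {n d : ℕ} (α : ℝ)
    (z : Fin n → EuclideanSpace ℝ (Fin d)) (T : ℕ) (v : EuclideanSpace ℝ (Fin d)) : Prop :=
  ∃ s : RAMState, p.Runs (inputState α z) T s ∧ outputVector d s = v

/-! ### The statistical model -/

/-- `z` is an `ε`-corruption of `x`: the two agree on at least a `(1 - ε)`-fraction of the indices,
and are otherwise unrelated. -/
def IsCorruption {n : ℕ} {E : Type*} (ε : ℝ) (x z : Fin n → E) : Prop :=
  (1 - ε) * (n : ℝ) ≤ (Set.ncard {i : Fin n | z i = x i} : ℝ)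

/-- `(α, ρ)`-semi-product distributions on `ℝ^d`. -/
structure IsSemiProduct {d : ℕ} (α ρ : ℝ) (D : Measure (EuclideanSpace ℝ (Fin d))) : Prop where
  isProbabilityMeasure : IsProbabilityMeasure D
  symmetric : ∀ j : Fin d, D.map (fun η => -(η j)) = D.map (fun η => η j)
  small_noise : ∀ j : Fin d, ENNReal.ofReal α ≤ D {η | |η j| ≤ ρ}
  indep_sign_abs :
    IndepFun (fun η (j : Fin d) => Real.sign (η j)) (fun η (j : Fin d) => |η j|) D
  indep_signs : iIndepFun (fun (j : Fin d) η => Real.sign (η j)) D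

/-- `D` is the law of `μ + η`, where `η` has an `(α, ρ)`-semi-product distribution. -/
def IsSemiProductWithLocation {d : ℕ} (α ρ : ℝ) (μ : EuclideanSpace ℝ (Fin d))
    (D : Measure (EuclideanSpace ℝ (Fin d))) : Prop :=
  ∃ D₀ : Measure (EuclideanSpace ℝ (Fin d)), IsSemiProduct α ρ D₀ ∧ D = D₀.map (fun η => μ + η)

/-! Probability. A semi-product noise vector is a vector of absolute values multiplied by
independent symmetric signs, so its law is invariant under flipping signs (`map_signFlip_zero`).
Every probability is therefore an average over sign flips of a fixed sample
(`measure_le_of_signFlips`), and no moments of the noise are needed. Residuals are rescaled and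
clipped coordinatewise. For every scale `h` the clipped noise is a sign times a monotone function of
the absolute value, hence a mixture of signed threshold indicators. The statistics in use are convex
in each coordinate, so `n + 1` threshold patterns per coordinate control all scales at once
(`le_of_forall_signedPattern`), including scales that the adversary influences. Exponential moments
of sign sums and of sign chaos, with a union bound over patterns and a grid of directions, give
`NoiseBounds`. With `l = log (1/ε)`: sums of clipped noise are small, the part of the squared
projections above `8 l` has total at most `n ε l`, and the off-diagonal second moments are at most
`n ε l` in every direction. The diagonal depends on the unknown distribution, while the off-diagonal
part averages to zero over the signs; this replaces a known covariance.

Estimation. Empirical quantiles at the levels `1/2 ± α/4` enclose the location and lie within `ρ` of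
it; their distance `L` is the scale. Given weights, bisection finds a center `c` at which the
weighted clipped residuals nearly cancel in each coordinate. Test this balance against the
displacement `s = (μ - c) / (4 L)`. The points close to the location produce a drift of at least
`(α/4) n |s|²`. Clean fluctuations and removed weight contribute order `n |s| ε √l`. By
Cauchy–Schwarz the corrupted points contribute at most `n |s|` times the root of `ε` times a bound
on second moments, governed by the top eigenvalue `lam` of the off-diagonal second-moment matrix
(`Snapshot.sq_radius_le`). Hence a small `lam` certifies the center (`radius_le_of_certificate`). A
large `lam` must come from corrupted points (`le_of_radius_bound`,
`Snapshot.sum_score_good_le_bad`); then down-weighting the points of largest score removes at least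
as much bad as good weight and makes one more weight vanish (`downweight`). So `n + 1` iterations
suffice. The eigenvalue is read off the matrix power `2 ^ n`, obtained by repeated squaring
(`Matrix.PosSemidef.dotProduct_mulVec_le_of_pow`).

Unknown `ε`. Stages try `e = 2^(-k)`, with `k` in place of `log (1/ε)`, and overwrite the output
only when the certificate holds. The stage with `2^(-k)` comparable to `ε` succeeds; at smaller `e`
the certificate is still sound, so later overwriting is harmless (`CorruptedSample.iteration_step`,
`CorruptedSample.estimator_accurate`).

Machine. The estimator is written in a small language of array assignments whose meaning is a
function on arrays. `ArrayProgram.runs_compile` shows by induction that compiled programs compute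
this function in polynomial time. -/

/-! ### Averages over sign patterns -/

/-- The sign `1` or `-1` encoded by a Boolean. -/
noncomputable def signValue (b : Bool) : ℝ := cond b 1 (-1)

@[simp] theorem signValue_true : signValue true = 1 := rfl
@[simp] theorem signValue_false : signValue false = -1 := rfl

theorem signValue_sq (b : Bool) : signValue b ^ 2 = 1 := by cases b <;> simp

theorem abs_signValue (b : Bool) : |signValue b| = 1 := by cases b <;> simp

theorem sum_signs_succ {d : ℕ} (F : (Fin (d + 1) → Bool) → ℝ) :
    ∑ s, F s = ∑ s : Fin d → Bool, (F (Fin.cons true s) + F (Fin.cons false s)) := by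
  rw [← (Fin.consEquiv (fun _ => Bool)).sum_comp, Fintype.sum_prod_type]
  simp [Finset.sum_add_distrib, Fin.consEquiv]

theorem exp_add_exp_neg_le (x : ℝ) : Real.exp x + Real.exp (-x) ≤ 2 * Real.exp (x ^ 2 / 2) := by
  have := Real.cosh_le_exp_half_sq x
  rw [Real.cosh_eq] at this
  linarith

/-- Exponential moments of a Rademacher chaos of order two. -/
theorem sum_exp_chaos_le {d : ℕ} (b : Fin d → ℝ) (l m : ℝ) (hm : 0 ≤ m)
    (h : |l| * (1 + 2 * m * ∑ j, b j ^ 2) ≤ m) :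
    ∑ s : Fin d → Bool, Real.exp (l * ((∑ j, signValue (s j) * b j) ^ 2 - ∑ j, b j ^ 2))
      ≤ 2 ^ d * Real.exp (2 * m ^ 2 * (∑ j, b j ^ 2) ^ 2) := by
  induction d generalizing l with
  | zero => simp
  | succ d ih =>
    rw [sum_signs_succ]
    simp only [Fin.sum_univ_succ, Fin.cons_zero, Fin.cons_succ, signValue_true,
      signValue_false] at h ⊢
    set S : ℝ := ∑ j : Fin d, b j.succ ^ 2 with hS
    have hS0 : 0 ≤ S := Finset.sum_nonneg fun _ _ => sq_nonneg _
    -- Average over the first sign: `cosh x ≤ exp (x²/2)` turns the cross term `2 l b₀ B` into a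
    -- multiple of `B²`, so the shorter chaos reappears with `l` raised to `l + 2 l² b₀²`.
    have key : ∀ s : Fin d → Bool,
        Real.exp (l * ((1 * b 0 + ∑ j, signValue (s j) * b j.succ) ^ 2 - (b 0 ^ 2 + S)))
          + Real.exp (l * ((-1 * b 0 + ∑ j, signValue (s j) * b j.succ) ^ 2 - (b 0 ^ 2 + S)))
        ≤ 2 * Real.exp (2 * l ^ 2 * b 0 ^ 2 * S) * Real.exp ((l + 2 * l ^ 2 * b 0 ^ 2)
            * ((∑ j, signValue (s j) * b j.succ) ^ 2 - S)) := by
      intro s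
      set B : ℝ := ∑ j, signValue (s j) * b j.succ
      have h1 := exp_add_exp_neg_le (2 * l * b 0 * B)
      have e1 : l * ((1 * b 0 + B) ^ 2 - (b 0 ^ 2 + S)) = l * (B ^ 2 - S) + 2 * l * b 0 * B := by
        ring
      have e2 : l * ((-1 * b 0 + B) ^ 2 - (b 0 ^ 2 + S)) = l * (B ^ 2 - S) + -(2 * l * b 0 * B) := by
        ring
      rw [e1, e2, Real.exp_add, Real.exp_add, ← mul_add]
      calc _ ≤ Real.exp (l * (B ^ 2 - S)) * (2 * Real.exp ((2 * l * b 0 * B) ^ 2 / 2)) := by gcongr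
        _ = _ := by
          rw [mul_left_comm, ← Real.exp_add, mul_assoc 2 (Real.exp _), ← Real.exp_add]
          ring_nf
    have hq : 0 ≤ 1 + 2 * m * S := by positivity
    -- The hypothesis on `l` is built to reproduce itself: the factor `1 + 2 m ∑ b²` loses `2 m
    -- b₀²`, and this pays for the growth of `l`.
    have hl' : |l + 2 * l ^ 2 * b 0 ^ 2| * (1 + 2 * m * S) ≤ m := by
      have h1 : |l + 2 * l ^ 2 * b 0 ^ 2| ≤ |l| * (1 + 2 * |l| * b 0 ^ 2) := by
        refine (abs_add_le _ _).trans (le_of_eq ?_)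
        rw [abs_of_nonneg (by positivity : 0 ≤ 2 * l ^ 2 * b 0 ^ 2), ← sq_abs l]
        ring
      refine (mul_le_mul_of_nonneg_right h1 hq).trans ?_
      set q : ℝ := 1 + 2 * m * S with hqdef
      set t : ℝ := 2 * m * b 0 ^ 2 with ht
      have ht0 : 0 ≤ t := by positivity
      have h' : |l| * (q + t) ≤ m := by
        refine le_trans (le_of_eq ?_) h
        rw [hqdef, ht]; ring
      have hq1 : 1 ≤ q := by rw [hqdef]; nlinarith [mul_nonneg hm hS0]
      have ha := abs_nonneg l
      have h2 : 2 * |l| * b 0 ^ 2 * (q + t) ≤ t := by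
        have := mul_le_mul_of_nonneg_left h' (by positivity : 0 ≤ 2 * b 0 ^ 2)
        rw [ht]; rw [ht] at this; linarith
      have h3 : (|l| * (1 + 2 * |l| * b 0 ^ 2) * q) * (q + t) ^ 2 ≤ m * (q + t) ^ 2 := by
        have h4 : (1 + 2 * |l| * b 0 ^ 2) * (q + t) ≤ q + 2 * t := by linarith
        calc (|l| * (1 + 2 * |l| * b 0 ^ 2) * q) * (q + t) ^ 2
            = (|l| * (q + t)) * ((1 + 2 * |l| * b 0 ^ 2) * (q + t)) * q := by ring
          _ ≤ m * (q + 2 * t) * q := by gcongr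
          _ ≤ m * (q + t) ^ 2 := by nlinarith [mul_nonneg hm (sq_nonneg t)]
      exact le_of_mul_le_mul_right h3 (by positivity)
    calc _ ≤ ∑ s : Fin d → Bool, 2 * Real.exp (2 * l ^ 2 * b 0 ^ 2 * S) *
            Real.exp ((l + 2 * l ^ 2 * b 0 ^ 2)
            * ((∑ j, signValue (s j) * b j.succ) ^ 2 - S)) := Finset.sum_le_sum fun s _ => key s
      _ ≤ 2 * Real.exp (2 * l ^ 2 * b 0 ^ 2 * S) * (2 ^ d * Real.exp (2 * m ^ 2 * S ^ 2)) := by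
        rw [← Finset.mul_sum]
        gcongr
        exact ih (fun j => b j.succ) _ hl'
      _ = 2 ^ (d + 1) * Real.exp (2 * l ^ 2 * b 0 ^ 2 * S + 2 * m ^ 2 * S ^ 2) := by
        rw [Real.exp_add]; ring
      _ ≤ _ := by
        gcongr
        have hlm : l ^ 2 ≤ m ^ 2 := by
          rw [sq_le_sq, abs_of_nonneg hm]
          refine le_trans ?_ h
          have : 0 ≤ 2 * m * (b 0 ^ 2 + S) := by positivity
          nlinarith [abs_nonneg l]
        have h0 : 0 ≤ b 0 ^ 2 * S := by positivity
        have h1 : l ^ 2 * (b 0 ^ 2 * S) ≤ m ^ 2 * (b 0 ^ 2 * S) :=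
          mul_le_mul_of_nonneg_right hlm h0
        have h2 : 0 ≤ m ^ 2 * (b 0 ^ 2) ^ 2 := by positivity
        have h3 : 0 ≤ m ^ 2 * (b 0 ^ 2 * S) := by positivity
        nlinarith

theorem sum_exp_chaos_le_of_sum_le_one {d : ℕ} (b : Fin d → ℝ) (hb : ∑ j, b j ^ 2 ≤ 1) (l : ℝ)
    (hl : |l| ≤ 1 / 4) :
    ∑ s : Fin d → Bool, Real.exp (l * ((∑ j, signValue (s j) * b j) ^ 2 - ∑ j, b j ^ 2))
      ≤ 2 ^ d * Real.exp (8 * l ^ 2) := by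
  have h0 : 0 ≤ ∑ j, b j ^ 2 := Finset.sum_nonneg fun _ _ => sq_nonneg _
  have ha := abs_nonneg l
  -- For `m = 2 |l|` the hypothesis amounts to `4 |l| ∑ b² ≤ 1`, which is where `|l| ≤ 1/4` enters.
  refine (sum_exp_chaos_le b l (2 * |l|) (by positivity) ?_).trans ?_
  · have : 2 * (2 * |l|) * ∑ j, b j ^ 2 ≤ 1 := by nlinarith
    nlinarith
  · refine mul_le_mul_of_nonneg_left (Real.exp_le_exp.2 ?_) (by positivity)
    rw [mul_pow, sq_abs]
    have : (∑ j, b j ^ 2) ^ 2 ≤ 1 := pow_le_one₀ h0 hb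
    nlinarith [sq_nonneg l]

/-- Since `exp (max 0 x) ≤ 1 + exp x`, rows below the level `t` cost nothing, and the chaos bound at
`l = 1/4` shows that those above it add only `exp (3/4 - t/4)`. With `t` a multiple of `log (1/ε)`
even `n` rows together cost little. -/
theorem sum_exp_excess_le {d : ℕ} (b : Fin d → ℝ) (hb : ∑ j, b j ^ 2 ≤ 1) (t : ℝ) :
    ∑ s : Fin d → Bool, Real.exp (max 0 ((∑ j, signValue (s j) * b j) ^ 2 - t) / 4)
      ≤ 2 ^ d * Real.exp (Real.exp (3 / 4 - t / 4)) := by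
  have h := sum_exp_chaos_le_of_sum_le_one b hb (1 / 4) (by norm_num)
  calc _ ≤ ∑ s : Fin d → Bool, (1 + Real.exp (1 / 4 - t / 4) *
        Real.exp (1 / 4 * ((∑ j, signValue (s j) * b j) ^ 2 - ∑ j, b j ^ 2))) := by
        refine Finset.sum_le_sum fun s _ => ?_
        rw [← Real.exp_add]
        rcases le_total ((∑ j, signValue (s j) * b j) ^ 2 - t) 0 with h1 | h1
        · rw [max_eq_left h1]
          simp [Real.exp_nonneg]
        · rw [max_eq_right h1]
          have : Real.exp (((∑ j, signValue (s j) * b j) ^ 2 - t) / 4) ≤ Real.exp (1 / 4 - t / 4 +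
            1 / 4 * ((∑ j, signValue (s j) * b j) ^ 2 - ∑ j, b j ^ 2)) := by
            gcongr; linarith
          linarith
    _ ≤ 2 ^ d + Real.exp (1 / 4 - t / 4) * (2 ^ d * Real.exp (8 * (1 / 4) ^ 2)) := by
        rw [Finset.sum_add_distrib, ← Finset.mul_sum]
        gcongr
        simp
    _ = 2 ^ d * (Real.exp (3 / 4 - t / 4) + 1) := by
        rw [mul_left_comm, ← Real.exp_add]; ring_nf
    _ ≤ _ := by gcongr; exact Real.add_one_le_exp _

/-- Independence of the rows of a matrix of signs. -/
theorem sum_prod_rows {n d : ℕ} (F : Fin n → (Fin d → Bool) → ℝ) :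
    ∑ S : Fin n → Fin d → Bool, ∏ i, F i (S i) = ∏ i, ∑ s, F i s := by
  rw [Finset.prod_univ_sum, Fintype.piFinset_univ]

theorem sum_exp_rows_le {n d : ℕ} (F : Fin n → (Fin d → Bool) → ℝ) (c : ℝ)
    (h : ∀ i, ∑ s, Real.exp (F i s) ≤ 2 ^ d * Real.exp c) :
    ∑ S : Fin n → Fin d → Bool, Real.exp (∑ i, F i (S i)) ≤ 2 ^ (n * d) * Real.exp (n * c) := by
  simp only [Real.exp_sum]
  rw [sum_prod_rows (fun i s => Real.exp (F i s))]
  calc _ ≤ ∏ _i : Fin n, (2 ^ d * Real.exp c) :=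
        Finset.prod_le_prod (fun i _ => Finset.sum_nonneg fun _ _ => Real.exp_nonneg _)
          fun i _ => h i
    _ = _ := by
      rw [Finset.prod_const, Finset.card_univ, Fintype.card_fin, mul_pow, ← pow_mul, mul_comm d n,
        Real.exp_nat_mul]

open Classical in
theorem card_filter_le_sum_exp {ι : Type*} [Fintype ι] (G : ι → ℝ) (x : ℝ) :
    ((Finset.univ.filter fun s => x ≤ G s).card : ℝ) ≤ Real.exp (-x) * ∑ s, Real.exp (G s) := by
  rw [Finset.card_filter, Nat.cast_sum, Finset.mul_sum]
  refine Finset.sum_le_sum fun s _ => ?_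
  rw [← Real.exp_add]
  split_ifs with h
  · simpa using by linarith
  · simpa using Real.exp_nonneg _

/-! ### A maximal inequality for threshold sums -/

-- Exponential form of Doob's inequality, by induction on the first sign. For `x > 0` the empty
-- prefix cannot reach `x`, so the first summand is used and the target moves to `x ∓ g 0`;
-- averaging the two exponentials costs `exp (l²/2)`. The maximum over prefixes costs no more than a
-- single sum.
open Classical in
theorem card_prefix_sum_ge {n : ℕ} (g : Fin n → ℝ) (hg : ∀ i, |g i| ≤ 1) (l : ℝ) (hl : 0 ≤ l)
    (x : ℝ) :
    ∑ s : Fin n → Bool, (if ∃ k : ℕ, x ≤ ∑ i : Fin n, (if (i : ℕ) < k then signValue (s i) * g i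
      else 0) then (1 : ℝ) else 0) ≤ 2 ^ n * Real.exp (-(l * x) + n * (l ^ 2 / 2)) := by
  induction n generalizing x with
  | zero =>
    simp only [Finset.univ_eq_empty, Finset.sum_empty, Finset.univ_unique, Finset.sum_const,
      Finset.card_singleton, exists_const, CharP.cast_eq_zero, zero_mul, add_zero, pow_zero,
      one_mul, one_smul]
    split_ifs with h
    · rw [Real.one_le_exp_iff]; nlinarith
    · exact Real.exp_nonneg _
  | succ n ih =>
    rcases le_or_gt x 0 with hx | hx
    · calc _ ≤ ∑ _s : Fin (n + 1) → Bool, (1 : ℝ) :=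
            Finset.sum_le_sum fun s _ => by split_ifs <;> norm_num
        _ = 2 ^ (n + 1) * 1 := by simp
        _ ≤ _ := by
          gcongr
          rw [Real.one_le_exp_iff]
          have : 0 ≤ ((n + 1 : ℕ) : ℝ) * (l ^ 2 / 2) := by positivity
          nlinarith
    · rw [sum_signs_succ]
      have step : ∀ (b : Bool) (s : Fin n → Bool),
          (if ∃ k : ℕ, x ≤ ∑ i : Fin (n + 1), (if (i : ℕ) < k then
            signValue ((Fin.cons b s : Fin (n + 1) → Bool) i) * g i else 0) then (1 : ℝ) else 0)
          ≤ (if ∃ k : ℕ, x - signValue b * g 0 ≤ ∑ i : Fin n, (if (i : ℕ) < k then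
            signValue (s i) * g i.succ else 0) then (1 : ℝ) else 0) := by
        intro b s
        split_ifs with h1 h2 h2
        · rfl
        · exfalso
          apply h2
          obtain ⟨k, hk⟩ := h1
          cases k with
          | zero => simp at hk; linarith
          | succ k =>
            refine ⟨k, ?_⟩
            rw [Fin.sum_univ_succ] at hk
            simp at hk
            linarith
        · norm_num
        · rfl
      calc _ ≤ ∑ s : Fin n → Bool,
            ((if ∃ k : ℕ, x - signValue true * g 0 ≤ ∑ i : Fin n, (if (i : ℕ) < k then
              signValue (s i) * g i.succ else 0) then (1 : ℝ) else 0)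
            + (if ∃ k : ℕ, x - signValue false * g 0 ≤ ∑ i : Fin n, (if (i : ℕ) < k then
              signValue (s i) * g i.succ else 0) then (1 : ℝ) else 0)) :=
            Finset.sum_le_sum fun s _ => add_le_add (step true s) (step false s)
        _ ≤ 2 ^ n * Real.exp (-(l * (x - signValue true * g 0)) + n * (l ^ 2 / 2))
            + 2 ^ n * Real.exp (-(l * (x - signValue false * g 0)) + n * (l ^ 2 / 2)) := by
            rw [Finset.sum_add_distrib]
            exact add_le_add (ih (fun i => g i.succ) (fun i => hg _) _)
              (ih (fun i => g i.succ) (fun i => hg _) _)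
        _ = 2 ^ n * Real.exp (-(l * x) + n * (l ^ 2 / 2)) *
            (Real.exp (l * g 0) + Real.exp (-(l * g 0))) := by
            rw [mul_add, mul_assoc, mul_assoc, ← Real.exp_add, ← Real.exp_add]
            simp only [signValue_true, signValue_false]
            ring_nf
        _ ≤ 2 ^ n * Real.exp (-(l * x) + n * (l ^ 2 / 2)) * (2 * Real.exp (l ^ 2 / 2)) := by
            gcongr
            refine (exp_add_exp_neg_le _).trans
              (mul_le_mul_of_nonneg_left (Real.exp_le_exp.2 ?_) (by norm_num))
            rw [mul_pow]
            have : g 0 ^ 2 ≤ 1 := by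
              rw [← sq_abs]; exact pow_le_one₀ (abs_nonneg _) (hg 0)
            nlinarith [sq_nonneg l]
        _ = _ := by
            rw [mul_mul_mul_comm, ← pow_succ, ← Real.exp_add]
            push_cast
            ring_nf

-- Sorting the indices by decreasing `a` turns each set of indices above a threshold into a prefix,
-- and a permutation of the signs does not change the count.
open Classical in
theorem card_threshold_sum_ge {n : ℕ} (g a : Fin n → ℝ) (hg : ∀ i, |g i| ≤ 1) (l : ℝ) (hl : 0 ≤ l)
    (x : ℝ) :
    ∑ s : Fin n → Bool, (if ∃ θ : ℝ, x ≤ ∑ i : Fin n, (if θ ≤ a i then signValue (s i) * g i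
      else 0) then (1 : ℝ) else 0) ≤ 2 ^ n * Real.exp (-(l * x) + n * (l ^ 2 / 2)) := by
  set e := Tuple.sort (fun i => -a i) with he
  have hmono : Monotone ((fun i => -a i) ∘ e) := Tuple.monotone_sort _
  refine le_trans ?_ (card_prefix_sum_ge (g ∘ e) (fun i => hg _) l hl x)
  rw [← (Equiv.arrowCongr e (Equiv.refl Bool)).sum_comp]
  refine Finset.sum_le_sum fun s _ => ?_
  split_ifs with h1 h2 h2
  · rfl
  · exfalso
    apply h2
    obtain ⟨θ, hθ⟩ := h1
    have hex : ∃ m : ℕ, ∀ i : Fin n, m ≤ i → ¬ θ ≤ a (e i) :=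
      ⟨n, fun i hi => absurd i.2 (by omega)⟩
    refine ⟨Nat.find hex, hθ.trans (le_of_eq ?_)⟩
    rw [← Equiv.sum_comp e (fun i => if θ ≤ a i then
      signValue ((Equiv.arrowCongr e (Equiv.refl Bool)) s i) * g i else 0)]
    refine Finset.sum_congr rfl fun i _ => ?_
    have : θ ≤ a (e i) ↔ (i : ℕ) < Nat.find hex := by
      constructor
      · intro h
        by_contra h'
        exact Nat.find_spec hex i (by omega) h
      · intro h
        have := Nat.find_min hex h
        push Not at this
        obtain ⟨i', hi', hi''⟩ := this
        have := hmono (show i ≤ i' from hi')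
        simp at this
        linarith
    simp [this, Equiv.arrowCongr]
  · norm_num
  · rfl

/-- Sum of the signed values above the threshold `a o`; there is none above the threshold `none`. -/
noncomputable def thresholdSum {n : ℕ} (a g : Fin n → ℝ) (o : Option (Fin n)) : ℝ :=
  o.elim 0 fun k => ∑ i, if a k ≤ a i then g i else 0

/-- Largest absolute value of a threshold sum. -/
noncomputable def maxThresholdSum {n : ℕ} (a g : Fin n → ℝ) : ℝ :=
  ⨆ o : Option (Fin n), |thresholdSum a g o|

theorem abs_thresholdSum_le_max {n : ℕ} (a g : Fin n → ℝ) (o : Option (Fin n)) :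
    |thresholdSum a g o| ≤ maxThresholdSum a g :=
  le_ciSup (f := fun o => |thresholdSum a g o|) (Set.finite_range _).bddAbove o

theorem maxThresholdSum_nonneg {n : ℕ} (a g : Fin n → ℝ) : 0 ≤ maxThresholdSum a g :=
  (abs_nonneg _).trans (abs_thresholdSum_le_max a g none)

theorem maxThresholdSum_le {n : ℕ} (a g : Fin n → ℝ) (hg : ∀ i, |g i| ≤ 1) :
    maxThresholdSum a g ≤ n := by
  refine ciSup_le fun o => ?_
  cases o with
  | none => simp [thresholdSum]
  | some k =>
    simp only [thresholdSum, Option.elim]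
    calc |∑ i, if a k ≤ a i then g i else 0| ≤ ∑ i, |if a k ≤ a i then g i else 0| :=
          Finset.abs_sum_le_sum_abs _ _
      _ ≤ ∑ _i : Fin n, (1 : ℝ) := by
          refine Finset.sum_le_sum fun i _ => ?_
          split_ifs
          · exact hg i
          · simp
      _ = n := by simp

open Classical in
theorem card_maxThresholdSum_ge {n : ℕ} (g a : Fin n → ℝ) (hg : ∀ i, |g i| ≤ 1) (l : ℝ)
    (hl : 0 ≤ l) (x : ℝ) :
    ∑ s : Fin n → Bool, (if x ≤ maxThresholdSum a (fun i => signValue (s i) * g i)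
      then (1 : ℝ) else 0) ≤ 2 * (2 ^ n * Real.exp (-(l * x) + n * (l ^ 2 / 2))) := by
  rcases le_or_gt x 0 with hx | hx
  · calc _ ≤ ∑ _s : Fin n → Bool, (1 : ℝ) :=
          Finset.sum_le_sum fun s _ => by split_ifs <;> norm_num
      _ = 2 ^ n * 1 := by simp
      _ ≤ 2 ^ n * Real.exp (-(l * x) + n * (l ^ 2 / 2)) := by
        gcongr
        rw [Real.one_le_exp_iff]
        have : 0 ≤ (n : ℝ) * (l ^ 2 / 2) := by positivity
        nlinarith
      _ ≤ _ := by
        have : 0 ≤ 2 ^ n * Real.exp (-(l * x) + n * (l ^ 2 / 2)) := by positivity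
        linarith
  have h1 := card_threshold_sum_ge g a hg l hl x
  have h2 := card_threshold_sum_ge (fun i => -g i) a (by simpa using hg) l hl x
  rw [two_mul]
  refine le_trans ?_ (add_le_add h1 h2)
  rw [← Finset.sum_add_distrib]
  refine Finset.sum_le_sum fun s _ => ?_
  by_cases h : x ≤ maxThresholdSum a (fun i => signValue (s i) * g i)
  · rw [if_pos h]
    obtain ⟨o, ho⟩ := exists_eq_ciSup_of_finite
      (f := fun o : Option (Fin n) => |thresholdSum a (fun i => signValue (s i) * g i) o|)
    have hx' : x ≤ |thresholdSum a (fun i => signValue (s i) * g i) o| := h.trans ho.ge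
    cases o with
    | none => simp [thresholdSum] at hx'; linarith
    | some k =>
      simp only [thresholdSum, Option.elim] at hx'
      rcases le_abs.1 hx' with h3 | h3
      · have : ∃ θ : ℝ, x ≤ ∑ i : Fin n, (if θ ≤ a i then signValue (s i) * g i else 0) := ⟨_, h3⟩
        rw [if_pos this]
        split_ifs <;> norm_num
      · have : ∃ θ : ℝ, x ≤ ∑ i : Fin n, (if θ ≤ a i then signValue (s i) * -g i else 0) := by
          refine ⟨a k, h3.trans (le_of_eq ?_)⟩
          rw [← Finset.sum_neg_distrib]
          refine Finset.sum_congr rfl fun i _ => ?_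
          split_ifs <;> ring
        rw [if_pos this]
        split_ifs <;> norm_num
  · rw [if_neg h]
    positivity

/-- The maximum over all thresholds is sub-Gaussian at scale `√n`. No union bound over thresholds is
made, so the linear statistics lose no factor `log n`. The values of the maximum are sliced into
layers of width `√n`. -/
theorem sum_exp_sq_maxThresholdSum_le {n : ℕ} (hn : 1 ≤ n) (g a : Fin n → ℝ)
    (hg : ∀ i, |g i| ≤ 1) :
    ∑ s : Fin n → Bool, Real.exp (maxThresholdSum a (fun i => signValue (s i) * g i) ^ 2 / (8 * n))
      ≤ 2 ^ n * Real.exp 3 := by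
  classical
  have hn0 : (0 : ℝ) < n := by exact_mod_cast hn
  have hsq : 0 < Real.sqrt n := Real.sqrt_pos.2 hn0
  have hsq2 : Real.sqrt n ^ 2 = n := Real.sq_sqrt hn0.le
  have hsq1 : 1 ≤ Real.sqrt n := by rw [Real.one_le_sqrt]; exact_mod_cast hn
  set M : (Fin n → Bool) → ℝ := fun s => maxThresholdSum a (fun i => signValue (s i) * g i) with hM
  have hg' : ∀ s : Fin n → Bool, ∀ i, |signValue (s i) * g i| ≤ 1 := fun s i => by
    rw [abs_mul, abs_signValue, one_mul]; exact hg i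
  have hM0 : ∀ s, 0 ≤ M s := fun s => maxThresholdSum_nonneg _ _
  have hMn : ∀ s, M s ≤ n := fun s => maxThresholdSum_le _ _ (hg' s)
  have pt : ∀ s, Real.exp (M s ^ 2 / (8 * n)) ≤ ∑ k ∈ Finset.range (n + 1),
      (if (k * Real.sqrt n : ℝ) ≤ M s then (1 : ℝ) else 0) * Real.exp (((k : ℝ) + 1) ^ 2 / 8) := by
    intro s
    set k := ⌊M s / Real.sqrt n⌋₊ with hk
    have hk1 : (k : ℝ) ≤ M s / Real.sqrt n := Nat.floor_le (div_nonneg (hM0 s) hsq.le)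
    have hk2 : M s / Real.sqrt n < k + 1 := Nat.lt_floor_add_one _
    have hkn : k ∈ Finset.range (n + 1) := by
      rw [Finset.mem_range]
      have : (k : ℝ) ≤ n := hk1.trans ((div_le_self (hM0 s) hsq1).trans (hMn s))
      have : k ≤ n := by exact_mod_cast this
      omega
    refine le_trans ?_ (Finset.single_le_sum (f := fun k : ℕ =>
      (if (k * Real.sqrt n : ℝ) ≤ M s then (1 : ℝ) else 0) * Real.exp (((k : ℝ) + 1) ^ 2 / 8))
      (fun k _ => by positivity) hkn)
    rw [if_pos ((le_div_iff₀ hsq).1 hk1), one_mul]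
    refine Real.exp_le_exp.2 ?_
    have : M s ^ 2 / n ≤ (k + 1) ^ 2 := by
      rw [← hsq2, ← div_pow]
      exact pow_le_pow_left₀ (div_nonneg (hM0 s) hsq.le) hk2.le 2
    calc M s ^ 2 / (8 * n) = M s ^ 2 / n / 8 := by ring
      _ ≤ _ := by gcongr
  calc _ ≤ ∑ s, ∑ k ∈ Finset.range (n + 1),
        (if (k * Real.sqrt n : ℝ) ≤ M s then (1 : ℝ) else 0) * Real.exp (((k : ℝ) + 1) ^ 2 / 8) :=
        Finset.sum_le_sum fun s _ => pt s
    _ = ∑ k ∈ Finset.range (n + 1), Real.exp (((k : ℝ) + 1) ^ 2 / 8) * ∑ s,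
        (if (k * Real.sqrt n : ℝ) ≤ M s then (1 : ℝ) else 0) := by
        rw [Finset.sum_comm]
        refine Finset.sum_congr rfl fun k _ => ?_
        rw [Finset.mul_sum]
        exact Finset.sum_congr rfl fun s _ => mul_comm _ _
    _ ≤ ∑ k ∈ Finset.range (n + 1), 2 ^ n * (2 * Real.exp (1 / 2)) * Real.exp (-(1 / 2)) ^ k := by
        refine Finset.sum_le_sum fun k _ => ?_
        -- The parameter `k / √n` is optimal at the level `k √n` and gives the tail `exp (-k²/2)`,
        -- which beats the layer value `exp ((k+1)²/8)` geometrically.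
        have h := card_maxThresholdSum_ge g a hg (k / Real.sqrt n) (by positivity) (k * Real.sqrt n)
        have e1 : -((k : ℝ) / Real.sqrt n * (k * Real.sqrt n)) + n * ((k / Real.sqrt n) ^ 2 / 2)
            = -((k : ℝ) ^ 2 / 2) := by
          rw [div_pow, hsq2]; field_simp; ring
        rw [e1] at h
        calc _ ≤ Real.exp (((k : ℝ) + 1) ^ 2 / 8) * (2 * (2 ^ n * Real.exp (-((k : ℝ) ^ 2 / 2)))) :=
              mul_le_mul_of_nonneg_left h (Real.exp_nonneg _)
          _ = 2 ^ n * 2 * Real.exp (((k : ℝ) + 1) ^ 2 / 8 + -((k : ℝ) ^ 2 / 2)) := by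
              rw [Real.exp_add]; ring
          _ ≤ 2 ^ n * 2 * Real.exp (1 / 2 + k * (-(1 / 2))) := by
              refine mul_le_mul_of_nonneg_left (Real.exp_le_exp.2 ?_) (by positivity)
              nlinarith [sq_nonneg ((k : ℝ) - 1)]
          _ = _ := by rw [Real.exp_add, Real.exp_nat_mul]; ring
    _ = 2 ^ n * (2 * Real.exp (1 / 2)) * ∑ k ∈ Finset.range (n + 1), Real.exp (-(1 / 2)) ^ k := by
        rw [Finset.mul_sum]
    _ ≤ 2 ^ n * (2 * Real.exp (1 / 2)) * 3 := by
        gcongr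
        have hx : Real.exp (-(1 / 2)) ≤ 2 / 3 := by
          rw [Real.exp_neg, inv_le_comm₀ (Real.exp_pos _) (by norm_num)]
          have := Real.add_one_le_exp (1 / 2 : ℝ)
          norm_num at this ⊢
          linarith
        calc _ ≤ ∑ k ∈ Finset.range (n + 1), (2 / 3 : ℝ) ^ k :=
              Finset.sum_le_sum fun k _ => pow_le_pow_left₀ (Real.exp_nonneg _) hx k
          _ ≤ 3 := by
            rw [geom_sum_eq (by norm_num), div_le_iff_of_neg (by norm_num)]
            have : (0 : ℝ) ≤ (2 / 3) ^ (n + 1) := by positivity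
            linarith
    _ ≤ _ := by
        rw [mul_assoc]
        gcongr
        have h1 : Real.exp 3 = Real.exp (1 / 2) * Real.exp (5 / 2) := by
          rw [← Real.exp_add]; norm_num
        have h2 : (6 : ℝ) ≤ Real.exp (5 / 2) := by
          have : Real.exp (5 / 2) = Real.exp (5 / 4) * Real.exp (5 / 4) := by
            rw [← Real.exp_add]; norm_num
          rw [this]
          have := Real.quadratic_le_exp_of_nonneg (show (0 : ℝ) ≤ 5 / 4 by norm_num)
          nlinarith
        rw [h1]
        nlinarith [Real.exp_pos (1 / 2 : ℝ)]

theorem sum_exp_sum_sq_maxThresholdSum_le {n d : ℕ} (hn : 1 ≤ n) (g a : Fin n → Fin d → ℝ)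
    (hg : ∀ i j, |g i j| ≤ 1) :
    ∑ S : Fin n → Fin d → Bool, Real.exp (∑ j, maxThresholdSum (fun i => a i j)
      (fun i => signValue (S i j) * g i j) ^ 2 / (8 * n)) ≤ 2 ^ (n * d) * Real.exp (d * 3) := by
  rw [← (Equiv.piComm fun (_ : Fin d) (_ : Fin n) => Bool).sum_comp, mul_comm n d]
  exact sum_exp_rows_le (fun j s => maxThresholdSum (fun i => a i j)
    (fun i => signValue (s i) * g i j) ^ 2 / (8 * n)) 3
    fun j => sum_exp_sq_maxThresholdSum_le hn _ _ fun i => hg i j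

/-! ### Invariance of semi-product distributions under sign flips -/

theorem measurable_real_sign : Measurable Real.sign := by
  have : Real.sign = fun r : ℝ => if r < 0 then -1 else if 0 < r then 1 else 0 := rfl
  rw [this]
  exact Measurable.ite measurableSet_Iio measurable_const
    (Measurable.ite measurableSet_Ioi measurable_const measurable_const)

theorem real_sign_mul_abs (x : ℝ) : Real.sign x * |x| = x := by
  rcases lt_trichotomy x 0 with h | h | h
  · rw [Real.sign_of_neg h, abs_of_neg h]; ring
  · simp [h]
  · rw [Real.sign_of_pos h, abs_of_pos h]; ring

theorem real_sign_signValue_mul (b : Bool) (x : ℝ) :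
    Real.sign (signValue b * x) = signValue b * Real.sign x := by
  cases b <;> simp [Real.sign_neg]

/-- Reflection of the coordinates with sign `-1` about the centre `μ`. -/
noncomputable def signFlip {d : ℕ} (μ : EuclideanSpace ℝ (Fin d)) (s : Fin d → Bool)
    (x : EuclideanSpace ℝ (Fin d)) : EuclideanSpace ℝ (Fin d) :=
  WithLp.toLp 2 fun j => μ j + signValue (s j) * (x j - μ j)

@[simp] theorem signFlip_apply {d : ℕ} (μ : EuclideanSpace ℝ (Fin d)) (s : Fin d → Bool)
    (x : EuclideanSpace ℝ (Fin d)) (j : Fin d) :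
    signFlip μ s x j = μ j + signValue (s j) * (x j - μ j) := rfl

theorem measurable_signFlip {d : ℕ} (μ : EuclideanSpace ℝ (Fin d)) (s : Fin d → Bool) :
    Measurable (signFlip μ s) := by
  unfold signFlip
  fun_prop

theorem map_signValue_mul_sign {d : ℕ} {α ρ : ℝ} {D : Measure (EuclideanSpace ℝ (Fin d))}
    (h : IsSemiProduct α ρ D) (b : Bool) (j : Fin d) :
    (D.map fun η => Real.sign (η j)).map (fun y => signValue b * y)
      = D.map fun η => Real.sign (η j) := by
  have hj : Measurable fun η : EuclideanSpace ℝ (Fin d) => η j := by fun_prop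
  have hs : Measurable fun η : EuclideanSpace ℝ (Fin d) => Real.sign (η j) :=
    measurable_real_sign.comp hj
  rw [Measure.map_map (by fun_prop) hs]
  cases b
  · have e : ((fun y => signValue false * y) ∘ fun η : EuclideanSpace ℝ (Fin d) => Real.sign (η j))
        = Real.sign ∘ fun η => -(η j) := by
      funext η; simp [Real.sign_neg]
    rw [e, ← Measure.map_map measurable_real_sign (by fun_prop), h.symmetric j,
      Measure.map_map measurable_real_sign hj]
    rfl
  · congr 1
    funext η; simp

/-- The vector is recovered as the product of its signs and its absolute values, and a flip acts on
the signs only. Their joint law is a product of symmetric laws, hence invariant, and independence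
from the absolute values carries this over to the whole vector. -/
theorem map_signFlip_zero {d : ℕ} {α ρ : ℝ} {D : Measure (EuclideanSpace ℝ (Fin d))}
    (h : IsSemiProduct α ρ D) (s : Fin d → Bool) : D.map (signFlip 0 s) = D := by
  have := h.isProbabilityMeasure
  set sg : EuclideanSpace ℝ (Fin d) → Fin d → ℝ := fun η j => Real.sign (η j) with hsg
  set ab : EuclideanSpace ℝ (Fin d) → Fin d → ℝ := fun η j => |η j| with hab
  have hs1 : ∀ j : Fin d, Measurable fun η : EuclideanSpace ℝ (Fin d) => Real.sign (η j) :=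
    fun j => measurable_real_sign.comp (by fun_prop)
  have msg : Measurable sg := measurable_pi_iff.2 hs1
  have mab : Measurable ab := measurable_pi_iff.2 fun j => by
    have : Measurable fun η : EuclideanSpace ℝ (Fin d) => η j := by fun_prop
    exact this.abs
  have hprod := (indepFun_iff_map_prod_eq_prod_map_map msg.aemeasurable mab.aemeasurable).1
    h.indep_sign_abs
  have hpi := (iIndepFun_iff_map_fun_eq_pi_map fun j => (hs1 j).aemeasurable).1 h.indep_signs
  set T : (Fin d → ℝ) → Fin d → ℝ := fun f j => signValue (s j) * f j with hT
  have mT : Measurable T := by rw [hT]; fun_prop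
  have hTsg : (D.map sg).map T = D.map sg := by
    have : ∀ j, IsProbabilityMeasure (D.map fun η => Real.sign (η j)) :=
      fun j => Measure.isProbabilityMeasure_map (hs1 j).aemeasurable
    have e : D.map sg = Measure.pi fun j => D.map fun η => Real.sign (η j) := hpi
    have : ∀ j, SigmaFinite ((D.map fun η : EuclideanSpace ℝ (Fin d) => Real.sign (η j)).map
        fun y => signValue (s j) * y) := fun j => by
      rw [map_signValue_mul_sign h]; infer_instance
    rw [e, hT, Measure.pi_map_pi (f := fun j y => signValue (s j) * y)
      (fun j => by fun_prop)]
    congr 1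
    funext j
    exact map_signValue_mul_sign h (s j) j
  set rec : (Fin d → ℝ) × (Fin d → ℝ) → EuclideanSpace ℝ (Fin d) :=
    fun p => WithLp.toLp 2 fun j => p.1 j * p.2 j with hrec
  have mrec : Measurable rec := by rw [hrec]; fun_prop
  have e1 : signFlip 0 s = rec ∘ Prod.map T id ∘ fun η => (sg η, ab η) := by
    funext η
    ext j
    simp [hrec, hT, hsg, hab, mul_assoc, real_sign_mul_abs]
  have e2 : (fun η => η) = rec ∘ fun η => (sg η, ab η) := by
    funext η
    ext j
    simp [hrec, hsg, hab, real_sign_mul_abs]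
  have mpair : Measurable fun η => (sg η, ab η) := msg.prodMk mab
  have hlaw : (D.map fun η => (sg η, ab η)).map (Prod.map T id) = D.map fun η => (sg η, ab η) := by
    have := Measure.isProbabilityMeasure_map (μ := D) msg.aemeasurable
    have := Measure.isProbabilityMeasure_map (μ := D) mab.aemeasurable
    rw [hprod, ← Measure.map_prod_map _ _ mT measurable_id, hTsg, Measure.map_id]
  calc D.map (signFlip 0 s)
      = (((D.map fun η => (sg η, ab η)).map (Prod.map T id)).map rec) := by
        rw [e1, Measure.map_map mrec (mT.prodMap measurable_id),
          Measure.map_map (mrec.comp (mT.prodMap measurable_id)) mpair]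
        rfl
    _ = D.map fun η => η := by
        rw [hlaw, Measure.map_map mrec mpair, ← e2]
    _ = D := Measure.map_id

theorem IsSemiProductWithLocation.isProbabilityMeasure {d : ℕ} {α ρ : ℝ}
    {μ : EuclideanSpace ℝ (Fin d)} {D : Measure (EuclideanSpace ℝ (Fin d))}
    (h : IsSemiProductWithLocation α ρ μ D) : IsProbabilityMeasure D := by
  obtain ⟨D₀, h₀, rfl⟩ := h
  have := h₀.isProbabilityMeasure
  exact Measure.isProbabilityMeasure_map (by fun_prop)

theorem IsSemiProductWithLocation.measurePreserving_signFlip {d : ℕ} {α ρ : ℝ}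
    {μ : EuclideanSpace ℝ (Fin d)} {D : Measure (EuclideanSpace ℝ (Fin d))}
    (h : IsSemiProductWithLocation α ρ μ D) (s : Fin d → Bool) :
    MeasurePreserving (signFlip μ s) D D := by
  refine ⟨measurable_signFlip μ s, ?_⟩
  obtain ⟨D₀, h₀, rfl⟩ := h
  have e : signFlip μ s ∘ (fun η => μ + η) = (fun η => μ + η) ∘ signFlip 0 s := by
    funext η
    ext j
    simp
  rw [Measure.map_map (measurable_signFlip μ s) (by fun_prop), e,
    ← Measure.map_map (by fun_prop) (measurable_signFlip 0 s), map_signFlip_zero h₀]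

theorem IsSemiProductWithLocation.small_noise {d : ℕ} {α ρ : ℝ}
    {μ : EuclideanSpace ℝ (Fin d)} {D : Measure (EuclideanSpace ℝ (Fin d))}
    (h : IsSemiProductWithLocation α ρ μ D) (j : Fin d) :
    ENNReal.ofReal α ≤ D {x | |x j - μ j| ≤ ρ} := by
  obtain ⟨D₀, h₀, rfl⟩ := h
  rw [Measure.map_apply (by fun_prop)]
  · refine (h₀.small_noise j).trans (le_of_eq ?_)
    congr 1
    ext η
    simp
  · exact measurableSet_le (by fun_prop) measurable_const

/-- To bound the probability of an event it suffices to bound, for every fixed sample, the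
proportion of sign flips that lead into the event. -/
theorem measure_le_of_signFlips {n d : ℕ} {D : Measure (EuclideanSpace ℝ (Fin d))}
    [IsProbabilityMeasure D] (μ : EuclideanSpace ℝ (Fin d))
    (hD : ∀ s, MeasurePreserving (signFlip μ s) D D)
    {A : Set (Fin n → EuclideanSpace ℝ (Fin d))} (hA : MeasurableSet A) {c : ℝ}
    (h : ∀ x : Fin n → EuclideanSpace ℝ (Fin d), ∀ [DecidablePred fun S : Fin n → Fin d → Bool =>
      (fun i => signFlip μ (S i) (x i)) ∈ A],
      ((Finset.univ.filter fun S : Fin n → Fin d → Bool =>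
        (fun i => signFlip μ (S i) (x i)) ∈ A).card : ℝ) ≤ 2 ^ (n * d) * c) :
    Measure.pi (fun _ : Fin n => D) A ≤ ENNReal.ofReal c := by
  classical
  set P := Measure.pi (fun _ : Fin n => D)
  have hpres : ∀ S : Fin n → Fin d → Bool,
      MeasurePreserving (fun (x : Fin n → EuclideanSpace ℝ (Fin d)) i => signFlip μ (S i) (x i))
        P P := fun S => measurePreserving_pi _ _ fun i => hD (S i)
  have key : (2 : ENNReal) ^ (n * d) * P A ≤ 2 ^ (n * d) * ENNReal.ofReal c := by
    calc (2 : ENNReal) ^ (n * d) * P A = ∑ _S : Fin n → Fin d → Bool, P A := by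
          rw [Finset.sum_const, nsmul_eq_mul, Finset.card_univ]
          simp [pow_mul, mul_comm n d]
      -- Every flip preserves the product measure, so the probability may be averaged over all `2 ^
      -- (n d)` flips before integrating over the sample.
      _ = ∑ S : Fin n → Fin d → Bool, ∫⁻ x, A.indicator (fun _ => 1)
            (fun i => signFlip μ (S i) (x i)) ∂P := by
          refine Finset.sum_congr rfl fun S _ => ?_
          rw [(hpres S).lintegral_comp (f := A.indicator fun _ => 1)
            (measurable_const.indicator hA), lintegral_indicator_const hA, one_mul]
      _ = ∫⁻ x, ∑ S : Fin n → Fin d → Bool, A.indicator (fun _ => 1)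
            (fun i => signFlip μ (S i) (x i)) ∂P := by
          rw [lintegral_finsetSum]
          intro S _
          exact (measurable_const.indicator hA).comp (hpres S).measurable
      _ ≤ ∫⁻ _x, ENNReal.ofReal (2 ^ (n * d) * c) ∂P := by
          refine lintegral_mono fun x => ?_
          have e : ∑ S : Fin n → Fin d → Bool, A.indicator (fun _ => (1 : ENNReal))
              (fun i => signFlip μ (S i) (x i)) = ((Finset.univ.filter
              fun S : Fin n → Fin d → Bool => (fun i => signFlip μ (S i) (x i)) ∈ A).card :
                ENNReal) := by
            rw [Finset.card_filter]
            push_cast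
            refine Finset.sum_congr rfl fun S _ => ?_
            rw [Set.indicator_apply]
          simp only [e]
          rw [← ENNReal.ofReal_natCast]
          exact ENNReal.ofReal_le_ofReal (h x)
      _ = 2 ^ (n * d) * ENNReal.ofReal c := by
          rw [lintegral_const, measure_univ, mul_one, ENNReal.ofReal_mul (by positivity)]
          simp [ENNReal.ofReal_pow]
  exact (ENNReal.mul_le_mul_iff_right (by positivity) (by finiteness)).1 key

open Classical in
/-- Lower tail of a binomial count. -/
theorem measure_count_lt_le {n : ℕ} (hn : 1 ≤ n) {Ω : Type*} [MeasurableSpace Ω] {D : Measure Ω}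
    [IsProbabilityMeasure D] {A : Set Ω} (hA : MeasurableSet A) {p t : ℝ}
    (hp : ENNReal.ofReal p ≤ D A) (ht : 0 ≤ t) :
    Measure.pi (fun _ : Fin n => D)
      {x | ((Finset.univ.filter fun i => x i ∈ A).card : ℝ) < (p - t) * n}
      ≤ ENNReal.ofReal (Real.exp (-(2 * t ^ 2 * n))) := by
  -- The negated indicator turns the lower tail of the count into an upper tail, as Hoeffding's
  -- inequality requires; its range has length `1`.
  set f : Ω → ℝ := A.indicator fun _ => -1 with hf
  have hfm : Measurable f := measurable_const.indicator hA
  have hint : ∫ y, f y ∂D = -D.real A := by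
    rw [hf, integral_indicator_const _ hA]; simp
  have hp' : p ≤ D.real A := by
    rw [Measure.real, ← ENNReal.ofReal_le_iff_le_toReal (measure_ne_top _ _)]
    exact hp
  have hsub : HasSubgaussianMGF (fun y => f y - ∫ y, f y ∂D) ((‖(0 : ℝ) - (-1)‖₊ / 2) ^ 2) D := by
    refine hasSubgaussianMGF_of_mem_Icc hfm.aemeasurable (ae_of_all _ fun y => ?_)
    by_cases hy : y ∈ A <;> simp [hf, hy]
  set P := Measure.pi (fun _ : Fin n => D)
  have hind : iIndepFun (fun (i : Fin n) (x : Fin n → Ω) => f (x i) - ∫ y, f y ∂D) P :=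
    iIndepFun_pi (μ := fun _ : Fin n => D) (X := fun _ y => f y - ∫ y, f y ∂D)
      fun _ => (hfm.sub_const _).aemeasurable
  have hsub' : ∀ i ∈ (Finset.univ : Finset (Fin n)), HasSubgaussianMGF
      (fun (x : Fin n → Ω) => f (x i) - ∫ y, f y ∂D) ((‖(0 : ℝ) - (-1)‖₊ / 2) ^ 2) P := by
    intro i _
    have hmp := measurePreserving_eval (fun _ : Fin n => D) i
    refine HasSubgaussianMGF.of_map (Y := fun x : Fin n → Ω => x i)
      (X := fun y => f y - ∫ y, f y ∂D) (measurable_pi_apply i).aemeasurable ?_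
    have : P.map (fun x => x i) = D := hmp.map_eq
    rw [this]
    exact hsub
  have hoeff := HasSubgaussianMGF.measure_sum_ge_le_of_iIndepFun hind hsub'
    (ε := t * n) (by positivity)
  refine le_trans (measure_mono ?_) ((ENNReal.le_ofReal_iff_toReal_le (measure_ne_top _ _)
    (Real.exp_nonneg _)).2 (hoeff.trans (le_of_eq ?_)))
  · intro x hx
    simp only [Set.mem_ofPred_eq] at hx ⊢
    have e : ∑ i : Fin n, f (x i) = -((Finset.univ.filter fun i => x i ∈ A).card : ℝ) := by
      rw [Finset.card_filter]
      push_cast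
      rw [← Finset.sum_neg_distrib]
      refine Finset.sum_congr rfl fun i _ => ?_
      by_cases hy : x i ∈ A <;> simp [hf, hy]
    rw [Finset.sum_sub_distrib, e, hint]
    simp only [Finset.sum_const, Finset.card_univ, Fintype.card_fin, nsmul_eq_mul]
    have : (0 : ℝ) ≤ n := by positivity
    nlinarith
  · congr 1
    have : (n : ℝ) ≠ 0 := by positivity
    simp
    field_simp

/-! ### Clipping and threshold patterns -/

/-- Truncation to the interval `[-1, 1]`. -/
noncomputable def clip (x : ℝ) : ℝ := max (-1) (min 1 x)

theorem abs_clip_le_one (x : ℝ) : |clip x| ≤ 1 := by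
  rw [abs_le]
  exact ⟨le_max_left _ _, max_le (by norm_num) (min_le_left _ _)⟩

theorem clip_mono : Monotone clip := fun x y h => by unfold clip; gcongr

theorem abs_clip_sub_clip_le (x y : ℝ) : |clip x - clip y| ≤ |x - y| := by
  unfold clip
  refine (abs_max_sub_max_le_max _ _ _ _).trans (max_le (by simp) ?_)
  exact (abs_min_sub_min_le_max _ _ _ _).trans (max_le (by simp) le_rfl)

theorem clip_of_abs_le {x : ℝ} (h : |x| ≤ 1) : clip x = x := by
  rw [abs_le] at h
  rw [clip, min_eq_right h.2, max_eq_right h.1]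

@[simp] theorem clip_zero : clip 0 = 0 := clip_of_abs_le (by simp)

theorem clip_div_eq_sign_mul (x h : ℝ) (hh : 0 ≤ h) :
    clip (x / h) = Real.sign x * min 1 (|x| / h) := by
  rcases lt_trichotomy x 0 with hx | hx | hx
  · rw [Real.sign_of_neg hx, abs_of_neg hx, clip, min_eq_right, neg_div, neg_one_mul, ← max_neg_neg,
      neg_neg]
    exact (div_nonpos_of_nonpos_of_nonneg hx.le hh).trans zero_le_one
  · simp [hx]
  · rw [Real.sign_of_pos hx, abs_of_pos hx, clip, one_mul, max_eq_right]
    have : 0 ≤ x / h := div_nonneg hx.le hh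
    exact le_min (by norm_num) (by linarith)

/-- Indicator of the indices above the threshold `a o`; it is zero for `o = none`. -/
noncomputable def thresholdPattern {n : ℕ} (a : Fin n → ℝ) (o : Option (Fin n)) : Fin n → ℝ :=
  fun i => o.elim 0 fun k => if a k ≤ a i then 1 else 0

theorem thresholdPattern_mem_Icc {n : ℕ} (a : Fin n → ℝ) (o : Option (Fin n)) (i : Fin n) :
    thresholdPattern a o i ∈ Set.Icc (0 : ℝ) 1 := by
  cases o with
  | none => simp [thresholdPattern]
  | some k =>
    simp only [thresholdPattern, Option.elim]
    split_ifs <;> simp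

theorem thresholdSum_eq {n : ℕ} (a g : Fin n → ℝ) (o : Option (Fin n)) :
    thresholdSum a g o = ∑ i, thresholdPattern a o i * g i := by
  cases o <;> simp [thresholdSum, thresholdPattern]

/-- An upward closed set of indices is empty, the case `none`, or is cut out by its member with the
smallest value. Hence only `n + 1` patterns occur. -/
theorem exists_thresholdPattern_eq {n : ℕ} (a : Fin n → ℝ) (p : Fin n → Prop) [DecidablePred p]
    (hp : ∀ i k, p k → a k ≤ a i → p i) :
    ∃ o, thresholdPattern a o = fun i => if p i then 1 else 0 := by
  by_cases hex : ∃ i, p i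
  · obtain ⟨i₀, hi₀⟩ := hex
    obtain ⟨k, hk, hmin⟩ := Finset.exists_min_image (Finset.univ.filter p) a
      ⟨i₀, by simpa using hi₀⟩
    simp only [Finset.mem_filter, Finset.mem_univ, true_and] at hk hmin
    refine ⟨some k, funext fun i => ?_⟩
    simp only [thresholdPattern, Option.elim]
    by_cases hi : p i
    · rw [if_pos hi, if_pos (hmin i hi)]
    · rw [if_neg hi, if_neg fun h => hi (hp i k hk h)]
  · push Not at hex
    exact ⟨none, funext fun i => by simp [thresholdPattern, hex i]⟩

/-- A monotone function of `a` with values in `[0, 1]` is a mixture of threshold patterns. -/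
theorem mem_convexHull_thresholdPattern {n : ℕ} (a f : Fin n → ℝ) (hf : ∀ i, f i ∈ Set.Icc 0 1)
    (hmono : ∀ i k, a k ≤ a i → f k ≤ f i) :
    f ∈ convexHull ℝ (Set.range (thresholdPattern a)) := by
  -- Layer-cake formula: `f i` is the integral over `s ∈ (0, 1]` of the indicator of `s ≤ f i`. Each
  -- such indicator is a threshold pattern, and the average of points of a closed convex set stays
  -- in the set.
  set ν : Measure ℝ := volume.restrict (Set.Ioc 0 1) with hν
  have : IsProbabilityMeasure ν := ⟨by simp [hν]⟩
  set F : ℝ → Fin n → ℝ := fun s i => if s ≤ f i then 1 else 0 with hF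
  have hFi : ∀ i, Measurable fun s => F s i := fun i =>
    Measurable.ite measurableSet_Iic measurable_const measurable_const
  have hFb : ∀ i s, ‖F s i‖ ≤ 1 := fun i s => by
    simp only [hF]; split_ifs <;> simp
  have hint : ∀ i, Integrable (fun s => F s i) ν := fun i =>
    Integrable.of_bound (hFi i).aestronglyMeasurable 1 (ae_of_all _ (hFb i))
  have hmem : ∫ s, F s ∂ν ∈ convexHull ℝ (Set.range (thresholdPattern a)) := by
    refine (convex_convexHull ℝ _).integral_mem
      ((Set.finite_range _).isClosed_convexHull ℝ) (ae_of_all _ fun s => ?_) (Integrable.of_eval hint)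
    obtain ⟨o, ho⟩ := exists_thresholdPattern_eq a (fun i => s ≤ f i)
      fun i k hk h => hk.trans (hmono i k h)
    exact subset_convexHull ℝ _ ⟨o, ho⟩
  convert hmem using 1
  funext i
  rw [eval_integral hint]
  have e : (fun s => F s i) = (Set.Iic (f i)).indicator fun _ => 1 := by
    funext s
    simp [hF, Set.indicator_apply]
  rw [e, integral_indicator_const _ measurableSet_Iic]
  have : Set.Iic (f i) ∩ Set.Ioc 0 1 = Set.Ioc 0 (f i) := by
    ext s
    simp only [Set.mem_inter_iff, Set.mem_Iic, Set.mem_Ioc]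
    constructor
    · rintro ⟨h1, h2, -⟩; exact ⟨h2, h1⟩
    · rintro ⟨h1, h2⟩; exact ⟨h2, h1, h2.trans (hf i).2⟩
  rw [Measure.real, hν, Measure.restrict_apply measurableSet_Iic, this]
  simp [(hf i).1]

/-- A function that is convex in every coordinate attains its maximum over a product of convex hulls
at a product of extreme points. -/
theorem le_of_forall_mem_convexHull {d : ℕ} {V : Type*} [AddCommGroup V] [Module ℝ V]
    {Q : (Fin d → V) → ℝ} (hQ : ∀ f j, ConvexOn ℝ Set.univ fun g => Q (Function.update f j g))
    (T : Fin d → Set V) {B : ℝ} (h : ∀ f, (∀ j, f j ∈ T j) → Q f ≤ B) (f : Fin d → V)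
    (hf : ∀ j, f j ∈ convexHull ℝ (T j)) : Q f ≤ B := by
  have key : ∀ (s : Finset (Fin d)) (f : Fin d → V), (∀ j ∈ s, f j ∈ convexHull ℝ (T j)) →
      (∀ j ∉ s, f j ∈ T j) → Q f ≤ B := by
    intro s
    induction s using Finset.induction_on with
    | empty => exact fun f _ h2 => h f fun j => h2 j (Finset.notMem_empty j)
    | insert j s hj ih =>
      intro f h1 h2
      obtain ⟨y, hy, hle⟩ := (hQ f j).exists_ge_of_mem_convexHull (Set.subset_univ (T j))
        (h1 j (Finset.mem_insert_self _ _))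
      rw [Function.update_eq_self] at hle
      refine hle.trans (ih _ (fun k hk => ?_) fun k hk => ?_)
      · have : k ≠ j := fun e => hj (e ▸ hk)
        rw [Function.update_of_ne this]
        exact h1 k (Finset.mem_insert_of_mem hk)
      · by_cases e : k = j
        · subst e; simpa using hy
        · rw [Function.update_of_ne e]
          exact h2 k (by simp [e, hk])
  exact key Finset.univ f (fun j _ => hf j) fun j hj => absurd (Finset.mem_univ j) hj

/-! ### Two statistics of a data matrix -/

/-- The part above `t` of the squares of the data in direction `v`. -/
noncomputable def excess {n d : ℕ} (t : ℝ) (v : Fin d → ℝ) (y : Fin n → Fin d → ℝ) : ℝ :=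
  ∑ i, max 0 ((∑ j, v j * y i j) ^ 2 - t)

/-- The off-diagonal part of the quadratic form of the second moments. -/
noncomputable def offDiagForm {n d : ℕ} (v : Fin d → ℝ) (y : Fin n → Fin d → ℝ) : ℝ :=
  ∑ i, ((∑ j, v j * y i j) ^ 2 - ∑ j, (v j * y i j) ^ 2)

theorem sum_mul_update {n d : ℕ} (m : Fin d → ℝ) (f : Fin d → Fin n → ℝ) (j : Fin d)
    (g : Fin n → ℝ) (i : Fin n) :
    ∑ k, m k * Function.update f j g k i = (∑ k, m k * f k i - m j * f j i) + m j * g i := by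
  rw [← Finset.add_sum_erase _ _ (Finset.mem_univ j),
    ← Finset.add_sum_erase _ (fun k => m k * f k i) (Finset.mem_univ j)]
  have : ∀ k ∈ Finset.univ.erase j, m k * Function.update f j g k i = m k * f k i := by
    intro k hk
    rw [Function.update_of_ne (Finset.ne_of_mem_erase hk)]
  rw [Finset.sum_congr rfl this]
  simp only [Function.update_self, Finset.sum_erase_eq_sub (Finset.mem_univ j)]
  ring

theorem sum_sq_update {n d : ℕ} (m : Fin d → ℝ) (f : Fin d → Fin n → ℝ) (j : Fin d)
    (g : Fin n → ℝ) (i : Fin n) :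
    ∑ k, (m k * Function.update f j g k i) ^ 2
      = (∑ k, (m k * f k i) ^ 2 - (m j * f j i) ^ 2) + (m j * g i) ^ 2 := by
  rw [← Finset.add_sum_erase _ _ (Finset.mem_univ j),
    ← Finset.add_sum_erase _ (fun k => (m k * f k i) ^ 2) (Finset.mem_univ j)]
  have : ∀ k ∈ Finset.univ.erase j,
      (m k * Function.update f j g k i) ^ 2 = (m k * f k i) ^ 2 := by
    intro k hk
    rw [Function.update_of_ne (Finset.ne_of_mem_erase hk)]
  rw [Finset.sum_congr rfl this]
  simp only [Function.update_self, Finset.sum_erase_eq_sub (Finset.mem_univ j)]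
  ring

/-- With the other columns fixed, each projection is affine in column `j`; the positive part of its
square minus a constant is convex. -/
theorem convexOn_excess_update {n d : ℕ} (t : ℝ) (v : Fin d → ℝ) (σ : Fin n → Fin d → ℝ)
    (f : Fin d → Fin n → ℝ) (j : Fin d) :
    ConvexOn ℝ Set.univ fun g => excess t v fun i k => σ i k * Function.update f j g k i := by
  refine ⟨convex_univ, fun x _ y _ a b ha hb hab => ?_⟩
  simp only [excess, ← mul_assoc, smul_eq_mul, Finset.mul_sum, ← Finset.sum_add_distrib]
  refine Finset.sum_le_sum fun i _ => ?_
  simp only [sum_mul_update (fun k => v k * σ i k) f j _ i, Pi.add_apply, Pi.smul_apply,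
    smul_eq_mul]
  set c := ∑ k, v k * σ i k * f k i - v j * σ i j * f j i
  set e := v j * σ i j
  have h1 : (c + e * (a * x i + b * y i)) ^ 2 ≤ a * (c + e * x i) ^ 2 + b * (c + e * y i) ^ 2 := by
    have : b = 1 - a := by linarith
    subst this
    nlinarith [mul_nonneg (mul_nonneg ha hb) (sq_nonneg (e * (x i - y i)))]
  have h2 := mul_le_mul_of_nonneg_left (le_max_right 0 ((c + e * x i) ^ 2 - t)) ha
  have h3 := mul_le_mul_of_nonneg_left (le_max_right 0 ((c + e * y i) ^ 2 - t)) hb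
  refine max_le (add_nonneg (mul_nonneg ha (le_max_left _ _)) (mul_nonneg hb (le_max_left _ _))) ?_
  have : t = a * t + b * t := by rw [← add_mul, hab, one_mul]
  linarith

/-- Removing the diagonal cancels the square of column `j`, so the form is affine in each column
separately. It is thus convex with either sign `τ`, which allows two-sided bounds. -/
theorem convexOn_offDiagForm_update {n d : ℕ} (τ : ℝ) (v : Fin d → ℝ) (σ : Fin n → Fin d → ℝ)
    (f : Fin d → Fin n → ℝ) (j : Fin d) :
    ConvexOn ℝ Set.univ
      fun g => τ * offDiagForm v fun i k => σ i k * Function.update f j g k i := by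
  refine ⟨convex_univ, fun x _ y _ a b _ _ hab => le_of_eq ?_⟩
  simp only [offDiagForm, ← mul_assoc, smul_eq_mul, Finset.mul_sum, ← Finset.sum_add_distrib]
  refine Finset.sum_congr rfl fun i _ => ?_
  simp only [sum_mul_update (fun k => v k * σ i k) f j _ i,
    sum_sq_update (fun k => v k * σ i k) f j _ i, Pi.add_apply, Pi.smul_apply, smul_eq_mul]
  have : b = 1 - a := by linarith
  subst this
  ring

/-- The noise with absolute values replaced by threshold patterns. -/
noncomputable def signedPattern {n d : ℕ} (η : Fin n → Fin d → ℝ) (κ : Fin d → Option (Fin n)) :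
    Fin n → Fin d → ℝ :=
  fun i j => Real.sign (η i j) * thresholdPattern (fun k => |η k j|) (κ j) i

theorem abs_real_sign_le_one (x : ℝ) : |Real.sign x| ≤ 1 := by
  rcases Real.sign_apply_eq x with h | h | h <;> rw [h] <;> simp

theorem abs_signedPattern_le_one {n d : ℕ} (η : Fin n → Fin d → ℝ) (κ : Fin d → Option (Fin n))
    (i : Fin n) (j : Fin d) : |signedPattern η κ i j| ≤ 1 := by
  have h := thresholdPattern_mem_Icc (fun k => |η k j|) (κ j) i
  rw [signedPattern, abs_mul, abs_of_nonneg h.1]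
  exact mul_le_one₀ (abs_real_sign_le_one _) h.1 h.2

theorem min_abs_div_mem_convexHull {n d : ℕ} (η : Fin n → Fin d → ℝ) {h : Fin d → ℝ}
    (hh : ∀ j, 0 ≤ h j) (j : Fin d) :
    (fun i => min 1 (|η i j| / h j)) ∈
      convexHull ℝ (Set.range (thresholdPattern fun i => |η i j|)) := by
  refine mem_convexHull_thresholdPattern _ _ (fun i => ?_) fun i k hik => ?_
  · exact ⟨le_min zero_le_one (div_nonneg (abs_nonneg _) (hh j)), min_le_left _ _⟩
  · exact min_le_min le_rfl (div_le_div_of_nonneg_right hik (hh j))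

/-- The clipped noise is the sign times `min 1 (|η|/h)`, monotone in `|η|`, hence a mixture of
signed patterns column by column. A separately convex statistic is largest at pure patterns, so
finitely many patterns, independent of `h`, cover all scales. This uniformity is needed because the
scales are computed from corrupted data. -/
theorem le_of_forall_signedPattern {n d : ℕ} (η : Fin n → Fin d → ℝ) {h : Fin d → ℝ}
    (hh : ∀ j, 0 ≤ h j) (Q : (Fin n → Fin d → ℝ) → ℝ)
    (hQ : ∀ (f : Fin d → Fin n → ℝ) j, ConvexOn ℝ Set.univ
      fun g => Q fun i k => Real.sign (η i k) * Function.update f j g k i) {B : ℝ}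
    (hB : ∀ κ, Q (signedPattern η κ) ≤ B) : Q (fun i j => clip (η i j / h j)) ≤ B := by
  simp only [fun i j => clip_div_eq_sign_mul (η i j) (h j) (hh j)]
  refine le_of_forall_mem_convexHull (Q := fun f : Fin d → Fin n → ℝ =>
    Q fun i k => Real.sign (η i k) * f k i) hQ
    (fun j => Set.range (thresholdPattern fun i => |η i j|)) (fun f hf => ?_)
    (fun j i => min 1 (|η i j| / h j)) fun j => min_abs_div_mem_convexHull η hh j
  choose κ hκ using hf
  refine le_trans (le_of_eq ?_) (hB κ)
  congr 1
  funext i j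
  simp only [signedPattern, hκ]

theorem excess_clip_le {n d : ℕ} (η : Fin n → Fin d → ℝ) {h : Fin d → ℝ} (hh : ∀ j, 0 ≤ h j)
    (t : ℝ) (v : Fin d → ℝ) {B : ℝ} (hB : ∀ κ, excess t v (signedPattern η κ) ≤ B) :
    excess t v (fun i j => clip (η i j / h j)) ≤ B :=
  le_of_forall_signedPattern η hh _
    (fun f j => convexOn_excess_update t v (fun i k => Real.sign (η i k)) f j) hB

theorem abs_offDiagForm_clip_le {n d : ℕ} (η : Fin n → Fin d → ℝ) {h : Fin d → ℝ}
    (hh : ∀ j, 0 ≤ h j) (v : Fin d → ℝ) {B : ℝ}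
    (hB : ∀ κ, |offDiagForm v (signedPattern η κ)| ≤ B) :
    |offDiagForm v (fun i j => clip (η i j / h j))| ≤ B := by
  have h1 := le_of_forall_signedPattern η hh (fun y => 1 * offDiagForm v y)
    (fun f j => convexOn_offDiagForm_update 1 v (fun i k => Real.sign (η i k)) f j) (B := B)
    fun κ => by simpa using (abs_le.1 (hB κ)).2
  have h2 := le_of_forall_signedPattern η hh (fun y => (-1) * offDiagForm v y)
    (fun f j => convexOn_offDiagForm_update (-1) v (fun i k => Real.sign (η i k)) f j) (B := B)
    fun κ => by
      have := (abs_le.1 (hB κ)).1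
      linarith
  rw [abs_le]
  constructor <;> linarith

theorem abs_sum_clip_le {n : ℕ} (η : Fin n → ℝ) {h : ℝ} (hh : 0 ≤ h) :
    |∑ i, clip (η i / h)| ≤ maxThresholdSum (fun i => |η i|) fun i => Real.sign (η i) := by
  have key : ∀ τ : ℝ, |τ| = 1 → τ * ∑ i, clip (η i / h)
      ≤ maxThresholdSum (fun i => |η i|) fun i => Real.sign (η i) := by
    intro τ hτ
    have := le_of_forall_signedPattern (d := 1) (fun i _ => η i) (h := fun _ => h) (fun _ => hh)
      (fun y => τ * ∑ i, y i 0) (fun f j => ?_)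
      (B := maxThresholdSum (fun i => |η i|) fun i => Real.sign (η i)) fun κ => ?_
    · exact this
    · refine ⟨convex_univ, fun x _ y _ a b _ _ _ => le_of_eq ?_⟩
      have hj : j = 0 := Subsingleton.elim _ _
      subst hj
      simp only [Function.update_self, Finset.mul_sum, smul_eq_mul, ← Finset.sum_add_distrib,
        Pi.add_apply, Pi.smul_apply]
      refine Finset.sum_congr rfl fun i _ => ?_
      ring
    · refine le_trans ?_ (abs_thresholdSum_le_max _ _ (κ 0))
      refine (le_abs_self _).trans (le_of_eq ?_)
      rw [abs_mul, hτ, one_mul, thresholdSum_eq]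
      congr 1
      refine Finset.sum_congr rfl fun i _ => ?_
      rw [signedPattern, mul_comm]
  have h1 := key 1 (by simp)
  have h2 := key (-1) (by simp)
  rw [abs_le]
  constructor <;> linarith

/-! ### A grid of directions -/

/-- The points `-1, -1 + 1/N, …, 1`. -/
noncomputable def gridValue (N : ℕ) (k : Fin (2 * N + 1)) : ℝ := ((k : ℝ) - N) / N

/-- Rounding is towards zero, so that a direction in the unit ball stays in the unit ball. -/
theorem exists_gridValue {N : ℕ} (hN : 1 ≤ N) {x : ℝ} (hx : |x| ≤ 1) :
    ∃ k : Fin (2 * N + 1), |x - gridValue N k| ≤ 1 / N ∧ |gridValue N k| ≤ |x| := by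
  have hN0 : (0 : ℝ) < N := by exact_mod_cast hN
  set m := ⌊|x| * N⌋₊ with hm
  have hpos : 0 ≤ |x| * N := by positivity
  have h1 : (m : ℝ) ≤ |x| * N := Nat.floor_le hpos
  have h2 : |x| * N < m + 1 := Nat.lt_floor_add_one _
  have hmN : m ≤ N := by
    have : (m : ℝ) ≤ N := h1.trans (by nlinarith)
    exact_mod_cast this
  rcases le_total 0 x with h0 | h0
  · rw [abs_of_nonneg h0] at h1 h2
    refine ⟨⟨N + m, by omega⟩, ?_⟩
    have e : gridValue N ⟨N + m, by omega⟩ = m / N := by simp [gridValue]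
    rw [e, abs_of_nonneg h0, abs_of_nonneg (by positivity : (0 : ℝ) ≤ m / N)]
    have h3 : (m : ℝ) / N ≤ x := (div_le_iff₀ hN0).2 h1
    refine ⟨?_, h3⟩
    rw [abs_of_nonneg (by linarith), sub_le_iff_le_add, ← add_div, le_div_iff₀ hN0]
    linarith
  · rw [abs_of_nonpos h0] at h1 h2
    refine ⟨⟨N - m, by omega⟩, ?_⟩
    have e : gridValue N ⟨N - m, by omega⟩ = -(m / N) := by
      simp only [gridValue, Nat.cast_sub hmN]
      ring
    rw [e, abs_of_nonpos h0, abs_neg, abs_of_nonneg (by positivity : (0 : ℝ) ≤ m / N)]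
    have h3 : (m : ℝ) / N ≤ -x := (div_le_iff₀ hN0).2 h1
    refine ⟨?_, h3⟩
    rw [abs_of_nonpos (by linarith), neg_sub, sub_le_iff_le_add]
    have : -x ≤ 1 / N + m / N := by
      rw [← add_div, le_div_iff₀ hN0]; linarith
    linarith

theorem sq_sub_sq_le_of_near {d : ℕ} {v u y : Fin d → ℝ} {γ : ℝ} (hv : ∀ j, |v j| ≤ 1)
    (hu : ∀ j, |u j| ≤ 1) (hy : ∀ j, |y j| ≤ 1) (hγ : ∀ j, |v j - u j| ≤ γ) :
    |(∑ j, v j * y j) ^ 2 - (∑ j, u j * y j) ^ 2| ≤ 2 * d ^ 2 * γ ∧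
    |∑ j, (v j * y j) ^ 2 - ∑ j, (u j * y j) ^ 2| ≤ 2 * d * γ := by
  have hb : ∀ w : Fin d → ℝ, (∀ j, |w j| ≤ 1) → |∑ j, w j * y j| ≤ d := by
    intro w hw
    refine (Finset.abs_sum_le_sum_abs _ _).trans ?_
    calc _ ≤ ∑ _j : Fin d, (1 : ℝ) := Finset.sum_le_sum fun j _ => by
          rw [abs_mul]; exact mul_le_one₀ (hw j) (abs_nonneg _) (hy j)
      _ = d := by simp
  constructor
  · have e : (∑ j, v j * y j) ^ 2 - (∑ j, u j * y j) ^ 2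
        = (∑ j, v j * y j + ∑ j, u j * y j) * ∑ j, (v j - u j) * y j := by
      simp only [sub_mul, Finset.sum_sub_distrib]; ring
    have h2 : |∑ j, (v j - u j) * y j| ≤ d * γ := by
      refine (Finset.abs_sum_le_sum_abs _ _).trans ?_
      calc _ ≤ ∑ _j : Fin d, γ := Finset.sum_le_sum fun j _ => by
            rw [abs_mul]
            have := mul_le_mul (hγ j) (hy j) (abs_nonneg _) ((abs_nonneg _).trans (hγ j))
            linarith
        _ = d * γ := by simp
    rw [e, abs_mul]
    calc _ ≤ ((d : ℝ) + d) * (d * γ) := by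
          refine mul_le_mul ((abs_add_le _ _).trans (add_le_add (hb v hv) (hb u hu))) h2
            (abs_nonneg _) (by positivity)
      _ = _ := by ring
  · rw [← Finset.sum_sub_distrib]
    refine (Finset.abs_sum_le_sum_abs _ _).trans ?_
    calc _ ≤ ∑ _j : Fin d, 2 * γ := Finset.sum_le_sum fun j _ => by
          have e : (v j * y j) ^ 2 - (u j * y j) ^ 2 = (v j - u j) * ((v j + u j) * y j ^ 2) := by
            ring
          rw [e, abs_mul, mul_comm (2 : ℝ)]
          refine mul_le_mul (hγ j) ?_ (abs_nonneg _) ((abs_nonneg _).trans (hγ j))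
          rw [abs_mul]
          have h1 : |v j + u j| ≤ 2 := (abs_add_le _ _).trans (by linarith [hv j, hu j])
          have h2 : |y j ^ 2| ≤ 1 := by rw [abs_pow]; exact pow_le_one₀ (abs_nonneg _) (hy j)
          nlinarith [abs_nonneg (v j + u j), abs_nonneg (y j ^ 2)]
      _ = _ := by simp; ring

theorem abs_le_one_of_sum_sq_le {d : ℕ} {v : Fin d → ℝ} (hv : ∑ j, v j ^ 2 ≤ 1) (j : Fin d) :
    |v j| ≤ 1 := by
  rw [← sq_le_one_iff_abs_le_one]
  exact (Finset.single_le_sum (f := fun j => v j ^ 2) (fun j _ => sq_nonneg _)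
    (Finset.mem_univ j)).trans hv

/-- Bounds for directions from a fine grid extend to all directions. -/
theorem forms_le_of_grid {n d N : ℕ} (hN : 1 ≤ N) (hNd : 4 * (d : ℝ) ^ 2 * n ≤ N) {t B : ℝ}
    {y : Fin n → Fin d → ℝ} (hy : ∀ i j, |y i j| ≤ 1)
    (hS : ∀ k : Fin d → Fin (2 * N + 1), ∑ j, gridValue N (k j) ^ 2 ≤ 1 →
      excess t (fun j => gridValue N (k j)) y ≤ B)
    (hO : ∀ k : Fin d → Fin (2 * N + 1), ∑ j, gridValue N (k j) ^ 2 ≤ 1 →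
      |offDiagForm (fun j => gridValue N (k j)) y| ≤ B)
    {v : Fin d → ℝ} (hv : ∑ j, v j ^ 2 ≤ 1) : excess t v y ≤ B + 1 ∧ |offDiagForm v y| ≤ B + 1 := by
  have hv1 := abs_le_one_of_sum_sq_le hv
  have hN0 : (0 : ℝ) < N := by exact_mod_cast hN
  choose k hk1 hk2 using fun j => exists_gridValue hN (hv1 j)
  have hu : ∑ j, gridValue N (k j) ^ 2 ≤ 1 :=
    (Finset.sum_le_sum fun j _ => sq_le_sq.2 (hk2 j)).trans hv
  have hu1 := abs_le_one_of_sum_sq_le hu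
  have near := fun i => sq_sub_sq_le_of_near hv1 hu1 (hy i) hk1
  have hdd : (d : ℝ) ≤ d ^ 2 := by
    have : d ≤ d ^ 2 := by nlinarith [Nat.zero_le d, Nat.le_mul_self d]
    exact_mod_cast this
  have hsmall : (n : ℝ) * (4 * d ^ 2 * (1 / N)) ≤ 1 := by
    rw [mul_one_div, ← mul_div_assoc, div_le_one hN0]; linarith
  have hN1 : (0 : ℝ) ≤ 1 / N := by positivity
  have hdN : 2 * (d : ℝ) * (1 / N) ≤ 2 * d ^ 2 * (1 / N) := by gcongr
  constructor
  · have : excess t v y ≤ excess t (fun j => gridValue N (k j)) y + n * (4 * d ^ 2 * (1 / N)) := by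
      calc excess t v y ≤ ∑ i, (max 0 ((∑ j, gridValue N (k j) * y i j) ^ 2 - t)
            + 4 * d ^ 2 * (1 / N)) := by
            refine Finset.sum_le_sum fun i _ => ?_
            have h1 := (abs_le.1 (near i).1).2
            have h2 := le_max_right 0 ((∑ j, gridValue N (k j) * y i j) ^ 2 - t)
            have h3 := le_max_left 0 ((∑ j, gridValue N (k j) * y i j) ^ 2 - t)
            have h4 : 0 ≤ 2 * (d : ℝ) ^ 2 * (1 / N) := by positivity
            refine max_le (by linarith) (by linarith)
        _ = _ := by rw [Finset.sum_add_distrib]; simp [excess]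
    linarith [hS k hu]
  · have : |offDiagForm v y - offDiagForm (fun j => gridValue N (k j)) y|
        ≤ n * (4 * d ^ 2 * (1 / N)) := by
      unfold offDiagForm
      rw [← Finset.sum_sub_distrib]
      refine (Finset.abs_sum_le_sum_abs _ _).trans ?_
      calc _ ≤ ∑ _i : Fin n, 4 * (d : ℝ) ^ 2 * (1 / N) := by
            refine Finset.sum_le_sum fun i _ => ?_
            have h1 := abs_le.1 (near i).1
            have h2 := abs_le.1 (near i).2
            rw [abs_le]
            constructor <;> linarith [h1.1, h1.2, h2.1, h2.2]
        _ = _ := by simp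
    have h3 := abs_le.1 this
    have h4 := abs_le.1 (hO k hu)
    rw [abs_le]
    constructor <;> linarith [h3.1, h3.2, h4.1, h4.2]

/-! ### The noise is well spread with high probability -/

/-- The matrix of deviations of the points from the centre. -/
def noise {n d : ℕ} (μ : EuclideanSpace ℝ (Fin d)) (x : Fin n → EuclideanSpace ℝ (Fin d)) :
    Fin n → Fin d → ℝ :=
  fun i j => x i j - μ j

/-- Regularity of a noise matrix, uniformly over all scales `h` and all directions `v`. -/
structure NoiseBounds {n d : ℕ} (η : Fin n → Fin d → ℝ) (X t B : ℝ) : Prop where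
  signs : ∀ (j : Fin d) (θ : ℝ), (∑ i, if θ ≤ |η i j| then Real.sign (η i j) else 0) ^ 2 ≤ X
  linear : ∀ h : Fin d → ℝ, (∀ j, 0 ≤ h j) → ∑ j, (∑ i, clip (η i j / h j)) ^ 2 ≤ X
  excess : ∀ h : Fin d → ℝ, (∀ j, 0 ≤ h j) → ∀ v : Fin d → ℝ, ∑ j, v j ^ 2 ≤ 1 →
    excess t v (fun i j => clip (η i j / h j)) ≤ B
  offDiag : ∀ h : Fin d → ℝ, (∀ j, 0 ≤ h j) → ∀ v : Fin d → ℝ, ∑ j, v j ^ 2 ≤ 1 →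
    |offDiagForm v (fun i j => clip (η i j / h j))| ≤ B

/-- The grid is so fine that moving a direction to it changes both forms by at most `1`, hence `B +
1`. The linear bounds need no grid of directions. -/
theorem noiseBounds_of_patterns {n d N : ℕ} (hN : 1 ≤ N) (hNd : 4 * (d : ℝ) ^ 2 * n ≤ N)
    {η : Fin n → Fin d → ℝ} {X t B : ℝ}
    (hX : ∀ κ : Fin d → Option (Fin n), ∑ j, thresholdSum (fun i => |η i j|)
      (fun i => Real.sign (η i j)) (κ j) ^ 2 ≤ X)
    (hS : ∀ (κ : Fin d → Option (Fin n)) (k : Fin d → Fin (2 * N + 1)),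
      ∑ j, gridValue N (k j) ^ 2 ≤ 1 →
      excess t (fun j => gridValue N (k j)) (signedPattern η κ) ≤ B)
    (hO : ∀ (κ : Fin d → Option (Fin n)) (k : Fin d → Fin (2 * N + 1)),
      ∑ j, gridValue N (k j) ^ 2 ≤ 1 →
      |offDiagForm (fun j => gridValue N (k j)) (signedPattern η κ)| ≤ B) :
    NoiseBounds η X t (B + 1) := by
  have forms : ∀ κ (v : Fin d → ℝ), ∑ j, v j ^ 2 ≤ 1 → _ := fun κ v hv =>
    forms_le_of_grid hN hNd (abs_signedPattern_le_one η κ) (hS κ) (hO κ) hv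
  -- The thresholds `κ j` are chosen independently in the coordinates, so the bound for all `κ`
  -- bounds the sum of the squared maxima.
  have hmax : ∑ j, maxThresholdSum (fun i => |η i j|) (fun i => Real.sign (η i j)) ^ 2 ≤ X := by
    choose κ hκ using fun j => exists_eq_ciSup_of_finite
      (f := fun o : Option (Fin n) => |thresholdSum (fun i => |η i j|)
        (fun i => Real.sign (η i j)) o|)
    refine le_trans (le_of_eq ?_) (hX κ)
    refine Finset.sum_congr rfl fun j _ => ?_
    rw [maxThresholdSum, ← hκ j, sq_abs]
  refine ⟨fun j θ => ?_, fun h hh => ?_, fun h hh v hv => ?_, fun h hh v hv => ?_⟩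
  · refine le_trans ?_ hmax
    refine le_trans ?_ (Finset.single_le_sum (f := fun j => maxThresholdSum (fun i => |η i j|)
      (fun i => Real.sign (η i j)) ^ 2) (fun j _ => sq_nonneg _) (Finset.mem_univ j))
    obtain ⟨o, ho⟩ := exists_thresholdPattern_eq (fun i => |η i j|) (fun i => θ ≤ |η i j|)
      fun i k h1 h2 => h1.trans h2
    have := abs_thresholdSum_le_max (fun i => |η i j|) (fun i => Real.sign (η i j)) o
    rw [thresholdSum_eq, ho] at this
    simp only [ite_mul, one_mul, zero_mul] at this
    rw [sq_le_sq, abs_of_nonneg (maxThresholdSum_nonneg _ _)]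
    exact this
  · refine le_trans (Finset.sum_le_sum fun j _ => ?_) hmax
    rw [sq_le_sq, abs_of_nonneg (maxThresholdSum_nonneg _ _)]
    exact abs_sum_clip_le _ (hh j)
  · exact excess_clip_le η hh t v fun κ => (forms κ v hv).1
  · exact abs_offDiagForm_clip_le η hh v fun κ => (forms κ v hv).2

theorem noise_signFlip {n d : ℕ} (μ : EuclideanSpace ℝ (Fin d)) (S : Fin n → Fin d → Bool)
    (x : Fin n → EuclideanSpace ℝ (Fin d)) :
    noise μ (fun i => signFlip μ (S i) (x i)) = fun i j => signValue (S i j) * noise μ x i j := by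
  funext i j
  simp [noise]

theorem abs_signValue_mul (b : Bool) (x : ℝ) : |signValue b * x| = |x| := by
  rw [abs_mul, abs_signValue, one_mul]

/-- Patterns depend on absolute values only, so flipping multiplies a fixed matrix with entries in
`[-1, 1]` by free signs. This is what makes the chaos bounds applicable for each fixed `κ`. -/
theorem signedPattern_signFlip {n d : ℕ} (η : Fin n → Fin d → ℝ) (S : Fin n → Fin d → Bool)
    (κ : Fin d → Option (Fin n)) :
    signedPattern (fun i j => signValue (S i j) * η i j) κ
      = fun i j => signValue (S i j) * signedPattern η κ i j := by
  funext i j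
  simp only [signedPattern, real_sign_signValue_mul, abs_signValue_mul]
  ring

theorem measurable_noise_apply {n d : ℕ} (μ : EuclideanSpace ℝ (Fin d)) (i : Fin n) (j : Fin d) :
    Measurable fun x : Fin n → EuclideanSpace ℝ (Fin d) => noise μ x i j := by
  unfold noise
  have : Measurable fun x : Fin n → EuclideanSpace ℝ (Fin d) => x i := measurable_pi_apply i
  fun_prop

theorem measurable_thresholdPattern {n d : ℕ} (μ : EuclideanSpace ℝ (Fin d)) (j : Fin d)
    (o : Option (Fin n)) (i : Fin n) :
    Measurable fun x : Fin n → EuclideanSpace ℝ (Fin d) =>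
      thresholdPattern (fun k => |noise μ x k j|) o i := by
  cases o with
  | none => exact measurable_const
  | some k =>
    exact Measurable.ite (measurableSet_le (measurable_noise_apply μ k j).abs
      (measurable_noise_apply μ i j).abs) measurable_const measurable_const

theorem measurable_signedPattern {n d : ℕ} (μ : EuclideanSpace ℝ (Fin d))
    (κ : Fin d → Option (Fin n)) (i : Fin n) (j : Fin d) :
    Measurable fun x : Fin n → EuclideanSpace ℝ (Fin d) => signedPattern (noise μ x) κ i j :=
  (measurable_real_sign.comp (measurable_noise_apply μ i j)).mul
    (measurable_thresholdPattern μ j (κ j) i)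

theorem card_filter_le_of_imp {n d : ℕ} {p : (Fin n → Fin d → Bool) → Prop} [DecidablePred p]
    (G : (Fin n → Fin d → Bool) → ℝ) (x c : ℝ) (hp : ∀ S, p S → x ≤ G S)
    (hG : ∑ S, Real.exp (G S) ≤ 2 ^ (n * d) * Real.exp c) :
    ((Finset.univ.filter p).card : ℝ) ≤ 2 ^ (n * d) * Real.exp (c - x) := by
  classical
  have h1 : (Finset.univ.filter p).card ≤ (Finset.univ.filter fun S => x ≤ G S).card :=
    Finset.card_le_card fun S hS => by
      simp only [Finset.mem_filter, Finset.mem_univ, true_and] at hS ⊢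
      exact hp S hS
  calc ((Finset.univ.filter p).card : ℝ) ≤ _ := by exact_mod_cast h1
    _ ≤ Real.exp (-x) * (2 ^ (n * d) * Real.exp c) := (card_filter_le_sum_exp G x).trans
        (mul_le_mul_of_nonneg_left hG (Real.exp_nonneg _))
    _ = _ := by rw [sub_eq_add_neg, Real.exp_add]; ring

section NoiseProbability

variable {n d : ℕ} {D : Measure (EuclideanSpace ℝ (Fin d))} [IsProbabilityMeasure D]
  {μ : EuclideanSpace ℝ (Fin d)}

/-- The columns carry independent signs, so the exponential moment of the sum of squared maxima is
at most `exp (3 d)` on average. The choice of `κ` is thereby covered without counting the `(n + 1) ^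
d` patterns. -/
theorem measure_thresholdSum_gt_le (hn : 1 ≤ n) (hD : ∀ s, MeasurePreserving (signFlip μ s) D D)
    (X : ℝ) :
    Measure.pi (fun _ : Fin n => D) {x | ∃ κ : Fin d → Option (Fin n), X < ∑ j,
      thresholdSum (fun i => |noise μ x i j|) (fun i => Real.sign (noise μ x i j)) (κ j) ^ 2}
      ≤ ENNReal.ofReal (Real.exp (d * 3 - X / (8 * n))) := by
  have hn0 : (0 : ℝ) < n := by exact_mod_cast hn
  refine measure_le_of_signFlips μ hD ?_ fun x _ => ?_
  · rw [Set.ofPred_exists]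
    refine MeasurableSet.iUnion fun κ => measurableSet_lt measurable_const ?_
    refine Finset.measurable_fun_sum _ fun j _ => Measurable.pow_const ?_ 2
    simp only [thresholdSum_eq]
    exact Finset.measurable_fun_sum _ fun i _ => (measurable_thresholdPattern μ j (κ j) i).mul
      (measurable_real_sign.comp (measurable_noise_apply μ i j))
  · refine card_filter_le_of_imp (fun S => ∑ j, maxThresholdSum (fun i => |noise μ x i j|)
      (fun i => signValue (S i j) * Real.sign (noise μ x i j)) ^ 2 / (8 * n)) _ _ (fun S hS => ?_)
      (sum_exp_sum_sq_maxThresholdSum_le hn (fun i j => Real.sign (noise μ x i j))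
        (fun i j => |noise μ x i j|) fun i j => abs_real_sign_le_one _)
    obtain ⟨κ, hκ⟩ := hS
    simp only [noise_signFlip, abs_signValue_mul, real_sign_signValue_mul] at hκ
    rw [← Finset.sum_div]
    gcongr
    refine hκ.le.trans (Finset.sum_le_sum fun j _ => ?_)
    rw [sq_le_sq, abs_of_nonneg (maxThresholdSum_nonneg _ _)]
    exact abs_thresholdSum_le_max _ _ _

theorem sum_sq_mul_signedPattern_le {v : Fin d → ℝ} (hv : ∑ j, v j ^ 2 ≤ 1)
    (η : Fin n → Fin d → ℝ) (κ : Fin d → Option (Fin n)) (i : Fin n) :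
    ∑ j, (v j * signedPattern η κ i j) ^ 2 ≤ 1 := by
  refine (Finset.sum_le_sum fun j _ => ?_).trans hv
  rw [mul_pow]
  have : signedPattern η κ i j ^ 2 ≤ 1 := by
    rw [← sq_abs]; exact pow_le_one₀ (abs_nonneg _) (abs_signedPattern_le_one _ _ _ _)
  nlinarith [sq_nonneg (v j)]

theorem measure_excess_gt_le (hD : ∀ s, MeasurePreserving (signFlip μ s) D D)
    {v : Fin d → ℝ} (hv : ∑ j, v j ^ 2 ≤ 1) (κ : Fin d → Option (Fin n)) (t B : ℝ) :
    Measure.pi (fun _ : Fin n => D) {x | B < excess t v (signedPattern (noise μ x) κ)}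
      ≤ ENNReal.ofReal (Real.exp (n * Real.exp (3 / 4 - t / 4) - B / 4)) := by
  refine measure_le_of_signFlips μ hD ?_ fun x _ => ?_
  · refine measurableSet_lt measurable_const ?_
    refine Finset.measurable_fun_sum _ fun i _ => measurable_const.max (Measurable.sub_const
      (Measurable.pow_const ?_ 2) _)
    exact Finset.measurable_fun_sum _ fun j _ =>
      measurable_const.mul (measurable_signedPattern μ κ i j)
  · refine card_filter_le_of_imp (fun S => ∑ i, max 0 ((∑ j, signValue (S i j) *
      (v j * signedPattern (noise μ x) κ i j)) ^ 2 - t) / 4) _ _ (fun S hS => ?_)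
      (sum_exp_rows_le (fun i s => max 0 ((∑ j, signValue (s j) *
      (v j * signedPattern (noise μ x) κ i j)) ^ 2 - t) / 4) _ fun i =>
        sum_exp_excess_le _ (sum_sq_mul_signedPattern_le hv _ κ i) t)
    simp only [noise_signFlip, signedPattern_signFlip, excess, Set.mem_ofPred_eq] at hS
    rw [← Finset.sum_div]
    gcongr
    refine hS.le.trans (le_of_eq (Finset.sum_congr rfl fun i _ => ?_))
    simp only [mul_left_comm]

theorem measure_offDiagForm_gt_le (hD : ∀ s, MeasurePreserving (signFlip μ s) D D)
    {v : Fin d → ℝ} (hv : ∑ j, v j ^ 2 ≤ 1) (κ : Fin d → Option (Fin n)) {τ l : ℝ}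
    (hτ : |τ| = 1) (hl0 : 0 ≤ l) (hl : l ≤ 1 / 4) (B : ℝ) :
    Measure.pi (fun _ : Fin n => D) {x | B < τ * offDiagForm v (signedPattern (noise μ x) κ)}
      ≤ ENNReal.ofReal (Real.exp (n * (8 * l ^ 2) - l * B)) := by
  refine measure_le_of_signFlips μ hD ?_ fun x _ => ?_
  · refine measurableSet_lt measurable_const (Measurable.const_mul ?_ _)
    refine Finset.measurable_fun_sum _ fun i _ => Measurable.sub (Measurable.pow_const ?_ 2) ?_
    · exact Finset.measurable_fun_sum _ fun j _ =>
        measurable_const.mul (measurable_signedPattern μ κ i j)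
    · exact Finset.measurable_fun_sum _ fun j _ =>
        (measurable_const.mul (measurable_signedPattern μ κ i j)).pow_const 2
  · have hlτ : |l * τ| = l := by rw [abs_mul, hτ, mul_one, abs_of_nonneg hl0]
    refine card_filter_le_of_imp (fun S => ∑ i, l * τ * ((∑ j, signValue (S i j) *
      (v j * signedPattern (noise μ x) κ i j)) ^ 2 - ∑ j, (v j * signedPattern (noise μ x) κ i j) ^ 2))
      _ _ (fun S hS => ?_)
      (sum_exp_rows_le (fun i s => l * τ * ((∑ j, signValue (s j) *
      (v j * signedPattern (noise μ x) κ i j)) ^ 2 - ∑ j, (v j * signedPattern (noise μ x) κ i j) ^ 2))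
        _ fun i => (sum_exp_chaos_le_of_sum_le_one _ (sum_sq_mul_signedPattern_le hv _ κ i) (l * τ)
          (hlτ.le.trans hl)).trans_eq ?_)
    · simp only [noise_signFlip, signedPattern_signFlip, offDiagForm, Set.mem_ofPred_eq] at hS
      rw [← Finset.mul_sum, mul_assoc]
      refine mul_le_mul_of_nonneg_left (hS.le.trans (le_of_eq ?_)) hl0
      congr 1
      refine Finset.sum_congr rfl fun i _ => ?_
      simp only [mul_left_comm (v _), mul_pow (signValue _), signValue_sq, one_mul]
    · rw [← sq_abs (l * τ), hlτ]

/-- The noise is well spread with high probability. -/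
theorem measure_not_noiseBounds_le (hn : 1 ≤ n) (hD : ∀ s, MeasurePreserving (signFlip μ s) D D)
    {N : ℕ} (hN : 1 ≤ N) (hNd : 4 * (d : ℝ) ^ 2 * n ≤ N) (X t B : ℝ) {l : ℝ} (hl0 : 0 ≤ l)
    (hl : l ≤ 1 / 4) :
    Measure.pi (fun _ : Fin n => D) {x | ¬ NoiseBounds (noise μ x) X t (B + 1)}
      ≤ ENNReal.ofReal (Real.exp (d * 3 - X / (8 * n)) + (((n + 1) * (2 * N + 1)) ^ d : ℕ) *
        (Real.exp (n * Real.exp (3 / 4 - t / 4) - B / 4)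
          + 2 * Real.exp (n * (8 * l ^ 2) - l * B))) := by
  set P := Measure.pi (fun _ : Fin n => D)
  set A₁ : Set (Fin n → EuclideanSpace ℝ (Fin d)) := {x | ∃ κ : Fin d → Option (Fin n), X < ∑ j,
      thresholdSum (fun i => |noise μ x i j|) (fun i => Real.sign (noise μ x i j)) (κ j) ^ 2}
  set A₂ : (Fin d → Option (Fin n)) × (Fin d → Fin (2 * N + 1)) →
      Set (Fin n → EuclideanSpace ℝ (Fin d)) := fun p => {x | ∑ j, gridValue N (p.2 j) ^ 2 ≤ 1 ∧
        (B < excess t (fun j => gridValue N (p.2 j)) (signedPattern (noise μ x) p.1) ∨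
        (B < 1 * offDiagForm (fun j => gridValue N (p.2 j)) (signedPattern (noise μ x) p.1) ∨
        B < -1 * offDiagForm (fun j => gridValue N (p.2 j)) (signedPattern (noise μ x) p.1)))}
    with hA₂
  set c := Real.exp (n * Real.exp (3 / 4 - t / 4) - B / 4)
    + 2 * Real.exp (n * (8 * l ^ 2) - l * B) with hc
  have hc0 : 0 ≤ c := by positivity
  have hA₂le : ∀ p, P (A₂ p) ≤ ENNReal.ofReal c := by
    intro p
    by_cases hv : ∑ j, gridValue N (p.2 j) ^ 2 ≤ 1
    · simp only [hA₂, hv, true_and]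
      rw [Set.ofPred_or, Set.ofPred_or, hc, two_mul (Real.exp (n * (8 * l ^ 2) - l * B)), ENNReal.ofReal_add (by positivity)
        (by positivity), ENNReal.ofReal_add (by positivity) (by positivity)]
      refine (measure_union_le _ _).trans (add_le_add (measure_excess_gt_le hD hv p.1 t B) ?_)
      exact (measure_union_le _ _).trans (add_le_add
        (measure_offDiagForm_gt_le hD hv p.1 (by simp) hl0 hl B)
        (measure_offDiagForm_gt_le hD hv p.1 (by simp) hl0 hl B))
    · simp [hA₂, hv]
  -- Union bound over one pattern and one grid value per coordinate; only the two quadratic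
  -- statistics require it.
  calc P {x | ¬ NoiseBounds (noise μ x) X t (B + 1)} ≤ P (A₁ ∪ ⋃ p, A₂ p) := by
        refine measure_mono fun x hx => ?_
        by_contra hcon
        simp only [Set.mem_union, Set.mem_iUnion, not_or, not_exists] at hcon
        refine hx (noiseBounds_of_patterns hN hNd (fun κ => ?_) (fun κ k hk => ?_)
          fun κ k hk => ?_)
        · by_contra h
          exact hcon.1 ⟨κ, not_le.1 h⟩
        · by_contra h
          exact hcon.2 (κ, k) ⟨hk, Or.inl (not_le.1 h)⟩
        · by_contra h
          rcases lt_abs.1 (not_le.1 h) with h | h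
          · exact hcon.2 (κ, k) ⟨hk, Or.inr (Or.inl (by linarith))⟩
          · exact hcon.2 (κ, k) ⟨hk, Or.inr (Or.inr (by linarith))⟩
    _ ≤ P A₁ + ∑ p, P (A₂ p) := (measure_union_le _ _).trans
        (add_le_add le_rfl (measure_iUnion_fintype_le _ _))
    _ ≤ ENNReal.ofReal (Real.exp (d * 3 - X / (8 * n)))
        + ∑ _p : (Fin d → Option (Fin n)) × (Fin d → Fin (2 * N + 1)), ENNReal.ofReal c :=
        add_le_add (measure_thresholdSum_gt_le hn hD X) (Finset.sum_le_sum fun p _ => hA₂le p)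
    _ = _ := by
        rw [Finset.sum_const, Finset.card_univ, nsmul_eq_mul, ← ENNReal.ofReal_natCast,
          ← ENNReal.ofReal_mul (by positivity), ← ENNReal.ofReal_add (by positivity)
          (by positivity)]
        congr 3
        simp [mul_pow]

end NoiseProbability

/-! ### Deterministic analysis of clipped residuals -/

/-- The residuals at the centre `c`, rescaled by `4 L` and clipped. -/
noncomputable def clippedResidual {n d : ℕ} (z : Fin n → Fin d → ℝ) (L c : Fin d → ℝ) :
    Fin n → Fin d → ℝ :=
  fun i j => clip ((z i j - c j) / (4 * L j))

/-- The off-diagonal quadratic form of one row. -/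
noncomputable def rowForm {d : ℕ} (v y : Fin d → ℝ) : ℝ :=
  (∑ j, v j * y j) ^ 2 - ∑ j, (v j * y j) ^ 2

/-- A weighted and corrupted sample together with a centre. The indices in `G` are those of the
uncorrupted points, and `η` is the noise of the clean sample. -/
structure Snapshot {n d : ℕ} (α ε l : ℝ) (η z : Fin n → Fin d → ℝ) (μ L c : Fin d → ℝ)
    (w : Fin n → ℝ) (G : Finset (Fin n)) : Prop where
  n_pos : 1 ≤ n
  d_pos : 1 ≤ d
  α_pos : 0 < α
  α_le : α ≤ 1
  ε_pos : 0 < ε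
  l_ge : 1 ≤ l
  small : ε * l ≤ α ^ 2 / 10 ^ 6
  bounds : NoiseBounds η (n ^ 2 * (ε ^ 2 * l)) (8 * l) (n * (ε * l))
  good : ∀ i ∈ G, ∀ j, z i j = μ j + η i j
  bad : (Gᶜ.card : ℝ) ≤ ε * n
  L_nonneg : ∀ j, 0 ≤ L j
  near : ∀ j, |μ j - c j| ≤ 2 * L j
  count : ∀ j, α / 2 * n - ε * n ≤ ((G.filter fun i => |η i j| ≤ L j).card : ℝ)
  w_mem : ∀ i, w i ∈ Set.Icc (0 : ℝ) 1
  loss : ∑ i, (if i ∈ G then 1 - w i else 1) ≤ 5 * ε * n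

theorem le_mul_sum_sq_of_homogeneous {d : ℕ} {F : (Fin d → ℝ) → ℝ} {K : ℝ}
    (hF : ∀ (a : ℝ) v, F (fun j => a * v j) = a ^ 2 * F v)
    (h : ∀ v, ∑ j, v j ^ 2 ≤ 1 → F v ≤ K) (v : Fin d → ℝ) : F v ≤ K * ∑ j, v j ^ 2 := by
  have h0 : 0 ≤ ∑ j, v j ^ 2 := Finset.sum_nonneg fun _ _ => sq_nonneg _
  rcases h0.eq_or_lt with h0 | h0
  · have hv : v = fun j => 0 * v j := by
      funext j
      have := (Finset.sum_eq_zero_iff_of_nonneg fun _ _ => sq_nonneg _).1 h0.symm j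
        (Finset.mem_univ j)
      simpa using this
    rw [← h0, hv, hF]
    simp
  · set q := ∑ j, v j ^ 2
    have hs : 0 < Real.sqrt q := Real.sqrt_pos.2 h0
    have h1 : F (fun j => (Real.sqrt q)⁻¹ * v j) ≤ K := by
      refine h _ (le_of_eq ?_)
      simp only [mul_pow, ← Finset.mul_sum]
      rw [inv_pow, Real.sq_sqrt h0.le]
      exact inv_mul_cancel₀ h0.ne'
    rw [hF, inv_pow, Real.sq_sqrt h0.le, inv_mul_le_iff₀ h0] at h1
    linarith

theorem rowForm_smul {d : ℕ} (a : ℝ) (v y : Fin d → ℝ) :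
    rowForm (fun j => a * v j) y = a ^ 2 * rowForm v y := by
  simp only [rowForm, mul_assoc, mul_pow, ← Finset.mul_sum]
  ring

theorem sq_sum_mul_le {ι : Type*} (s : Finset ι) (f g : ι → ℝ) :
    (∑ i ∈ s, f i * g i) ^ 2 ≤ (∑ i ∈ s, f i ^ 2) * ∑ i ∈ s, g i ^ 2 :=
  Finset.sum_mul_sq_le_sq_mul_sq s f g

theorem sq_sum_weight_mul_le {ι : Type*} (s : Finset ι) (a f : ι → ℝ) (ha : ∀ i ∈ s, 0 ≤ a i) :
    (∑ i ∈ s, a i * f i) ^ 2 ≤ (∑ i ∈ s, a i) * ∑ i ∈ s, a i * f i ^ 2 := by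
  have h := sq_sum_mul_le s (fun i => Real.sqrt (a i)) (fun i => Real.sqrt (a i) * f i)
  have e1 : ∑ i ∈ s, Real.sqrt (a i) * (Real.sqrt (a i) * f i) = ∑ i ∈ s, a i * f i :=
    Finset.sum_congr rfl fun i hi => by rw [← mul_assoc, Real.mul_self_sqrt (ha i hi)]
  have e2 : ∑ i ∈ s, Real.sqrt (a i) ^ 2 = ∑ i ∈ s, a i :=
    Finset.sum_congr rfl fun i hi => Real.sq_sqrt (ha i hi)
  have e3 : ∑ i ∈ s, (Real.sqrt (a i) * f i) ^ 2 = ∑ i ∈ s, a i * f i ^ 2 :=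
    Finset.sum_congr rfl fun i hi => by rw [mul_pow, Real.sq_sqrt (ha i hi)]
  rwa [e1, e2, e3] at h

theorem sum_ite_mem_add {n : ℕ} (G : Finset (Fin n)) (f : Fin n → ℝ) :
    ∑ i, f i = ∑ i ∈ G, f i + ∑ i ∈ Gᶜ, f i := (Finset.sum_add_sum_compl G f).symm

/-! ### Clean second moments, drift of the residuals, and the radius of a balanced center -/

namespace Snapshot

variable {n d : ℕ} {α ε l : ℝ} {η z : Fin n → Fin d → ℝ} {μ L c : Fin d → ℝ} {w : Fin n → ℝ}
  {G : Finset (Fin n)}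

/-- Displacement of the centre in units of the scale. -/
noncomputable def shift (μ L c : Fin d → ℝ) : Fin d → ℝ := fun j => (μ j - c j) / (4 * L j)

/-- Length of the displacement. -/
noncomputable def radius (μ L c : Fin d → ℝ) : ℝ := Real.sqrt (∑ j, shift μ L c j ^ 2)

/-- The clipped clean noise. -/
noncomputable def cleanResidual (η : Fin n → Fin d → ℝ) (L : Fin d → ℝ) : Fin n → Fin d → ℝ :=
  fun i j => clip (η i j / (4 * L j))

/-- Weight of the clean sample that is missing at index `i`. -/
noncomputable def missing (w : Fin n → ℝ) (G : Finset (Fin n)) (i : Fin n) : ℝ :=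
  if i ∈ G then 1 - w i else 1

theorem radius_nonneg (μ L c : Fin d → ℝ) : 0 ≤ radius μ L c := Real.sqrt_nonneg _

theorem radius_sq (μ L c : Fin d → ℝ) : radius μ L c ^ 2 = ∑ j, shift μ L c j ^ 2 :=
  Real.sq_sqrt (Finset.sum_nonneg fun _ _ => sq_nonneg _)

theorem abs_shift_le_radius (μ L c : Fin d → ℝ) (j : Fin d) : |shift μ L c j| ≤ radius μ L c := by
  refine Real.abs_le_sqrt ?_
  exact Finset.single_le_sum (f := fun j => shift μ L c j ^ 2) (fun j _ => sq_nonneg _)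
    (Finset.mem_univ j)

variable (S : Snapshot α ε l η z μ L c w G)
include S

theorem n_pos' : (0 : ℝ) < n := by exact_mod_cast S.n_pos

theorem ε_le : ε ≤ ε * l := le_mul_of_one_le_right S.ε_pos.le S.l_ge

theorem φ_le : ε * l ≤ α / 10 ^ 6 := by
  refine S.small.trans ?_
  gcongr
  nlinarith [S.α_pos, S.α_le]

theorem missing_mem (i : Fin n) : missing w G i ∈ Set.Icc (0 : ℝ) 1 := by
  have := S.w_mem i
  unfold missing
  split_ifs
  · exact ⟨by linarith [this.2], by linarith [this.1]⟩
  · simp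

omit S in
theorem one_sub_missing (f : Fin n → ℝ) : ∑ i, (1 - missing w G i) * f i = ∑ i ∈ G, w i * f i := by
  rw [sum_ite_mem_add G]
  have h1 : ∑ i ∈ Gᶜ, (1 - missing w G i) * f i = 0 :=
    Finset.sum_eq_zero fun i hi => by simp [missing, Finset.mem_compl.1 hi]
  rw [h1, add_zero]
  exact Finset.sum_congr rfl fun i hi => by simp [missing, hi]

theorem abs_residual_sub_le {i : Fin n} (hi : i ∈ G) (j : Fin d) :
    |clippedResidual z L c i j - cleanResidual η L i j| ≤ |shift μ L c j| := by
  refine (abs_clip_sub_clip_le _ _).trans (le_of_eq ?_)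
  rw [S.good i hi j, shift]
  congr 1
  ring

theorem residual_sub_mul_shift_nonneg {i : Fin n} (hi : i ∈ G) (j : Fin d) :
    0 ≤ (clippedResidual z L c i j - cleanResidual η L i j) * shift μ L c j := by
  have e : (z i j - c j) / (4 * L j) = η i j / (4 * L j) + shift μ L c j := by
    rw [S.good i hi j, shift]; ring
  simp only [clippedResidual, cleanResidual, e]
  rcases le_total 0 (shift μ L c j) with h | h
  · exact mul_nonneg (sub_nonneg.2 (clip_mono (by linarith))) h
  · exact mul_nonneg_of_nonpos_of_nonpos (sub_nonpos.2 (clip_mono (by linarith))) h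

theorem abs_shift_le (j : Fin d) : |shift μ L c j| ≤ 1 / 2 := by
  rw [shift, abs_div, abs_of_nonneg (by linarith [S.L_nonneg j] : 0 ≤ 4 * L j)]
  refine div_le_of_le_mul₀ (by linarith [S.L_nonneg j]) (by norm_num) ?_
  linarith [S.near j]

/-- Here the factor `4` in the scale is used: noise of size at most `L` rescales to at most `1/4`
and the displacement to at most `1/2`, so neither argument is clipped. For `L j = 0` division by
zero returns `0` and both sides vanish. -/
theorem residual_sub_eq {i : Fin n} (hi : i ∈ G) {j : Fin d} (hij : |η i j| ≤ L j) :
    clippedResidual z L c i j - cleanResidual η L i j = shift μ L c j := by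
  have e : (z i j - c j) / (4 * L j) = η i j / (4 * L j) + shift μ L c j := by
    rw [S.good i hi j, shift]; ring
  have h1 : |η i j / (4 * L j)| ≤ 1 / 4 := by
    rw [abs_div, abs_of_nonneg (by linarith [S.L_nonneg j] : 0 ≤ 4 * L j)]
    refine div_le_of_le_mul₀ (by linarith [S.L_nonneg j]) (by norm_num) ?_
    linarith
  have h2 := S.abs_shift_le j
  simp only [clippedResidual, cleanResidual, e]
  rw [clip_of_abs_le ((abs_add_le _ _).trans (by linarith)), clip_of_abs_le (by linarith)]
  ring

theorem sum_missing_le : ∑ i, missing w G i ≤ 5 * ε * n := S.loss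

theorem four_L_nonneg (j : Fin d) : 0 ≤ 4 * L j := by linarith [S.L_nonneg j]

/-- Second moments of a part of the clean sample. -/
theorem sum_weight_sq_le {a : Fin n → ℝ} (ha : ∀ i, a i ∈ Set.Icc (0 : ℝ) 1) (v : Fin d → ℝ) :
    ∑ i, a i * (∑ j, v j * cleanResidual η L i j) ^ 2
      ≤ (8 * l * ∑ i, a i + n * (ε * l)) * ∑ j, v j ^ 2 := by
  refine le_mul_sum_sq_of_homogeneous
    (F := fun v => ∑ i, a i * (∑ j, v j * cleanResidual η L i j) ^ 2) (fun b v => ?_)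
    (fun v hv => ?_) v
  · simp only [mul_assoc, ← Finset.mul_sum, mul_pow]
    rw [Finset.mul_sum]
    exact Finset.sum_congr rfl fun i _ => by ring
  · have h := S.bounds.excess (fun j => 4 * L j) S.four_L_nonneg v hv
    -- Pointwise `a x² ≤ 8 l a + max 0 (x² - 8 l)` for `a ∈ [0, 1]`: the weight pays for the part
    -- below the level and the excess bound for the rest.
    calc ∑ i, a i * (∑ j, v j * cleanResidual η L i j) ^ 2
        ≤ ∑ i, (8 * l * a i + max 0 ((∑ j, v j * cleanResidual η L i j) ^ 2 - 8 * l)) := by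
          refine Finset.sum_le_sum fun i _ => ?_
          have h1 := le_max_left 0 ((∑ j, v j * cleanResidual η L i j) ^ 2 - 8 * l)
          have h2 := le_max_right 0 ((∑ j, v j * cleanResidual η L i j) ^ 2 - 8 * l)
          have h3 := mul_le_mul_of_nonneg_left h2 (ha i).1
          have h4 := mul_le_of_le_one_left h1 (ha i).2
          linarith
      _ ≤ _ := by
          rw [Finset.sum_add_distrib, ← Finset.mul_sum]
          exact add_le_add le_rfl h

omit S in
theorem abs_clippedResidual_le_one (i : Fin n) (j : Fin d) : |clippedResidual z L c i j| ≤ 1 := abs_clip_le_one _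

omit S in
theorem abs_cleanResidual_le_one (i : Fin n) (j : Fin d) : |cleanResidual η L i j| ≤ 1 :=
  abs_clip_le_one _

omit S in
theorem sum_mul_sq_le {v y : Fin d → ℝ} (hy : ∀ j, |y j| ≤ 1) :
    ∑ j, (v j * y j) ^ 2 ≤ ∑ j, v j ^ 2 := by
  refine Finset.sum_le_sum fun j _ => ?_
  rw [mul_pow]
  have : y j ^ 2 ≤ 1 := by rw [← sq_abs]; exact pow_le_one₀ (abs_nonneg _) (hy j)
  nlinarith [sq_nonneg (v j)]

theorem sum_sq_clean_le {v : Fin d → ℝ} (hv : ∑ j, v j ^ 2 ≤ 1) :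
    ∑ i, (∑ j, v j * cleanResidual η L i j) ^ 2 ≤ 2 * n := by
  have h := (abs_le.1 (S.bounds.offDiag (fun j => 4 * L j) S.four_L_nonneg v hv)).2
  have h2 : ∑ i : Fin n, ∑ j, (v j * cleanResidual η L i j) ^ 2 ≤ ∑ _i : Fin n, (1 : ℝ) :=
    Finset.sum_le_sum fun i _ =>
      (sum_mul_sq_le (abs_cleanResidual_le_one (η := η) (L := L) i)).trans hv
  have h3 : ε * l ≤ 1 := by
    refine S.φ_le.trans ?_
    have := S.α_le
    linarith
  have h4 : (n : ℝ) * (ε * l) ≤ n * 1 := mul_le_mul_of_nonneg_left h3 (Nat.cast_nonneg n)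
  have h' : ∑ i, ((∑ j, v j * cleanResidual η L i j) ^ 2
      - ∑ j, (v j * cleanResidual η L i j) ^ 2) ≤ n * (ε * l) := h
  rw [Finset.sum_sub_distrib] at h'
  simp at h2
  linarith

/-- The clean part has small off-diagonal second moments. -/
theorem abs_sum_rowForm_le {v : Fin d → ℝ} (hv : ∑ j, v j ^ 2 ≤ 1) :
    |∑ i ∈ G, w i * rowForm v (clippedResidual z L c i)|
      ≤ n * (47 * (ε * l) + 5 * radius μ L c + radius μ L c ^ 2) := by
  set r := radius μ L c with hr
  have hr0 : 0 ≤ r := radius_nonneg _ _ _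
  set Y := cleanResidual η L with hY
  set y := clippedResidual z L c with hy
  set ξ : Fin n → ℝ := fun i => ∑ j, v j * Y i j with hξ
  have hn0 := S.n_pos'
  have hm := S.missing_mem
  -- Full clean sample, minus its missing weight, plus the effect of the displacement. The first two
  -- contribute `1 + 46` multiples of `ε l`; the last contributes the terms in `r`.
  have e : ∑ i ∈ G, w i * rowForm v (y i) = ∑ i, rowForm v (Y i)
      - ∑ i, missing w G i * rowForm v (Y i)
      + ∑ i ∈ G, w i * (rowForm v (y i) - rowForm v (Y i)) := by
    have := one_sub_missing (w := w) (G := G) fun i => rowForm v (Y i)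
    simp only [mul_sub, sub_mul, one_mul, Finset.sum_sub_distrib] at this ⊢
    linarith
  have h1 : |∑ i, rowForm v (Y i)| ≤ n * (ε * l) :=
    S.bounds.offDiag (fun j => 4 * L j) S.four_L_nonneg v hv
  have hrow : ∀ i, |rowForm v (Y i)| ≤ ξ i ^ 2 + 1 := by
    intro i
    have a1 : ∑ j, (v j * Y i j) ^ 2 ≤ 1 :=
      (sum_mul_sq_le (abs_cleanResidual_le_one (η := η) (L := L) i)).trans hv
    have a2 : 0 ≤ ∑ j, (v j * Y i j) ^ 2 := Finset.sum_nonneg fun _ _ => sq_nonneg _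
    rw [rowForm, abs_le]
    constructor
    · nlinarith [sq_nonneg (ξ i)]
    · have : (∑ j, v j * Y i j) ^ 2 = ξ i ^ 2 := rfl
      linarith
  have h2 : |∑ i, missing w G i * rowForm v (Y i)| ≤ 46 * n * (ε * l) := by
    refine (Finset.abs_sum_le_sum_abs _ _).trans ?_
    have b1 : ∑ i, |missing w G i * rowForm v (Y i)|
        ≤ ∑ i, (missing w G i * ξ i ^ 2 + missing w G i) := by
      refine Finset.sum_le_sum fun i _ => ?_
      rw [abs_mul, abs_of_nonneg (hm i).1]
      have := mul_le_mul_of_nonneg_left (hrow i) (hm i).1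
      linarith
    have b2 := S.sum_weight_sq_le hm v
    have b3 := S.sum_missing_le
    rw [Finset.sum_add_distrib] at b1
    have b4 : (8 * l * ∑ i, missing w G i + n * (ε * l)) * ∑ j, v j ^ 2
        ≤ 8 * l * ∑ i, missing w G i + n * (ε * l) := by
      refine mul_le_of_le_one_right ?_ hv
      have : 0 ≤ ∑ i, missing w G i := Finset.sum_nonneg fun i _ => (hm i).1
      have := S.l_ge
      have := S.ε_pos
      positivity
    have b5 : 8 * l * ∑ i, missing w G i ≤ 8 * l * (5 * ε * n) :=
      mul_le_mul_of_nonneg_left b3 (by linarith [S.l_ge])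
    have b6 : 5 * ε * n ≤ 5 * (ε * l) * n := by nlinarith [S.ε_le]
    calc _ ≤ ∑ i, missing w G i * ξ i ^ 2 + ∑ i, missing w G i := b1
      _ ≤ 8 * l * (5 * ε * n) + n * (ε * l) + 5 * (ε * l) * n := by linarith
      _ = _ := by ring
  have hdiff : ∀ i ∈ G, |rowForm v (y i) - rowForm v (Y i)| ≤ r * ξ i ^ 2 + (3 * r + r ^ 2) := by
    intro i hi
    set t := ∑ j, v j * (y i j - Y i j) with ht
    have c1 : |t| ≤ r := by
      rw [← abs_of_nonneg hr0, ← sq_le_sq]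
      refine (sq_sum_mul_le _ _ _).trans ?_
      have : ∑ j, (y i j - Y i j) ^ 2 ≤ r ^ 2 := by
        rw [hr, radius_sq]
        exact Finset.sum_le_sum fun j _ => sq_le_sq.2 (S.abs_residual_sub_le hi j)
      have h0 : 0 ≤ ∑ j, (y i j - Y i j) ^ 2 := Finset.sum_nonneg fun _ _ => sq_nonneg _
      nlinarith
    have c2 : ∑ j, v j * y i j = ξ i + t := by
      rw [hξ, ht, ← Finset.sum_add_distrib]
      exact Finset.sum_congr rfl fun j _ => by ring
    have c3 : |∑ j, (v j * y i j) ^ 2 - ∑ j, (v j * Y i j) ^ 2| ≤ 2 * r := by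
      rw [← Finset.sum_sub_distrib]
      refine (Finset.abs_sum_le_sum_abs _ _).trans ?_
      calc _ ≤ ∑ j, v j ^ 2 * (2 * r) := by
            refine Finset.sum_le_sum fun j _ => ?_
            have e' : (v j * y i j) ^ 2 - (v j * Y i j) ^ 2
                = v j ^ 2 * ((y i j + Y i j) * (y i j - Y i j)) := by ring
            rw [e', abs_mul, abs_mul, abs_of_nonneg (sq_nonneg (v j))]
            refine mul_le_mul_of_nonneg_left ?_ (sq_nonneg _)
            refine mul_le_mul ?_ ((S.abs_residual_sub_le hi j).trans (abs_shift_le_radius _ _ _ j))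
              (abs_nonneg _) (by norm_num)
            exact (abs_add_le _ _).trans (by
              linarith [abs_clippedResidual_le_one (z := z) (L := L) (c := c) i j, abs_cleanResidual_le_one (η := η) (L := L) i j])
        _ = (∑ j, v j ^ 2) * (2 * r) := by rw [Finset.sum_mul]
        _ ≤ 1 * (2 * r) := by gcongr
        _ = 2 * r := one_mul _
    have c4 : |(ξ i + t) ^ 2 - ξ i ^ 2| ≤ r * ξ i ^ 2 + r + r ^ 2 := by
      have e' : (ξ i + t) ^ 2 - ξ i ^ 2 = 2 * ξ i * t + t ^ 2 := by ring
      have t2 : t ^ 2 ≤ r ^ 2 := by rw [← sq_abs t]; exact pow_le_pow_left₀ (abs_nonneg _) c1 2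
      have t3 : |2 * ξ i * t| ≤ r * (ξ i ^ 2 + 1) := by
        rw [abs_mul, mul_comm]
        refine mul_le_mul c1 ?_ (abs_nonneg _) hr0
        rw [abs_mul, abs_of_pos (by norm_num : (0 : ℝ) < 2), ← sq_abs (ξ i)]
        nlinarith [sq_nonneg (|ξ i| - 1)]
      rw [e']
      refine (abs_add_le _ _).trans ?_
      rw [abs_of_nonneg (sq_nonneg t)]
      linarith
    have e' : rowForm v (y i) - rowForm v (Y i) = ((ξ i + t) ^ 2 - ξ i ^ 2)
        - (∑ j, (v j * y i j) ^ 2 - ∑ j, (v j * Y i j) ^ 2) := by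
      rw [rowForm, rowForm, c2]; ring
    rw [e']
    refine (abs_sub _ _).trans ?_
    linarith
  have h3 : |∑ i ∈ G, w i * (rowForm v (y i) - rowForm v (Y i))| ≤ n * (5 * r + r ^ 2) := by
    refine (Finset.abs_sum_le_sum_abs _ _).trans ?_
    calc _ ≤ ∑ i ∈ G, (r * ξ i ^ 2 + (3 * r + r ^ 2)) := by
          refine Finset.sum_le_sum fun i hi => ?_
          rw [abs_mul, abs_of_nonneg (S.w_mem i).1]
          exact (mul_le_of_le_one_left (abs_nonneg _) (S.w_mem i).2).trans (hdiff i hi)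
      _ ≤ ∑ i, (r * ξ i ^ 2 + (3 * r + r ^ 2)) :=
          Finset.sum_le_sum_of_subset_of_nonneg (Finset.subset_univ _) fun i _ _ => by positivity
      _ ≤ r * (2 * n) + n * (3 * r + r ^ 2) := by
          rw [Finset.sum_add_distrib, ← Finset.mul_sum]
          refine add_le_add (mul_le_mul_of_nonneg_left (S.sum_sq_clean_le hv) hr0)
            (le_of_eq (by simp; ring))
      _ = _ := by ring
  rw [e]
  have k1 := abs_le.1 h1
  have k2 := abs_le.1 h2
  have k3 := abs_le.1 h3
  rw [abs_le]
  constructor <;> linarith [k1.1, k1.2, k2.1, k2.2, k3.1, k3.2]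

theorem abs_sum_rowForm_le_mul (v : Fin d → ℝ) :
    |∑ i ∈ G, w i * rowForm v (clippedResidual z L c i)|
      ≤ n * (47 * (ε * l) + 5 * radius μ L c + radius μ L c ^ 2) * ∑ j, v j ^ 2 := by
  refine le_mul_sum_sq_of_homogeneous
    (F := fun v => |∑ i ∈ G, w i * rowForm v (clippedResidual z L c i)|) (fun b v => ?_)
    (fun v hv => S.abs_sum_rowForm_le hv) v
  simp only [rowForm_smul, mul_left_comm _ (b ^ 2), ← Finset.mul_sum]
  rw [abs_mul, abs_of_nonneg (sq_nonneg b)]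

/-- The points near the centre contribute the full displacement. -/
theorem sum_near_ge (j : Fin d) :
    α / 4 * n ≤ ∑ i ∈ G.filter (fun i => |η i j| ≤ L j), w i := by
  have h1 := S.count j
  set P := G.filter (fun i => |η i j| ≤ L j)
  have h2 : ∑ i ∈ P, missing w G i ≤ 5 * ε * n :=
    (Finset.sum_le_sum_of_subset_of_nonneg (Finset.subset_univ _)
      fun i _ _ => (S.missing_mem i).1).trans S.sum_missing_le
  have h3 : ∑ i ∈ P, missing w G i = P.card - ∑ i ∈ P, w i := by
    have : ∑ i ∈ P, missing w G i = ∑ i ∈ P, (1 - w i) :=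
      Finset.sum_congr rfl fun i hi => by simp [missing, (Finset.mem_filter.1 hi).1]
    rw [this]
    simp
  have h4 := S.ε_le.trans S.φ_le
  have hn := S.n_pos'
  have h5 : ε * n ≤ α / 10 ^ 6 * n := mul_le_mul_of_nonneg_right h4 hn.le
  have := mul_pos S.α_pos hn
  linarith

/-- By monotonicity of clipping no good point pulls against the displacement, and the points with
noise at most `L` contribute it in full. -/
theorem sum_residual_sub_mul_ge (j : Fin d) :
    α / 4 * n * shift μ L c j ^ 2
      ≤ ∑ i ∈ G, w i * ((clippedResidual z L c i j - cleanResidual η L i j) * shift μ L c j) := by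
  calc α / 4 * n * shift μ L c j ^ 2
      ≤ (∑ i ∈ G.filter (fun i => |η i j| ≤ L j), w i) * shift μ L c j ^ 2 :=
        mul_le_mul_of_nonneg_right (S.sum_near_ge j) (sq_nonneg _)
    _ = ∑ i ∈ G.filter (fun i => |η i j| ≤ L j),
        w i * ((clippedResidual z L c i j - cleanResidual η L i j) * shift μ L c j) := by
        rw [Finset.sum_mul]
        refine Finset.sum_congr rfl fun i hi => ?_
        rw [S.residual_sub_eq (Finset.mem_filter.1 hi).1 (Finset.mem_filter.1 hi).2, sq]
    _ ≤ _ := Finset.sum_le_sum_of_subset_of_nonneg (Finset.filter_subset _ _) fun i hi _ =>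
        mul_nonneg (S.w_mem i).1 (S.residual_sub_mul_shift_nonneg hi j)

theorem sum_bad_le : ∑ i ∈ Gᶜ, w i ≤ ε * n := by
  refine le_trans ?_ S.bad
  calc ∑ i ∈ Gᶜ, w i ≤ ∑ _i ∈ Gᶜ, (1 : ℝ) := Finset.sum_le_sum fun i _ => (S.w_mem i).2
    _ = _ := by simp

/-- At a centre far on one side of the location the weighted residuals have a definite sign. -/
theorem shift_mul_sum_residual_nonneg {j : Fin d} (hj : 1 / 4 ≤ |shift μ L c j|) :
    0 ≤ shift μ L c j * ∑ i, w i * clippedResidual z L c i j := by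
  set s := shift μ L c j with hs
  have hn := S.n_pos'
  have hm := S.missing_mem
  have h1 := S.sum_residual_sub_mul_ge j
  have h2 : |∑ i ∈ Gᶜ, w i * clippedResidual z L c i j| ≤ ε * n := by
    refine (Finset.abs_sum_le_sum_abs _ _).trans (le_trans (Finset.sum_le_sum fun i _ => ?_)
      S.sum_bad_le)
    rw [abs_mul, abs_of_nonneg (S.w_mem i).1]
    exact mul_le_of_le_one_right (S.w_mem i).1 (abs_clippedResidual_le_one (z := z) (L := L) (c := c) i j)
  have h3 : |∑ i, missing w G i * cleanResidual η L i j| ≤ 5 * ε * n := by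
    refine (Finset.abs_sum_le_sum_abs _ _).trans (le_trans (Finset.sum_le_sum fun i _ => ?_)
      S.sum_missing_le)
    rw [abs_mul, abs_of_nonneg (hm i).1]
    exact mul_le_of_le_one_right (hm i).1 (abs_cleanResidual_le_one i j)
  have h4 : |∑ i, cleanResidual η L i j| ≤ n * (α / 1000) := by
    refine abs_le_of_sq_le_sq ?_ (by have := S.α_pos; positivity)
    refine (Finset.single_le_sum (f := fun j => (∑ i, cleanResidual η L i j) ^ 2)
      (fun j _ => sq_nonneg _) (Finset.mem_univ j)).trans
      ((S.bounds.linear (fun j => 4 * L j) S.four_L_nonneg).trans ?_)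
    rw [mul_pow]
    refine mul_le_mul_of_nonneg_left ?_ (sq_nonneg _)
    have h5 : ε ≤ 1 := by linarith [S.ε_le.trans S.φ_le, S.α_le]
    have h6 : ε ^ 2 * l ≤ ε * l := by
      rw [sq, mul_assoc]
      exact mul_le_of_le_one_left (mul_nonneg S.ε_pos.le (by linarith [S.l_ge])) h5
    have := S.small
    linarith
  -- Clean sum, minus the missing weight, plus the drift of the good points, plus the corrupted
  -- points; only the drift is large.
  have e : ∑ i, w i * clippedResidual z L c i j = ∑ i, cleanResidual η L i j
      - ∑ i, missing w G i * cleanResidual η L i j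
      + ∑ i ∈ G, w i * (clippedResidual z L c i j - cleanResidual η L i j)
      + ∑ i ∈ Gᶜ, w i * clippedResidual z L c i j := by
    have := one_sub_missing (w := w) (G := G) fun i => cleanResidual η L i j
    rw [sum_ite_mem_add G]
    simp only [mul_sub, sub_mul, one_mul, Finset.sum_sub_distrib] at this ⊢
    linarith
  have h1' : α / 4 * n * s ^ 2
      ≤ s * ∑ i ∈ G, w i * (clippedResidual z L c i j - cleanResidual η L i j) := by
    rw [Finset.mul_sum]
    refine h1.trans (le_of_eq (Finset.sum_congr rfl fun i _ => by ring))
  -- At `|s| ≥ 1/4` the drift `(α/4) n s²` is at least `|s| α n / 16`, which is the size allowed to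
  -- everything else.
  have hrest : |∑ i, cleanResidual η L i j - ∑ i, missing w G i * cleanResidual η L i j
      + ∑ i ∈ Gᶜ, w i * clippedResidual z L c i j| ≤ α / 16 * n := by
    have k1 := abs_le.1 h2
    have k2 := abs_le.1 h3
    have k3 := abs_le.1 h4
    have h7 : ε * n ≤ α / 10 ^ 6 * n := mul_le_mul_of_nonneg_right (S.ε_le.trans S.φ_le) hn.le
    have := mul_pos S.α_pos hn
    rw [abs_le]
    constructor <;> linarith [k1.1, k1.2, k2.1, k2.2, k3.1, k3.2]
  set A := ∑ i, cleanResidual η L i j - ∑ i, missing w G i * cleanResidual η L i j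
      + ∑ i ∈ Gᶜ, w i * clippedResidual z L c i j with hA
  have e2 : s * ∑ i, w i * clippedResidual z L c i j = s * A
      + s * ∑ i ∈ G, w i * (clippedResidual z L c i j - cleanResidual η L i j) := by
    rw [e, hA]; ring
  have h8 : -(|s| * (α / 16 * n)) ≤ s * A := by
    have : |s * A| ≤ |s| * (α / 16 * n) := by
      rw [abs_mul]; exact mul_le_mul_of_nonneg_left hrest (abs_nonneg _)
    exact (abs_le.1 this).1
  rw [e2]
  have h9 : |s| * (1 / 4) ≤ s ^ 2 := by
    rw [← sq_abs s, sq]; exact mul_le_mul_of_nonneg_left hj (abs_nonneg _)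
  have h10 : (|s| * (1 / 4)) * (α / 4 * n) ≤ s ^ 2 * (α / 4 * n) :=
    mul_le_mul_of_nonneg_right h9 (by have := S.α_pos; positivity)
  linarith

/-- The displacement of a balanced centre is controlled by the off-diagonal second moments. -/
theorem sq_radius_le {β lam : ℝ} (hβ : ∀ j, |∑ i, w i * clippedResidual z L c i j| ≤ β * n)
    (hβd : d * β ^ 2 ≤ ε ^ 2)
    (hlam : ∀ v : Fin d → ℝ,
      ∑ i, w i * rowForm v (clippedResidual z L c i) ≤ n * (lam + ε) * ∑ j, v j ^ 2) :
    α ^ 2 * radius μ L c ^ 2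
      ≤ 32 * ε * (lam + 5 * radius μ L c + radius μ L c ^ 2 + 340 * (ε * l)) := by
  set r := radius μ L c with hr
  have hr0 : 0 ≤ r := radius_nonneg _ _ _
  set s := shift μ L c with hs
  have hrs : ∑ j, s j ^ 2 = r ^ 2 := (radius_sq _ _ _).symm
  set Y := cleanResidual η L with hY
  set y := clippedResidual z L c with hy
  have hn := S.n_pos'
  have hm := S.missing_mem
  have hl0 : 0 ≤ l := by linarith [S.l_ge]
  have hε := S.ε_pos
  set q := ε * Real.sqrt l with hq
  have hq0 : 0 ≤ q := by positivity
  have hq2 : q ^ 2 = ε * (ε * l) := by rw [hq, mul_pow, Real.sq_sqrt hl0]; ring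
  have hεq : ε ≤ q := le_mul_of_one_le_right hε.le (Real.one_le_sqrt.2 S.l_ge)
  have swap : ∀ (a : Fin n → ℝ) (x : Fin n → Fin d → ℝ) (s' : Finset (Fin n)),
      ∑ i ∈ s', a i * ∑ j, s j * x i j = ∑ j, s j * ∑ i ∈ s', a i * x i j := by
    intro a x s'
    simp only [Finset.mul_sum]
    rw [Finset.sum_comm]
    exact Finset.sum_congr rfl fun j _ => Finset.sum_congr rfl fun i _ => by ring
  -- The bounds `T1` to `T5` estimate the pieces of the balance equation tested against `s`: balance
  -- error, clean fluctuation, missing weight, drift, corrupted points.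
  have T1 : |∑ i, w i * ∑ j, s j * y i j| ≤ n * r * q := by
    refine abs_le_of_sq_le_sq ?_ (by positivity)
    rw [swap]
    refine (sq_sum_mul_le _ _ _).trans ?_
    rw [hrs]
    have : ∑ j, (∑ i, w i * y i j) ^ 2 ≤ ∑ _j : Fin d, (β * n) ^ 2 :=
      Finset.sum_le_sum fun j _ => sq_le_sq.2 ((hβ j).trans (le_abs_self _))
    have h2 : ∑ _j : Fin d, (β * n) ^ 2 = (d * β ^ 2) * n ^ 2 := by simp; ring
    have h3 : (d * β ^ 2) * n ^ 2 ≤ q ^ 2 * n ^ 2 := by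
      refine mul_le_mul_of_nonneg_right (hβd.trans (pow_le_pow_left₀ hε.le hεq 2)) (by positivity)
    calc _ ≤ r ^ 2 * (q ^ 2 * n ^ 2) := by
          refine mul_le_mul_of_nonneg_left ?_ (by positivity)
          linarith
      _ = _ := by ring
  have T2 : |∑ i, ∑ j, s j * Y i j| ≤ n * r * q := by
    refine abs_le_of_sq_le_sq ?_ (by positivity)
    have e : ∑ i, ∑ j, s j * Y i j = ∑ j, s j * ∑ i, Y i j := by
      rw [Finset.sum_comm]; simp only [Finset.mul_sum]
    rw [e]
    refine (sq_sum_mul_le _ _ _).trans ?_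
    rw [hrs]
    calc _ ≤ r ^ 2 * (n ^ 2 * (ε ^ 2 * l)) := mul_le_mul_of_nonneg_left
          (S.bounds.linear (fun j => 4 * L j) S.four_L_nonneg) (by positivity)
      _ = _ := by rw [mul_pow, hq2]; ring
  have T3 : |∑ i, missing w G i * ∑ j, s j * Y i j| ≤ 15 * (n * r * q) := by
    refine abs_le_of_sq_le_sq ?_ (by positivity)
    refine (sq_sum_weight_mul_le _ _ _ fun i _ => (hm i).1).trans ?_
    have a1 := S.sum_weight_sq_le hm s
    rw [hrs] at a1
    have a2 := S.sum_missing_le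
    have a0 : 0 ≤ ∑ i, missing w G i := Finset.sum_nonneg fun i _ => (hm i).1
    have a3 : (8 * l * ∑ i, missing w G i + n * (ε * l)) * r ^ 2
        ≤ (8 * l * (5 * ε * n) + n * (ε * l)) * r ^ 2 := by gcongr
    calc _ ≤ (5 * ε * n) * ((8 * l * (5 * ε * n) + n * (ε * l)) * r ^ 2) := by
          refine mul_le_mul a2 (a1.trans a3) ?_ (by positivity)
          exact Finset.sum_nonneg fun i _ => mul_nonneg (hm i).1 (sq_nonneg _)
      _ = 205 * (n * r) ^ 2 * (ε * (ε * l)) := by ring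
      _ ≤ 225 * (n * r) ^ 2 * (ε * (ε * l)) := by gcongr; norm_num
      _ = _ := by rw [← hq2]; ring
  have T4 : α / 4 * n * r ^ 2 ≤ ∑ i ∈ G, w i * ∑ j, s j * (y i j - Y i j) := by
    rw [swap w (fun i j => y i j - Y i j) G, ← hrs, Finset.mul_sum]
    refine Finset.sum_le_sum fun j _ => (S.sum_residual_sub_mul_ge j).trans (le_of_eq ?_)
    rw [Finset.mul_sum]
    exact Finset.sum_congr rfl fun i _ => by ring
  set W := lam + 49 * (ε * l) + 5 * r + r ^ 2 with hW
  -- Cauchy–Schwarz on the corrupted points: their weight is at most `ε n`, and their second moment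
  -- is the total off-diagonal form, minus that of the good points, plus their own diagonal, which
  -- is at most `ε n r²`.
  have T5 : (∑ i ∈ Gᶜ, w i * ∑ j, s j * y i j) ^ 2 ≤ (n * r) ^ 2 * (ε * W) := by
    refine (sq_sum_weight_mul_le _ _ _ fun i _ => (S.w_mem i).1).trans ?_
    have b1 := hlam s
    have b2 := (abs_le.1 (S.abs_sum_rowForm_le_mul s)).1
    rw [hrs] at b1 b2
    have b3 : ∑ i ∈ Gᶜ, w i * ∑ j, (s j * y i j) ^ 2 ≤ ε * n * r ^ 2 := by
      calc _ ≤ ∑ i ∈ Gᶜ, w i * r ^ 2 := Finset.sum_le_sum fun i _ =>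
            mul_le_mul_of_nonneg_left (hrs ▸ sum_mul_sq_le (abs_clippedResidual_le_one (z := z) (L := L) (c := c) i))
              (S.w_mem i).1
        _ = (∑ i ∈ Gᶜ, w i) * r ^ 2 := by rw [Finset.sum_mul]
        _ ≤ _ := mul_le_mul_of_nonneg_right S.sum_bad_le (sq_nonneg _)
    have b4 : ∑ i ∈ Gᶜ, w i * (∑ j, s j * y i j) ^ 2 = ∑ i, w i * rowForm s (y i)
        - ∑ i ∈ G, w i * rowForm s (y i) + ∑ i ∈ Gᶜ, w i * ∑ j, (s j * y i j) ^ 2 := by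
      rw [sum_ite_mem_add G]
      simp only [rowForm, mul_sub, Finset.sum_sub_distrib]
      ring
    have b5 : ∑ i ∈ Gᶜ, w i * (∑ j, s j * y i j) ^ 2 ≤ n * r ^ 2 * W := by
      rw [b4]
      have : n * r ^ 2 * (2 * ε) ≤ n * r ^ 2 * (2 * (ε * l)) := by
        have := S.ε_le
        gcongr
      calc _ ≤ n * (lam + ε) * r ^ 2 + n * (47 * (ε * l) + 5 * r + r ^ 2) * r ^ 2 + ε * n * r ^ 2 := by
            linarith
        _ ≤ _ := by rw [hW]; linarith
    calc _ ≤ (ε * n) * (n * r ^ 2 * W) := by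
          refine mul_le_mul S.sum_bad_le b5 ?_ (by positivity)
          exact Finset.sum_nonneg fun i _ => mul_nonneg (S.w_mem i).1 (sq_nonneg _)
      _ = _ := by ring
  have e : ∑ i, w i * ∑ j, s j * y i j = ∑ i, ∑ j, s j * Y i j
      - ∑ i, missing w G i * ∑ j, s j * Y i j
      + ∑ i ∈ G, w i * ∑ j, s j * (y i j - Y i j)
      + ∑ i ∈ Gᶜ, w i * ∑ j, s j * y i j := by
    have := one_sub_missing (w := w) (G := G) fun i => ∑ j, s j * Y i j
    rw [sum_ite_mem_add G]
    simp only [mul_sub, sub_mul, one_mul, Finset.sum_sub_distrib] at this ⊢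
    linarith
  set x := ∑ i ∈ Gᶜ, w i * ∑ j, s j * y i j with hx
  rcases hr0.eq_or_lt with h0 | h0
  · have hsz : ∑ j, s j ^ 2 = 0 := by rw [hrs, ← h0]; norm_num
    -- For `r = 0` only the sign of the right-hand side matters. A coordinate vector has zero
    -- off-diagonal form, which forces `lam ≥ -ε`.
    have W0 : 0 ≤ lam + 340 * (ε * l) := by
      have j0 : Fin d := ⟨0, S.d_pos⟩
      have f1 := hlam (Pi.single j0 1)
      have f2 : ∀ i, rowForm (Pi.single j0 1) (y i) = 0 := by
        intro i
        simp [rowForm, Pi.single_apply]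
      simp only [f2, mul_zero, Finset.sum_const_zero] at f1
      have f3 : ∑ j, (Pi.single j0 (1 : ℝ) : Fin d → ℝ) j ^ 2 = 1 := by
        simp [Pi.single_apply]
      rw [f3, mul_one] at f1
      have := (mul_nonneg_iff_of_pos_left hn).1 f1
      linarith [S.ε_le]
    rw [← h0]
    have : 0 ≤ 32 * ε * (lam + 340 * (ε * l)) := by positivity
    linarith
  · have hx1 : α / 4 * r - 17 * q ≤ |x| / (n * r) := by
      rw [le_div_iff₀ (by positivity)]
      have k1 := abs_le.1 T1
      have k2 := abs_le.1 T2
      have k3 := abs_le.1 T3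
      have k4 := neg_abs_le x
      nlinarith [k1.1, k1.2, k2.1, k2.2, k3.1, k3.2]
    have hx2 : (|x| / (n * r)) ^ 2 ≤ ε * W := by
      rw [div_pow, sq_abs, div_le_iff₀ (by positivity)]
      linarith
    have hx3 : α / 4 * r ≤ 17 * q + |x| / (n * r) := by linarith
    have hx4 : (α / 4 * r) ^ 2 ≤ 2 * (17 * q) ^ 2 + 2 * (|x| / (n * r)) ^ 2 := by
      have := S.α_pos
      have h1 := pow_le_pow_left₀ (by positivity) hx3 2
      nlinarith [sq_nonneg (17 * q - |x| / (n * r))]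
    rw [mul_pow 17 q, hq2] at hx4
    rw [hW] at hx2
    nlinarith

end Snapshot

/-! ### Scores of good and of corrupted points -/

namespace Snapshot

variable {n d : ℕ} {α ε l : ℝ} {η z : Fin n → Fin d → ℝ} {μ L c : Fin d → ℝ} {w : Fin n → ℝ}
  {G : Finset (Fin n)} (S : Snapshot α ε l η z μ L c w G)
include S

/-- Total score of a set of uncorrupted points. -/
theorem sum_score_le {V : Fin d → Fin d → ℝ} (hV : ∑ k, ∑ j, V k j ^ 2 = 1) {P : Finset (Fin n)}
    (hP : P ⊆ G) :
    ∑ i ∈ P, ∑ k, (∑ j, V k j * clippedResidual z L c i j) ^ 2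
      ≤ 2 * (8 * l * P.card + n * (ε * l)) + 2 * P.card * radius μ L c ^ 2 := by
  classical
  set r := radius μ L c with hr
  have hone : ∀ k, ∑ i ∈ P, (∑ j, V k j * clippedResidual z L c i j) ^ 2
      ≤ (2 * (8 * l * P.card + n * (ε * l)) + 2 * P.card * r ^ 2) * ∑ j, V k j ^ 2 := by
    intro k
    have h1 := S.sum_weight_sq_le (a := fun i => if i ∈ P then 1 else 0)
      (fun i => by split_ifs <;> simp) (V k)
    simp only [ite_mul, one_mul, zero_mul, Finset.sum_ite_mem, Finset.univ_inter,
      Finset.sum_const, nsmul_eq_mul, mul_one] at h1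
    have h2 : ∀ i ∈ P, (∑ j, V k j * clippedResidual z L c i j) ^ 2
        ≤ 2 * (∑ j, V k j * cleanResidual η L i j) ^ 2 + 2 * r ^ 2 * ∑ j, V k j ^ 2 := by
      intro i hi
      have e : ∑ j, V k j * clippedResidual z L c i j = ∑ j, V k j * cleanResidual η L i j
          + ∑ j, V k j * (clippedResidual z L c i j - cleanResidual η L i j) := by
        rw [← Finset.sum_add_distrib]
        exact Finset.sum_congr rfl fun j _ => by ring
      have h3 : (∑ j, V k j * (clippedResidual z L c i j - cleanResidual η L i j)) ^ 2
          ≤ (∑ j, V k j ^ 2) * r ^ 2 := by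
        refine (sq_sum_mul_le _ _ _).trans (mul_le_mul_of_nonneg_left ?_
          (Finset.sum_nonneg fun _ _ => sq_nonneg _))
        rw [hr, radius_sq]
        exact Finset.sum_le_sum fun j _ => sq_le_sq.2 (S.abs_residual_sub_le (hP hi) j)
      rw [e]
      nlinarith [sq_nonneg (∑ j, V k j * cleanResidual η L i j
        - ∑ j, V k j * (clippedResidual z L c i j - cleanResidual η L i j))]
    calc _ ≤ ∑ i ∈ P, (2 * (∑ j, V k j * cleanResidual η L i j) ^ 2
          + 2 * r ^ 2 * ∑ j, V k j ^ 2) := Finset.sum_le_sum h2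
      _ = 2 * ∑ i ∈ P, (∑ j, V k j * cleanResidual η L i j) ^ 2
          + P.card * (2 * r ^ 2 * ∑ j, V k j ^ 2) := by
          rw [Finset.sum_add_distrib, ← Finset.mul_sum]; simp
      _ ≤ _ := by linarith
  rw [Finset.sum_comm]
  calc _ ≤ ∑ k, (2 * (8 * l * P.card + n * (ε * l)) + 2 * P.card * r ^ 2) * ∑ j, V k j ^ 2 :=
        Finset.sum_le_sum fun k _ => hone k
    _ = _ := by rw [← Finset.mul_sum, hV, mul_one]

/-- Among the points with the largest scores, the corrupted ones dominate. -/
theorem sum_score_good_le_bad {V : Fin d → Fin d → ℝ} (hV : ∑ k, ∑ j, V k j ^ 2 = 1)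
    {τ : Fin n → ℝ} (hτ : ∀ i, τ i = ∑ k, (∑ j, V k j * clippedResidual z L c i j) ^ 2)
    {lam e : ℝ} (hlam : n * lam = ∑ i, w i * ∑ k, rowForm (V k) (clippedResidual z L c i))
    (he : ε ≤ e) (he' : e ≤ 2 * ε)
    (hbig : 131 * (ε * l) + 5 * radius μ L c + 2 * radius μ L c ^ 2 ≤ lam)
    (A : Finset (Fin n))
    (hA : ∀ i, i ∈ A ↔ ((Finset.univ.filter fun k => τ i ≤ τ k).card : ℝ) ≤ 2 * e * n) :
    ∑ i ∈ G ∩ A, w i * τ i ≤ ∑ i ∈ Gᶜ ∩ A, w i * τ i ∧ 0 < ∑ i ∈ Gᶜ ∩ A, w i * τ i := by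
  classical
  set r := radius μ L c with hr
  have hr0 : 0 ≤ r := radius_nonneg _ _ _
  set y := clippedResidual z L c with hy
  have hn := S.n_pos'
  have hε := S.ε_pos
  have hl := S.l_ge
  have hτ0 : ∀ i, 0 ≤ τ i := fun i => by
    rw [hτ]; exact Finset.sum_nonneg fun _ _ => sq_nonneg _
  have hw0 : ∀ i, 0 ≤ w i := fun i => (S.w_mem i).1
  have hε10 : 10 * ε ≤ 1 := by linarith [S.ε_le.trans S.φ_le, S.α_le]
  -- size of the selected set
  have hAcard : (A.card : ℝ) ≤ 2 * e * n := by
    rcases A.eq_empty_or_nonempty with h | h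
    · have : 0 < e := hε.trans_le he
      rw [h]; simp; positivity
    · obtain ⟨i, hi, hmin⟩ := Finset.exists_min_image A τ h
      refine le_trans ?_ ((hA i).1 hi)
      exact_mod_cast Finset.card_le_card fun k hk =>
        Finset.mem_filter.2 ⟨Finset.mem_univ _, hmin k hk⟩
  have good : ∑ i ∈ G ∩ A, w i * τ i ≤ n * (66 * (ε * l) + 8 * ε * r ^ 2) := by
    have h1 := S.sum_score_le hV (P := G ∩ A) Finset.inter_subset_left
    have h2 : ((G ∩ A).card : ℝ) ≤ 4 * ε * n := by
      have : ((G ∩ A).card : ℝ) ≤ A.card := by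
        exact_mod_cast Finset.card_le_card Finset.inter_subset_right
      nlinarith
    calc ∑ i ∈ G ∩ A, w i * τ i ≤ ∑ i ∈ G ∩ A, τ i := Finset.sum_le_sum fun i _ =>
          mul_le_of_le_one_left (hτ0 i) (S.w_mem i).2
      _ ≤ 2 * (8 * l * (G ∩ A).card + n * (ε * l)) + 2 * (G ∩ A).card * r ^ 2 := by
          simp only [hτ]; exact h1
      _ ≤ 2 * (8 * l * (4 * ε * n) + n * (ε * l)) + 2 * (4 * ε * n) * r ^ 2 := by gcongr
      _ = _ := by ring
  -- A point outside `A` is outranked by more than `2 e n` points, counting ties; more than `ε n` of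
  -- these are uncorrupted. Its score is at most the average of their scores, which `sum_score_le`
  -- controls.
  have small : ∀ i ∉ A, τ i ≤ 18 * l + 2 * r ^ 2 := by
    intro i hi
    have h0 : 2 * e * n < ((Finset.univ.filter fun k => τ i ≤ τ k).card : ℝ) := by
      by_contra h
      exact hi ((hA i).2 (not_lt.1 h))
    set P := G.filter fun k => τ i ≤ τ k with hP
    have h1 : ((Finset.univ.filter fun k => τ i ≤ τ k).card : ℝ) ≤ P.card + Gᶜ.card := by
      have : (Finset.univ.filter fun k => τ i ≤ τ k) ⊆ P ∪ Gᶜ := by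
        intro k hk
        by_cases hkG : k ∈ G
        · exact Finset.mem_union_left _ (Finset.mem_filter.2 ⟨hkG, (Finset.mem_filter.1 hk).2⟩)
        · exact Finset.mem_union_right _ (Finset.mem_compl.2 hkG)
      exact_mod_cast (Finset.card_le_card this).trans (Finset.card_union_le _ _)
    have h2 : ε * n < P.card := by
      have h3 := S.bad
      have : ε * n ≤ e * n := by gcongr
      linarith
    have h3 : P.card * τ i ≤ ∑ k ∈ P, τ k := by
      rw [← nsmul_eq_mul]
      exact Finset.card_nsmul_le_sum _ _ _ fun k hk => (Finset.mem_filter.1 hk).2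
    have h4 : ∑ k ∈ P, τ k ≤ 2 * (8 * l * P.card + n * (ε * l)) + 2 * P.card * r ^ 2 := by
      simp only [hτ]; exact S.sum_score_le hV (Finset.filter_subset _ _)
    have hP0 : (0 : ℝ) < P.card := by have : 0 < ε * n := by positivity
                                      linarith
    have h5 : n * (ε * l) ≤ l * P.card := by
      have := mul_le_mul_of_nonneg_left h2.le (by linarith : 0 ≤ l)
      linarith
    refine le_of_mul_le_mul_left (a := (P.card : ℝ)) ?_ hP0
    linarith
  have bad_out : ∑ i ∈ Gᶜ \ A, w i * τ i ≤ n * (18 * (ε * l) + 2 * ε * r ^ 2) := by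
    calc ∑ i ∈ Gᶜ \ A, w i * τ i ≤ ∑ i ∈ Gᶜ \ A, w i * (18 * l + 2 * r ^ 2) :=
          Finset.sum_le_sum fun i hi =>
            mul_le_mul_of_nonneg_left (small i (Finset.mem_sdiff.1 hi).2) (hw0 i)
      _ ≤ ∑ i ∈ Gᶜ, w i * (18 * l + 2 * r ^ 2) :=
          Finset.sum_le_sum_of_subset_of_nonneg Finset.sdiff_subset fun i _ _ =>
            mul_nonneg (hw0 i) (by positivity)
      _ = (∑ i ∈ Gᶜ, w i) * (18 * l + 2 * r ^ 2) := by rw [Finset.sum_mul]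
      _ ≤ (ε * n) * (18 * l + 2 * r ^ 2) :=
          mul_le_mul_of_nonneg_right S.sum_bad_le (by positivity)
      _ = _ := by ring
  -- The weighted off-diagonal form equals `n lam` and the good points account for a bounded part of
  -- it. The corrupted points must supply the rest, and their scores dominate their off-diagonal
  -- forms.
  have bad_all : n * (lam - (47 * (ε * l) + 5 * r + r ^ 2)) ≤ ∑ i ∈ Gᶜ, w i * τ i := by
    have h1 : ∑ i ∈ G, w i * ∑ k, rowForm (V k) (y i)
        ≤ n * (47 * (ε * l) + 5 * r + r ^ 2) := by
      have e1 : ∑ i ∈ G, w i * ∑ k, rowForm (V k) (y i)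
          = ∑ k, ∑ i ∈ G, w i * rowForm (V k) (y i) := by
        simp only [Finset.mul_sum]; rw [Finset.sum_comm]
      rw [e1]
      calc _ ≤ ∑ k, n * (47 * (ε * l) + 5 * r + r ^ 2) * ∑ j, V k j ^ 2 :=
            Finset.sum_le_sum fun k _ => (abs_le.1 (S.abs_sum_rowForm_le_mul (V k))).2
        _ = _ := by rw [← Finset.mul_sum, hV, mul_one]
    have h2 : ∑ i ∈ Gᶜ, w i * ∑ k, rowForm (V k) (y i) ≤ ∑ i ∈ Gᶜ, w i * τ i := by
      refine Finset.sum_le_sum fun i _ => mul_le_mul_of_nonneg_left ?_ (hw0 i)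
      rw [hτ]
      refine Finset.sum_le_sum fun k _ => ?_
      exact sub_le_self _ (Finset.sum_nonneg fun _ _ => sq_nonneg _)
    rw [sum_ite_mem_add G] at hlam
    linarith
  have split : ∑ i ∈ Gᶜ, w i * τ i = ∑ i ∈ Gᶜ ∩ A, w i * τ i + ∑ i ∈ Gᶜ \ A, w i * τ i :=
    (Finset.sum_inter_add_sum_sdiff _ _ _).symm
  -- The threshold on `lam` is chosen for this balance: `66 + 18 + 47 = 131`, and `10 ε ≤ 1` absorbs
  -- `10 ε r²` into one of the two copies of `r²`.
  have main : n * (66 * (ε * l) + 8 * ε * r ^ 2) ≤ ∑ i ∈ Gᶜ ∩ A, w i * τ i := by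
    have h1 : n * (131 * (ε * l) + 5 * r + 2 * r ^ 2) ≤ n * lam :=
      mul_le_mul_of_nonneg_left hbig hn.le
    have h2 : (n : ℝ) * (10 * ε) * r ^ 2 ≤ n * 1 * r ^ 2 := by gcongr
    linarith
  refine ⟨good.trans main, lt_of_lt_of_le ?_ main⟩
  have : 0 < ε * l := by positivity
  positivity

end Snapshot

/-- Were `lam` below the target, the radius inequality would contain `r` on both sides and give `r ≤
700 ψ` with `ψ = φ / α²`. The target would then be smaller than `5100 ψ`, contrary to the lower
bound on `lam`. So failing the eigenvalue certificate leaves enough spectral mass for filtering. -/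
theorem le_of_radius_bound {α φ ε r lam : ℝ} (hα : 0 < α) (hα1 : α ≤ 1) (hε : 0 < ε) (hεφ : ε ≤ φ)
    (hφ : φ ≤ α ^ 2 / 10 ^ 6) (hr : 0 ≤ r)
    (h : α ^ 2 * r ^ 2 ≤ 32 * ε * (lam + 5 * r + r ^ 2 + 340 * φ))
    (hlam : 5100 * φ / α ^ 2 ≤ lam) : 131 * φ + 5 * r + 2 * r ^ 2 ≤ lam := by
  by_contra hcon
  push Not at hcon
  set ψ := φ / α ^ 2 with hψ
  have hα2 : 0 < α ^ 2 := by positivity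
  have hφ' : φ = α ^ 2 * ψ := by rw [hψ]; field_simp
  have hψ0 : 0 < ψ := div_pos (hε.trans_le hεφ) hα2
  have hψ1 : ψ ≤ 1 / 10 ^ 6 := by
    rw [hψ, div_le_iff₀ hα2]; linarith
  have hφψ : φ ≤ ψ := by
    rw [hφ']; exact mul_le_of_le_one_left hψ0.le (pow_le_one₀ hα.le hα1)
  have hlam' : 5100 * ψ ≤ lam := by rw [hψ]; linarith [mul_div_assoc 5100 φ (α ^ 2)]
  have h1 : r ^ 2 ≤ 32 * ψ * (471 * ψ + 10 * r + 3 * r ^ 2) := by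
    have h2 : α ^ 2 * r ^ 2 ≤ α ^ 2 * (32 * ψ * (471 * ψ + 10 * r + 3 * r ^ 2)) := by
      have hb : 0 ≤ 471 * ψ + 10 * r + 3 * r ^ 2 := by positivity
      calc _ ≤ 32 * ε * (lam + 5 * r + r ^ 2 + 340 * φ) := h
        _ ≤ 32 * ε * (471 * ψ + 10 * r + 3 * r ^ 2) :=
            mul_le_mul_of_nonneg_left (by linarith) (by positivity)
        _ ≤ 32 * (α ^ 2 * ψ) * (471 * ψ + 10 * r + 3 * r ^ 2) := by
            rw [← hφ']; gcongr
        _ = _ := by ring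
    exact le_of_mul_le_mul_left h2 hα2
  have hr2 : 0 ≤ r ^ 2 := sq_nonneg r
  have h96 : 96 * ψ * r ^ 2 ≤ 1 / 100 * r ^ 2 := by gcongr; linarith
  have hr700 : r ≤ 700 * ψ := by
    by_contra hc
    push Not at hc
    have k1 : ψ * ψ ≤ (r / 700) * (r / 700) := by gcongr <;> linarith
    have k2 : ψ * r ≤ (r / 700) * r := by gcongr; linarith
    have : 0 < r ^ 2 := by have : 0 < r := by linarith
                           positivity
    nlinarith
  nlinarith

/-- Soundness of the certificate: with `κ = ε √l / α²` the hypothesis becomes a quadratic inequality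
bounding `r²` by multiples of `κ²`, `κ r` and a small multiple of `r²`. The constant `15300 = 3 *
5100` leaves room for a misjudged scale. -/
theorem radius_le_of_certificate {α l ε r lam : ℝ} (hα : 0 < α) (hα1 : α ≤ 1) (hε : 0 < ε)
    (hl : 1 ≤ l) (hφ : ε * l ≤ α ^ 2 / 10 ^ 6)
    (h : α ^ 2 * r ^ 2 ≤ 32 * ε * (lam + 5 * r + r ^ 2 + 340 * (ε * l)))
    (hlam : lam ≤ 15300 * (ε * l) / α ^ 2) : r ≤ 1400 * (ε * Real.sqrt l / α ^ 2) := by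
  by_contra hc
  push Not at hc
  set q := ε * Real.sqrt l with hq
  have hl0 : 0 ≤ l := by linarith
  have hq2 : q ^ 2 = ε * (ε * l) := by rw [hq, mul_pow, Real.sq_sqrt hl0]; ring
  have hεq : ε ≤ q := le_mul_of_one_le_right hε.le (Real.one_le_sqrt.2 hl)
  set κ := q / α ^ 2 with hκ
  have hα2 : 0 < α ^ 2 := by positivity
  have hα21 : α ^ 2 ≤ 1 := pow_le_one₀ hα.le hα1
  have hq' : q = α ^ 2 * κ := by rw [hκ]; field_simp
  have hκ0 : 0 < κ := div_pos (hε.trans_le hεq) hα2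
  have hr0 : 0 < r := by linarith
  have hε2 : ε ≤ α ^ 2 / 10 ^ 6 := (le_mul_of_one_le_right hε.le hl).trans hφ
  have h1 : r ^ 2 ≤ 32 * (15640 * κ ^ 2 + 5 * κ * r + r ^ 2 / 10 ^ 6) := by
    refine le_of_mul_le_mul_left (a := α ^ 2) ?_ hα2
    have k1 : ε * (15300 * (ε * l) / α ^ 2) = α ^ 2 * (15300 * κ ^ 2) := by
      have : ε * (15300 * (ε * l) / α ^ 2) = 15300 * q ^ 2 / α ^ 2 := by rw [hq2]; ring
      rw [this, hq']; field_simp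
    have k2 : ε * (ε * l) ≤ α ^ 2 * κ ^ 2 := by
      rw [← hq2, hq', mul_pow]
      have : (α ^ 2) ^ 2 ≤ α ^ 2 * 1 := by rw [sq]; gcongr
      have := mul_le_mul_of_nonneg_right this (sq_nonneg κ)
      linarith
    have k3 : ε * r ≤ α ^ 2 * κ * r := by rw [← hq']; gcongr
    have k4 : ε * r ^ 2 ≤ α ^ 2 / 10 ^ 6 * r ^ 2 := by gcongr
    have k5 : ε * lam ≤ ε * (15300 * (ε * l) / α ^ 2) := by gcongr
    linarith
  have k1 : κ ^ 2 ≤ (r / 1400) ^ 2 := by gcongr; linarith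
  have k2 : κ * r ≤ (r / 1400) * r := by gcongr; linarith
  have : 0 < r ^ 2 := by positivity
  nlinarith

/-! ### Down-weighting -/

open Classical in
/-- One step of down-weighting: the removed weight comes mostly from outside `G`, and at least one
weight becomes zero. -/
theorem downweight {n : ℕ} {w w' τ : Fin n → ℝ} {t : ℝ} {G A : Finset (Fin n)}
    (hw : ∀ i, w i ∈ Set.Icc (0 : ℝ) 1) (hτ : ∀ i, 0 ≤ τ i)
    (hdom : ∑ i ∈ G ∩ A, w i * τ i ≤ ∑ i ∈ Gᶜ ∩ A, w i * τ i)
    (hpos : 0 < ∑ i ∈ Gᶜ ∩ A, w i * τ i)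
    (ht : (∃ i ∈ A, 0 < w i) → ∃ i ∈ A, 0 < w i ∧ τ i = t ∧ ∀ k ∈ A, 0 < w k → τ k ≤ t)
    (hw' : ∀ i, w' i = if i ∈ A then w i * (1 - τ i / t) else w i)
    (hinv : ∑ i ∈ G, (1 - w i) ≤ ∑ i ∈ Gᶜ, (1 - w i)) :
    (∀ i, w' i ∈ Set.Icc (0 : ℝ) 1) ∧ ∑ i ∈ G, (1 - w' i) ≤ ∑ i ∈ Gᶜ, (1 - w' i) ∧
      (Finset.univ.filter fun i => w i = 0).card + 1 ≤
        (Finset.univ.filter fun i => w' i = 0).card := by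
  obtain ⟨i₁, hi₁, hpos₁⟩ : ∃ i ∈ Gᶜ ∩ A, 0 < w i * τ i := by
    by_contra h
    push Not at h
    exact absurd hpos (not_lt.2 (Finset.sum_nonpos h))
  have hw₁ : 0 < w i₁ := by
    rcases (hw i₁).1.eq_or_lt with h | h
    · rw [← h, zero_mul] at hpos₁; exact absurd hpos₁ (lt_irrefl _)
    · exact h
  obtain ⟨i₀, hi₀, hw₀, htop, hmax⟩ := ht ⟨i₁, (Finset.mem_inter.1 hi₁).2, hw₁⟩
  have ht0 : 0 < t := by
    have h1 := hmax i₁ (Finset.mem_inter.1 hi₁).2 hw₁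
    have h2 : 0 < τ i₁ := by
      by_contra h
      exact absurd hpos₁ (not_lt.2 (mul_nonpos_of_nonneg_of_nonpos (hw i₁).1 (not_lt.1 h)))
    linarith
  have hsub : ∀ i, w i - w' i = if i ∈ A then w i * τ i / t else 0 := by
    intro i
    rw [hw']
    split_ifs <;> ring
  refine ⟨fun i => ?_, ?_, ?_⟩
  · rw [hw']
    split_ifs with hi
    · rcases (hw i).1.eq_or_lt with h | h
      · rw [← h]; simp
      · have h1 : τ i / t ≤ 1 := (div_le_one ht0).2 (hmax i hi h)
        have h2 : 0 ≤ τ i / t := div_nonneg (hτ i) ht0.le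
        exact ⟨mul_nonneg h.le (by linarith), mul_le_one₀ (hw i).2 (by linarith) (by linarith)⟩
    · exact hw i
  -- The weight removed from a set is its total weighted score within `A`, divided by `t`; so the
  -- dominance of scores becomes dominance of removed weight.
  · have hsum : ∀ P : Finset (Fin n), ∑ i ∈ P, (1 - w' i)
        = ∑ i ∈ P, (1 - w i) + (∑ i ∈ P ∩ A, w i * τ i) / t := by
      intro P
      rw [Finset.sum_div, ← Finset.sum_ite_mem P A (fun i => w i * τ i / t),
        ← Finset.sum_add_distrib]
      refine Finset.sum_congr rfl fun i _ => ?_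
      rw [← hsub i]; ring
    rw [hsum, hsum]
    gcongr
  · rw [Nat.succ_le_iff]
    -- Zero weights stay zero, and the index attaining the maximum `t` had positive weight and now
    -- has weight zero.
    refine Finset.card_lt_card (Finset.ssubset_iff_of_subset ?_ |>.2 ⟨i₀, ?_, ?_⟩)
    · intro i hi
      simp only [Finset.mem_filter, Finset.mem_univ, true_and] at hi ⊢
      rw [hw', hi]; simp
    · simp only [Finset.mem_filter, Finset.mem_univ, true_and]
      rw [hw', if_pos hi₀, htop, div_self ht0.ne']; ring
    · simp only [Finset.mem_filter, Finset.mem_univ, true_and]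
      exact hw₀.ne'

/-! ### The power method -/

/-- The quotient `P` is the average of `ev` with weights `ev ^ N`, so deviations from `P` weighted
by `ev ^ N` sum to zero. Each term is at least `-P ^ (N + 1)`, while a value above `(1 + γ) P` would
by Bernoulli's inequality contribute more than `γ (1 + N γ) P ^ (N + 1)`, too much for the others to
cancel. -/
theorem weighted_average_ge {ι : Type*} [Fintype ι] {ev : ι → ℝ} (hev : ∀ i, 0 ≤ ev i) {N : ℕ}
    (hS : 0 < ∑ i, ev i ^ N) {γ : ℝ} (hγ : 0 < γ) (h : (Fintype.card ι : ℝ) ≤ γ * (1 + N * γ))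
    (i : ι) : ev i ≤ (1 + γ) * ((∑ i, ev i ^ (N + 1)) / ∑ i, ev i ^ N) := by
  set P := (∑ i, ev i ^ (N + 1)) / ∑ i, ev i ^ N with hP
  have hP0 : 0 ≤ P := div_nonneg (Finset.sum_nonneg fun i _ => pow_nonneg (hev i) _) hS.le
  by_contra hcon
  push Not at hcon
  have hPi : P < ev i := by nlinarith
  have hsum : ∑ k, ev k ^ N * (ev k - P) = 0 := by
    have : ∑ k, ev k ^ N * (ev k - P) = ∑ k, ev k ^ (N + 1) - (∑ k, ev k ^ N) * P := by
      rw [Finset.sum_mul, ← Finset.sum_sub_distrib]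
      exact Finset.sum_congr rfl fun k _ => by ring
    rw [this, hP, mul_div_cancel₀ _ hS.ne', sub_self]
  have hPpos : 0 < P := by
    rw [hP]
    refine div_pos (Finset.sum_pos' (fun k _ => pow_nonneg (hev k) _) ⟨i, Finset.mem_univ _, ?_⟩) hS
    exact pow_pos (hP0.trans_lt hPi) _
  classical
  have hlow : ∀ k, -(P ^ N * P) ≤ ev k ^ N * (ev k - P) := by
    intro k
    rcases le_total P (ev k) with hk | hk
    · have h1 : 0 ≤ ev k ^ N * (ev k - P) :=
        mul_nonneg (pow_nonneg (hev k) _) (sub_nonneg.2 hk)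
      have h2 : 0 ≤ P ^ N * P := by positivity
      linarith
    · have h1 : ev k ^ N * (P - ev k) ≤ P ^ N * P := by
        gcongr
        · exact hev k
        · linarith [hev k]
      linarith
  have h1 : ev i ^ N * (ev i - P) ≤ Fintype.card ι * (P ^ N * P) := by
    rw [← Finset.add_sum_erase _ _ (Finset.mem_univ i)] at hsum
    have h2 : ∑ _k ∈ Finset.univ.erase i, -(P ^ N * P)
        ≤ ∑ k ∈ Finset.univ.erase i, ev k ^ N * (ev k - P) := Finset.sum_le_sum fun k _ => hlow k
    rw [Finset.sum_const, nsmul_eq_mul] at h2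
    have h3 : ((Finset.univ.erase i).card : ℝ) ≤ Fintype.card ι := by
      exact_mod_cast Finset.card_le_univ _
    have h4 : 0 ≤ P ^ N * P := by positivity
    nlinarith
  have h2 : (1 + N * γ) * P ^ N * (γ * P) < ev i ^ N * (ev i - P) := by
    have h3 : (1 + N * γ) * P ^ N ≤ ev i ^ N := by
      calc (1 + N * γ) * P ^ N ≤ (1 + γ) ^ N * P ^ N := by
            gcongr
            exact one_add_mul_le_pow (by linarith) N
        _ = ((1 + γ) * P) ^ N := (mul_pow _ _ _).symm
        _ ≤ ev i ^ N := by gcongr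
    have h4 : γ * P < ev i - P := by linarith
    have h5 : 0 < (1 + N * γ) * P ^ N := by positivity
    calc _ < (1 + N * γ) * P ^ N * (ev i - P) := mul_lt_mul_of_pos_left h4 h5
      _ ≤ _ := mul_le_mul_of_nonneg_right h3 (by linarith)
  have h3 : Fintype.card ι * (P ^ N * P) ≤ γ * (1 + N * γ) * (P ^ N * P) := by gcongr
  linarith

namespace Matrix

variable {ι : Type*} [Fintype ι] [DecidableEq ι] {A : Matrix ι ι ℝ}

theorem IsHermitian.trace_pow_eq_sum (hA : A.IsHermitian) (m : ℕ) :
    (A ^ m).trace = ∑ i, hA.eigenvalues i ^ m := by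
  conv_lhs => rw [hA.spectral_theorem, ← map_pow, Unitary.conjStarAlgAut_apply, Matrix.trace_mul_comm,
    ← mul_assoc]
  simp [Matrix.diagonal_pow, Matrix.trace_diagonal]

theorem IsHermitian.dotProduct_mulVec_le (hA : A.IsHermitian) {t : ℝ}
    (ht : ∀ i, hA.eigenvalues i ≤ t) (v : ι → ℝ) : v ⬝ᵥ A *ᵥ v ≤ t * (v ⬝ᵥ v) := by
  set U : Matrix ι ι ℝ := (hA.eigenvectorUnitary : Matrix ι ι ℝ) with hU
  have hUU : U * star U = 1 := Unitary.coe_mul_star_self hA.eigenvectorUnitary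
  set u := star U *ᵥ v with hu
  have hv : v ⬝ᵥ v = u ⬝ᵥ u := by
    rw [hu, Matrix.dotProduct_mulVec, Matrix.vecMul_mulVec, ← Matrix.dotProduct_mulVec]
    simp only [Matrix.star_eq_conjTranspose, Matrix.conjTranspose_eq_transpose_of_trivial,
      Matrix.transpose_transpose] at hUU ⊢
    rw [hUU, Matrix.one_mulVec]
  have hAv : v ⬝ᵥ A *ᵥ v = ∑ i, hA.eigenvalues i * u i ^ 2 := by
    have e : A = U * diagonal hA.eigenvalues * star U := by
      conv_lhs => rw [hA.spectral_theorem, Unitary.conjStarAlgAut_apply]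
      rfl
    have e2 : v ⬝ᵥ A *ᵥ v = u ⬝ᵥ (diagonal hA.eigenvalues *ᵥ u) := by
      conv_lhs => rw [e]
      rw [← Matrix.mulVec_mulVec, ← Matrix.mulVec_mulVec, ← hu, Matrix.dotProduct_mulVec]
      congr 1
      rw [hu, Matrix.star_eq_conjTranspose, Matrix.conjTranspose_eq_transpose_of_trivial,
        Matrix.mulVec_transpose]
    rw [e2]
    simp only [Matrix.mulVec_diagonal, dotProduct]
    exact Finset.sum_congr rfl fun i _ => by ring
  rw [hAv, hv, dotProduct, Finset.mul_sum]
  exact Finset.sum_le_sum fun i _ => by nlinarith [sq_nonneg (u i), ht i]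

/-- A high power of a positive semidefinite matrix estimates its largest eigenvalue. -/
theorem PosSemidef.dotProduct_mulVec_le_of_pow (hA : A.PosSemidef) {e : ℝ} (he : 0 < e) {m : ℕ}
    (htr : A.trace = Fintype.card ι) (hι : 1 ≤ Fintype.card ι)
    (hm : (Fintype.card ι : ℝ) ^ 3 ≤ e ^ 2 * m) :
    0 < ∑ i, ∑ j, (A ^ m) i j ^ 2 ∧ ∀ v : ι → ℝ, v ⬝ᵥ A *ᵥ v ≤
      ((∑ i, ∑ j, (A ^ m * A) i j * (A ^ m) i j) / (∑ i, ∑ j, (A ^ m) i j ^ 2) + e)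
        * (v ⬝ᵥ v) := by
  set D : ℝ := (Fintype.card ι : ℝ) with hD
  have hD1 : 1 ≤ D := by rw [hD]; exact_mod_cast hι
  have hsymm : ∀ i j, (A ^ m) i j = (A ^ m) j i := by
    intro i j
    have h := (hA.1.pow m).apply i j
    simpa using h.symm
  have hT : ∑ i, ∑ j, (A ^ m) i j ^ 2 = (A ^ (m + m)).trace := by
    rw [pow_add]
    simp only [Matrix.trace, Matrix.diag, Matrix.mul_apply]
    exact Finset.sum_congr rfl fun i _ => Finset.sum_congr rfl fun j _ => by rw [sq, hsymm j i]
  have hT' : ∑ i, ∑ j, (A ^ m * A) i j * (A ^ m) i j = (A ^ (m + m + 1)).trace := by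
    rw [show m + m + 1 = m + 1 + m by ring, pow_add, pow_succ]
    simp only [Matrix.trace, Matrix.diag, Matrix.mul_apply (M := A ^ m * A)]
    exact Finset.sum_congr rfl fun i _ => Finset.sum_congr rfl fun j _ => by rw [hsymm j i]
  have hev := hA.eigenvalues_nonneg
  have htrev : ∑ i, hA.1.eigenvalues i = D := by
    have := hA.1.trace_pow_eq_sum 1
    simp only [pow_one] at this
    rw [← this, htr]
  have hle : ∀ i, hA.1.eigenvalues i ≤ D := fun i => by
    rw [← htrev]
    exact Finset.single_le_sum (f := hA.1.eigenvalues) (fun i _ => hev i) (Finset.mem_univ i)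
  obtain ⟨i₀, hi₀⟩ : ∃ i, 0 < hA.1.eigenvalues i := by
    by_contra h
    push Not at h
    have := Finset.sum_nonpos fun i (_ : i ∈ Finset.univ) => h i
    linarith
  have hpos : 0 < ∑ i, hA.1.eigenvalues i ^ (m + m) :=
    Finset.sum_pos' (fun i _ => pow_nonneg (hev i) _) ⟨i₀, Finset.mem_univ _, pow_pos hi₀ _⟩
  rw [hT, hT', hA.1.trace_pow_eq_sum, hA.1.trace_pow_eq_sum]
  refine ⟨hpos, fun v => hA.1.dotProduct_mulVec_le (fun i => ?_) v⟩
  have hPle : (∑ i, hA.1.eigenvalues i ^ (m + m + 1)) / ∑ i, hA.1.eigenvalues i ^ (m + m) ≤ D := by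
    rw [div_le_iff₀ hpos, Finset.mul_sum]
    refine Finset.sum_le_sum fun i _ => ?_
    rw [pow_succ']
    exact mul_le_mul_of_nonneg_right (hle i) (pow_nonneg (hev i) _)
  -- Take relative error `γ = e / D` and exponent `N = 2 m`. Positive semidefiniteness and trace `D`
  -- bound the eigenvalues by `D`, so relative error `γ` is absolute error `e`.
  have hcond : (Fintype.card ι : ℝ) ≤ e / D * (1 + (m + m : ℕ) * (e / D)) := by
    rw [← hD]
    have h1 : D ≤ e ^ 2 * m / D ^ 2 := by
      rw [le_div_iff₀ (by positivity)]
      linarith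
    have h2 : e / D * (1 + (m + m : ℕ) * (e / D)) = e / D + 2 * (e ^ 2 * m / D ^ 2) := by
      push_cast
      field_simp
      ring
    rw [h2]
    have : 0 < e / D := by positivity
    linarith
  refine (weighted_average_ge hev hpos (by positivity) hcond i).trans ?_
  rw [add_mul, one_mul]
  gcongr
  calc e / D * _ ≤ e / D * D := by gcongr
    _ = e := by field_simp

end Matrix

/-! ### A language of array assignments -/

/-- The three sizes that bound the loops of an array program. -/
inductive Size where
  | points
  | coords
  | unit

namespace Size

/-- Value of a size for `n` points in dimension `d`. -/
def val (n d : ℕ) : Size → ℕ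
  | points => n
  | coords => d
  | unit => 1

/-- Register that holds a size. -/
def reg : Size → ℕ
  | points => 0
  | coords => 1
  | unit => 2

end Size

/-- Index variables: row, column, summation index, and the constant `0`. -/
inductive Index where
  | row
  | col
  | sum
  | zero

namespace Index

/-- Value of an index variable. -/
def val (i j k : ℕ) : Index → ℕ
  | row => i
  | col => j
  | sum => k
  | zero => 0

/-- Integer expression for an index variable. -/
def toInt : Index → IntExp
  | row => .var 10
  | col => .var 11
  | sum => .var 12
  | zero => .lit 0

end Index

/-- Real terms over the arrays. -/
inductive Term where
  | lit (m : ℕ)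
  | size (b : Size)
  | cell (a : Fin 32) (x y : Index)
  | add (r₁ r₂ : Term)
  | sub (r₁ r₂ : Term)
  | mul (r₁ r₂ : Term)
  | div (r₁ r₂ : Term)

/-- Contents of the named arrays. -/
abbrev Arrays := Fin 32 → ℕ → ℕ → ℝ

namespace Term

/-- Value of a term. -/
noncomputable def val (n d : ℕ) (R : Arrays) (i j k : ℕ) : Term → ℝ
  | lit m => m
  | size b => b.val n d
  | cell a x y => R a (x.val i j k) (y.val i j k)
  | add r₁ r₂ => r₁.val n d R i j k + r₂.val n d R i j k
  | sub r₁ r₂ => r₁.val n d R i j k - r₂.val n d R i j k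
  | mul r₁ r₂ => r₁.val n d R i j k * r₂.val n d R i j k
  | div r₁ r₂ => r₁.val n d R i j k / r₂.val n d R i j k

/-- Compilation of a term. -/
def toReal : Term → RealExp
  | lit m => .ofInt (.lit m)
  | size b => .ofInt (.var b.reg)
  | cell a x y => .cell a x.toInt y.toInt
  | add r₁ r₂ => .plus r₁.toReal r₂.toReal
  | sub r₁ r₂ => .minus r₁.toReal r₂.toReal
  | mul r₁ r₂ => .times r₁.toReal r₂.toReal
  | div r₁ r₂ => .divide r₁.toReal r₂.toReal

end Term

/-- Conditions on terms and on index variables. -/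
inductive Cond where
  | lt (r₁ r₂ : Term)
  | eq (x y : Index)
  | not (t : Cond)
  | and (t₁ t₂ : Cond)

namespace Cond

/-- Truth of a condition. -/
def Holds (n d : ℕ) (R : Arrays) (i j k : ℕ) : Cond → Prop
  | lt r₁ r₂ => r₁.val n d R i j k < r₂.val n d R i j k
  | eq x y => x.val i j k = y.val i j k
  | not t => ¬ t.Holds n d R i j k
  | and t₁ t₂ => t₁.Holds n d R i j k ∧ t₂.Holds n d R i j k

/-- Compilation of a condition. -/
def toTest : Cond → TestExp
  | lt r₁ r₂ => .ltReal r₁.toReal r₂.toReal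
  | eq x y => .both (.neg (.ltInt x.toInt y.toInt)) (.neg (.ltInt y.toInt x.toInt))
  | not t => .neg t.toTest
  | and t₁ t₂ => .both t₁.toTest t₂.toTest

end Cond

/-- Array programs: simultaneous assignment of sums to the cells of an array, sequencing, guarded
commands and bounded repetition. -/
inductive ArrayProgram where
  | tab (a : Fin 32) (b₁ b₂ b₃ : Size) (t : Cond) (r₁ r₂ : Term)
  | seq (p q : ArrayProgram)
  | guard (t : Cond) (p : ArrayProgram)
  | rep (b : Size) (p : ArrayProgram)

namespace ArrayProgram

open Classical in
/-- New value of a cell in a simultaneous assignment. -/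
noncomputable def entry (n d : ℕ) (R : Arrays) (b₃ : Size) (t : Cond) (r₁ r₂ : Term) (i j : ℕ) : ℝ :=
  ∑ k ∈ Finset.range (b₃.val n d),
    if t.Holds n d R i j k then r₁.val n d R i j k else r₂.val n d R i j k

open Classical in
/-- Effect of a program on the arrays. -/
noncomputable def sem (n d : ℕ) : ArrayProgram → Arrays → Arrays
  | tab a b₁ b₂ b₃ t r₁ r₂, R => Function.update R a fun i j =>
      if i < b₁.val n d ∧ j < b₂.val n d then entry n d R b₃ t r₁ r₂ i j else R a i j
  | seq p q, R => q.sem n d (p.sem n d R)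
  | guard t p, R => if t.Holds n d R 0 0 0 then p.sem n d R else R
  | rep b p, R => (p.sem n d)^[b.val n d] R

/-- A counted loop with counter register `c` and bound register `b`. -/
def forLoop (c b : ℕ) (p : RAMProgram) : RAMProgram :=
  .seq (.setInt c (.lit 0))
    (.loop (.ltInt (.var c) (.var b)) (.seq p (.setInt c (.plus (.var c) (.lit 1)))))

/-- The auxiliary cell in which sums are accumulated. -/
def scratch : RealExp := .cell 32 (.var 10) (.var 11)

/-- Compilation; `depth` is the number of enclosing repetitions. -/
def compile : ℕ → ArrayProgram → RAMProgram
  | _, tab a b₁ b₂ b₃ t r₁ r₂ =>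
      -- Values are first accumulated in the scratch array and then copied, so all right-hand sides
      -- read the old contents even if `a` occurs in them.
      .seq
        (forLoop 10 b₁.reg (forLoop 11 b₂.reg
          (.seq (.setReal 32 (.var 10) (.var 11) (.ofInt (.lit 0)))
            (forLoop 12 b₃.reg (.branch t.toTest
              (.setReal 32 (.var 10) (.var 11) (.plus scratch r₁.toReal))
              (.setReal 32 (.var 10) (.var 11) (.plus scratch r₂.toReal)))))))
        (forLoop 10 b₁.reg (forLoop 11 b₂.reg (.setReal a (.var 10) (.var 11) scratch)))
  | depth, seq p q => .seq (p.compile depth) (q.compile depth)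
  | depth, guard t p =>
      -- A guard is evaluated with all three index variables equal to `0`, so the index registers
      -- are reset first.
      .seq (.setInt 10 (.lit 0)) (.seq (.setInt 11 (.lit 0)) (.seq (.setInt 12 (.lit 0))
        (.branch t.toTest (p.compile depth) .skip)))
  -- Counters of nested repetitions occupy distinct registers, from `20` on, away from sizes and
  -- index variables.
  | depth, rep b p => forLoop (20 + depth) b.reg (p.compile (depth + 1))

/-- Degree of the polynomial time bound. -/
def degree : ArrayProgram → ℕ
  | tab .. => 3
  | seq p q => max p.degree q.degree
  | guard _ p => p.degree
  | rep _ p => p.degree + 1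

/-- Coefficient of the polynomial time bound. -/
def coefficient : ArrayProgram → ℕ
  | tab _ _ _ _ t r₁ r₂ => 100 + t.toTest.cost + r₁.toReal.cost + r₂.toReal.cost
  | seq p q => p.coefficient + q.coefficient
  | guard t p => p.coefficient + t.toTest.cost + 10
  | rep _ p => p.coefficient + 20

end ArrayProgram

/-! ### Correctness of the compilation -/

/-- The state `s` represents `n` points in dimension `d` with array contents `R`. -/
structure Represents (n d : ℕ) (R : Arrays) (s : RAMState) : Prop where
  points : s.int 0 = n
  coords : s.int 1 = d
  unit : s.int 2 = 1
  arrays : ∀ a : Fin 32, s.real a = R a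

namespace Represents

variable {n d : ℕ} {R : Arrays} {s : RAMState}

theorem size_reg (h : Represents n d R s) (b : Size) : s.int b.reg = b.val n d := by
  cases b
  exacts [h.points, h.coords, h.unit]

theorem index_eval {i j k : ℕ} (h : s.int 10 = i ∧ s.int 11 = j ∧ s.int 12 = k) (x : Index) :
    x.toInt.eval s = x.val i j k := by
  cases x
  exacts [h.1, h.2.1, h.2.2, rfl]

theorem term_eval (h : Represents n d R s) {i j k : ℕ}
    (hs : s.int 10 = i ∧ s.int 11 = j ∧ s.int 12 = k) (r : Term) :
    r.toReal.eval s = r.val n d R i j k := by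
  induction r with
  | lit m => rfl
  | size b => exact congrArg Nat.cast (h.size_reg b)
  | cell a x y =>
    simp only [Term.toReal, RealExp.eval, Term.val, index_eval hs, h.arrays]
  | add r₁ r₂ ih₁ ih₂ => simp only [Term.toReal, RealExp.eval, Term.val, ih₁, ih₂]
  | sub r₁ r₂ ih₁ ih₂ => simp only [Term.toReal, RealExp.eval, Term.val, ih₁, ih₂]
  | mul r₁ r₂ ih₁ ih₂ => simp only [Term.toReal, RealExp.eval, Term.val, ih₁, ih₂]
  | div r₁ r₂ ih₁ ih₂ => simp only [Term.toReal, RealExp.eval, Term.val, ih₁, ih₂]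

theorem cond_holds (h : Represents n d R s) {i j k : ℕ}
    (hs : s.int 10 = i ∧ s.int 11 = j ∧ s.int 12 = k) (t : Cond) :
    t.toTest.Holds s ↔ t.Holds n d R i j k := by
  induction t with
  | lt r₁ r₂ => simp only [Cond.toTest, TestExp.Holds, Cond.Holds, h.term_eval hs]
  | eq x y =>
    simp only [Cond.toTest, TestExp.Holds, Cond.Holds, index_eval hs]
    omega
  | not t ih => simp only [Cond.toTest, TestExp.Holds, Cond.Holds, ih]
  | and t₁ t₂ ih₁ ih₂ => simp only [Cond.toTest, TestExp.Holds, Cond.Holds, ih₁, ih₂]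

theorem congr_int (h : Represents n d R s) {s' : RAMState} (hr : s'.real = s.real)
    (h0 : s'.int 0 = s.int 0) (h1 : s'.int 1 = s.int 1) (h2 : s'.int 2 = s.int 2) :
    Represents n d R s' :=
  ⟨h0.trans h.points, h1.trans h.coords, h2.trans h.unit, fun a => by rw [hr, h.arrays]⟩

end Represents

namespace ArrayProgram

/-- The invariant is stated after the counter has been advanced. A round costs at most `B` for the
body, `4` for the increment and `4` for the test; the final `6` pays for initialisation and the
failing test. -/
theorem runs_forLoop {c b N B : ℕ} {p : RAMProgram} (hcb : c ≠ b) (Inv : ℕ → RAMState → Prop)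
    (hp : ∀ i < N, ∀ s, Inv i s → s.int c = i → s.int b = N →
      ∃ T s', p.Runs s T s' ∧ T ≤ B ∧ s'.int c = i ∧ s'.int b = N ∧
        Inv (i + 1) (s'.writeInt c (i + 1)))
    {s : RAMState} (h0 : Inv 0 (s.writeInt c 0)) (hb : s.int b = N) :
    ∃ T s', (forLoop c b p).Runs s T s' ∧ T ≤ N * (B + 8) + 6 ∧ Inv N s' ∧ s'.int b = N := by
  have key : ∀ m i, i + m = N → ∀ s, Inv i s → s.int c = i → s.int b = N →
      ∃ T s', RAMProgram.Runs (.loop (.ltInt (.var c) (.var b))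
        (.seq p (.setInt c (.plus (.var c) (.lit 1))))) s T s' ∧ T ≤ m * (B + 8) + 4 ∧
        Inv N s' ∧ s'.int b = N := by
    intro m
    induction m with
    | zero =>
      intro i hi s hs hc hb
      obtain rfl : i = N := by omega
      exact ⟨_, s, .loopFalse _ (by simp [TestExp.Holds, IntExp.eval, hc, hb]),
        by simp [TestExp.cost, IntExp.cost], hs, hb⟩
    | succ m ih =>
      intro i hi s hs hc hb
      obtain ⟨T, s', hr, hT, hc', hb', hs'⟩ := hp i (by omega) s hs hc hb
      have hset : RAMProgram.Runs (.setInt c (.plus (.var c) (.lit 1))) s' 4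
          (s'.writeInt c (i + 1)) := by
        have := RAMProgram.Runs.setInt s' c (.plus (.var c) (.lit 1))
        simpa [IntExp.cost, IntExp.eval, hc'] using this
      obtain ⟨T', s'', hr', hT', h⟩ := ih (i + 1) (by omega) _ hs' (by simp [RAMState.writeInt])
        (by simp [RAMState.writeInt, hcb.symm, hb'])
      refine ⟨_, s'', .loopTrue (by simp [TestExp.Holds, IntExp.eval, hc, hb]; omega)
        (.seq hr hset) hr', ?_, h⟩
      simp only [TestExp.cost, IntExp.cost]
      rw [Nat.succ_mul]
      omega
  obtain ⟨T, s', hr, hT, h⟩ := key N 0 (by omega) _ h0 (by simp [RAMState.writeInt])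
    (by simp [RAMState.writeInt, hcb.symm, hb])
  refine ⟨_, s', .seq (.setInt s c (.lit 0)) hr, ?_, h⟩
  simp only [IntExp.cost]
  omega

end ArrayProgram

/-- The two states agree on all integer registers except the three index registers. -/
def AgreeOffIndices (s₀ s : RAMState) : Prop :=
  ∀ x, x ≠ 10 → x ≠ 11 → x ≠ 12 → s.int x = s₀.int x

namespace ArrayProgram

/-- The invariant concerns the real memory only and is indexed by the current position; `hrow`
identifies the end of a row with the start of the next. -/
theorem runs_grid {b₁ b₂ N₁ N₂ B : ℕ} {p : RAMProgram} (hb₁ : b₁ < 3) (hb₂ : b₂ < 3)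
    {s₀ : RAMState} (h₁ : s₀.int b₁ = N₁) (h₂ : s₀.int b₂ = N₂)
    (Inv : ℕ → ℕ → (ℕ → ℕ → ℕ → ℝ) → Prop)
    (hp : ∀ i < N₁, ∀ j < N₂, ∀ s, AgreeOffIndices s₀ s → s.int 10 = i → s.int 11 = j →
      Inv i j s.real → ∃ T s', p.Runs s T s' ∧ T ≤ B ∧ AgreeOffIndices s₀ s' ∧ s'.int 10 = i ∧
        s'.int 11 = j ∧ Inv i (j + 1) s'.real)
    (hrow : ∀ i < N₁, ∀ f, Inv i N₂ f → Inv (i + 1) 0 f) (h0 : Inv 0 0 s₀.real) :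
    ∃ T s', (forLoop 10 b₁ (forLoop 11 b₂ p)).Runs s₀ T s' ∧ T ≤ N₁ * (N₂ * (B + 8) + 14) + 6 ∧
      AgreeOffIndices s₀ s' ∧ Inv N₁ 0 s'.real := by
  have hrow' : ∀ i < N₁, ∀ s, (AgreeOffIndices s₀ s ∧ Inv i 0 s.real) → s.int 10 = i → s.int b₁ = N₁ →
      ∃ T s', (forLoop 11 b₂ p).Runs s T s' ∧ T ≤ N₂ * (B + 8) + 6 ∧ s'.int 10 = i ∧ s'.int b₁ = N₁ ∧
        (AgreeOffIndices s₀ (s'.writeInt 10 (i + 1)) ∧ Inv (i + 1) 0 (s'.writeInt 10 (i + 1)).real) := by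
    rintro i hi s ⟨hs, hI⟩ hc hb
    have hcol : ∀ j < N₂, ∀ s, (AgreeOffIndices s₀ s ∧ s.int 10 = i ∧ Inv i j s.real) → s.int 11 = j → s.int b₂ = N₂ →
        ∃ T s', p.Runs s T s' ∧ T ≤ B ∧ s'.int 11 = j ∧ s'.int b₂ = N₂ ∧
          (AgreeOffIndices s₀ (s'.writeInt 11 (j + 1)) ∧ (s'.writeInt 11 (j + 1)).int 10 = i ∧ Inv i (j + 1) (s'.writeInt 11 (j + 1)).real) := by
      rintro j hj s ⟨hs, hi', hI⟩ hc hb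
      obtain ⟨T, s', hr, hT, h1, h2, h3, h4⟩ := hp i hi j hj s hs hi' hc hI
      refine ⟨T, s', hr, hT, h3, ?_, ?_, ?_, h4⟩
      · rw [h1 _ (by omega) (by omega) (by omega), h₂]
      · intro x hx hx' hx''
        simp [RAMState.writeInt, hx', h1 x hx hx' hx'']
      · simp [RAMState.writeInt, h2]
    obtain ⟨T, s', hr, hT, hs', hb'⟩ := runs_forLoop (c := 11) (b := b₂) (N := N₂) (B := B)
      (p := p) (by omega)
      (fun j s => AgreeOffIndices s₀ s ∧ s.int 10 = i ∧ Inv i j s.real) hcol (s := s)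
      ⟨fun x hx hx' hx'' => by simp [RAMState.writeInt, hx', hs x hx hx' hx''],
        by simp [RAMState.writeInt, hc], hI⟩ (by rw [hs _ (by omega) (by omega) (by omega), h₂])
    · refine ⟨T, s', hr, hT, hs'.2.1, ?_, ?_, hrow i hi _ hs'.2.2⟩
      · rw [hs'.1 _ (by omega) (by omega) (by omega), h₁]
      · intro x hx hx' hx''
        simp [RAMState.writeInt, hx, hs'.1 x hx hx' hx'']
  obtain ⟨T, s', hr, hT, hs, -⟩ := runs_forLoop (c := 10) (b := b₁) (N := N₁)
    (B := N₂ * (B + 8) + 6) (p := forLoop 11 b₂ p) (by omega)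
    (fun i s => AgreeOffIndices s₀ s ∧ Inv i 0 s.real) hrow' (s := s₀)
    ⟨fun x hx hx' hx'' => by simp [RAMState.writeInt, hx], h0⟩ h₁
  exact ⟨T, s', hr, hT, hs⟩

open Classical in
theorem runs_accumulate {n d : ℕ} {R : Arrays} (b₃ : Size) (t : Cond) (r₁ r₂ : Term) {s : RAMState}
    (hs : Represents n d R s) :
    ∃ T s', RAMProgram.Runs (.seq (.setReal 32 (.var 10) (.var 11) (.ofInt (.lit 0)))
            (forLoop 12 b₃.reg (.branch t.toTest
              (.setReal 32 (.var 10) (.var 11) (.plus scratch r₁.toReal))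
              (.setReal 32 (.var 10) (.var 11) (.plus scratch r₂.toReal))))) s T s' ∧
      T ≤ b₃.val n d * (t.toTest.cost + r₁.toReal.cost + r₂.toReal.cost + 16) + 11 ∧
      AgreeOffIndices s s' ∧ s'.int 10 = s.int 10 ∧ s'.int 11 = s.int 11 ∧
      s'.real 32 (s.int 10) (s.int 11) = entry n d R b₃ t r₁ r₂ (s.int 10) (s.int 11) ∧
      ∀ a i j, ¬ (a = 32 ∧ i = s.int 10 ∧ j = s.int 11) → s'.real a i j = s.real a i j := by
  set i := s.int 10
  set j := s.int 11
  have hreg : b₃.reg < 3 := by cases b₃ <;> simp [Size.reg]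
  set g : ℕ → ℝ := fun k =>
    if t.Holds n d R i j k then r₁.val n d R i j k else r₂.val n d R i j k with hg
  obtain ⟨T, s', hr, hT, hI, -⟩ : ∃ T s', (forLoop 12 b₃.reg (.branch t.toTest
      (.setReal 32 (.var 10) (.var 11) (.plus scratch r₁.toReal))
      (.setReal 32 (.var 10) (.var 11) (.plus scratch r₂.toReal)))).Runs (s.writeReal 32 i j 0) T s' ∧
      T ≤ b₃.val n d * (t.toTest.cost + r₁.toReal.cost + r₂.toReal.cost + 8 + 8) + 6 ∧
      (AgreeOffIndices s s' ∧ s'.int 10 = i ∧ s'.int 11 = j ∧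
        s'.real 32 i j = ∑ k ∈ Finset.range (b₃.val n d), g k ∧
        ∀ a x y, ¬ (a = 32 ∧ x = i ∧ y = j) → s'.real a x y = s.real a x y) ∧
      s'.int b₃.reg = b₃.val n d := by
    refine runs_forLoop (c := 12) (b := b₃.reg) (N := b₃.val n d)
        (B := t.toTest.cost + r₁.toReal.cost + r₂.toReal.cost + 8) (p := .branch t.toTest
                  (.setReal 32 (.var 10) (.var 11) (.plus scratch r₁.toReal))
                  (.setReal 32 (.var 10) (.var 11) (.plus scratch r₂.toReal))) (by omega)
        (fun k s' => AgreeOffIndices s s' ∧ s'.int 10 = i ∧ s'.int 11 = j ∧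
          s'.real 32 i j = ∑ k ∈ Finset.range k, g k ∧
          ∀ a x y, ¬ (a = 32 ∧ x = i ∧ y = j) → s'.real a x y = s.real a x y) ?_
        (s := s.writeReal 32 i j 0) ⟨?_, ?_, ?_, ?_, ?_⟩ (hs.size_reg b₃)
    · rintro k hk s' ⟨h1, h2, h3, h4, h5⟩ hc hb
      have hrep : Represents n d R s' := by
        refine ⟨(h1 0 (by omega) (by omega) (by omega)).trans hs.points,
          (h1 1 (by omega) (by omega) (by omega)).trans hs.coords,
          (h1 2 (by omega) (by omega) (by omega)).trans hs.unit, fun a => ?_⟩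
        rw [← hs.arrays a]
        funext x y
        exact h5 _ _ _ fun h => absurd h.1 (by have := a.2; omega)
      have hidx : s'.int 10 = i ∧ s'.int 11 = j ∧ s'.int 12 = k := ⟨h2, h3, hc⟩
      have hrun : ∀ r : Term, g k = r.val n d R i j k →
          RAMProgram.Runs (.setReal 32 (.var 10) (.var 11) (.plus scratch r.toReal)) s'
          (7 + r.toReal.cost) (s'.writeReal 32 i j (∑ k ∈ Finset.range (k + 1), g k)) := by
        intro r hgr
        have h := RAMProgram.Runs.setReal s' 32 (.var 10) (.var 11) (.plus scratch r.toReal)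
        simp only [scratch, IntExp.cost, RealExp.cost, IntExp.eval, RealExp.eval,
          hrep.term_eval hidx, h2, h3, h4] at h
        rw [Finset.sum_range_succ, hgr]
        rw [show 7 + r.toReal.cost = 1 + 1 + (1 + 1 + 1 + r.toReal.cost + 1) + 1 by omega]
        exact h
      have hfin : ∀ v, ((s'.writeReal 32 i j v).writeInt 12 (k + 1)).int 10 = i ∧
          ((s'.writeReal 32 i j v).writeInt 12 (k + 1)).int 11 = j ∧
          ((s'.writeReal 32 i j v).writeInt 12 (k + 1)).real 32 i j = v ∧
          ∀ a x y, ¬ (a = 32 ∧ x = i ∧ y = j) →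
            ((s'.writeReal 32 i j v).writeInt 12 (k + 1)).real a x y = s.real a x y := by
        intro v
        refine ⟨by simp [RAMState.writeInt, RAMState.writeReal, h2],
          by simp [RAMState.writeInt, RAMState.writeReal, h3],
          by simp [RAMState.writeInt, RAMState.writeReal], fun a x y h => ?_⟩
        simp only [RAMState.writeInt, RAMState.writeReal, if_neg h]
        exact h5 a x y h
      have hagree : ∀ v, AgreeOffIndices s ((s'.writeReal 32 i j v).writeInt 12 (k + 1)) := by
        intro v x hx hx' hx''
        simp [RAMState.writeInt, RAMState.writeReal, hx'', h1 x hx hx' hx'']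
      by_cases ht : t.Holds n d R i j k
      · have ht' : t.toTest.Holds s' := (hrep.cond_holds hidx t).2 ht
        exact ⟨_, _, .branchTrue _ ht' (hrun r₁ (by rw [hg]; exact if_pos ht)), by omega, hc,
          hb, hagree _, hfin _⟩
      · have ht' : ¬ t.toTest.Holds s' := fun h => ht ((hrep.cond_holds hidx t).1 h)
        exact ⟨_, _, .branchFalse _ ht' (hrun r₂ (by rw [hg]; exact if_neg ht)), by omega, hc,
          hb, hagree _, hfin _⟩
    · intro x hx hx' hx''
      simp [RAMState.writeInt, RAMState.writeReal, hx'']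
    · simp [RAMState.writeInt, RAMState.writeReal, i]
    · simp [RAMState.writeInt, RAMState.writeReal, j]
    · simp [RAMState.writeInt, RAMState.writeReal]
    · intro a x y h
      simp [RAMState.writeInt, RAMState.writeReal, h]
  have hset : RAMProgram.Runs (.setReal 32 (.var 10) (.var 11) (.ofInt (.lit 0))) s 5
      (s.writeReal 32 i j 0) := by
    have := RAMProgram.Runs.setReal s 32 (.var 10) (.var 11) (.ofInt (.lit 0))
    simpa [IntExp.eval, RealExp.eval, IntExp.cost, RealExp.cost] using this
  exact ⟨_, s', .seq hset hr, by linarith, hI.1, hI.2.1, hI.2.2.1, hI.2.2.2.1, hI.2.2.2.2⟩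

theorem runs_tab {n d m : ℕ} (hn : n ≤ m) (hd : d ≤ m) (hm : 1 ≤ m) {R : Arrays} (a : Fin 32)
    (b₁ b₂ b₃ : Size) (t : Cond) (r₁ r₂ : Term) {s : RAMState} (hs : Represents n d R s)
    (depth : ℕ) :
    ∃ T s', ((tab a b₁ b₂ b₃ t r₁ r₂).compile depth).Runs s T s' ∧
      (∀ c : Fin 32, s'.real c = (tab a b₁ b₂ b₃ t r₁ r₂).sem n d R c) ∧ AgreeOffIndices s s' ∧
      T ≤ (tab a b₁ b₂ b₃ t r₁ r₂).coefficient * m ^ 3 := by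
  have hreg : ∀ b : Size, b.reg < 3 := fun b => by cases b <;> simp [Size.reg]
  have hval : ∀ b : Size, b.val n d ≤ m := fun b => by cases b <;> simpa [Size.val]
  set Q := t.toTest.cost + r₁.toReal.cost + r₂.toReal.cost with hQ
  have hrep : ∀ s', AgreeOffIndices s s' → (∀ c ≠ 32, s'.real c = s.real c) →
      Represents n d R s' := by
    intro s' h1 h2
    refine ⟨(h1 0 (by omega) (by omega) (by omega)).trans hs.points,
        (h1 1 (by omega) (by omega) (by omega)).trans hs.coords,
        (h1 2 (by omega) (by omega) (by omega)).trans hs.unit, fun a => ?_⟩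
    rw [← hs.arrays a, h2 _ (by have := a.2; omega)]
  -- First pass: only the scratch array `32` changes, so each entry is computed from the original
  -- contents `R`.
  obtain ⟨T₁, s₁, hr₁, hT₁, ha₁, hf₁, hv₁⟩ := runs_grid (s₀ := s) (hreg b₁) (hreg b₂)
    (hs.size_reg b₁) (hs.size_reg b₂) (B := b₃.val n d * (Q + 16) + 11)
    (p := .seq (.setReal 32 (.var 10) (.var 11) (.ofInt (.lit 0)))
            (forLoop 12 b₃.reg (.branch t.toTest
              (.setReal 32 (.var 10) (.var 11) (.plus scratch r₁.toReal))
              (.setReal 32 (.var 10) (.var 11) (.plus scratch r₂.toReal)))))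
    (fun i j f => (∀ c ≠ 32, f c = s.real c) ∧
      ∀ x y, y < b₂.val n d → (x < i ∨ (x = i ∧ y < j)) → f 32 x y = entry n d R b₃ t r₁ r₂ x y)
    (by
      rintro i hi j hj s' hs' h10 h11 ⟨hf, hv⟩
      obtain ⟨T, s'', hr, hT, h1, h2, h3, h4, h5⟩ := runs_accumulate b₃ t r₁ r₂ (hrep s' hs' hf)
      rw [h10, h11] at h4
      rw [h10, h11] at h5
      refine ⟨T, s'', hr, hT, fun x hx hx' hx'' => (h1 x hx hx' hx'').trans (hs' x hx hx' hx''),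
        h2.trans h10, h3.trans h11, fun c hc => ?_, fun x y hy hxy => ?_⟩
      · rw [← hf c hc]
        funext x y
        exact h5 c x y fun h => hc h.1
      · by_cases hxy' : x = i ∧ y = j
        · rw [hxy'.1, hxy'.2, h4]
        · rw [h5 _ _ _ fun h => hxy' h.2]
          exact hv x y hy (by omega))
    (fun i _ f hf => ⟨hf.1, fun x y hy hxy => hf.2 x y hy (by omega)⟩)
    ⟨fun _ _ => rfl, fun x y _ h => by omega⟩
  have hs₁ := hrep s₁ ha₁ hf₁
  have hcopy : ∀ s' : RAMState, ∃ T, T ≤ 6 ∧ RAMProgram.Runs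
      (.setReal a (.var 10) (.var 11) scratch) s' T
      (s'.writeReal a (s'.int 10) (s'.int 11) (s'.real 32 (s'.int 10) (s'.int 11))) := fun s' =>
    ⟨_, by simp [IntExp.cost, RealExp.cost, scratch], RAMProgram.Runs.setReal s' a _ _ scratch⟩
  have ha32 : (32 : ℕ) ≠ a := by have := a.2; omega
  -- Second pass: the invariant records that visited cells hold the scratch values while all other
  -- cells of `a` are still those of `R`.
  obtain ⟨T₂, s₂, hr₂, hT₂, ha₂, hf₂, hg₂, hv₂⟩ := runs_grid (s₀ := s₁) (hreg b₁) (hreg b₂)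
    (hs₁.size_reg b₁) (hs₁.size_reg b₂) (B := 6)
    (p := .setReal a (.var 10) (.var 11) scratch)
    (fun i j f => (∀ c ≠ (a : ℕ), f c = s₁.real c) ∧
      (∀ x y, ¬ (y < b₂.val n d ∧ (x < i ∨ (x = i ∧ y < j))) → f a x y = R a x y) ∧
      ∀ x y, y < b₂.val n d → (x < i ∨ (x = i ∧ y < j)) → f a x y = s₁.real 32 x y)
    (by
      rintro i hi j hj s' hs' h10 h11 ⟨hf, hg, hv⟩
      obtain ⟨T, hT, hr⟩ := hcopy s'
      rw [h10, h11] at hr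
      refine ⟨T, _, hr, hT, hs', h10, h11, fun c hc => ?_, fun x y hxy => ?_, fun x y hy hxy => ?_⟩
      · funext x y
        simp [RAMState.writeReal, hc, hf c hc]
      · have : ¬ (x = i ∧ y = j) := by rintro ⟨rfl, rfl⟩; exact hxy ⟨hj, by omega⟩
        simp only [RAMState.writeReal, true_and, if_neg this]
        exact hg x y fun h => hxy ⟨h.1, by omega⟩
      · by_cases hxy' : x = i ∧ y = j
        · simp only [RAMState.writeReal, true_and, if_pos hxy']
          rw [hxy'.1, hxy'.2, hf 32 ha32]
        · simp only [RAMState.writeReal, true_and, if_neg hxy']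
          exact hv x y hy (by omega))
    (fun i _ f hf => ⟨hf.1, fun x y h => hf.2.1 x y fun h' => h ⟨h'.1, by omega⟩,
      fun x y hy hxy => hf.2.2 x y hy (by omega)⟩)
    ⟨fun _ _ => rfl, fun x y _ => by rw [hs₁.arrays], fun x y _ h => by omega⟩
  refine ⟨_, s₂, .seq hr₁ hr₂, fun c => ?_,
    fun x hx hx' hx'' => (ha₂ x hx hx' hx'').trans (ha₁ x hx hx' hx''), ?_⟩
  · simp only [sem]
    by_cases hc : c = a
    · subst hc
      rw [Function.update_self]
      funext x y
      split_ifs with h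
      · rw [hv₂ x y h.2 (Or.inl h.1), hv₁ x y h.2 (Or.inl h.1)]
      · exact hg₂ x y fun h' => h ⟨by omega, h'.1⟩
    · rw [Function.update_of_ne hc, hf₂ c fun h => hc (Fin.ext h), hs₁.arrays]
  · have e : (tab a b₁ b₂ b₃ t r₁ r₂).coefficient = 100 + Q := by
      simp only [coefficient, hQ]; omega
    rw [e]
    have k1 : b₃.val n d * (Q + 16) + 11 + 8 ≤ m * (Q + 35) := by
      have := Nat.mul_le_mul_right (Q + 16) (hval b₃)
      nlinarith
    have k2 : b₂.val n d * (b₃.val n d * (Q + 16) + 11 + 8) + 14 ≤ m ^ 2 * (Q + 49) := by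
      have := Nat.mul_le_mul (hval b₂) k1
      have h2 : 1 ≤ m ^ 2 := Nat.one_le_pow _ _ hm
      nlinarith
    have k3 : b₁.val n d * (b₂.val n d * (b₃.val n d * (Q + 16) + 11 + 8) + 14) + 6
        ≤ m ^ 3 * (Q + 55) := by
      have := Nat.mul_le_mul (hval b₁) k2
      have h2 : 1 ≤ m ^ 3 := Nat.one_le_pow _ _ hm
      nlinarith
    have k4 : b₂.val n d * (6 + 8) + 14 ≤ m * 28 := by
      have := Nat.mul_le_mul_right (6 + 8) (hval b₂)
      nlinarith
    have k5 : b₁.val n d * (b₂.val n d * (6 + 8) + 14) + 6 ≤ m ^ 3 * 34 := by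
      have := Nat.mul_le_mul (hval b₁) k4
      have h2 : m ^ 2 ≤ m ^ 3 := Nat.pow_le_pow_right hm (by omega)
      have h3 : 1 ≤ m ^ 3 := Nat.one_le_pow _ _ hm
      nlinarith
    have h3 : 1 ≤ m ^ 3 := Nat.one_le_pow _ _ hm
    nlinarith

/-- Compiled programs compute the effect of the source program in polynomial time. -/
theorem runs_compile {n d m : ℕ} (hn : n ≤ m) (hd : d ≤ m) (hm : 1 ≤ m) (p : ArrayProgram) :
    ∀ (depth : ℕ) (R : Arrays) (s : RAMState), Represents n d R s →
      ∃ T s', (p.compile depth).Runs s T s' ∧ Represents n d (p.sem n d R) s' ∧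
        (∀ x < 20 + depth, x ≠ 10 → x ≠ 11 → x ≠ 12 → s'.int x = s.int x) ∧
        T ≤ p.coefficient * m ^ p.degree := by
  have hval : ∀ b : Size, b.val n d ≤ m := fun b => by cases b <;> simpa [Size.val]
  induction p with
  | tab a b₁ b₂ b₃ t r₁ r₂ =>
    intro depth R s hs
    obtain ⟨T, s', hr, hv, ha, hT⟩ := runs_tab hn hd hm a b₁ b₂ b₃ t r₁ r₂ hs depth
    exact ⟨T, s', hr, ⟨(ha 0 (by omega) (by omega) (by omega)).trans hs.points,
        (ha 1 (by omega) (by omega) (by omega)).trans hs.coords,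
        (ha 2 (by omega) (by omega) (by omega)).trans hs.unit, hv⟩, fun x _ => ha x, hT⟩
  | seq p q ihp ihq =>
    intro depth R s hs
    obtain ⟨T₁, s₁, hr₁, hs₁, hf₁, hT₁⟩ := ihp depth R s hs
    obtain ⟨T₂, s₂, hr₂, hs₂, hf₂, hT₂⟩ := ihq depth _ s₁ hs₁
    refine ⟨_, s₂, .seq hr₁ hr₂, hs₂, fun x h h0 h1 h2 =>
      (hf₂ x h h0 h1 h2).trans (hf₁ x h h0 h1 h2), ?_⟩
    simp only [coefficient, degree]
    have h1 : m ^ p.degree ≤ m ^ max p.degree q.degree := Nat.pow_le_pow_right hm (le_max_left _ _)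
    have h2 : m ^ q.degree ≤ m ^ max p.degree q.degree := Nat.pow_le_pow_right hm (le_max_right _ _)
    have h3 := Nat.mul_le_mul_left p.coefficient h1
    have h4 := Nat.mul_le_mul_left q.coefficient h2
    rw [add_mul]
    omega
  | guard t p ih =>
    intro depth R s hs
    set s₁ := ((s.writeInt 10 0).writeInt 11 0).writeInt 12 0 with hs₁
    have ha : AgreeOffIndices s s₁ := fun x h0 h1 h2 => by
      simp [hs₁, RAMState.writeInt, h0, h1, h2]
    have hrep : Represents n d R s₁ := hs.congr_int rfl (ha 0 (by omega) (by omega) (by omega))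
      (ha 1 (by omega) (by omega) (by omega)) (ha 2 (by omega) (by omega) (by omega))
    have hidx : s₁.int 10 = 0 ∧ s₁.int 11 = 0 ∧ s₁.int 12 = 0 := by
      simp [hs₁, RAMState.writeInt]
    have hset : ∀ (T : ℕ) (s' : RAMState) (q : RAMProgram), q.Runs s₁ T s' → RAMProgram.Runs
        (.seq (.setInt 10 (.lit 0)) (.seq (.setInt 11 (.lit 0)) (.seq (.setInt 12 (.lit 0)) q)))
        s (2 + (2 + (2 + T))) s' := fun T s' q hq =>
      .seq (.setInt s 10 (.lit 0)) (.seq (.setInt _ 11 (.lit 0)) (.seq (.setInt _ 12 (.lit 0)) hq))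
    have h3 : 1 ≤ m ^ p.degree := Nat.one_le_pow _ _ hm
    by_cases ht : t.Holds n d R 0 0 0
    · obtain ⟨T, s', hr, hs', hf, hT⟩ := ih depth R s₁ hrep
      refine ⟨_, s', hset _ _ _ (.branchTrue _ ((hrep.cond_holds hidx t).2 ht) hr), ?_,
        fun x h h0 h1 h2 => (hf x h h0 h1 h2).trans (ha x h0 h1 h2), ?_⟩
      · simpa only [sem, if_pos ht] using hs'
      · simp only [coefficient, degree]
        nlinarith [Nat.zero_le t.toTest.cost]
    · refine ⟨_, s₁, hset _ _ _ (.branchFalse _ (fun h => ht ((hrep.cond_holds hidx t).1 h))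
        (.skip _)), ?_, fun x h h0 h1 h2 => ha x h0 h1 h2, ?_⟩
      · simpa only [sem, if_neg ht] using hrep
      · simp only [coefficient, degree]
        nlinarith [Nat.zero_le t.toTest.cost, Nat.zero_le p.coefficient]
  | rep b p ih =>
    intro depth R s hs
    have hreg : b.reg < 3 := by cases b <;> simp [Size.reg]
    obtain ⟨T, s', hr, hT, ⟨hs', hf⟩, -⟩ :
        ∃ T s', (forLoop (20 + depth) b.reg (p.compile (depth + 1))).Runs s T s' ∧
          T ≤ b.val n d * (p.coefficient * m ^ p.degree + 8) + 6 ∧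
          (Represents n d ((p.sem n d)^[b.val n d] R) s' ∧
            ∀ x < 20 + depth, x ≠ 10 → x ≠ 11 → x ≠ 12 → s'.int x = s.int x) ∧
          s'.int b.reg = b.val n d := by
      refine runs_forLoop (c := 20 + depth) (b := b.reg)
          (N := b.val n d) (B := p.coefficient * m ^ p.degree) (p := p.compile (depth + 1)) (by omega)
          (fun i s' => Represents n d ((p.sem n d)^[i] R) s' ∧
            ∀ x < 20 + depth, x ≠ 10 → x ≠ 11 → x ≠ 12 → s'.int x = s.int x) ?_ (s := s) ⟨?_, ?_⟩
          (hs.size_reg b)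
      · rintro i hi s₁ ⟨hs₁, hf₁⟩ hc hb
        obtain ⟨T, s₂, hr, hs₂, hf₂, hT⟩ := ih (depth + 1) _ s₁ hs₁
        have hw : ∀ x, x < 20 + depth → (s₂.writeInt (20 + depth) (i + 1)).int x = s₂.int x :=
          fun x hx => by simp [RAMState.writeInt, hx.ne]
        refine ⟨T, s₂, hr, hT, ?_, ?_, ?_, ?_⟩
        · rw [hf₂ _ (by omega) (by omega) (by omega) (by omega), hc]
        · rw [hf₂ _ (by omega) (by omega) (by omega) (by omega), hb]
        · rw [Function.iterate_succ_apply']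
          exact hs₂.congr_int rfl (hw 0 (by omega)) (hw 1 (by omega)) (hw 2 (by omega))
        · intro x h h0 h1 h2
          rw [hw x h, hf₂ x (by omega) h0 h1 h2, hf₁ x h h0 h1 h2]
      · have hw : ∀ x, x < 20 + depth → (s.writeInt (20 + depth) 0).int x = s.int x :=
          fun x hx => by simp [RAMState.writeInt, hx.ne]
        exact hs.congr_int rfl (hw 0 (by omega)) (hw 1 (by omega)) (hw 2 (by omega))
      · intro x h _ _ _
        simp [RAMState.writeInt, h.ne]
    refine ⟨T, s', hr, by simpa only [sem] using hs', hf, ?_⟩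
    simp only [coefficient, degree]
    have h1 : 1 ≤ m ^ p.degree := Nat.one_le_pow _ _ hm
    have h2 := Nat.mul_le_mul_right (p.coefficient * m ^ p.degree + 8) (hval b)
    rw [pow_succ]
    nlinarith [Nat.mul_le_mul hm h1]

end ArrayProgram

/-! ### Frame rule and evaluation rules for assignments -/

namespace ArrayProgram

/-- Arrays that a program may change. -/
def writes : ArrayProgram → List (Fin 32)
  | tab a .. => [a]
  | seq p q => p.writes ++ q.writes
  | guard _ p => p.writes
  | rep _ p => p.writes

variable {n d : ℕ} {R : Arrays}

/-- Frame rule: facts about an array survive any program that does not write to it, and the side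
condition is decidable for concrete programs. -/
theorem sem_of_notMem_writes {p : ArrayProgram} {c : Fin 32} :
    ∀ {R : Arrays}, c ∉ p.writes → p.sem n d R c = R c := by
  induction p with
  | tab a b₁ b₂ b₃ t r₁ r₂ =>
    intro R h
    simp only [writes, List.mem_singleton] at h
    simp only [sem, Function.update_of_ne h]
  | seq p q ihp ihq =>
    intro R h
    simp only [writes, List.mem_append, not_or] at h
    simp only [sem, ihq h.2, ihp h.1]
  | guard t p ih =>
    intro R h
    simp only [sem]
    split_ifs
    · exact ih h
    · rfl
  | rep b p ih =>
    intro R h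
    simp only [sem]
    generalize b.val n d = m
    induction m with
    | zero => rfl
    | succ m ihm => rw [Function.iterate_succ_apply', ih h, ihm]

/-- The condition that always holds. -/
def always : Cond := .eq .zero .zero

/-- Assignment of a sum of terms to every cell. -/
def assignSum (a : Fin 32) (b₁ b₂ b₃ : Size) (r : Term) : ArrayProgram := tab a b₁ b₂ b₃ always r r

/-- Assignment of a term to every cell. -/
def assign (a : Fin 32) (b₁ b₂ : Size) (r : Term) : ArrayProgram := assignSum a b₁ b₂ .unit r

/-- Assignment by cases to every cell. -/
def assignIf (a : Fin 32) (b₁ b₂ : Size) (t : Cond) (r₁ r₂ : Term) : ArrayProgram :=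
  tab a b₁ b₂ .unit t r₁ r₂

theorem tab_apply {a : Fin 32} {b₁ b₂ b₃ : Size} {t : Cond} {r₁ r₂ : Term} {i j : ℕ}
    (hi : i < b₁.val n d) (hj : j < b₂.val n d) (P : Fin (b₃.val n d) → Prop) [DecidablePred P]
    (hP : ∀ k : Fin (b₃.val n d), t.Holds n d R i j k ↔ P k) :
    (tab a b₁ b₂ b₃ t r₁ r₂).sem n d R a i j
      = ∑ k : Fin (b₃.val n d), if P k then r₁.val n d R i j k else r₂.val n d R i j k := by
  simp only [sem, Function.update_self, hi, hj, and_self, if_true, entry]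
  rw [Finset.sum_range]
  refine Finset.sum_congr rfl fun k _ => ?_
  by_cases h : t.Holds n d R i j k
  · rw [if_pos h, if_pos ((hP k).1 h)]
  · rw [if_neg h, if_neg fun h' => h ((hP k).2 h')]

theorem assignSum_apply {a : Fin 32} {b₁ b₂ b₃ : Size} {r : Term} {i j : ℕ}
    (hi : i < b₁.val n d) (hj : j < b₂.val n d) :
    (assignSum a b₁ b₂ b₃ r).sem n d R a i j = ∑ k : Fin (b₃.val n d), r.val n d R i j k := by
  rw [assignSum, tab_apply hi hj (fun _ => True) fun k => by simp [always, Cond.Holds]]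
  simp

theorem assign_apply {a : Fin 32} {b₁ b₂ : Size} {r : Term} {i j : ℕ}
    (hi : i < b₁.val n d) (hj : j < b₂.val n d) :
    (assign a b₁ b₂ r).sem n d R a i j = r.val n d R i j 0 := by
  rw [assign, assignSum_apply hi hj]
  exact Fin.sum_univ_one _

theorem assignIf_apply {a : Fin 32} {b₁ b₂ : Size} {t : Cond} {r₁ r₂ : Term} {i j : ℕ}
    (hi : i < b₁.val n d) (hj : j < b₂.val n d) (P : Prop) [Decidable P]
    (hP : t.Holds n d R i j 0 ↔ P) :
    (assignIf a b₁ b₂ t r₁ r₂).sem n d R a i j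
      = if P then r₁.val n d R i j 0 else r₂.val n d R i j 0 := by
  rw [assignIf, tab_apply hi hj (fun _ => P) fun k => ?_]
  · exact Fin.sum_univ_one _
  · have : (k : ℕ) = 0 := by have := k.2; simp only [Size.val] at this; omega
    rw [this, hP]

/-! ### Residuals -/

/-- Clipped residuals with respect to the centers in row `0` of the array `c`. -/
def residuals (c : Fin 32) : ArrayProgram :=
  .seq (assign 11 .points .coords
    (.div (.sub (.cell 0 .row .col) (.cell c .zero .col)) (.mul (.lit 4) (.cell 5 .zero .col))))
  (.seq (assignIf 11 .points .coords (.lt (.lit 1) (.cell 11 .row .col)) (.lit 1)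
    (.cell 11 .row .col))
  (assignIf 11 .points .coords (.lt (.cell 11 .row .col) (.sub (.lit 0) (.lit 1)))
    (.sub (.lit 0) (.lit 1)) (.cell 11 .row .col)))

theorem residuals_apply {c : Fin 32} (i : Fin n) (j : Fin d) :
    (residuals c).sem n d R 11 i j = clippedResidual (fun (i : Fin n) (j : Fin d) => R 0 i j)
      (fun j => R 5 0 j) (fun j => R c 0 j) i j := by
  have hi : (i : ℕ) < Size.val n d .points := i.2
  have hj : (j : ℕ) < Size.val n d .coords := j.2
  set u := (R 0 i j - R c 0 j) / (4 * R 5 0 j) with hu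
  set R₁ := (assign 11 .points .coords (.div (.sub (.cell 0 .row .col) (.cell c .zero .col))
    (.mul (.lit 4) (.cell 5 .zero .col)))).sem n d R with hR₁
  set R₂ := (assignIf 11 .points .coords (.lt (.lit 1) (.cell 11 .row .col)) (.lit 1)
    (.cell 11 .row .col)).sem n d R₁ with hR₂
  have e₁ : R₁ 11 i j = u := by
    rw [hR₁, assign_apply hi hj]
    simp [Term.val, Index.val, u]
  have e₂ : R₂ 11 i j = if 1 < u then 1 else u := by
    rw [hR₂, assignIf_apply hi hj (1 < u) (by simp [Cond.Holds, Term.val, Index.val, e₁])]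
    simp [Term.val, Index.val, e₁]
  have e₃ : (residuals c).sem n d R 11 i j = if R₂ 11 i j < -1 then -1 else R₂ 11 i j := by
    change (assignIf 11 .points .coords (.lt (.cell 11 .row .col) (.sub (.lit 0) (.lit 1)))
      (.sub (.lit 0) (.lit 1)) (.cell 11 .row .col)).sem n d R₂ 11 i j = _
    rw [assignIf_apply hi hj (R₂ 11 i j < -1) (by simp [Cond.Holds, Term.val, Index.val])]
    simp [Term.val, Index.val]
  rw [e₃, e₂]
  simp only [clippedResidual, clip, ← hu]
  rcases lt_or_ge 1 u with h | h
  · rw [if_pos h, if_neg (by norm_num), min_eq_left h.le, max_eq_right (by norm_num)]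
  · rw [if_neg h.not_gt, min_eq_right h]
    rcases lt_or_ge u (-1) with h' | h'
    · rw [if_pos h', max_eq_left h'.le]
    · rw [if_neg h'.not_gt, max_eq_right h']

/-! ### Bisection -/

/-- Bisection step for the centers. -/
def bisectStep : ArrayProgram :=
  .seq (assign 25 .unit .coords
    (.div (.add (.cell 9 .zero .col) (.cell 10 .zero .col)) (.lit 2)))
  (.seq (residuals 25)
  (.seq (assignSum 24 .unit .coords .points (.mul (.cell 8 .sum .zero) (.cell 11 .sum .col)))
  (.seq (assignIf 9 .unit .coords (.lt (.lit 0) (.cell 24 .zero .col)) (.cell 25 .zero .col)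
    (.cell 9 .zero .col))
  (assignIf 10 .unit .coords (.lt (.lit 0) (.cell 24 .zero .col)) (.cell 10 .zero .col)
    (.cell 25 .zero .col)))))

/-- Weighted sum of the clipped residuals in one coordinate. -/
noncomputable def residualSum (z : Fin n → Fin d → ℝ) (L : Fin d → ℝ) (w : Fin n → ℝ) (j : Fin d)
    (t : ℝ) : ℝ := ∑ i, w i * clippedResidual z L (fun _ => t) i j

theorem bisectStep_apply (j : Fin d) :
    let m := (R 9 0 j + R 10 0 j) / 2
    let F := residualSum (fun (i : Fin n) (j : Fin d) => R 0 i j) (fun j => R 5 0 j)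
      (fun i => R 8 i 0) j m
    bisectStep.sem n d R 9 0 j = (if 0 < F then m else R 9 0 j) ∧
      bisectStep.sem n d R 10 0 j = if 0 < F then R 10 0 j else m := by
  have h0 : 0 < Size.val n d .unit := Nat.one_pos
  have hj : (j : ℕ) < Size.val n d .coords := j.2
  intro m F
  set R₁ := (assign 25 .unit .coords
    (.div (.add (.cell 9 .zero .col) (.cell 10 .zero .col)) (.lit 2))).sem n d R with hR₁
  set R₂ := (residuals 25).sem n d R₁ with hR₂
  set R₃ := (assignSum 24 .unit .coords .points
    (.mul (.cell 8 .sum .zero) (.cell 11 .sum .col))).sem n d R₂ with hR₃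
  set R₄ := (assignIf 9 .unit .coords (.lt (.lit 0) (.cell 24 .zero .col)) (.cell 25 .zero .col)
    (.cell 9 .zero .col)).sem n d R₃ with hR₄
  have f₁ : ∀ c : Fin 32, c ≠ 25 → R₁ c = R c := fun c hc => sem_of_notMem_writes (by
    simpa [assign, assignSum, writes] using hc)
  have f₂ : ∀ c : Fin 32, c ≠ 11 → R₂ c = R₁ c := fun c hc => sem_of_notMem_writes (by
    simpa [residuals, assign, assignSum, assignIf, writes] using hc)
  have f₃ : ∀ c : Fin 32, c ≠ 24 → R₃ c = R₂ c := fun c hc => sem_of_notMem_writes (by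
    simpa [assign, assignSum, writes] using hc)
  have f₄ : ∀ c : Fin 32, c ≠ 9 → R₄ c = R₃ c := fun c hc => sem_of_notMem_writes (by
    simpa [assignIf, writes] using hc)
  have e25 : R₁ 25 0 j = m := by
    rw [hR₁, assign_apply h0 hj]
    simp [Term.val, Index.val, m]
  have e24 : R₃ 24 0 j = F := by
    rw [hR₃, assignSum_apply h0 hj]
    simp only [Term.val, Index.val]
    refine Finset.sum_congr rfl fun (i : Fin n) _ => ?_
    rw [f₂ 8 (by decide), f₁ 8 (by decide), hR₂, residuals_apply]
    simp only [clippedResidual, f₁ 0 (by decide), f₁ 5 (by decide), e25]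
  have e25' : R₃ 25 0 j = m := by rw [f₃ 25 (by decide), f₂ 25 (by decide), e25]
  have e9 : R₃ 9 0 j = R 9 0 j := by
    rw [f₃ 9 (by decide), f₂ 9 (by decide), f₁ 9 (by decide)]
  have e10 : R₃ 10 0 j = R 10 0 j := by
    rw [f₃ 10 (by decide), f₂ 10 (by decide), f₁ 10 (by decide)]
  have hsem : bisectStep.sem n d R = (assignIf 10 .unit .coords (.lt (.lit 0) (.cell 24 .zero .col))
    (.cell 10 .zero .col) (.cell 25 .zero .col)).sem n d R₄ := rfl
  constructor
  · rw [hsem, sem_of_notMem_writes (by simp [assignIf, writes]), hR₄,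
      assignIf_apply h0 hj (0 < F) (by simp [Cond.Holds, Term.val, Index.val, e24])]
    simp only [Term.val, Index.val, e25', e9]
  · rw [hsem, assignIf_apply h0 hj (0 < F) (by
      simp [Cond.Holds, Term.val, Index.val, f₄ 24 (by decide), e24])]
    simp only [Term.val, Index.val, f₄ 25 (by decide), f₄ 10 (by decide), e25', e10]

/-- Bisection for the centers. -/
def bisect : ArrayProgram :=
  .seq (assign 9 .unit .coords (.sub (.cell 3 .zero .col) (.cell 5 .zero .col)))
  (.seq (assign 10 .unit .coords (.add (.cell 4 .zero .col) (.cell 5 .zero .col)))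
  (.rep .points bisectStep))

/-- Invariant: an end of the interval is either still the initial one or has the recorded sign of
`F`, and the width halves. Monotonicity of `F` is not needed; later only the sign change and the
Lipschitz bound are used. -/
theorem bisect_apply (j : Fin d) :
    let F := residualSum (fun (i : Fin n) (j : Fin d) => R 0 i j) (fun j => R 5 0 j)
      (fun i => R 8 i 0) j
    let lo := R 3 0 j - R 5 0 j
    let hi := R 4 0 j + R 5 0 j
    let R' := bisect.sem n d R
    lo ≤ hi → (R' 9 0 j = lo ∨ 0 < F (R' 9 0 j)) ∧ (R' 10 0 j = hi ∨ F (R' 10 0 j) ≤ 0) ∧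
      lo ≤ R' 9 0 j ∧ R' 10 0 j ≤ hi ∧ R' 10 0 j - R' 9 0 j = (hi - lo) / 2 ^ n := by
  intro F lo hi R' hlohi
  have h0 : 0 < Size.val n d .unit := Nat.one_pos
  have hj : (j : ℕ) < Size.val n d .coords := j.2
  set R₁ := (assign 9 .unit .coords (.sub (.cell 3 .zero .col) (.cell 5 .zero .col))).sem n d R
    with hR₁
  set R₂ := (assign 10 .unit .coords (.add (.cell 4 .zero .col) (.cell 5 .zero .col))).sem n d R₁
    with hR₂
  have f₁ : ∀ c : Fin 32, c ≠ 9 → R₁ c = R c := fun c hc => sem_of_notMem_writes (by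
    simpa [assign, assignSum, writes] using hc)
  have f₂ : ∀ c : Fin 32, c ≠ 10 → R₂ c = R₁ c := fun c hc => sem_of_notMem_writes (by
    simpa [assign, assignSum, writes] using hc)
  have hR' : R' = (bisectStep.sem n d)^[n] R₂ := rfl
  have key : ∀ m : ℕ, let S := (bisectStep.sem n d)^[m] R₂
      (S 0 = R 0 ∧ S 5 = R 5 ∧ S 8 = R 8) ∧ (S 9 0 j = lo ∨ 0 < F (S 9 0 j)) ∧
        (S 10 0 j = hi ∨ F (S 10 0 j) ≤ 0) ∧
      lo ≤ S 9 0 j ∧ S 10 0 j ≤ hi ∧ S 10 0 j - S 9 0 j = (hi - lo) / 2 ^ m := by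
    intro m
    induction m with
    | zero =>
      have e9 : R₂ 9 0 j = lo := by
        rw [f₂ 9 (by decide), hR₁, assign_apply h0 hj]; rfl
      have e10 : R₂ 10 0 j = hi := by
        rw [hR₂, assign_apply h0 hj]
        simp only [Term.val, Index.val, f₁ 4 (by decide), f₁ 5 (by decide)]
        rfl
      refine ⟨⟨?_, ?_, ?_⟩, Or.inl e9, Or.inl e10, e9.ge, e10.le, ?_⟩
      · exact (f₂ 0 (by decide)).trans (f₁ 0 (by decide))
      · exact (f₂ 5 (by decide)).trans (f₁ 5 (by decide))
      · exact (f₂ 8 (by decide)).trans (f₁ 8 (by decide))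
      · simp [e9, e10]
    | succ m ih =>
      simp only [Function.iterate_succ_apply']
      set S := (bisectStep.sem n d)^[m] R₂
      obtain ⟨⟨h0', h5, h8⟩, h9, h10, hl, hh, hd⟩ := ih
      have hstep := bisectStep_apply (n := n) (R := S) j
      have hfr : ∀ c : Fin 32, c ∉ ([25, 11, 11, 11, 24, 9, 10] : List (Fin 32)) →
          bisectStep.sem n d S c = S c := fun c hc => sem_of_notMem_writes hc
      have hw : (0 : ℝ) ≤ (hi - lo) / 2 ^ m := by
        have : 0 ≤ hi - lo := sub_nonneg.2 hlohi
        positivity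
      refine ⟨⟨(hfr 0 (by decide)).trans h0', (hfr 5 (by decide)).trans h5,
        (hfr 8 (by decide)).trans h8⟩, ?_⟩
      simp only [h0', h5, h8] at hstep
      rw [hstep.1, hstep.2, pow_succ]
      by_cases hF : 0 < F ((S 9 0 j + S 10 0 j) / 2)
      · rw [if_pos hF, if_pos hF]
        exact ⟨Or.inr hF, h10, by linarith, hh, by rw [← div_div, ← hd]; ring⟩
      · rw [if_neg hF, if_neg hF]
        exact ⟨h9, Or.inr (not_lt.1 hF), hl, by linarith, by rw [← div_div, ← hd]; ring⟩
  exact (key n).2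

end ArrayProgram

namespace ArrayProgram

variable {n d : ℕ} {R : Arrays}

/-! ### Spectral scores -/

/-- Second-moment matrix of the rows of `y` with the diagonal replaced by `1`. -/
noncomputable def unitDiagGram (w : Fin n → ℝ) (y : Fin n → Fin d → ℝ) : Matrix (Fin d) (Fin d) ℝ :=
  Matrix.of fun j k => if j = k then 1 else ∑ i, w i * (y i j * y i k) / n

/-- Assignment of `unitDiagGram` to array `13`. -/
def gram : ArrayProgram :=
  .seq (assignSum 13 .coords .coords .points
    (.div (.mul (.cell 8 .sum .zero) (.mul (.cell 11 .sum .row) (.cell 11 .sum .col)))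
      (.size .points)))
  (assignIf 13 .coords .coords (.eq .row .col) (.lit 1) (.cell 13 .row .col))

theorem gram_apply (j k : Fin d) : gram.sem n d R 13 j k =
    unitDiagGram (fun i : Fin n => R 8 i 0) (fun (i : Fin n) (j : Fin d) => R 11 i j) j k := by
  have hj : (j : ℕ) < Size.val n d .coords := j.2
  have hk : (k : ℕ) < Size.val n d .coords := k.2
  set R₁ := (assignSum 13 .coords .coords .points
    (.div (.mul (.cell 8 .sum .zero) (.mul (.cell 11 .sum .row) (.cell 11 .sum .col)))
      (.size .points))).sem n d R with hR₁
  have e : R₁ 13 j k = ∑ i : Fin n, R 8 i 0 * (R 11 i j * R 11 i k) / n := by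
    rw [hR₁, assignSum_apply hj hk]
    rfl
  change (assignIf 13 .coords .coords (.eq .row .col) (.lit 1) (.cell 13 .row .col)).sem n d R₁ 13
    j k = _
  rw [assignIf_apply hj hk (j = k) (by simp [Cond.Holds, Index.val, Fin.ext_iff])]
  simp only [Term.val, Index.val, e, unitDiagGram, Matrix.of_apply, Nat.cast_one]

/-- Repeated squaring of the matrix in array `13`; the result is in array `12`. -/
def power : ArrayProgram :=
  .seq (assign 12 .coords .coords (.cell 13 .row .col))
  (.rep .points (assignSum 12 .coords .coords .coords (.mul (.cell 12 .row .sum)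
    (.cell 12 .sum .col))))

/-- Squaring `n` times reaches the exponent `2 ^ n` at polynomial cost. So high an exponent makes
the eigenvalue error at most `ε` as soon as `d³ ≤ ε² 2 ^ n`. -/
theorem power_apply (j k : Fin d) : power.sem n d R 12 j k =
    ((Matrix.of fun j k : Fin d => R 13 j k) ^ (2 ^ n)) j k := by
  set A : Matrix (Fin d) (Fin d) ℝ := Matrix.of fun j k : Fin d => R 13 j k with hA
  set R₁ := (assign 12 .coords .coords (.cell 13 .row .col)).sem n d R with hR₁
  have key : ∀ m : ℕ, ∀ j k : Fin d, ((assignSum 12 .coords .coords .coords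
      (.mul (.cell 12 .row .sum) (.cell 12 .sum .col))).sem n d)^[m] R₁ 12 j k
      = (A ^ (2 ^ m)) j k := by
    intro m
    induction m with
    | zero =>
      intro j k
      rw [Function.iterate_zero, id, hR₁, assign_apply (b₁ := .coords) (b₂ := .coords) j.2 k.2]
      simp [Term.val, Index.val, hA]
    | succ m ih =>
      intro j k
      rw [Function.iterate_succ_apply', assignSum_apply (b₁ := .coords) (b₂ := .coords) j.2 k.2,
        pow_succ 2 m, mul_two, pow_add, Matrix.mul_apply]
      refine Finset.sum_congr rfl fun (l : Fin d) _ => ?_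
      simp only [Term.val, Index.val]
      rw [ih j l, ih l k]
  exact key n j k

/-- Largest-eigenvalue estimate (array `17`), scores of the points (array `16`) and the removed
weight (array `18`). -/
def scores : ArrayProgram :=
  .seq (assignSum 26 .coords .coords .coords (.mul (.cell 12 .row .sum) (.cell 13 .sum .col)))
  (.seq (assignSum 27 .coords .unit .coords (.mul (.cell 12 .row .sum) (.cell 12 .row .sum)))
  (.seq (assignSum 14 .unit .unit .coords (.cell 27 .sum .zero))
  (.seq (assignSum 27 .coords .unit .coords (.mul (.cell 26 .row .sum) (.cell 12 .row .sum)))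
  (.seq (assignSum 17 .unit .unit .coords (.cell 27 .sum .zero))
  (.seq (assign 17 .unit .unit (.sub (.div (.cell 17 .zero .zero) (.cell 14 .zero .zero)) (.lit 1)))
  (.seq (assignSum 15 .points .coords .coords (.mul (.cell 12 .col .sum) (.cell 11 .row .sum)))
  (.seq (assignSum 16 .points .unit .coords
    (.div (.mul (.cell 15 .row .sum) (.cell 15 .row .sum)) (.cell 14 .zero .zero)))
  (assignSum 18 .unit .unit .points (.sub (.lit 1) (.cell 8 .sum .zero))))))))))

/-- Dividing by `T`, the squared Frobenius norm of `V`, normalises the scores. Subtracting `1`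
removes the contribution of the unit diagonal, so array `17` estimates the top eigenvalue of the
off-diagonal part. -/
theorem scores_apply :
    let V : Matrix (Fin d) (Fin d) ℝ := Matrix.of fun j k : Fin d => R 12 j k
    let A : Matrix (Fin d) (Fin d) ℝ := Matrix.of fun j k : Fin d => R 13 j k
    let T := ∑ i, ∑ j, V i j ^ 2
    let R' := scores.sem n d R
    R' 17 0 0 = (∑ i, ∑ j, (V * A) i j * V i j) / T - 1 ∧
      (∀ i : Fin n, R' 16 i 0 = ∑ k, (∑ j, V k j * R 11 i j) ^ 2 / T) ∧
      R' 18 0 0 = ∑ i : Fin n, (1 - R 8 i 0) := by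
  intro V A T R'
  have h0 : 0 < Size.val n d .unit := Nat.one_pos
  set R₁ := (assignSum 26 .coords .coords .coords
    (.mul (.cell 12 .row .sum) (.cell 13 .sum .col))).sem n d R with hR₁
  set R₂ := (assignSum 27 .coords .unit .coords
    (.mul (.cell 12 .row .sum) (.cell 12 .row .sum))).sem n d R₁ with hR₂
  set R₃ := (assignSum 14 .unit .unit .coords (.cell 27 .sum .zero)).sem n d R₂ with hR₃
  set R₄ := (assignSum 27 .coords .unit .coords
    (.mul (.cell 26 .row .sum) (.cell 12 .row .sum))).sem n d R₃ with hR₄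
  set R₅ := (assignSum 17 .unit .unit .coords (.cell 27 .sum .zero)).sem n d R₄ with hR₅
  set R₆ := (assign 17 .unit .unit
    (.sub (.div (.cell 17 .zero .zero) (.cell 14 .zero .zero)) (.lit 1))).sem n d R₅ with hR₆
  set R₇ := (assignSum 15 .points .coords .coords
    (.mul (.cell 12 .col .sum) (.cell 11 .row .sum))).sem n d R₆ with hR₇
  set R₈ := (assignSum 16 .points .unit .coords
    (.div (.mul (.cell 15 .row .sum) (.cell 15 .row .sum)) (.cell 14 .zero .zero))).sem n d R₇
    with hR₈
  have hR' : R' = (assignSum 18 .unit .unit .points (.sub (.lit 1) (.cell 8 .sum .zero))).sem n d R₈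
    := rfl
  have fr : ∀ (a : Fin 32) (b₁ b₂ b₃ : Size) (r : Term) (S : Arrays) (c : Fin 32), c ≠ a →
      (assignSum a b₁ b₂ b₃ r).sem n d S c = S c := fun a b₁ b₂ b₃ r S c hc =>
    sem_of_notMem_writes (by simpa [assignSum, writes] using hc)
  have f₁ : ∀ c : Fin 32, c ≠ 26 → R₁ c = R c := fun c hc => fr _ _ _ _ _ _ _ hc
  have f₂ : ∀ c : Fin 32, c ≠ 27 → R₂ c = R₁ c := fun c hc => fr _ _ _ _ _ _ _ hc
  have f₃ : ∀ c : Fin 32, c ≠ 14 → R₃ c = R₂ c := fun c hc => fr _ _ _ _ _ _ _ hc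
  have f₄ : ∀ c : Fin 32, c ≠ 27 → R₄ c = R₃ c := fun c hc => fr _ _ _ _ _ _ _ hc
  have f₅ : ∀ c : Fin 32, c ≠ 17 → R₅ c = R₄ c := fun c hc => fr _ _ _ _ _ _ _ hc
  have f₆ : ∀ c : Fin 32, c ≠ 17 → R₆ c = R₅ c := fun c hc => fr _ _ _ _ _ _ _ hc
  have f₇ : ∀ c : Fin 32, c ≠ 15 → R₇ c = R₆ c := fun c hc => fr _ _ _ _ _ _ _ hc
  have f₈ : ∀ c : Fin 32, c ≠ 16 → R₈ c = R₇ c := fun c hc => fr _ _ _ _ _ _ _ hc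
  have f₉ : ∀ c : Fin 32, c ≠ 18 → R' c = R₈ c := fun c hc => fr _ _ _ _ _ _ _ hc
  have eVA : ∀ i j : Fin d, R₁ 26 i j = (V * A) i j := by
    intro i j
    rw [hR₁, assignSum_apply (b₁ := .coords) (b₂ := .coords) i.2 j.2, Matrix.mul_apply]
    rfl
  have e27 : ∀ i : Fin d, R₂ 27 i 0 = ∑ j, V i j ^ 2 := by
    intro i
    rw [hR₂, assignSum_apply (b₁ := .coords) i.2 h0]
    refine Finset.sum_congr rfl fun (j : Fin d) _ => ?_
    simp only [Term.val, Index.val, f₁ 12 (by decide), sq]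
    rfl
  have eT : R₃ 14 0 0 = T := by
    rw [hR₃, assignSum_apply h0 h0]
    exact Finset.sum_congr rfl fun (i : Fin d) _ => e27 i
  have e27' : ∀ i : Fin d, R₄ 27 i 0 = ∑ j, (V * A) i j * V i j := by
    intro i
    rw [hR₄, assignSum_apply (b₁ := .coords) i.2 h0]
    refine Finset.sum_congr rfl fun (j : Fin d) _ => ?_
    simp only [Term.val, Index.val, f₃ 26 (by decide), f₂ 26 (by decide), eVA,
      f₃ 12 (by decide), f₂ 12 (by decide), f₁ 12 (by decide)]
    rfl
  have e17 : R₅ 17 0 0 = ∑ i, ∑ j, (V * A) i j * V i j := by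
    rw [hR₅, assignSum_apply h0 h0]
    exact Finset.sum_congr rfl fun (i : Fin d) _ => e27' i
  have eT5 : R₅ 14 = R₃ 14 := (f₅ 14 (by decide)).trans (f₄ 14 (by decide))
  have e17' : R₆ 17 0 0 = (∑ i, ∑ j, (V * A) i j * V i j) / T - 1 := by
    rw [hR₆, assign_apply h0 h0]
    simp only [Term.val, Index.val, e17, eT5, eT, Nat.cast_one]
  have e11 : ∀ c : Fin 32, c ≠ 26 → c ≠ 27 → c ≠ 14 → c ≠ 17 → R₆ c = R c :=
    fun c h1 h2 h3 h4 => by rw [f₆ c h4, f₅ c h4, f₄ c h2, f₃ c h3, f₂ c h2, f₁ c h1]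
  have e15 : ∀ (i : Fin n) (k : Fin d), R₇ 15 i k = ∑ j : Fin d, V k j * R 11 i j := by
    intro i k
    rw [hR₇, assignSum_apply (b₁ := .points) (b₂ := .coords) i.2 k.2]
    refine Finset.sum_congr rfl fun (j : Fin d) _ => ?_
    simp only [Term.val, Index.val, e11 12 (by decide) (by decide) (by decide) (by decide),
      e11 11 (by decide) (by decide) (by decide) (by decide)]
    rfl
  have eT7 : R₇ 14 0 0 = T := by rw [f₇ 14 (by decide), f₆ 14 (by decide), eT5, eT]
  refine ⟨?_, fun i => ?_, ?_⟩
  · rw [f₉ 17 (by decide), f₈ 17 (by decide), f₇ 17 (by decide), e17']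
  · rw [f₉ 16 (by decide), hR₈, assignSum_apply (b₁ := .points) i.2 h0]
    refine Finset.sum_congr rfl fun (k : Fin d) _ => ?_
    simp only [Term.val, Index.val, eT7, e15, sq]
  · rw [hR', assignSum_apply h0 h0]
    refine Finset.sum_congr rfl fun (i : Fin n) _ => ?_
    simp only [Term.val, Index.val, f₈ 8 (by decide), f₇ 8 (by decide),
      e11 8 (by decide) (by decide) (by decide) (by decide), Nat.cast_one]

/-- Scores of the residuals around the current centers. -/
def spectral : ArrayProgram := .seq (residuals 9) (.seq gram (.seq power scores))

theorem spectral_apply :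
    let w : Fin n → ℝ := fun i => R 8 i 0
    let y : Fin n → Fin d → ℝ := clippedResidual (fun i j => R 0 i j) (fun j => R 5 0 j)
      (fun j => R 9 0 j)
    let A := unitDiagGram w y
    let V := A ^ (2 ^ n)
    let T := ∑ i, ∑ j, V i j ^ 2
    let R' := spectral.sem n d R
    R' 17 0 0 = (∑ i, ∑ j, (V * A) i j * V i j) / T - 1 ∧
      (∀ i : Fin n, R' 16 i 0 = ∑ k, (∑ j, V k j * y i j) ^ 2 / T) ∧
      R' 18 0 0 = ∑ i, (1 - w i) := by
  intro w y A V T R'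
  set R₁ := (residuals 9).sem n d R with hR₁
  set R₂ := gram.sem n d R₁ with hR₂
  set R₃ := power.sem n d R₂ with hR₃
  have hR' : R' = scores.sem n d R₃ := rfl
  have f₁ : ∀ c : Fin 32, c ∉ (residuals 9).writes → R₁ c = R c := fun c hc =>
    sem_of_notMem_writes hc
  have f₂ : ∀ c : Fin 32, c ∉ gram.writes → R₂ c = R₁ c := fun c hc => sem_of_notMem_writes hc
  have f₃ : ∀ c : Fin 32, c ∉ power.writes → R₃ c = R₂ c := fun c hc => sem_of_notMem_writes hc
  have ey : ∀ (i : Fin n) (j : Fin d), R₁ 11 i j = y i j := fun i j => residuals_apply i j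
  have ew : ∀ i : Fin n, R₁ 8 i 0 = w i := fun i => by rw [f₁ 8 (by decide)]
  have eA : ∀ j k : Fin d, R₂ 13 j k = A j k := fun j k => by
    rw [hR₂, gram_apply]
    simp only [ey, ew, A]
  have eV : ∀ j k : Fin d, R₃ 12 j k = V j k := fun j k => by
    rw [hR₃, power_apply]
    have : (Matrix.of fun j k : Fin d => R₂ 13 j k) = A := by ext j k; exact eA j k
    rw [this]
  have h := scores_apply (n := n) (d := d) (R := R₃)
  have hV : (Matrix.of fun j k : Fin d => R₃ 12 j k) = V := by ext j k; exact eV j k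
  have hA : (Matrix.of fun j k : Fin d => R₃ 13 j k) = A := by
    ext j k
    rw [Matrix.of_apply, f₃ 13 (by decide), eA]
  have h11 : ∀ (i : Fin n) (j : Fin d), R₃ 11 i j = y i j := fun i j => by
    rw [f₃ 11 (by decide), f₂ 11 (by decide), ey]
  have h8 : ∀ i : Fin n, R₃ 8 i 0 = w i := fun i => by
    rw [f₃ 8 (by decide), f₂ 8 (by decide), ew]
  simp only [hV, hA, h11, h8] at h
  exact h

/-! ### Filtering -/

/-- Twice the number of points that may be corrupted at the current scale. -/
def budget : Term := .mul (.mul (.lit 2) (.cell 6 .zero .zero)) (.size .points)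

/-- The certificate for the current centers. -/
def certified : Cond :=
  .and (.not (.lt (.div (.mul (.mul (.lit 5100) (.cell 7 .zero .zero)) (.cell 6 .zero .zero))
    (.mul (.cell 1 .zero .zero) (.cell 1 .zero .zero))) (.cell 17 .zero .zero)))
  (.not (.lt budget (.cell 18 .zero .zero)))

/-- The summation index belongs to a point of positive weight with one of the largest scores. -/
def topSum : Cond := .and (.not (.lt budget (.cell 29 .sum .zero))) (.lt (.lit 0) (.cell 8 .sum .zero))

/-- Output of certified centers and down-weighting. -/
def filter : ArrayProgram :=
  .seq (guard certified (assign 2 .unit .coords (.cell 9 .zero .col)))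
  (.seq (.tab 29 .points .unit .points (.not (.lt (.cell 16 .sum .zero) (.cell 16 .row .zero)))
    (.lit 1) (.lit 0))
  (.seq (.tab 30 .points .unit .points
    (.and topSum (.lt (.cell 16 .row .zero) (.cell 16 .sum .zero))) (.lit 1) (.lit 0))
  (.seq (.tab 27 .unit .unit .points
    (.and topSum (.not (.lt (.lit 0) (.cell 30 .sum .zero)))) (.cell 16 .sum .zero) (.lit 0))
  (.seq (.tab 28 .unit .unit .points
    (.and topSum (.not (.lt (.lit 0) (.cell 30 .sum .zero)))) (.lit 1) (.lit 0))
  (.seq (assign 31 .unit .unit (.div (.cell 27 .zero .zero) (.cell 28 .zero .zero)))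
  (assignIf 8 .points .unit (.not (.lt budget (.cell 29 .row .zero)))
    (.mul (.cell 8 .row .zero) (.sub (.lit 1) (.div (.cell 16 .row .zero) (.cell 31 .zero .zero))))
    (.cell 8 .row .zero)))))))

end ArrayProgram

open Classical in
/-- Average of `v` over the indices that satisfy `P`. -/
noncomputable def selectedAverage {n : ℕ} (P : Fin n → Prop) (v : Fin n → ℝ) : ℝ :=
  (∑ i, if P i then v i else 0) / ∑ i, if P i then (1 : ℝ) else 0

/-- Array assignments only form sums, so a maximum or a quantile is extracted as the average over
all indices attaining it; ties are harmless. -/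
theorem selectedAverage_eq {n : ℕ} {P : Fin n → Prop} {v : Fin n → ℝ} {t : ℝ} (h : ∃ i, P i)
    (ht : ∀ i, P i → v i = t) : selectedAverage P v = t := by
  classical
  have e : (∑ i, if P i then v i else 0) = (∑ i, if P i then (1 : ℝ) else 0) * t := by
    rw [Finset.sum_mul]
    refine Finset.sum_congr rfl fun i _ => ?_
    split_ifs with hi
    · rw [ht i hi, one_mul]
    · rw [zero_mul]
  obtain ⟨i, hi⟩ := h
  have hpos : 0 < ∑ i, if P i then (1 : ℝ) else 0 :=
    Finset.sum_pos' (fun i _ => by split_ifs <;> norm_num) ⟨i, Finset.mem_univ _, by simp [hi]⟩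
  rw [selectedAverage, e, mul_div_cancel_left₀ _ hpos.ne']

namespace ArrayProgram

variable {n d : ℕ} {R : Arrays}

open Classical in
theorem filter_apply :
    let w : Fin n → ℝ := fun i => R 8 i 0
    let τ : Fin n → ℝ := fun i => R 16 i 0
    let top : Fin n → Prop := fun i =>
      ((Finset.univ.filter fun k => τ i ≤ τ k).card : ℝ) ≤ 2 * R 6 0 0 * n
    let sel : Fin n → Prop := fun i => top i ∧ 0 < w i
    let t := selectedAverage (fun i => sel i ∧ ∀ k, sel k → τ k ≤ τ i) τ
    let R' := filter.sem n d R
    (∀ j : Fin d, R' 2 0 j = if R 17 0 0 ≤ 5100 * R 7 0 0 * R 6 0 0 / (R 1 0 0 * R 1 0 0) ∧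
        R 18 0 0 ≤ 2 * R 6 0 0 * n then R 9 0 j else R 2 0 j) ∧
      ∀ i : Fin n, R' 8 i 0 = if top i then w i * (1 - τ i / t) else w i := by
  intro w τ top sel t R'
  have h0 : 0 < Size.val n d .unit := Nat.one_pos
  set R₁ := (guard certified (assign 2 .unit .coords (.cell 9 .zero .col))).sem n d R with hR₁
  set R₂ := (tab 29 .points .unit .points (.not (.lt (.cell 16 .sum .zero) (.cell 16 .row .zero)))
    (.lit 1) (.lit 0)).sem n d R₁ with hR₂
  set R₃ := (tab 30 .points .unit .points
    (.and topSum (.lt (.cell 16 .row .zero) (.cell 16 .sum .zero))) (.lit 1) (.lit 0)).sem n d R₂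
    with hR₃
  set R₄ := (tab 27 .unit .unit .points
    (.and topSum (.not (.lt (.lit 0) (.cell 30 .sum .zero)))) (.cell 16 .sum .zero)
    (.lit 0)).sem n d R₃ with hR₄
  set R₅ := (tab 28 .unit .unit .points
    (.and topSum (.not (.lt (.lit 0) (.cell 30 .sum .zero)))) (.lit 1) (.lit 0)).sem n d R₄ with hR₅
  set R₆ := (assign 31 .unit .unit (.div (.cell 27 .zero .zero) (.cell 28 .zero .zero))).sem n d R₅
    with hR₆
  have hR' : R' = (assignIf 8 .points .unit (.not (.lt budget (.cell 29 .row .zero)))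
    (.mul (.cell 8 .row .zero) (.sub (.lit 1) (.div (.cell 16 .row .zero) (.cell 31 .zero .zero))))
    (.cell 8 .row .zero)).sem n d R₆ := rfl
  have fr : ∀ (a : Fin 32) (b₁ b₂ b₃ : Size) (t : Cond) (r₁ r₂ : Term) (S : Arrays) (c : Fin 32),
      c ≠ a → (tab a b₁ b₂ b₃ t r₁ r₂).sem n d S c = S c := fun a b₁ b₂ b₃ t r₁ r₂ S c hc =>
    sem_of_notMem_writes (by simpa [writes] using hc)
  have f₁ : ∀ c : Fin 32, c ≠ 2 → R₁ c = R c := fun c hc => sem_of_notMem_writes (by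
    simpa [assign, assignSum, writes] using hc)
  have f₂ : ∀ c : Fin 32, c ≠ 29 → R₂ c = R₁ c := fun c hc => fr _ _ _ _ _ _ _ _ _ hc
  have f₃ : ∀ c : Fin 32, c ≠ 30 → R₃ c = R₂ c := fun c hc => fr _ _ _ _ _ _ _ _ _ hc
  have f₄ : ∀ c : Fin 32, c ≠ 27 → R₄ c = R₃ c := fun c hc => fr _ _ _ _ _ _ _ _ _ hc
  have f₅ : ∀ c : Fin 32, c ≠ 28 → R₅ c = R₄ c := fun c hc => fr _ _ _ _ _ _ _ _ _ hc
  have f₆ : ∀ c : Fin 32, c ≠ 31 → R₆ c = R₅ c := fun c hc => fr _ _ _ _ _ _ _ _ _ hc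
  have f₇ : ∀ c : Fin 32, c ≠ 8 → R' c = R₆ c := fun c hc => fr _ _ _ _ _ _ _ _ _ hc
  -- Array `29` holds ranks: the number of points whose score is at least that of point `i`.
  have e29 : ∀ i : Fin n, R₂ 29 i 0 = ((Finset.univ.filter fun k => τ i ≤ τ k).card : ℝ) := by
    intro i
    rw [hR₂, tab_apply (b₁ := .points) (b₃ := .points) i.2 h0 (fun k : Fin n => τ i ≤ τ k) fun k => by
      simp only [Cond.Holds, Term.val, Index.val, f₁ 16 (by decide), not_lt]; rfl]
    simp only [Term.val, Nat.cast_one, Nat.cast_zero]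
    rw [Finset.card_filter, Nat.cast_sum]
    exact Finset.sum_congr rfl fun k _ => by split_ifs <;> simp
  have htop : ∀ (S : Arrays) (i : Fin n) (j k : ℕ), S 6 = R 6 → S 29 = R₂ 29 →
      (Cond.Holds n d S i j k (.not (.lt budget (.cell 29 .row .zero))) ↔ top i) := by
    intro S i j k h6 h29
    simp only [Cond.Holds, Term.val, Index.val, budget, h6, h29, e29, not_lt, Size.val]
    norm_num [top]
  have hsel : ∀ (S : Arrays) (i j : ℕ) (k : Fin n), S 6 = R 6 → S 29 = R₂ 29 → S 8 = R 8 →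
      (topSum.Holds n d S i j k ↔ sel k) := by
    intro S i j k h6 h29 h8
    simp only [topSum, Cond.Holds, Term.val, Index.val, budget, h6, h29, e29, not_lt, Size.val, h8]
    norm_num [top, sel, w]
  have g₂ : ∀ c : Fin 32, c ≠ 2 → c ≠ 29 → R₂ c = R c := fun c h1 h2 => by rw [f₂ c h2, f₁ c h1]
  -- Array `30` marks the points beaten by a selected point; the unmarked selected points attain the
  -- maximum.
  have e30 : ∀ i : Fin n, (0 < R₃ 30 i 0 ↔ ∃ k, sel k ∧ τ i < τ k) := by
    intro i
    rw [hR₃, tab_apply (b₁ := .points) (b₃ := .points) i.2 h0 (fun k : Fin n => sel k ∧ τ i < τ k) fun k => by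
      simp only [Cond.Holds]
      rw [hsel R₂ i 0 k (g₂ 6 (by decide) (by decide)) rfl (g₂ 8 (by decide) (by decide))]
      simp only [Term.val, Index.val, g₂ 16 (by decide) (by decide)]; rfl]
    simp only [Term.val, Nat.cast_one, Nat.cast_zero]
    constructor
    · intro h
      by_contra hcon
      push Not at hcon
      refine absurd h (not_lt.2 (Finset.sum_nonpos fun k _ => ?_))
      rw [if_neg fun h' => absurd h'.2 (not_lt.2 (hcon k h'.1))]
    · rintro ⟨k, hk⟩
      exact Finset.sum_pos' (fun i _ => by split_ifs <;> norm_num)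
        ⟨k, Finset.mem_univ _, by rw [if_pos hk]; norm_num⟩
  have hmax : ∀ (S : Arrays) (i j : ℕ) (k : Fin n), S 6 = R 6 → S 29 = R₂ 29 → S 8 = R 8 →
      S 30 = R₃ 30 → (Cond.Holds n d S i j k (.and topSum
        (.not (.lt (.lit 0) (.cell 30 .sum .zero)))) ↔ sel k ∧ ∀ l, sel l → τ l ≤ τ k) := by
    intro S i j k h6 h29 h8 h30
    simp only [Cond.Holds]
    rw [hsel S i j k h6 h29 h8]
    simp only [Term.val, Index.val, h30, Nat.cast_zero, e30]
    push Not
    rfl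
  have g₃ : ∀ c : Fin 32, c ≠ 2 → c ≠ 29 → c ≠ 30 → R₃ c = R c := fun c h1 h2 h3 => by
    rw [f₃ c h3, g₂ c h1 h2]
  have e27 : R₄ 27 0 0 = ∑ k, if sel k ∧ ∀ l, sel l → τ l ≤ τ k then τ k else 0 := by
    rw [hR₄, tab_apply (b₃ := .points) h0 h0 (fun k : Fin n => sel k ∧ ∀ l, sel l → τ l ≤ τ k) fun k =>
      hmax R₃ 0 0 k (g₃ 6 (by decide) (by decide) (by decide)) (f₃ 29 (by decide))
        (g₃ 8 (by decide) (by decide) (by decide)) rfl]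
    simp only [Term.val, Index.val, g₃ 16 (by decide) (by decide) (by decide), Nat.cast_zero]
    rfl
  have g₄ : ∀ c : Fin 32, c ≠ 2 → c ≠ 29 → c ≠ 30 → c ≠ 27 → R₄ c = R c := fun c h1 h2 h3 h4 => by
    rw [f₄ c h4, g₃ c h1 h2 h3]
  have e28 : R₅ 28 0 0 = ∑ k, if sel k ∧ ∀ l, sel l → τ l ≤ τ k then (1 : ℝ) else 0 := by
    rw [hR₅, tab_apply (b₃ := .points) h0 h0 (fun k : Fin n => sel k ∧ ∀ l, sel l → τ l ≤ τ k) fun k =>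
      hmax R₄ 0 0 k (g₄ 6 (by decide) (by decide) (by decide) (by decide))
        ((f₄ 29 (by decide)).trans (f₃ 29 (by decide)))
        (g₄ 8 (by decide) (by decide) (by decide) (by decide)) (f₄ 30 (by decide))]
    simp only [Term.val, Nat.cast_zero, Nat.cast_one]
    rfl
  have e31 : R₆ 31 0 0 = t := by
    rw [hR₆, assign_apply h0 h0]
    simp only [Term.val, Index.val, e28, f₅ 27 (by decide), e27, t, selectedAverage]
    congr!
  have g₆ : ∀ c : Fin 32, c ≠ 2 → c ≠ 29 → c ≠ 30 → c ≠ 27 → c ≠ 28 → c ≠ 31 → R₆ c = R c :=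
    fun c h1 h2 h3 h4 h5 h6 => by rw [f₆ c h6, f₅ c h5, g₄ c h1 h2 h3 h4]
  refine ⟨fun j => ?_, fun i => ?_⟩
  · rw [f₇ 2 (by decide), f₆ 2 (by decide), f₅ 2 (by decide), f₄ 2 (by decide), f₃ 2 (by decide),
      f₂ 2 (by decide), hR₁]
    simp only [sem]
    have hc : certified.Holds n d R 0 0 0 ↔
        (R 17 0 0 ≤ 5100 * R 7 0 0 * R 6 0 0 / (R 1 0 0 * R 1 0 0) ∧
          R 18 0 0 ≤ 2 * R 6 0 0 * n) := by
      simp only [certified, Cond.Holds, Term.val, Index.val, budget, not_lt, Size.val]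
      norm_num
    by_cases h : certified.Holds n d R 0 0 0
    · rw [if_pos h, if_pos (hc.1 h), assign_apply h0 (b₂ := .coords) j.2]
      rfl
    · rw [if_neg h, if_neg fun h' => h (hc.2 h')]
  · rw [hR', assignIf_apply (b₁ := .points) i.2 h0 (top i) (htop R₆ i 0 0
      (g₆ 6 (by decide) (by decide) (by decide) (by decide) (by decide) (by decide))
      (by rw [f₆ 29 (by decide), f₅ 29 (by decide), f₄ 29 (by decide), f₃ 29 (by decide)]))]
    simp only [Term.val, Index.val, e31, Nat.cast_one,
      g₆ 8 (by decide) (by decide) (by decide) (by decide) (by decide) (by decide),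
      g₆ 16 (by decide) (by decide) (by decide) (by decide) (by decide) (by decide)]
    rfl

end ArrayProgram

/-! ### Empirical quantiles -/

open Classical in
/-- The number `q` is an empirical quantile of `v` at the level `θ`. -/
def IsQuantile {n : ℕ} (θ : ℝ) (v : Fin n → ℝ) (q : ℝ) : Prop :=
  ((Finset.univ.filter fun i => v i < q).card : ℝ) < θ ∧
    θ ≤ ((Finset.univ.filter fun i => v i ≤ q).card : ℝ)

/-- Take the smallest sample value with at least `θ` points at or below it. If `θ` points lay
strictly below, the largest of those would qualify as well. -/
theorem exists_isQuantile {n : ℕ} {θ : ℝ} (hθ : 0 < θ) (hθn : θ ≤ n) (v : Fin n → ℝ) :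
    ∃ i, IsQuantile θ v (v i) := by
  classical
  have hn : 0 < n := by
    rcases Nat.eq_zero_or_pos n with rfl | h
    · norm_num at hθn; linarith
    · exact h
  have : Nonempty (Fin n) := ⟨⟨0, hn⟩⟩
  set Q := Finset.univ.filter fun i => θ ≤ ((Finset.univ.filter fun k => v k ≤ v i).card : ℝ)
    with hQ
  have hne : Q.Nonempty := by
    obtain ⟨m, -, hm⟩ := Finset.exists_max_image Finset.univ v Finset.univ_nonempty
    refine ⟨m, Finset.mem_filter.2 ⟨Finset.mem_univ _, ?_⟩⟩
    rw [Finset.filter_true_of_mem fun k _ => hm k (Finset.mem_univ _)]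
    simpa using hθn
  obtain ⟨i, hi, hmin⟩ := Finset.exists_min_image Q v hne
  refine ⟨i, ?_, (Finset.mem_filter.1 hi).2⟩
  by_contra hcon
  rw [not_lt] at hcon
  have hne' : (Finset.univ.filter fun k => v k < v i).Nonempty := by
    rw [← Finset.card_pos]
    exact_mod_cast hθ.trans_le hcon
  obtain ⟨l, hl, hmax⟩ := Finset.exists_max_image _ v hne'
  have hlQ : l ∈ Q := by
    refine Finset.mem_filter.2 ⟨Finset.mem_univ _, hcon.trans ?_⟩
    exact_mod_cast Finset.card_le_card fun k hk =>
      Finset.mem_filter.2 ⟨Finset.mem_univ _, hmax k hk⟩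
  exact absurd (hmin l hlQ) (not_le.2 (Finset.mem_filter.1 hl).2)

theorem IsQuantile.unique {n : ℕ} {θ : ℝ} {v : Fin n → ℝ} {i k : Fin n}
    (hi : IsQuantile θ v (v i)) (hk : IsQuantile θ v (v k)) : v i = v k := by
  classical
  by_contra hne
  wlog h : v i < v k generalizing i k
  · exact this hk hi (Ne.symm hne) (lt_of_le_of_ne (not_lt.1 h) (Ne.symm hne))
  have h1 : (Finset.univ.filter fun l => v l ≤ v i).card
      ≤ (Finset.univ.filter fun l => v l < v k).card :=
    Finset.card_le_card fun l hl => Finset.mem_filter.2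
      ⟨Finset.mem_univ _, (Finset.mem_filter.1 hl).2.trans_lt h⟩
  have h2 : ((Finset.univ.filter fun l => v l ≤ v i).card : ℝ)
      ≤ (Finset.univ.filter fun l => v l < v k).card := by exact_mod_cast h1
  linarith [hi.2, hk.1]

theorem isQuantile_selectedAverage {n : ℕ} {θ : ℝ} (hθ : 0 < θ) (hθn : θ ≤ n) (v : Fin n → ℝ) :
    IsQuantile θ v (selectedAverage (fun i => IsQuantile θ v (v i)) v) := by
  obtain ⟨i, hi⟩ := exists_isQuantile hθ hθn v
  rw [selectedAverage_eq ⟨i, hi⟩ fun k hk => hk.unique hi]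
  exact hi

namespace ArrayProgram

variable {n d : ℕ} {R : Arrays}

/-- Coordinatewise empirical quantiles of the data at the level `θ`, in row `0` of the array `a`. -/
def quantile (a : Fin 32) (θ : Term) : ArrayProgram :=
  .seq (.tab 19 .points .coords .points (.lt (.cell 0 .sum .col) (.cell 0 .row .col))
    (.lit 1) (.lit 0))
  (.seq (.tab 20 .points .coords .points (.not (.lt (.cell 0 .row .col) (.cell 0 .sum .col)))
    (.lit 1) (.lit 0))
  (.seq (.tab 21 .unit .coords .points (.and (.lt (.cell 19 .sum .col) θ)
    (.not (.lt (.cell 20 .sum .col) θ))) (.cell 0 .sum .col) (.lit 0))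
  (.seq (.tab 22 .unit .coords .points (.and (.lt (.cell 19 .sum .col) θ)
    (.not (.lt (.cell 20 .sum .col) θ))) (.lit 1) (.lit 0))
  (assign a .unit .coords (.div (.cell 21 .zero .col) (.cell 22 .zero .col))))))

theorem quantile_apply {a : Fin 32} {θ : Term} {x : ℝ}
    (hθ : ∀ (S : Arrays) (i j k : ℕ), S 1 = R 1 → θ.val n d S i j k = x) (j : Fin d) :
    (quantile a θ).sem n d R a 0 j =
      selectedAverage (fun i : Fin n => IsQuantile x (fun i : Fin n => R 0 i j) (R 0 i j))
        (fun i : Fin n => R 0 i j) := by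
  classical
  have h0 : 0 < Size.val n d .unit := Nat.one_pos
  have hj : (j : ℕ) < Size.val n d .coords := j.2
  set R₁ := (tab 19 .points .coords .points (.lt (.cell 0 .sum .col) (.cell 0 .row .col))
    (.lit 1) (.lit 0)).sem n d R with hR₁
  set R₂ := (tab 20 .points .coords .points (.not (.lt (.cell 0 .row .col) (.cell 0 .sum .col)))
    (.lit 1) (.lit 0)).sem n d R₁ with hR₂
  set R₃ := (tab 21 .unit .coords .points (.and (.lt (.cell 19 .sum .col) θ)
    (.not (.lt (.cell 20 .sum .col) θ))) (.cell 0 .sum .col) (.lit 0)).sem n d R₂ with hR₃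
  set R₄ := (tab 22 .unit .coords .points (.and (.lt (.cell 19 .sum .col) θ)
    (.not (.lt (.cell 20 .sum .col) θ))) (.lit 1) (.lit 0)).sem n d R₃ with hR₄
  have fr : ∀ (a : Fin 32) (b₁ b₂ b₃ : Size) (t : Cond) (r₁ r₂ : Term) (S : Arrays) (c : Fin 32),
      c ≠ a → (tab a b₁ b₂ b₃ t r₁ r₂).sem n d S c = S c := fun a b₁ b₂ b₃ t r₁ r₂ S c hc =>
    sem_of_notMem_writes (by simpa [writes] using hc)
  have f₁ : ∀ c : Fin 32, c ≠ 19 → R₁ c = R c := fun c hc => fr _ _ _ _ _ _ _ _ _ hc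
  have f₂ : ∀ c : Fin 32, c ≠ 20 → R₂ c = R₁ c := fun c hc => fr _ _ _ _ _ _ _ _ _ hc
  have f₃ : ∀ c : Fin 32, c ≠ 21 → R₃ c = R₂ c := fun c hc => fr _ _ _ _ _ _ _ _ _ hc
  have f₄ : ∀ c : Fin 32, c ≠ 22 → R₄ c = R₃ c := fun c hc => fr _ _ _ _ _ _ _ _ _ hc
  have e19 : ∀ i : Fin n, R₁ 19 i j
      = ((Finset.univ.filter fun k : Fin n => R 0 k j < R 0 i j).card : ℝ) := by
    intro i
    rw [hR₁, tab_apply (b₁ := .points) (b₃ := .points) i.2 hj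
      (fun k : Fin n => R 0 k j < R 0 i j) fun k => Iff.rfl]
    simp only [Term.val, Nat.cast_one, Nat.cast_zero]
    rw [Finset.card_filter, Nat.cast_sum]
    exact Finset.sum_congr rfl fun k _ => by split_ifs <;> simp
  have e20 : ∀ i : Fin n, R₂ 20 i j
      = ((Finset.univ.filter fun k : Fin n => R 0 k j ≤ R 0 i j).card : ℝ) := by
    intro i
    rw [hR₂, tab_apply (b₁ := .points) (b₃ := .points) i.2 hj
      (fun k : Fin n => R 0 k j ≤ R 0 i j) fun k => by
        simp only [Cond.Holds, Term.val, Index.val, f₁ 0 (by decide), not_lt]]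
    simp only [Term.val, Nat.cast_one, Nat.cast_zero]
    rw [Finset.card_filter, Nat.cast_sum]
    exact Finset.sum_congr rfl fun k _ => by split_ifs <;> simp
  have hsel : ∀ (S : Arrays) (i : ℕ) (k : Fin n), S 1 = R 1 → S 19 = R₁ 19 → S 20 = R₂ 20 →
      (Cond.Holds n d S i j k (.and (.lt (.cell 19 .sum .col) θ)
        (.not (.lt (.cell 20 .sum .col) θ))) ↔ IsQuantile x (fun i : Fin n => R 0 i j) (R 0 k j)) := by
    intro S i k h1 h19 h20
    simp only [Cond.Holds, hθ S _ _ _ h1]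
    simp only [Term.val, Index.val, h19, h20, e19, e20, not_lt]
    unfold IsQuantile
    congr!
  have e21 : R₃ 21 0 j = ∑ k : Fin n, if IsQuantile x (fun i : Fin n => R 0 i j) (R 0 k j)
      then R 0 k j else 0 := by
    rw [hR₃, tab_apply (b₃ := .points) h0 hj
      (fun k : Fin n => IsQuantile x (fun i : Fin n => R 0 i j) (R 0 k j)) fun k =>
      hsel R₂ 0 k ((f₂ 1 (by decide)).trans (f₁ 1 (by decide))) (f₂ 19 (by decide)) rfl]
    simp only [Term.val, Index.val, f₂ 0 (by decide), f₁ 0 (by decide), Nat.cast_zero]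
    rfl
  have e22 : R₄ 22 0 j = ∑ k : Fin n, if IsQuantile x (fun i : Fin n => R 0 i j) (R 0 k j)
      then (1 : ℝ) else 0 := by
    rw [hR₄, tab_apply (b₃ := .points) h0 hj
      (fun k : Fin n => IsQuantile x (fun i : Fin n => R 0 i j) (R 0 k j)) fun k =>
      hsel R₃ 0 k ((f₃ 1 (by decide)).trans ((f₂ 1 (by decide)).trans (f₁ 1 (by decide))))
        ((f₃ 19 (by decide)).trans (f₂ 19 (by decide))) (f₃ 20 (by decide))]
    simp only [Term.val, Nat.cast_zero, Nat.cast_one]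
    rfl
  change (assign a .unit .coords
    (.div (.cell 21 .zero .col) (.cell 22 .zero .col))).sem n d R₄ a 0 j = _
  rw [assign_apply h0 hj]
  simp only [Term.val, Index.val, e22, f₄ 21 (by decide), e21, selectedAverage]

/-! ### The estimator -/

/-- Centers, scores and one filtering step. -/
def iteration : ArrayProgram := .seq bisect (.seq spectral filter)

/-- All filtering steps for the next smaller guess of the corruption level. -/
def stage : ArrayProgram :=
  .seq (assign 6 .unit .unit (.div (.cell 6 .zero .zero) (.lit 2)))
  (.seq (assign 7 .unit .unit (.add (.cell 7 .zero .zero) (.lit 1)))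
  (.seq (assign 8 .points .unit (.lit 1))
  -- These are `n + 1` iterations, one more than the number of weights that can be driven to zero.
  (.seq (.rep .points iteration) iteration)))

/-- Lower and upper quantiles, their distance, and the initial scale. -/
def prepare : ArrayProgram :=
  .seq (quantile 3 (.mul (.sub (.div (.lit 1) (.lit 2)) (.div (.cell 1 .zero .zero) (.lit 4)))
    (.size .points)))
  (.seq (quantile 4 (.mul (.add (.div (.lit 1) (.lit 2)) (.div (.cell 1 .zero .zero) (.lit 4)))
    (.size .points)))
  (.seq (assign 5 .unit .coords (.sub (.cell 4 .zero .col) (.cell 3 .zero .col)))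
  (.seq (assign 6 .unit .unit (.lit 1)) (assign 7 .unit .unit (.lit 0)))))

/-- The whole estimator. -/
def estimator : ArrayProgram := .seq prepare (.rep .points stage)

theorem prepare_apply (h1 : 0 < R 1 0 0) (h2 : R 1 0 0 ≤ 1) (hn : 1 ≤ n) :
    let R' := prepare.sem n d R
    (∀ j : Fin d, IsQuantile ((1 / 2 - R 1 0 0 / 4) * n) (fun i : Fin n => R 0 i j) (R' 3 0 j) ∧
      IsQuantile ((1 / 2 + R 1 0 0 / 4) * n) (fun i : Fin n => R 0 i j) (R' 4 0 j) ∧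
      R' 5 0 j = R' 4 0 j - R' 3 0 j) ∧
      R' 6 0 0 = 1 ∧ R' 7 0 0 = 0 ∧ R' 0 = R 0 ∧ R' 1 = R 1 := by
  intro R'
  have h0 : 0 < Size.val n d .unit := Nat.one_pos
  have hn' : (0 : ℝ) < n := by exact_mod_cast hn
  set R₁ := (quantile 3 (.mul (.sub (.div (.lit 1) (.lit 2)) (.div (.cell 1 .zero .zero) (.lit 4)))
    (.size .points))).sem n d R with hR₁
  set R₂ := (quantile 4 (.mul (.add (.div (.lit 1) (.lit 2)) (.div (.cell 1 .zero .zero) (.lit 4)))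
    (.size .points))).sem n d R₁ with hR₂
  set R₃ := (assign 5 .unit .coords (.sub (.cell 4 .zero .col) (.cell 3 .zero .col))).sem n d R₂
    with hR₃
  set R₄ := (assign 6 .unit .unit (.lit 1)).sem n d R₃ with hR₄
  have hR' : R' = (assign 7 .unit .unit (.lit 0)).sem n d R₄ := rfl
  have f₁ : ∀ c : Fin 32, c ∉ [19, 20, 21, 22, 3] → R₁ c = R c := fun c hc => sem_of_notMem_writes hc
  have f₂ : ∀ c : Fin 32, c ∉ [19, 20, 21, 22, 4] → R₂ c = R₁ c := fun c hc =>
    sem_of_notMem_writes hc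
  have f₃ : ∀ c : Fin 32, c ∉ [5] → R₃ c = R₂ c := fun c hc => sem_of_notMem_writes hc
  have f₄ : ∀ c : Fin 32, c ∉ [6] → R₄ c = R₃ c := fun c hc => sem_of_notMem_writes hc
  have f₅ : ∀ c : Fin 32, c ∉ [7] → R' c = R₄ c := fun c hc => by
    rw [hR']; exact sem_of_notMem_writes hc
  have e3 : R' 3 = R₁ 3 := by
    rw [f₅ 3 (by decide), f₄ 3 (by decide), f₃ 3 (by decide), f₂ 3 (by decide)]
  have e4 : R' 4 = R₂ 4 := by rw [f₅ 4 (by decide), f₄ 4 (by decide), f₃ 4 (by decide)]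
  refine ⟨fun j => ⟨?_, ?_, ?_⟩, ?_, ?_, ?_, ?_⟩
  · rw [e3, hR₁, quantile_apply (x := (1 / 2 - R 1 0 0 / 4) * n) fun S i j k hS => by
      simp [Term.val, Index.val, hS, Size.val]]
    exact isQuantile_selectedAverage (by nlinarith) (by nlinarith) _
  · rw [e4, hR₂, quantile_apply (x := (1 / 2 + R 1 0 0 / 4) * n) fun S i j k hS => by
      simp [Term.val, Index.val, hS, Size.val, f₁ 1 (by decide)], f₁ 0 (by decide)]
    exact isQuantile_selectedAverage (by nlinarith) (by nlinarith) _
  · rw [e3, e4, f₅ 5 (by decide), f₄ 5 (by decide), hR₃, assign_apply h0 (b₂ := .coords) j.2]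
    simp only [Term.val, Index.val, f₂ 3 (by decide)]
  · rw [f₅ 6 (by decide), hR₄, assign_apply h0 h0]
    simp [Term.val]
  · rw [hR', assign_apply h0 h0]
    simp [Term.val]
  · rw [f₅ 0 (by decide), f₄ 0 (by decide), f₃ 0 (by decide), f₂ 0 (by decide), f₁ 0 (by decide)]
  · rw [f₅ 1 (by decide), f₄ 1 (by decide), f₃ 1 (by decide), f₂ 1 (by decide), f₁ 1 (by decide)]

end ArrayProgram

/-! ### Quadratic forms of the Gram matrix -/

namespace ArrayProgram

variable {n d : ℕ}

theorem sum_sum_ne_eq_rowForm (v y : Fin d → ℝ) :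
    ∑ j, ∑ k, (if j = k then 0 else v j * (y j * y k) * v k) = rowForm v y := by
  have h1 : (∑ j, v j * y j) ^ 2 = ∑ j, ∑ k, v j * (y j * y k) * v k := by
    rw [sq, Finset.sum_mul_sum]
    exact Finset.sum_congr rfl fun j _ => Finset.sum_congr rfl fun k _ => by ring
  have h2 : ∑ j, (v j * y j) ^ 2 = ∑ j, ∑ k, (if j = k then v j * (y j * y k) * v k else 0) := by
    refine Finset.sum_congr rfl fun j _ => ?_
    rw [Finset.sum_ite_eq]
    simp only [Finset.mem_univ, if_true]
    ring
  rw [rowForm, h1, h2, ← Finset.sum_sub_distrib]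
  refine Finset.sum_congr rfl fun j _ => ?_
  rw [← Finset.sum_sub_distrib]
  refine Finset.sum_congr rfl fun k _ => ?_
  split_ifs <;> ring

/-- The unit diagonal contributes `∑ v_j²`, so the matrix is the off-diagonal second-moment matrix
shifted by the identity. -/
theorem unitDiagGram_quadForm (w : Fin n → ℝ) (y : Fin n → Fin d → ℝ) (v : Fin d → ℝ) :
    ∑ j, ∑ k, v j * unitDiagGram w y j k * v k
      = ∑ j, v j ^ 2 + (∑ i, w i * rowForm v (y i)) / n := by
  have h1 : ∀ j k, v j * unitDiagGram w y j k * v k = (if j = k then v j * v k else 0)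
      + ∑ i, w i / n * (if j = k then 0 else v j * (y i j * y i k) * v k) := by
    intro j k
    simp only [unitDiagGram, Matrix.of_apply]
    split_ifs with h
    · simp
    · rw [zero_add, Finset.mul_sum, Finset.sum_mul]
      exact Finset.sum_congr rfl fun i _ => by ring
  simp only [h1, Finset.sum_add_distrib]
  congr 1
  · refine Finset.sum_congr rfl fun j _ => ?_
    rw [Finset.sum_ite_eq]
    simp [sq]
  · rw [Finset.sum_div]
    calc _ = ∑ j, ∑ i, ∑ k, w i / n * (if j = k then 0 else v j * (y i j * y i k) * v k) :=
          Finset.sum_congr rfl fun j _ => Finset.sum_comm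
      _ = ∑ i, ∑ j, ∑ k, w i / n * (if j = k then 0 else v j * (y i j * y i k) * v k) :=
          Finset.sum_comm
      _ = _ := by
          refine Finset.sum_congr rfl fun i _ => ?_
          simp only [← Finset.mul_sum]
          rw [sum_sum_ne_eq_rowForm]
          ring

theorem dotProduct_mulVec_eq_sum (A : Matrix (Fin d) (Fin d) ℝ) (v : Fin d → ℝ) :
    v ⬝ᵥ A.mulVec v = ∑ j, ∑ k, v j * A j k * v k := by
  simp only [dotProduct, Matrix.mulVec, Finset.mul_sum, mul_assoc]

/-- The off-diagonal form is a square minus the diagonal part. Clipped entries and weights at most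
`1` bound that part by `∑ v_j²` on average, which is exactly what the unit diagonal restores. -/
theorem unitDiagGram_posSemidef {w : Fin n → ℝ} (hn : 1 ≤ n) (hw : ∀ i, w i ∈ Set.Icc (0 : ℝ) 1)
    {y : Fin n → Fin d → ℝ} (hy : ∀ i j, |y i j| ≤ 1) : (unitDiagGram w y).PosSemidef := by
  have hn0 : (0 : ℝ) < n := by exact_mod_cast hn
  refine Matrix.PosSemidef.of_dotProduct_mulVec_nonneg ?_ fun v => ?_
  · ext j k
    simp only [Matrix.conjTranspose_apply, unitDiagGram, Matrix.of_apply, star_trivial]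
    by_cases h : j = k
    · rw [if_pos h, if_pos h.symm]
    · rw [if_neg h, if_neg (Ne.symm h)]
      exact Finset.sum_congr rfl fun i _ => by ring
  · rw [star_trivial, dotProduct_mulVec_eq_sum, unitDiagGram_quadForm]
    have h1 : ∀ i, -∑ j, v j ^ 2 ≤ w i * rowForm v (y i) := by
      intro i
      have h2 : ∑ j, (v j * y i j) ^ 2 ≤ ∑ j, v j ^ 2 := Snapshot.sum_mul_sq_le (hy i)
      have h3 : 0 ≤ (∑ j, v j * y i j) ^ 2 := sq_nonneg _
      have h4 : 0 ≤ ∑ j, v j ^ 2 := Finset.sum_nonneg fun _ _ => sq_nonneg _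
      have h5 : -∑ j, v j ^ 2 ≤ rowForm v (y i) := by unfold rowForm; linarith
      nlinarith [(hw i).1, (hw i).2]
    have h2 : -(n * ∑ j, v j ^ 2) ≤ ∑ i, w i * rowForm v (y i) := by
      calc -(n * ∑ j, v j ^ 2) = ∑ _i : Fin n, -∑ j, v j ^ 2 := by simp
        _ ≤ _ := Finset.sum_le_sum fun i _ => h1 i
    have h3 : -∑ j, v j ^ 2 ≤ (∑ i, w i * rowForm v (y i)) / n := by
      rw [le_div_iff₀ hn0]
      linarith
    linarith

/-- The outcome of the power method, in terms of a normalized matrix `U`. -/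
theorem exists_spectral_data {w : Fin n → ℝ} (hn : 1 ≤ n) (hd : 1 ≤ d)
    (hw : ∀ i, w i ∈ Set.Icc (0 : ℝ) 1) {y : Fin n → Fin d → ℝ} (hy : ∀ i j, |y i j| ≤ 1) {ε : ℝ}
    (hε : 0 < ε) (hnd : (d : ℝ) ^ 3 ≤ ε ^ 2 * 2 ^ n) {lam : ℝ} {τ : Fin n → ℝ}
    (hlam : lam = (∑ i, ∑ j, (unitDiagGram w y ^ (2 ^ n) * unitDiagGram w y) i j
      * (unitDiagGram w y ^ (2 ^ n)) i j) / (∑ i, ∑ j, (unitDiagGram w y ^ (2 ^ n)) i j ^ 2) - 1)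
    (hτ : ∀ i, τ i = ∑ k, (∑ j, (unitDiagGram w y ^ (2 ^ n)) k j * y i j) ^ 2
      / (∑ i, ∑ j, (unitDiagGram w y ^ (2 ^ n)) i j ^ 2)) :
    ∃ U : Fin d → Fin d → ℝ, ∑ k, ∑ j, U k j ^ 2 = 1 ∧
      (∀ i, τ i = ∑ k, (∑ j, U k j * y i j) ^ 2) ∧
      n * lam = ∑ i, w i * ∑ k, rowForm (U k) (y i) ∧
      ∀ v : Fin d → ℝ, ∑ i, w i * rowForm v (y i) ≤ n * (lam + ε) * ∑ j, v j ^ 2 := by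
  have hn0 : (0 : ℝ) < n := by exact_mod_cast hn
  set A := unitDiagGram w y with hA
  set V := A ^ (2 ^ n) with hV
  set T := ∑ i, ∑ j, V i j ^ 2 with hT
  have htr : A.trace = Fintype.card (Fin d) := by
    simp [hA, Matrix.trace, unitDiagGram]
  obtain ⟨hTpos, hquad⟩ := (unitDiagGram_posSemidef hn hw hy).dotProduct_mulVec_le_of_pow hε
    (m := 2 ^ n) htr (by simpa using hd) (by simpa using hnd)
  change 0 < T at hTpos
  set s := Real.sqrt T with hs
  have hs2 : s ^ 2 = T := Real.sq_sqrt hTpos.le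
  have hs0 : 0 < s := Real.sqrt_pos.2 hTpos
  have hform : ∀ k i, rowForm (fun j => s⁻¹ * V k j) (y i) = rowForm (V k) (y i) / T := by
    intro k i
    rw [rowForm_smul, inv_pow, hs2]
    ring
  -- `U` is the matrix power divided by its Frobenius norm, so its rows act as a unit family of test
  -- directions.
  refine ⟨fun k j => s⁻¹ * V k j, ?_, fun i => ?_, ?_, fun v => ?_⟩
  · simp only [mul_pow, ← Finset.mul_sum]
    rw [inv_pow, hs2, ← hT, inv_mul_cancel₀ hTpos.ne']
  · rw [hτ i]
    refine Finset.sum_congr rfl fun k _ => ?_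
    simp only [mul_assoc, ← Finset.mul_sum]
    rw [mul_pow, inv_pow, hs2]
    ring
  · have h1 : ∑ i, ∑ j, (V * A) i j * V i j = T + (∑ k, ∑ i, w i * rowForm (V k) (y i)) / n := by
      have : ∀ k, ∑ j, (V * A) k j * V k j = ∑ j, V k j ^ 2 + (∑ i, w i * rowForm (V k) (y i)) / n := by
        intro k
        rw [← unitDiagGram_quadForm, ← hA, Finset.sum_comm]
        refine Finset.sum_congr rfl fun j _ => ?_
        rw [Matrix.mul_apply, Finset.sum_mul]
      simp only [this, Finset.sum_add_distrib, Finset.sum_div]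
      rw [hT]
    rw [hlam, h1]
    simp only [hform]
    have h2 : ∑ i, w i * ∑ k, rowForm (V k) (y i) / T
        = (∑ k, ∑ i, w i * rowForm (V k) (y i)) / T := by
      rw [Finset.sum_comm, Finset.sum_div]
      refine Finset.sum_congr rfl fun i _ => ?_
      rw [← Finset.sum_div, ← Finset.mul_sum]
      ring
    rw [h2]
    field_simp
    ring
  · have h := hquad v
    rw [dotProduct_mulVec_eq_sum, unitDiagGram_quadForm] at h
    have hvv : v ⬝ᵥ v = ∑ j, v j ^ 2 := Finset.sum_congr rfl fun j _ => (sq _).symm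
    change _ ≤ ((∑ i, ∑ j, (V * A) i j * V i j) / T + ε) * _ at h
    rw [hvv, show (∑ i, ∑ j, (V * A) i j * V i j) / T = lam + 1 by rw [hlam]; ring] at h
    have h2 : (∑ i, w i * rowForm v (y i)) / n ≤ (lam + ε) * ∑ j, v j ^ 2 := by linarith
    rw [div_le_iff₀ hn0] at h2
    linarith

end ArrayProgram

/-! ### Quantiles of corrupted samples -/

/-- A corrupted sample: `η` is the noise of the clean sample, whose points with index in `G` are
uncorrupted, and `z` is the corrupted sample. -/
structure CorruptedSample {n d : ℕ} (α ρ ε l : ℝ) (η z : Fin n → Fin d → ℝ) (μ : Fin d → ℝ)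
    (G : Finset (Fin n)) : Prop where
  n_pos : 1 ≤ n
  d_pos : 1 ≤ d
  α_pos : 0 < α
  α_le : α ≤ 1
  ρ_pos : 0 < ρ
  ε_pos : 0 < ε
  l_ge : 1 ≤ l
  small : ε * l ≤ α ^ 2 / 10 ^ 6
  bounds : NoiseBounds η (n ^ 2 * (ε ^ 2 * l)) (8 * l) (n * (ε * l))
  good : ∀ i ∈ G, ∀ j, z i j = μ j + η i j
  bad : (Gᶜ.card : ℝ) ≤ ε * n
  count : ∀ j, 15 / 16 * α * n ≤ ((Finset.univ.filter fun i => |η i j| ≤ ρ).card : ℝ)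

/-- In a finite sample a strict threshold can be replaced by a weak one, the form in which the sign
bounds of `NoiseBounds` are stated. -/
theorem exists_threshold {n : ℕ} (a : Fin n → ℝ) (ρ : ℝ) : ∃ θ, ∀ i, θ ≤ a i ↔ ρ < a i := by
  classical
  rcases (Finset.univ.filter fun i => ρ < a i).eq_empty_or_nonempty with h | h
  · obtain ⟨b, hb⟩ := (Set.finite_range a).bddAbove
    refine ⟨b + 1, fun i => ⟨fun hi => ?_, fun hi => ?_⟩⟩
    · linarith [hb ⟨i, rfl⟩]
    · exact absurd (Finset.mem_filter.2 ⟨Finset.mem_univ i, hi⟩) (by rw [h]; simp)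
  · obtain ⟨i₀, hi₀, hmin⟩ := Finset.exists_min_image _ a h
    exact ⟨a i₀, fun i => ⟨fun hi => (Finset.mem_filter.1 hi₀).2.trans_le hi, fun hi =>
      hmin i (Finset.mem_filter.2 ⟨Finset.mem_univ i, hi⟩)⟩⟩

namespace CorruptedSample

variable {n d : ℕ} {α ρ ε l : ℝ} {η z : Fin n → Fin d → ℝ} {μ : Fin d → ℝ} {G : Finset (Fin n)}
  (S : CorruptedSample α ρ ε l η z μ G)
include S

theorem n_pos' : (0 : ℝ) < n := by exact_mod_cast S.n_pos

theorem eps_le : ε ≤ α / 10 ^ 6 := by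
  refine (le_mul_of_one_le_right S.ε_pos.le S.l_ge).trans (S.small.trans ?_)
  gcongr
  nlinarith [S.α_pos, S.α_le]

/-- A sum of signs above a threshold is the difference of the two one-sided counts, so
`NoiseBounds.signs` says that large noise is nearly balanced between the sides. -/
theorem two_mul_card_le (j : Fin d) (P Q : Fin n → Prop) [DecidablePred P] [DecidablePred Q]
    (θ : ℝ) (hP : ∀ i, P i ↔ θ ≤ |η i j| ∧ 0 < η i j) (hQ : ∀ i, Q i ↔ θ ≤ |η i j| ∧ η i j < 0) :
    |((Finset.univ.filter P).card : ℝ) - (Finset.univ.filter Q).card| ≤ n * (ε * l) := by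
  have h := S.bounds.signs j θ
  have e : (∑ i, if θ ≤ |η i j| then Real.sign (η i j) else 0)
      = ((Finset.univ.filter P).card : ℝ) - (Finset.univ.filter Q).card := by
    rw [Finset.card_filter, Finset.card_filter, Nat.cast_sum, Nat.cast_sum,
      ← Finset.sum_sub_distrib]
    refine Finset.sum_congr rfl fun i _ => ?_
    simp only [hP, hQ]
    by_cases hθ : θ ≤ |η i j|
    · rcases lt_trichotomy (η i j) 0 with h | h | h
      · simp [hθ, h, h.not_gt, Real.sign_of_neg h]
      · simp [h, Real.sign_zero]
      · simp [hθ, h, h.not_gt, Real.sign_of_pos h]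
    · simp [hθ]
  rw [e] at h
  have hl := S.l_ge
  have hε := S.ε_pos
  refine abs_le_of_sq_le_sq (h.trans ?_) (by positivity)
  rw [mul_pow, mul_pow]
  gcongr
  nlinarith

/-- By near symmetry each side holds about half of the entries concerned. At most a fraction `1 - 15
α / 16` exceeds `ρ` in absolute value, which leaves room below `1/2 - 3 α / 8` for the imbalance. -/
theorem card_noise_le (j : Fin d) :
    ((Finset.univ.filter fun i => 0 < η i j).card : ℝ) ≤ (1 / 2 + α / 8) * n ∧
    ((Finset.univ.filter fun i => η i j < 0).card : ℝ) ≤ (1 / 2 + α / 8) * n ∧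
    ((Finset.univ.filter fun i => ρ < η i j).card : ℝ) ≤ (1 / 2 - 3 * α / 8) * n ∧
    ((Finset.univ.filter fun i => η i j < -ρ).card : ℝ) ≤ (1 / 2 - 3 * α / 8) * n := by
  have hρ := S.ρ_pos
  have hn := S.n_pos'
  have hα := S.α_pos
  have hφ : n * (ε * l) ≤ α / 10 ^ 6 * n := by
    rw [mul_comm]
    gcongr
    refine S.small.trans ?_
    gcongr
    nlinarith [S.α_le]
  have hαn : 0 < α * n := by positivity
  have h1 := abs_le.1 (S.two_mul_card_le j (fun i => 0 < η i j) (fun i => η i j < 0) 0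
    (fun i => by simp) (fun i => by simp))
  obtain ⟨θ, hθ⟩ := exists_threshold (fun i => |η i j|) ρ
  have h2 := abs_le.1 (S.two_mul_card_le j (fun i => ρ < η i j) (fun i => η i j < -ρ) θ
    (fun i => by
      rw [hθ i, lt_abs]
      constructor
      · exact fun h => ⟨Or.inl h, hρ.trans h⟩
      · rintro ⟨h | h, h'⟩
        · exact h
        · linarith)
    (fun i => by
      rw [hθ i, lt_abs]
      constructor
      · exact fun h => ⟨Or.inr (by linarith), by linarith⟩
      · rintro ⟨h | h, h'⟩
        · linarith
        · linarith))
  have hdisj : ∀ P Q : Fin n → Prop, ∀ [DecidablePred P] [DecidablePred Q],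
      (∀ i, P i → ¬ Q i) → ((Finset.univ.filter P).card : ℝ) + (Finset.univ.filter Q).card
        = (Finset.univ.filter fun i => P i ∨ Q i).card := by
    intro P Q _ _ h
    rw [Finset.filter_or, Finset.card_union_of_disjoint, Nat.cast_add]
    exact Finset.disjoint_filter.2 fun i _ => h i
  have h3 : ((Finset.univ.filter fun i => 0 < η i j).card : ℝ)
      + (Finset.univ.filter fun i => η i j < 0).card ≤ n := by
    rw [hdisj _ _ fun i hi => hi.not_gt]
    exact_mod_cast (Finset.card_le_univ _).trans (by simp)
  have h4 : ((Finset.univ.filter fun i => ρ < η i j).card : ℝ)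
      + (Finset.univ.filter fun i => η i j < -ρ).card ≤ (1 - 15 / 16 * α) * n := by
    rw [hdisj _ _ fun i hi => by linarith]
    have h5 : (Finset.univ.filter fun i => ρ < η i j ∨ η i j < -ρ).card
        + (Finset.univ.filter fun i => |η i j| ≤ ρ).card ≤ n := by
      rw [← Finset.card_union_of_disjoint]
      · exact (Finset.card_le_univ _).trans (by simp)
      · refine Finset.disjoint_filter.2 fun i _ hi hi' => ?_
        rw [abs_le] at hi'
        rcases hi with hi | hi <;> linarith [hi'.1, hi'.2]
    have h6 : ((Finset.univ.filter fun i => ρ < η i j ∨ η i j < -ρ).card : ℝ)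
        + (Finset.univ.filter fun i => |η i j| ≤ ρ).card ≤ n := by exact_mod_cast h5
    linarith [S.count j]
  refine ⟨?_, ?_, ?_, ?_⟩ <;> linarith [h1.1, h1.2, h2.1, h2.2]

/-- Passing from the corrupted to the clean sample changes counts by at most `ε n`. -/
theorem card_le_card_add (P Q : Fin n → Prop) [DecidablePred P] [DecidablePred Q]
    (h : ∀ i ∈ G, P i → Q i) :
    ((Finset.univ.filter P).card : ℝ) ≤ (Finset.univ.filter Q).card + ε * n := by
  have h1 : (Finset.univ.filter P).card ≤ (Finset.univ.filter Q).card + Gᶜ.card := by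
    refine (Finset.card_le_card ?_).trans (Finset.card_union_le _ _)
    intro i hi
    by_cases hiG : i ∈ G
    · exact Finset.mem_union_left _ (Finset.mem_filter.2 ⟨Finset.mem_univ _,
        h i hiG (Finset.mem_filter.1 hi).2⟩)
    · exact Finset.mem_union_right _ (Finset.mem_compl.2 hiG)
  have h2 : ((Finset.univ.filter P).card : ℝ) ≤ (Finset.univ.filter Q).card + Gᶜ.card := by
    exact_mod_cast h1
  linarith [S.bad]

variable {lo hi : Fin d → ℝ}
  (hlo : ∀ j, IsQuantile ((1 / 2 - α / 4) * n) (fun i => z i j) (lo j))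
  (hhi : ∀ j, IsQuantile ((1 / 2 + α / 4) * n) (fun i => z i j) (hi j))

omit S in
theorem card_lt_add_card_ge (v : Fin n → ℝ) (q : ℝ) :
    ((Finset.univ.filter fun i => v i < q).card : ℝ)
      + (Finset.univ.filter fun i => q ≤ v i).card = n := by
  classical
  have h := Finset.card_filter_add_card_filter_not (s := (Finset.univ : Finset (Fin n)))
    (fun i => v i < q)
  simp only [not_lt, Finset.card_univ, Fintype.card_fin] at h
  exact_mod_cast h

-- If the quantile exceeded `μ j`, more than `(1/2 + α/4) n` points would lie at or above it, yet at
-- most `(1/2 + α/8 + ε) n` can. If it were below `μ j - ρ`, at least `(1/2 - α/4) n` points would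
-- lie at or below it, yet at most `(1/2 - 3α/8 + ε) n` can.
include hlo in
theorem lo_bounds (j : Fin d) : lo j ≤ μ j ∧ μ j - ρ ≤ lo j := by
  classical
  have hn := S.n_pos'
  have hα := S.α_pos
  have hαn : 0 < α * n := by positivity
  have hε : ε * n ≤ α / 10 ^ 6 * n := by
    have := S.eps_le
    gcongr
  obtain ⟨c1, c2, c3, c4⟩ := S.card_noise_le j
  obtain ⟨q1, q2⟩ := hlo j
  constructor
  · by_contra h
    push Not at h
    have h1 := card_lt_add_card_ge (fun i => z i j) (lo j)
    have h2 := S.card_le_card_add (fun i => lo j ≤ z i j) (fun i => 0 < η i j) fun i hi h' => by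
      rw [S.good i hi j] at h'
      linarith
    have q1' : ((Finset.univ.filter fun i => z i j < lo j).card : ℝ) < (1 / 2 - α / 4) * n := by
      convert q1
    linarith
  · by_contra h
    push Not at h
    have h2 := S.card_le_card_add (fun i => z i j ≤ lo j) (fun i => η i j < -ρ) fun i hi h' => by
      rw [S.good i hi j] at h'
      linarith
    have q2' : (1 / 2 - α / 4) * n ≤ ((Finset.univ.filter fun i => z i j ≤ lo j).card : ℝ) := by
      convert q2
    linarith

include hhi in
theorem hi_bounds (j : Fin d) : μ j ≤ hi j ∧ hi j ≤ μ j + ρ := by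
  classical
  have hn := S.n_pos'
  have hα := S.α_pos
  have hαn : 0 < α * n := by positivity
  have hε : ε * n ≤ α / 10 ^ 6 * n := by
    have := S.eps_le
    gcongr
  obtain ⟨c1, c2, c3, c4⟩ := S.card_noise_le j
  obtain ⟨q1, q2⟩ := hhi j
  constructor
  · by_contra h
    push Not at h
    have h2 := S.card_le_card_add (fun i => z i j ≤ hi j) (fun i => η i j < 0) fun i hi h' => by
      rw [S.good i hi j] at h'
      linarith
    have q2' : (1 / 2 + α / 4) * n ≤ ((Finset.univ.filter fun i => z i j ≤ hi j).card : ℝ) := by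
      convert q2
    linarith
  · by_contra h
    push Not at h
    have h1 := card_lt_add_card_ge (fun i => z i j) (hi j)
    have h2 := S.card_le_card_add (fun i => hi j ≤ z i j) (fun i => ρ < η i j) fun i hi h' => by
      rw [S.good i hi j] at h'
      linarith
    have q1' : ((Finset.univ.filter fun i => z i j < hi j).card : ℝ) < (1 / 2 + α / 4) * n := by
      convert q1
    linarith

include hlo hhi

/-- The two quantile levels differ by `α n / 2`, so that many points lie between the quantiles, all
but `ε n` of them uncorrupted. The location lies there too, so their noise is at most the distance
of the quantiles. The scale is thus found without knowing `ρ`. -/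
theorem card_close_ge (j : Fin d) :
    α / 2 * n - ε * n ≤ ((G.filter fun i => |η i j| ≤ hi j - lo j).card : ℝ) := by
  classical
  obtain ⟨q1, -⟩ := hlo j
  obtain ⟨-, q2⟩ := hhi j
  have h1 := S.lo_bounds hlo j
  have h2 := S.hi_bounds hhi j
  have hsub : (Finset.univ.filter fun i => z i j ≤ hi j) ⊆
      (Finset.univ.filter fun i => z i j < lo j) ∪
        ((G.filter fun i => |η i j| ≤ hi j - lo j) ∪ Gᶜ) := by
    intro i hi'
    have hz := (Finset.mem_filter.1 hi').2
    by_cases hiG : i ∈ G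
    · rcases lt_or_ge (z i j) (lo j) with h | h
      · exact Finset.mem_union_left _ (Finset.mem_filter.2 ⟨Finset.mem_univ _, h⟩)
      · refine Finset.mem_union_right _ (Finset.mem_union_left _ (Finset.mem_filter.2 ⟨hiG, ?_⟩))
        rw [S.good i hiG j] at hz h
        rw [abs_le]
        constructor <;> linarith [h1.1, h2.1]
    · exact Finset.mem_union_right _ (Finset.mem_union_right _ (Finset.mem_compl.2 hiG))
  have hcard := (Finset.card_le_card hsub).trans ((Finset.card_union_le _ _).trans
    (Nat.add_le_add_left (Finset.card_union_le _ _) _))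
  have hcard' : ((Finset.univ.filter fun i => z i j ≤ hi j).card : ℝ) ≤
      (Finset.univ.filter fun i => z i j < lo j).card +
        ((G.filter fun i => |η i j| ≤ hi j - lo j).card + Gᶜ.card) := by exact_mod_cast hcard
  have q1' : ((Finset.univ.filter fun i => z i j < lo j).card : ℝ) < (1 / 2 - α / 4) * n := by
    convert q1
  have q2' : (1 / 2 + α / 4) * n ≤ ((Finset.univ.filter fun i => z i j ≤ hi j).card : ℝ) := by
    convert q2
  linarith [S.bad]

theorem snapshot {w : Fin n → ℝ} (hw : ∀ i, w i ∈ Set.Icc (0 : ℝ) 1)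
    (hloss : ∑ i, (if i ∈ G then 1 - w i else 1) ≤ 5 * ε * n) {c : Fin d → ℝ}
    (hc : ∀ j, |μ j - c j| ≤ 2 * (hi j - lo j)) :
    Snapshot α ε l η z μ (fun j => hi j - lo j) c w G where
  n_pos := S.n_pos
  d_pos := S.d_pos
  α_pos := S.α_pos
  α_le := S.α_le
  ε_pos := S.ε_pos
  l_ge := S.l_ge
  small := S.small
  bounds := S.bounds
  good := S.good
  bad := S.bad
  L_nonneg j := by linarith [S.lo_bounds hlo j, S.hi_bounds hhi j]
  near := hc
  count := S.card_close_ge hlo hhi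
  w_mem := hw
  loss := hloss

end CorruptedSample

/-! ### Balanced centers and their distance from the location -/

namespace CorruptedSample

variable {n d : ℕ} {α ρ ε l : ℝ} {η z : Fin n → Fin d → ℝ} {μ : Fin d → ℝ} {G : Finset (Fin n)}
  (S : CorruptedSample α ρ ε l η z μ G)
  {lo hi : Fin d → ℝ}
  (hlo : ∀ j, IsQuantile ((1 / 2 - α / 4) * n) (fun i => z i j) (lo j))
  (hhi : ∀ j, IsQuantile ((1 / 2 + α / 4) * n) (fun i => z i j) (hi j))
  {w : Fin n → ℝ} (hw : ∀ i, w i ∈ Set.Icc (0 : ℝ) 1)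
include S

omit S in
theorem residualSum_eq (L c : Fin d → ℝ) (j : Fin d) :
    ArrayProgram.residualSum z L w j (c j) = ∑ i, w i * clippedResidual z L c i j := rfl

include hw in
omit S in
theorem residualSum_sub_le {L : Fin d → ℝ} (hL : ∀ j, 0 ≤ L j) (j : Fin d) {s t b : ℝ}
    (hst : s ≤ t) (hb : 0 ≤ b) (htb : t - s ≤ 4 * L j * b) :
    ArrayProgram.residualSum z L w j s - ArrayProgram.residualSum z L w j t ≤ b * n := by
  unfold ArrayProgram.residualSum
  rw [← Finset.sum_sub_distrib]
  calc _ ≤ ∑ _i : Fin n, b := Finset.sum_le_sum fun i _ => ?_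
    _ = b * n := by simp [mul_comm]
  rw [← mul_sub]
  have h1 : clippedResidual z L (fun _ => s) i j - clippedResidual z L (fun _ => t) i j ≤ b := by
    refine (le_abs_self _).trans ((abs_clip_sub_clip_le _ _).trans ?_)
    rw [← sub_div, abs_div, abs_of_nonneg (by linarith [hL j] : 0 ≤ 4 * L j),
      show z i j - s - (z i j - t) = t - s by ring, abs_of_nonneg (sub_nonneg.2 hst)]
    exact div_le_of_le_mul₀ (by linarith [hL j]) hb (by linarith)
  nlinarith [(hw i).1, (hw i).2]

include hlo hhi hw

/-- At the outer ends `lo - L` and `hi + L` the displacement is at least `1/4`, so the residual sum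
has a definite sign there and bisection keeps a sign change. The final interval has length `3 L / 2
^ n` and a residual is Lipschitz with constant `1 / (4 L)`, so the sum is nearly zero at the left
end. For `L j = 0` all residuals vanish. -/
theorem center_bounds (hloss : ∑ i, (if i ∈ G then 1 - w i else 1) ≤ 5 * ε * n)
    {c c' : Fin d → ℝ}
    (h : ∀ j, let F := ArrayProgram.residualSum z (fun j => hi j - lo j) w j
      (c j = lo j - (hi j - lo j) ∨ 0 < F (c j)) ∧ (c' j = hi j + (hi j - lo j) ∨ F (c' j) ≤ 0) ∧
      lo j - (hi j - lo j) ≤ c j ∧ c' j ≤ hi j + (hi j - lo j) ∧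
      c' j - c j = (hi j + (hi j - lo j) - (lo j - (hi j - lo j))) / 2 ^ n) :
    (∀ j, |μ j - c j| ≤ 2 * (hi j - lo j)) ∧
      ∀ j, |∑ i, w i * clippedResidual z (fun j => hi j - lo j) c i j| ≤ 1 / 2 ^ n * n := by
  set L : Fin d → ℝ := fun j => hi j - lo j with hLdef
  have hlo' := fun j => (S.lo_bounds hlo j).1
  have hhi' := fun j => (S.hi_bounds hhi j).1
  have hL : ∀ j, 0 ≤ L j := fun j => by simp only [hLdef]; linarith [hlo' j, hhi' j]
  have hcc' : ∀ j, c j ≤ c' j ∧ c' j - c j = 3 * L j * (1 / 2 ^ n) := by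
    intro j
    obtain ⟨-, -, -, -, h5⟩ := h j
    have e : c' j - c j = 3 * L j * (1 / 2 ^ n) := by rw [h5]; simp only [hLdef]; ring
    have : 0 ≤ 3 * L j * (1 / 2 ^ n) := by have := hL j; positivity
    exact ⟨by linarith, e⟩
  have hnear : ∀ j, |μ j - c j| ≤ 2 * L j := by
    intro j
    obtain ⟨-, -, h3, h4, -⟩ := h j
    have h6 := (hcc' j).1
    rw [abs_le]
    simp only [hLdef]
    constructor <;> linarith [hlo' j, hhi' j]
  have hzero : ∀ j, L j = 0 → ∀ t, ArrayProgram.residualSum z L w j t = 0 := by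
    intro j hj t
    refine Finset.sum_eq_zero fun i _ => ?_
    simp [clippedResidual, hj, clip_zero]
  have hFlo : ∀ j, 0 ≤ ArrayProgram.residualSum z L w j (lo j - L j) := by
    intro j
    rcases (hL j).eq_or_lt with h0 | h0
    · exact (hzero j h0.symm _).ge
    · have hn : ∀ j, |μ j - (fun j => lo j - L j) j| ≤ 2 * (hi j - lo j) := by
        intro j
        simp only [hLdef]
        rw [abs_le]
        constructor <;> linarith [hlo' j, hhi' j]
      have hs : 1 / 4 ≤ Snapshot.shift μ L (fun j => lo j - L j) j := by
        rw [Snapshot.shift, le_div_iff₀ (by linarith)]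
        linarith [hlo' j]
      have h1 := (S.snapshot hlo hhi hw hloss hn).shift_mul_sum_residual_nonneg (j := j)
        (hs.trans (le_abs_self _))
      rw [residualSum_eq L (fun j => lo j - L j) j]
      exact nonneg_of_mul_nonneg_right h1 (by linarith)
  have hFhi : ∀ j, ArrayProgram.residualSum z L w j (hi j + L j) ≤ 0 := by
    intro j
    rcases (hL j).eq_or_lt with h0 | h0
    · exact (hzero j h0.symm _).le
    · have hn : ∀ j, |μ j - (fun j => hi j + L j) j| ≤ 2 * (hi j - lo j) := by
        intro j
        simp only [hLdef]
        rw [abs_le]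
        constructor <;> linarith [hlo' j, hhi' j]
      have hs : Snapshot.shift μ L (fun j => hi j + L j) j ≤ -(1 / 4) := by
        rw [Snapshot.shift, div_le_iff₀ (by linarith)]
        linarith [hhi' j]
      have h1 := (S.snapshot hlo hhi hw hloss hn).shift_mul_sum_residual_nonneg (j := j)
        ((by linarith : 1 / 4 ≤ -Snapshot.shift μ L (fun j => hi j + L j) j).trans (neg_le_abs _))
      rw [residualSum_eq L (fun j => hi j + L j) j]
      by_contra hcon
      push Not at hcon
      have := mul_neg_of_neg_of_pos (by linarith : Snapshot.shift μ L (fun j => hi j + L j) j < 0)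
        hcon
      exact absurd h1 (not_le.2 this)
  refine ⟨hnear, fun j => ?_⟩
  rw [← residualSum_eq]
  obtain ⟨h1, h2, -, -, -⟩ := h j
  have hpos : 0 ≤ ArrayProgram.residualSum z L w j (c j) := by
    rcases h1 with h1 | h1
    · rw [h1]; exact hFlo j
    · exact h1.le
  have hneg : ArrayProgram.residualSum z L w j (c' j) ≤ 0 := by
    rcases h2 with h2 | h2
    · rw [h2]; exact hFhi j
    · exact h2
  have hdiff := residualSum_sub_le (z := z) hw hL j (hcc' j).1 (b := 1 / 2 ^ n) (by positivity) (by
    rw [(hcc' j).2]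
    have : 0 ≤ L j * (1 / 2 ^ n) := mul_nonneg (hL j) (by positivity)
    linarith)
  rw [abs_of_nonneg hpos]
  linarith

omit hw in
/-- Centers with a small radius are close to the location. -/
theorem sum_sq_sub_le {c : Fin d → ℝ} (hc : ∀ j, |μ j - c j| ≤ 2 * (hi j - lo j)) :
    ∑ j, (c j - μ j) ^ 2 ≤ (8 * ρ * Snapshot.radius μ (fun j => hi j - lo j) c) ^ 2 := by
  rw [mul_pow, Snapshot.radius_sq, Finset.mul_sum]
  refine Finset.sum_le_sum fun j _ => ?_
  have h1 := S.lo_bounds hlo j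
  have h2 := S.hi_bounds hhi j
  rcases (by linarith : 0 ≤ hi j - lo j).eq_or_lt with h0 | h0
  · have h3 := hc j
    rw [← h0, mul_zero] at h3
    have h4 : μ j - c j = 0 := abs_nonpos_iff.1 h3
    have h5 : (c j - μ j) ^ 2 = 0 := by rw [show c j - μ j = -(μ j - c j) by ring, h4]; norm_num
    rw [h5]
    positivity
  · have e : c j - μ j = -(4 * (hi j - lo j) * Snapshot.shift μ (fun j => hi j - lo j) c j) := by
      rw [Snapshot.shift]
      field_simp
      ring
    rw [e, neg_sq, mul_pow]
    have h3 : 4 * (hi j - lo j) ≤ 8 * ρ := by linarith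
    gcongr

theorem radius_bound (hnd : (d : ℝ) ^ 3 ≤ ε ^ 2 * 2 ^ n) {c : Fin d → ℝ}
    (hloss : ∑ i, (if i ∈ G then 1 - w i else 1) ≤ 5 * ε * n)
    (hc : ∀ j, |μ j - c j| ≤ 2 * (hi j - lo j))
    (hβ : ∀ j, |∑ i, w i * clippedResidual z (fun j => hi j - lo j) c i j| ≤ 1 / 2 ^ n * n)
    {lam : ℝ} (hlam : ∀ v : Fin d → ℝ,
      ∑ i, w i * rowForm v (clippedResidual z (fun j => hi j - lo j) c i)
        ≤ n * (lam + ε) * ∑ j, v j ^ 2) :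
    let r := Snapshot.radius μ (fun j => hi j - lo j) c
    α ^ 2 * r ^ 2 ≤ 32 * ε * (lam + 5 * r + r ^ 2 + 340 * (ε * l)) := by
  refine (S.snapshot hlo hhi hw hloss hc).sq_radius_le hβ ?_ hlam
  have h2n : (1 : ℝ) ≤ 2 ^ n := one_le_pow₀ (by norm_num)
  have hd1 : (1 : ℝ) ≤ d := by exact_mod_cast S.d_pos
  have h1 : (d : ℝ) ≤ d ^ 3 := le_self_pow₀ hd1 (by norm_num)
  have h2 : (2 : ℝ) ^ n ≤ (2 ^ n) ^ 2 := le_self_pow₀ h2n (by norm_num)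
  rw [div_pow, one_pow, mul_one_div, div_le_iff₀ (by positivity)]
  calc (d : ℝ) ≤ ε ^ 2 * 2 ^ n := h1.trans hnd
    _ ≤ ε ^ 2 * (2 ^ n) ^ 2 := by gcongr

omit S hlo hhi hw in
theorem loss_eq (w : Fin n → ℝ) :
    ∑ i, (if i ∈ G then 1 - w i else 1) = ∑ i ∈ G, (1 - w i) + Gᶜ.card := by
  rw [sum_ite_mem_add G]
  congr 1
  · exact Finset.sum_congr rfl fun i hi => if_pos hi
  · rw [Finset.sum_congr rfl fun i hi => if_neg (Finset.mem_compl.1 hi)]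
    simp

-- Any total removal up to `4 ε n`, whatever points it hits, leaves a valid snapshot: counting the
-- corrupted points as missing adds at most `ε n`. This is all that the certificate needs about the
-- weights.
omit hlo hhi in
theorem loss_le_of_sum_le (h : ∑ i, (1 - w i) ≤ 4 * ε * n) :
    ∑ i, (if i ∈ G then 1 - w i else 1) ≤ 5 * ε * n := by
  rw [loss_eq]
  rw [sum_ite_mem_add G] at h
  have : 0 ≤ ∑ i ∈ Gᶜ, (1 - w i) := Finset.sum_nonneg fun i _ => by linarith [(hw i).2]
  linarith [S.bad]

-- Balance charges removed good weight to removed bad weight, and at most `ε n` of the latter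
-- exists.
omit hlo hhi in
theorem sum_le_of_balance (h : ∑ i ∈ G, (1 - w i) ≤ ∑ i ∈ Gᶜ, (1 - w i)) :
    ∑ i, (1 - w i) ≤ 2 * ε * n := by
  have h1 : ∑ i ∈ Gᶜ, (1 - w i) ≤ Gᶜ.card := by
    rw [← nsmul_one, ← Finset.sum_const]
    exact Finset.sum_le_sum fun i _ => by linarith [(hw i).1]
  rw [sum_ite_mem_add G]
  linarith [S.bad]

end CorruptedSample

/-! ### Removal of the largest scores -/

open Classical in
theorem selectedAverage_max {n : ℕ} {P : Fin n → Prop} {τ : Fin n → ℝ} (h : ∃ i, P i) :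
    let t := selectedAverage (fun i => P i ∧ ∀ k, P k → τ k ≤ τ i) τ
    ∃ i, P i ∧ τ i = t ∧ ∀ k, P k → τ k ≤ t := by
  intro t
  obtain ⟨i, hi, hmax⟩ := Finset.exists_max_image (Finset.univ.filter P) τ
    (by obtain ⟨i, hi⟩ := h; exact ⟨i, Finset.mem_filter.2 ⟨Finset.mem_univ _, hi⟩⟩)
  have hPi := (Finset.mem_filter.1 hi).2
  have hmax' : ∀ k, P k → τ k ≤ τ i := fun k hk =>
    hmax k (Finset.mem_filter.2 ⟨Finset.mem_univ _, hk⟩)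
  have ht : t = τ i := selectedAverage_eq ⟨i, hPi, hmax'⟩ fun k hk =>
    le_antisymm (hmax' k hk.1) (hk.2 i hPi)
  exact ⟨i, hPi, ht.symm, fun k hk => ht ▸ hmax' k hk⟩

/-- Weights remain valid at every scale, also at wrong guesses where the dominance of corrupted
scores is not available. -/
theorem downweight_mem_Icc {n : ℕ} {w τ : Fin n → ℝ} {P : Fin n → Prop}
    (hw : ∀ i, w i ∈ Set.Icc (0 : ℝ) 1) (hτ : ∀ i, 0 ≤ τ i) {t : ℝ}
    (ht : t = selectedAverage (fun i => (P i ∧ 0 < w i) ∧ ∀ k, P k ∧ 0 < w k → τ k ≤ τ i) τ)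
    {i : Fin n} (hi : P i) : w i * (1 - τ i / t) ∈ Set.Icc (0 : ℝ) 1 := by
  rcases (hw i).1.eq_or_lt with h | h
  · rw [← h]; simp
  · obtain ⟨i₀, -, -, hmax⟩ := selectedAverage_max (P := fun i => P i ∧ 0 < w i) (τ := τ)
      ⟨i, hi, h⟩
    rw [← ht] at hmax
    have h1 := hmax i ⟨hi, h⟩
    have h2 : τ i / t ≤ 1 := div_le_one_of_le₀ h1 ((hτ i).trans h1)
    have h3 : 0 ≤ τ i / t := div_nonneg (hτ i) ((hτ i).trans h1)
    exact ⟨mul_nonneg h.le (by linarith), mul_le_one₀ (hw i).2 (by linarith) (by linarith)⟩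

/-! ### One iteration and the start of a stage in terms of the data -/

namespace ArrayProgram

/-- The arrays hold the data `z`, the parameter `α`, the quantiles `lo` and `hi` and the scale `e`
with its number `k`. -/
structure Prepared {n d : ℕ} (α : ℝ) (z : Fin n → Fin d → ℝ) (lo hi : Fin d → ℝ) (e k : ℝ)
    (R : Arrays) : Prop where
  data : ∀ i j, R 0 (i : Fin n) (j : Fin d) = z i j
  param : R 1 0 0 = α
  low : ∀ j : Fin d, R 3 0 j = lo j
  high : ∀ j : Fin d, R 4 0 j = hi j
  width : ∀ j : Fin d, R 5 0 j = hi j - lo j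
  scale : R 6 0 0 = e
  level : R 7 0 0 = k

namespace Prepared

variable {n d : ℕ} {α : ℝ} {z : Fin n → Fin d → ℝ} {lo hi : Fin d → ℝ} {e k : ℝ} {R : Arrays}

theorem congr (h : Prepared α z lo hi e k R) {R' : Arrays}
    (hR : ∀ c : Fin 32, c ∈ [0, 1, 3, 4, 5, 6, 7] → R' c = R c) : Prepared α z lo hi e k R' where
  data i j := by rw [hR 0 (by decide), h.data]
  param := by rw [hR 1 (by decide), h.param]
  low j := by rw [hR 3 (by decide), h.low]
  high j := by rw [hR 4 (by decide), h.high]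
  width j := by rw [hR 5 (by decide), h.width]
  scale := by rw [hR 6 (by decide), h.scale]
  level := by rw [hR 7 (by decide), h.level]

theorem iteration (h : Prepared α z lo hi e k R) :
    Prepared α z lo hi e k (iteration.sem n d R) :=
  h.congr fun c hc => sem_of_notMem_writes (by
    have : ∀ c : Fin 32, c ∈ ([0, 1, 3, 4, 5, 6, 7] : List (Fin 32)) → c ∉ ArrayProgram.iteration.writes := by
      decide
    exact this c hc)

open Classical in
/-- One iteration in terms of the data. -/
theorem iteration_spec (h : Prepared α z lo hi e k R) (hlohi : ∀ j, lo j ≤ hi j) :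
    let w : Fin n → ℝ := fun i => R 8 i 0
    let L : Fin d → ℝ := fun j => hi j - lo j
    let R' := ArrayProgram.iteration.sem n d R
    ∃ (c c' : Fin d → ℝ) (lam : ℝ) (τ : Fin n → ℝ),
      (∀ j, let F := residualSum z L w j;
        (c j = lo j - (hi j - lo j) ∨ 0 < F (c j)) ∧ (c' j = hi j + (hi j - lo j) ∨ F (c' j) ≤ 0) ∧
        lo j - (hi j - lo j) ≤ c j ∧ c' j ≤ hi j + (hi j - lo j) ∧
        c' j - c j = (hi j + (hi j - lo j) - (lo j - (hi j - lo j))) / 2 ^ n) ∧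
      (let A := unitDiagGram w (clippedResidual z L c);
        lam = (∑ i, ∑ j, (A ^ (2 ^ n) * A) i j * (A ^ (2 ^ n)) i j)
          / (∑ i, ∑ j, (A ^ (2 ^ n)) i j ^ 2) - 1 ∧
        ∀ i, τ i = ∑ k, (∑ j, (A ^ (2 ^ n)) k j * clippedResidual z L c i j) ^ 2
          / (∑ i, ∑ j, (A ^ (2 ^ n)) i j ^ 2)) ∧
      (∀ j : Fin d, R' 2 0 j = if lam ≤ 5100 * k * e / (α * α) ∧ ∑ i, (1 - w i) ≤ 2 * e * n
        then c j else R 2 0 j) ∧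
      let top : Fin n → Prop := fun i =>
        ((Finset.univ.filter fun k => τ i ≤ τ k).card : ℝ) ≤ 2 * e * n
      let t := selectedAverage
        (fun i => (top i ∧ 0 < w i) ∧ ∀ k, top k ∧ 0 < w k → τ k ≤ τ i) τ
      ∀ i : Fin n, R' 8 i 0 = if top i then w i * (1 - τ i / t) else w i := by
  intro w L R'
  set R₁ := bisect.sem n d R with hR₁
  set R₂ := spectral.sem n d R₁ with hR₂
  have f₁ : ∀ c : Fin 32, c ∉ bisect.writes → R₁ c = R c := fun c hc => sem_of_notMem_writes hc
  have f₂ : ∀ c : Fin 32, c ∉ spectral.writes → R₂ c = R₁ c := fun c hc => sem_of_notMem_writes hc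
  have h₁ : Prepared α z lo hi e k R₁ := h.congr fun c hc => f₁ c (by
    have : ∀ c : Fin 32, c ∈ ([0, 1, 3, 4, 5, 6, 7] : List (Fin 32)) → c ∉ bisect.writes := by
      decide
    exact this c hc)
  have h₂ : Prepared α z lo hi e k R₂ := h₁.congr fun c hc => f₂ c (by
    have : ∀ c : Fin 32, c ∈ ([0, 1, 3, 4, 5, 6, 7] : List (Fin 32)) → c ∉ spectral.writes := by
      decide
    exact this c hc)
  have e8 : R₁ 8 = R 8 := f₁ 8 (by decide)
  have e8' : R₂ 8 = R 8 := (f₂ 8 (by decide)).trans e8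
  refine ⟨fun j => R₁ 9 0 j, fun j => R₁ 10 0 j, R₂ 17 0 0, fun i => R₂ 16 i 0, fun j => ?_, ?_, ?_⟩
  · have := bisect_apply (n := n) (R := R) j
    simp only [h.data, h.low, h.high, h.width] at this
    exact this (by linarith [hlohi j])
  · have := spectral_apply (n := n) (d := d) (R := R₁)
    simp only [h₁.data, h₁.width, e8] at this
    exact ⟨this.1, this.2.1⟩
  · have h18 := (spectral_apply (n := n) (d := d) (R := R₁)).2.2
    have := filter_apply (n := n) (d := d) (R := R₂)
    simp only [h₂.param, h₂.scale, h₂.level, e8', f₂ 9 (by decide), f₂ 2 (by decide),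
      f₁ 2 (by decide)] at this
    have h18' : R₂ 18 0 0 = ∑ i, (1 - w i) := by
      rw [hR₂, h18]
      simp only [e8, w]
    rw [h18'] at this
    exact this

theorem stage_start (h : Prepared α z lo hi e k R) :
    ∃ R₀ : Arrays, stage.sem n d R = (ArrayProgram.iteration.sem n d)^[n + 1] R₀ ∧
      Prepared α z lo hi (e / 2) (k + 1) R₀ ∧ (∀ i : Fin n, R₀ 8 i 0 = 1) ∧ R₀ 2 = R 2 := by
  have h0 : 0 < Size.val n d .unit := Nat.one_pos
  set R₁ := (assign 6 .unit .unit (.div (.cell 6 .zero .zero) (.lit 2))).sem n d R with hR₁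
  set R₂ := (assign 7 .unit .unit (.add (.cell 7 .zero .zero) (.lit 1))).sem n d R₁ with hR₂
  set R₃ := (assign 8 .points .unit (.lit 1)).sem n d R₂ with hR₃
  have f₁ : ∀ c : Fin 32, c ∉ [6] → R₁ c = R c := fun c hc => sem_of_notMem_writes hc
  have f₂ : ∀ c : Fin 32, c ∉ [7] → R₂ c = R₁ c := fun c hc => sem_of_notMem_writes hc
  have f₃ : ∀ c : Fin 32, c ∉ [8] → R₃ c = R₂ c := fun c hc => sem_of_notMem_writes hc
  have fr : ∀ c : Fin 32, c ∉ [6, 7, 8] → R₃ c = R c := fun c hc => by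
    simp only [List.mem_cons, not_or] at hc
    rw [f₃ c (by simp [hc]), f₂ c (by simp [hc]), f₁ c (by simp [hc])]
  refine ⟨R₃, ?_, ⟨fun i j => ?_, ?_, fun j => ?_, fun j => ?_, fun j => ?_, ?_, ?_⟩,
    fun i => ?_, fr 2 (by decide)⟩
  · rw [Function.iterate_succ_apply']
    rfl
  · rw [fr 0 (by decide), h.data]
  · rw [fr 1 (by decide), h.param]
  · rw [fr 3 (by decide), h.low]
  · rw [fr 4 (by decide), h.high]
  · rw [fr 5 (by decide), h.width]
  · rw [f₃ 6 (by decide), f₂ 6 (by decide), hR₁, assign_apply h0 h0]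
    simp [Term.val, Index.val, h.scale]
  · rw [f₃ 7 (by decide), hR₂, assign_apply h0 h0]
    simp [Term.val, Index.val, f₁ 7 (by decide), h.level]
  · rw [hR₃, assign_apply (b₁ := .points) i.2 h0]
    simp [Term.val]

end Prepared

end ArrayProgram

/-! ### Correctness of iterations, stages and the estimator -/

namespace CorruptedSample

open ArrayProgram

variable {n d : ℕ} {α ρ ε l : ℝ} {η z : Fin n → Fin d → ℝ} {μ : Fin d → ℝ} {G : Finset (Fin n)}
  (S : CorruptedSample α ρ ε l η z μ G)
  {lo hi : Fin d → ℝ}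
  (hlo : ∀ j, IsQuantile ((1 / 2 - α / 4) * n) (fun i => z i j) (lo j))
  (hhi : ∀ j, IsQuantile ((1 / 2 + α / 4) * n) (fun i => z i j) (hi j))
  (hnd : (d : ℝ) ^ 3 ≤ ε ^ 2 * 2 ^ n)

/-- The output in row `0` of array `2` is accurate. -/
def Accurate (d : ℕ) (ρ : ℝ) (κ : ℝ) (μ : Fin d → ℝ) (R : Arrays) : Prop :=
  ∑ j : Fin d, (R 2 0 j - μ j) ^ 2 ≤ (11200 * ρ * κ) ^ 2

/-- At least as much weight is missing outside `G` as inside. -/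
def Balanced (G : Finset (Fin n)) (R : Arrays) : Prop :=
  ∑ i ∈ G, (1 - R 8 i 0) ≤ ∑ i ∈ Gᶜ, (1 - R 8 i 0)

include S hlo hhi hnd

open Classical in
/-- One iteration keeps the weights in `[0, 1]`, keeps an accurate output accurate if the scale is
not too large, and at the right scale either makes the output accurate or removes one more point. -/
theorem iteration_step {e k : ℝ} {R : Arrays} (h : Prepared α z lo hi e k R)
    (hw : ∀ i : Fin n, R 8 i 0 ∈ Set.Icc (0 : ℝ) 1) :
    let R' := ArrayProgram.iteration.sem n d R
    let κ := ε * Real.sqrt l / α ^ 2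
    (∀ i : Fin n, R' 8 i 0 ∈ Set.Icc (0 : ℝ) 1) ∧
    (e ≤ 2 * ε → k * e ≤ 3 * (ε * l) → Accurate d ρ κ μ R → Accurate d ρ κ μ R') ∧
    (e ≤ 2 * ε → k * e ≤ 3 * (ε * l) → ε ≤ e → ε * l ≤ k * e → Balanced G R →
      Accurate d ρ κ μ R' ∨ (Balanced G R' ∧
        (Finset.univ.filter fun i : Fin n => R 8 i 0 = 0).card + 1
          ≤ (Finset.univ.filter fun i : Fin n => R' 8 i 0 = 0).card)) := by
  intro R' κ
  set w : Fin n → ℝ := fun i => R 8 i 0 with hwdef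
  set L : Fin d → ℝ := fun j => hi j - lo j with hL
  have hn0 := S.n_pos'
  have hα := S.α_pos
  have hε := S.ε_pos
  have hl := S.l_ge
  have hα2 : 0 < α ^ 2 := by positivity
  have hlohi : ∀ j, lo j ≤ hi j := fun j => by linarith [S.lo_bounds hlo j, S.hi_bounds hhi j]
  obtain ⟨c, c', lam, τ, hc, ⟨hlam, hτ⟩, hout, hweights⟩ := h.iteration_spec hlohi
  have hout₁ : (lam ≤ 5100 * k * e / (α * α) ∧ ∑ i, (1 - w i) ≤ 2 * e * n) →
      ∀ j : Fin d, R' 2 0 j = c j := fun hs j => (hout j).trans (if_pos hs)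
  have hout₂ : ¬ (lam ≤ 5100 * k * e / (α * α) ∧ ∑ i, (1 - w i) ≤ 2 * e * n) →
      ∀ j : Fin d, R' 2 0 j = R 2 0 j := fun hs j => (hout j).trans (if_neg hs)
  set t := selectedAverage (fun i => (((Finset.univ.filter fun k => τ i ≤ τ k).card : ℝ)
    ≤ 2 * e * n ∧ 0 < w i) ∧ ∀ k, ((Finset.univ.filter fun l => τ k ≤ τ l).card : ℝ)
    ≤ 2 * e * n ∧ 0 < w k → τ k ≤ τ i) τ with ht
  have hw' : ∀ i : Fin n, R' 8 i 0 = if ((Finset.univ.filter fun k => τ i ≤ τ k).card : ℝ)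
      ≤ 2 * e * n then w i * (1 - τ i / t) else w i := hweights
  have hy : ∀ i j, |clippedResidual z L c i j| ≤ 1 := fun i j =>
    Snapshot.abs_clippedResidual_le_one i j
  obtain ⟨U, hU, hτU, hlamU, hquad⟩ := exists_spectral_data S.n_pos S.d_pos hw hy hε hnd hlam hτ
  have hτ0 : ∀ i, 0 ≤ τ i := fun i => by
    rw [hτU]; exact Finset.sum_nonneg fun _ _ => sq_nonneg _
  -- Soundness at every scale that is not too large: the test on removed weight restores the
  -- snapshot without using balance, and the test on `lam` bounds the radius by `1400 κ`. With scale
  -- `4 L ≤ 8 ρ` this gives `8 * 1400 = 11200`.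
  have hcert : e ≤ 2 * ε → k * e ≤ 3 * (ε * l) →
      (lam ≤ 5100 * k * e / (α * α) ∧ ∑ i, (1 - w i) ≤ 2 * e * n) → Accurate d ρ κ μ R' := by
    intro he hk hs
    have hloss := S.loss_le_of_sum_le hw (hs.2.trans (by
      have := mul_le_mul_of_nonneg_right he hn0.le
      linarith))
    obtain ⟨hnear, hβ⟩ := S.center_bounds hlo hhi hw hloss hc
    have hr := S.radius_bound hlo hhi hw hnd hloss hnear hβ hquad
    have hr2 := radius_le_of_certificate hα S.α_le hε hl S.small hr (by
      refine hs.1.trans ?_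
      rw [← sq]
      gcongr ?_ / _
      linarith)
    have hacc := S.sum_sq_sub_le hlo hhi hnear
    unfold Accurate
    simp only [hout₁ hs]
    refine hacc.trans ?_
    have h0 := Snapshot.radius_nonneg μ (fun j => hi j - lo j) c
    have hρ := S.ρ_pos
    rw [show 11200 * ρ * κ = 8 * ρ * (1400 * κ) by ring]
    gcongr
  refine ⟨fun i => ?_, fun he hk hacc => ?_, fun he hk he' hk' hbal => ?_⟩
  · rw [hw' i]
    split_ifs with hi'
    · exact downweight_mem_Icc (P := fun i =>
        ((Finset.univ.filter fun k => τ i ≤ τ k).card : ℝ) ≤ 2 * e * n) hw hτ0 rfl hi'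
    · exact hw i
  · by_cases hs : lam ≤ 5100 * k * e / (α * α) ∧ ∑ i, (1 - w i) ≤ 2 * e * n
    · exact hcert he hk hs
    · unfold Accurate at hacc ⊢
      simp only [hout₂ hs]
      exact hacc
  · by_cases hs : lam ≤ 5100 * k * e / (α * α) ∧ ∑ i, (1 - w i) ≤ 2 * e * n
    · exact Or.inl (hcert he hk hs)
    · right
      have hsum := S.sum_le_of_balance hw hbal
      have hsum' : ∑ i, (1 - w i) ≤ 2 * e * n := hsum.trans (by gcongr)
      -- Balance guarantees the test on removed weight, so a failing certificate can only mean that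
      -- `lam` is large.
      have hlam' : 5100 * (ε * l) / α ^ 2 ≤ lam := by
        by_contra hcon
        push Not at hcon
        refine hs ⟨hcon.le.trans ?_, hsum'⟩
        rw [← sq]
        gcongr ?_ / _
        linarith
      have hloss := S.loss_le_of_sum_le hw (hsum.trans (by
        have : 0 ≤ ε * n := by positivity
        linarith))
      obtain ⟨hnear, hβ⟩ := S.center_bounds hlo hhi hw hloss hc
      have hr := S.radius_bound hlo hhi hw hnd hloss hnear hβ hquad
      have hbig := le_of_radius_bound hα S.α_le hε (le_mul_of_one_le_right hε.le hl) S.small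
        (Snapshot.radius_nonneg _ _ _) hr hlam'
      set A := Finset.univ.filter fun i =>
        ((Finset.univ.filter fun k => τ i ≤ τ k).card : ℝ) ≤ 2 * e * n with hA
      have hmemA : ∀ i, i ∈ A ↔ ((Finset.univ.filter fun k => τ i ≤ τ k).card : ℝ) ≤ 2 * e * n :=
        fun i => by simp [hA]
      obtain ⟨hdom, hpos⟩ := (S.snapshot hlo hhi hw hloss hnear).sum_score_good_le_bad hU hτU hlamU
        he' he hbig A hmemA
      have hstep := downweight (w := w) (w' := fun i => R' 8 i 0) (τ := τ) (G := G) (A := A)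
        (t := t) hw hτ0 hdom hpos (by
          rintro ⟨i, hi1, hi2⟩
          obtain ⟨i₀, h1, h2, h3⟩ := selectedAverage_max (P := fun i =>
            ((Finset.univ.filter fun k => τ i ≤ τ k).card : ℝ) ≤ 2 * e * n ∧ 0 < w i) (τ := τ)
            ⟨i, (hmemA i).1 hi1, hi2⟩
          exact ⟨i₀, (hmemA i₀).2 h1.1, h1.2, h2, fun k hk hk' => h3 k ⟨(hmemA k).1 hk, hk'⟩⟩)
        (fun i => by
          rw [hw' i]
          by_cases hi' : i ∈ A
          · rw [if_pos hi', if_pos ((hmemA i).1 hi')]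
          · rw [if_neg hi', if_neg fun hcon => hi' ((hmemA i).2 hcon)])
        hbal
      exact ⟨hstep.2.1, by convert hstep.2.2⟩

/-- A stage keeps an accurate output accurate if the scale is not too large, and makes the output
accurate at the right scale. -/
theorem stage_step {e k : ℝ} {R : Arrays} (h : Prepared α z lo hi e k R)
    (he : e / 2 ≤ 2 * ε) (hk : (k + 1) * (e / 2) ≤ 3 * (ε * l)) :
    let κ := ε * Real.sqrt l / α ^ 2
    (Accurate d ρ κ μ R → Accurate d ρ κ μ (stage.sem n d R)) ∧
      (ε ≤ e / 2 → ε * l ≤ (k + 1) * (e / 2) → Accurate d ρ κ μ (stage.sem n d R)) := by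
  classical
  intro κ
  obtain ⟨R₀, hR, hprep, hw, hout⟩ := h.stage_start
  have key : ∀ m : ℕ, let Q := (ArrayProgram.iteration.sem n d)^[m] R₀
      Prepared α z lo hi (e / 2) (k + 1) Q ∧ (∀ i : Fin n, Q 8 i 0 ∈ Set.Icc (0 : ℝ) 1) ∧
      (Accurate d ρ κ μ R → Accurate d ρ κ μ Q) ∧
      (ε ≤ e / 2 → ε * l ≤ (k + 1) * (e / 2) → Accurate d ρ κ μ Q ∨
        (Balanced G Q ∧ m ≤ (Finset.univ.filter fun i : Fin n => Q 8 i 0 = 0).card)) := by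
    intro m
    induction m with
    | zero =>
      refine ⟨hprep, fun i => ?_, fun hacc => ?_, fun _ _ => Or.inr ⟨?_, Nat.zero_le _⟩⟩
      · rw [Function.iterate_zero, id, hw i]; norm_num
      · unfold Accurate at hacc ⊢
        simpa only [Function.iterate_zero, id, hout] using hacc
      · simp [Balanced, hw]
    | succ m ih =>
      simp only [Function.iterate_succ_apply']
      set Q := (ArrayProgram.iteration.sem n d)^[m] R₀
      obtain ⟨hQ, hQw, hQa, hQb⟩ := ih
      obtain ⟨s1, s2, s3⟩ := S.iteration_step hlo hhi hnd hQ hQw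
      refine ⟨hQ.iteration, s1, fun hacc => s2 he hk (hQa hacc), fun he' hk' => ?_⟩
      rcases hQb he' hk' with hacc | ⟨hbal, hcard⟩
      · exact Or.inl (s2 he hk hacc)
      · rcases s3 he hk he' hk' hbal with hacc | ⟨hbal', hcard'⟩
        · exact Or.inl hacc
        · exact Or.inr ⟨hbal', by omega⟩
  rw [hR]
  obtain ⟨-, -, ka, kb⟩ := key (n + 1)
  refine ⟨ka, fun he' hk' => ?_⟩
  rcases kb he' hk' with hacc | ⟨-, hcard⟩
  · exact hacc
  -- Without an accurate output, `n + 1` iterations would have produced `n + 1` zero weights among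
  -- `n`.
  · exact absurd (hcard.trans (Finset.card_le_univ _)) (by simp)

omit hlo hhi in
/-- The estimator is accurate on corrupted samples. -/
theorem estimator_accurate {k₀ : ℕ} (hk1 : 1 ≤ k₀) (hkn : k₀ ≤ n) (he1 : ε ≤ (1 / 2) ^ k₀)
    (he2 : (1 / 2) ^ k₀ ≤ 2 * ε) (hφ1 : ε * l ≤ k₀ * (1 / 2) ^ k₀)
    (hφ2 : ∀ k : ℕ, k₀ ≤ k → k * (1 / 2) ^ k ≤ 3 * (ε * l)) {R : Arrays}
    (hdata : ∀ (i : Fin n) (j : Fin d), R 0 i j = z i j) (hα : R 1 0 0 = α) :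
    Accurate d ρ (ε * Real.sqrt l / α ^ 2) μ (estimator.sem n d R) := by
  obtain ⟨hq, h6, h7, h0, h1⟩ := prepare_apply (n := n) (d := d) (R := R) (by rw [hα]; exact S.α_pos)
    (by rw [hα]; exact S.α_le) S.n_pos
  set R₀ := prepare.sem n d R with hR₀
  simp only [hdata, hα] at hq
  have hlo : ∀ j : Fin d, IsQuantile ((1 / 2 - α / 4) * n) (fun i => z i j) (R₀ 3 0 j) :=
    fun j => (hq j).1
  have hhi : ∀ j : Fin d, IsQuantile ((1 / 2 + α / 4) * n) (fun i => z i j) (R₀ 4 0 j) :=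
    fun j => (hq j).2.1
  have hprep : Prepared α z (fun j : Fin d => R₀ 3 0 j) (fun j : Fin d => R₀ 4 0 j) 1 0 R₀ :=
    ⟨fun i j => by rw [h0, hdata], by rw [h1, hα], fun _ => rfl, fun _ => rfl,
      fun j => (hq j).2.2, h6, h7⟩
  have key : ∀ m : ℕ, Prepared α z (fun j : Fin d => R₀ 3 0 j) (fun j : Fin d => R₀ 4 0 j)
      ((1 / 2) ^ m) m ((stage.sem n d)^[m] R₀) ∧
      (k₀ ≤ m → Accurate d ρ (ε * Real.sqrt l / α ^ 2) μ ((stage.sem n d)^[m] R₀)) := by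
    intro m
    induction m with
    | zero => exact ⟨by simpa using hprep, fun h => by omega⟩
    | succ m ih =>
      obtain ⟨ih1, ih2⟩ := ih
      rw [Function.iterate_succ_apply']
      constructor
      · obtain ⟨R₁, hR₁, hp, -, -⟩ := ih1.stage_start
        rw [hR₁]
        have hpow : ((1 : ℝ) / 2) ^ (m + 1) = (1 / 2) ^ m / 2 := by rw [pow_succ]; ring
        rw [hpow]
        push_cast
        generalize n + 1 = m'
        induction m' with
        | zero => exact hp
        | succ m' ihm' => rw [Function.iterate_succ_apply']; exact ihm'.iteration
      · intro hm
        have hpow : ((1 : ℝ) / 2) ^ m / 2 = (1 / 2) ^ (m + 1) := by rw [pow_succ]; ring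
        have hs := S.stage_step hlo hhi hnd ih1
          (by
            rw [hpow]
            exact (pow_le_pow_of_le_one (by norm_num) (by norm_num) hm).trans he2)
          (by
            rw [hpow]
            have := hφ2 (m + 1) hm
            push_cast at this
            exact this)
        -- Stage `k₀` makes the output accurate; every later stage preserves accuracy.
        rcases Nat.lt_or_ge m k₀ with hlt | hge
        · obtain rfl : k₀ = m + 1 := by omega
          refine hs.2 (by rw [hpow]; exact he1) ?_
          rw [hpow]
          push_cast at hφ1
          exact hφ1
        · exact hs.1 (ih2 hge)
  exact (key n).2 hkn

end CorruptedSample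

/-! ### Choice of the parameters -/

theorem exp_le_div_of_add_log_le {a δ m : ℝ} (hδ : 0 < δ) (hm : 0 < m)
    (h : a + Real.log m + Real.log (1 / δ) ≤ 0) : Real.exp a ≤ δ / m := by
  rw [one_div, Real.log_inv] at h
  calc Real.exp a ≤ Real.exp (Real.log δ - Real.log m) := Real.exp_le_exp.2 (by linarith)
    _ = δ / m := by rw [Real.exp_sub, Real.exp_log hδ, Real.exp_log hm]

theorem log_le_div_hundred {u : ℝ} (hu : 5 * 10 ^ 5 ≤ u) : Real.log u ≤ u / 100 := by
  have hu0 : 0 < u := by linarith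
  have h1 : Real.log u = Real.log (u / 200) + Real.log 200 := by
    rw [← Real.log_mul (by positivity) (by norm_num)]
    congr 1
    ring
  have h2 := Real.log_le_sub_one_of_pos (by positivity : 0 < u / 200)
  have h3 := Real.log_le_sub_one_of_pos (by norm_num : (0 : ℝ) < 200)
  linarith

/-- Consequences of the assumptions on the parameters: here `l = log (1 / ε)` and
`Q = d log d + log (1 / δ)`. -/
structure Admissible (d n : ℕ) (α ε δ l Q : ℝ) : Prop where
  d_pos : 1 ≤ d
  α_pos : 0 < α
  α_le : α ≤ 1
  ε_pos : 0 < ε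
  δ_pos : 0 < δ
  exp_l : Real.exp l = 1 / ε
  l_ge : 32 ≤ l
  small : ε * l ≤ α ^ 2 / 10 ^ 6
  half_d_le : (d : ℝ) / 2 ≤ Q
  log_δ_le : Real.log (1 / δ) ≤ Q
  d_log_d_le : d * Real.log d ≤ Q
  sample : 10 ^ 6 * Q ≤ n * (ε ^ 2 * l)

/-- With `c = ε ^ (1/3)` one has `l = 3 log (1/c)` and `c l ≤ 3`, so `ε l = c² (c l)` is a small
multiple of `α²`. The case split on `d` and `δ` keeps `Q` bounded below: for `d = 1` the term `d log
d` vanishes and `log (1/δ) ≥ log 2` replaces it. -/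
theorem admissible {d n : ℕ} {α ε δ : ℝ} (hd : 1 ≤ d) (hα : 0 < α) (hα1 : α ≤ 1) (hε : 0 < ε)
    (hδ : 0 < δ) (hδ1 : δ < 1) (hdδ : 2 ≤ d ∨ δ ≤ 1 / 2) (hεα : ε ^ (1 / 3 : ℝ) ≤ α / 10 ^ 6)
    (hn : 10 ^ 6 * ((d * Real.log d + Real.log (1 / δ)) / (α ^ 4 * ε ^ 2 * Real.log (1 / ε))) ≤ n) :
    Admissible d n α ε δ (Real.log (1 / ε)) (d * Real.log d + Real.log (1 / δ)) := by
  set l := Real.log (1 / ε) with hl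
  set Q := d * Real.log d + Real.log (1 / δ) with hQ
  set c := ε ^ (1 / 3 : ℝ) with hc
  have hc0 : 0 < c := Real.rpow_pos_of_pos hε _
  have hc3 : c ^ 3 = ε := by
    rw [hc, ← Real.rpow_natCast, ← Real.rpow_mul hε.le]
    norm_num
  have hc6 : c ≤ 1 / 10 ^ 6 := hεα.trans (by gcongr)
  have hlc : l = 3 * Real.log (1 / c) := by
    rw [hl, ← hc3, one_div, one_div, Real.log_inv, Real.log_inv, Real.log_pow]
    push_cast
    ring
  have hl32 : 32 ≤ l := by
    have h1 : (2 : ℝ) ^ 19 ≤ 1 / c := by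
      rw [le_div_iff₀ hc0]
      calc (2 : ℝ) ^ 19 * c ≤ 2 ^ 19 * (1 / 10 ^ 6) := by gcongr
        _ ≤ 1 := by norm_num
    have h2 := Real.log_le_log (by positivity) h1
    rw [Real.log_pow] at h2
    have h3 := Real.log_two_gt_d9
    push_cast at h2
    linarith
  have hcl : c * l ≤ 3 := by
    have h1 := Real.log_le_sub_one_of_pos (by positivity : 0 < 1 / c)
    have h2 : Real.log (1 / c) ≤ 1 / c := by linarith
    calc c * l = 3 * (c * Real.log (1 / c)) := by rw [hlc]; ring
      _ ≤ 3 * (c * (1 / c)) := by gcongr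
      _ = 3 := by field_simp
  have hφ : ε * l ≤ α ^ 2 / 10 ^ 6 := by
    calc ε * l = c ^ 2 * (c * l) := by rw [← hc3]; ring
      _ ≤ (α / 10 ^ 6) ^ 2 * 3 := by gcongr
      _ ≤ α ^ 2 / 10 ^ 6 := by
        have : 0 < α ^ 2 := by positivity
        rw [div_pow]
        linarith
  have hd0 : (1 : ℝ) ≤ d := by exact_mod_cast hd
  have hlogd : 0 ≤ Real.log d := Real.log_nonneg hd0
  have hlogδ : 0 ≤ Real.log (1 / δ) := by
    refine Real.log_nonneg ?_
    rw [le_div_iff₀ hδ]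
    linarith
  have hdd : 0 ≤ d * Real.log d := by positivity
  have hlog2 := Real.log_two_gt_d9
  have hhalf : (d : ℝ) / 2 ≤ Q := by
    rcases hdδ with h | h
    · have h1 : Real.log 2 ≤ Real.log d := Real.log_le_log (by norm_num) (by exact_mod_cast h)
      have h2 : (d : ℝ) * (1 / 2) ≤ d * Real.log d := by gcongr; linarith
      linarith
    · rcases hd.eq_or_lt with h1 | h1
      · have h2 : Real.log 2 ≤ Real.log (1 / δ) := by
          refine Real.log_le_log (by norm_num) ?_
          rw [le_div_iff₀ hδ]
          linarith
        rw [← h1] at hQ ⊢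
        norm_num at hQ ⊢
        rw [one_div, Real.log_inv] at h2
        linarith
      · have h1' : Real.log 2 ≤ Real.log d := Real.log_le_log (by norm_num) (by exact_mod_cast h1)
        have h2 : (d : ℝ) * (1 / 2) ≤ d * Real.log d := by gcongr; linarith
        linarith
  have hQ0 : 0 < Q := by linarith
  refine ⟨hd, hα, hα1, hε, hδ, ?_, hl32, hφ, hhalf, by linarith, by linarith, ?_⟩
  · rw [hl, Real.exp_log (by positivity)]
  · have hl0 : 0 < l := by linarith
    rw [← mul_div_assoc, div_le_iff₀ (by positivity)] at hn
    calc 10 ^ 6 * Q ≤ n * (α ^ 4 * ε ^ 2 * l) := hn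
      _ = α ^ 4 * (n * (ε ^ 2 * l)) := by ring
      _ ≤ 1 * (n * (ε ^ 2 * l)) := by
          gcongr
          exact pow_le_one₀ hα.le hα1
      _ = _ := one_mul _

namespace Admissible

variable {d n : ℕ} {α ε δ l Q : ℝ} (A : Admissible d n α ε δ l Q)
include A

theorem one_le_d : (1 : ℝ) ≤ d := by exact_mod_cast A.d_pos

theorem half_le_Q : 1 / 2 ≤ Q := by linarith [A.one_le_d, A.half_d_le]

theorem φ_pos : 0 < ε * l := mul_pos A.ε_pos (by linarith [A.l_ge])

theorem φ_le : ε * l ≤ 1 / 10 ^ 6 := by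
  refine A.small.trans ?_
  gcongr
  exact pow_le_one₀ A.α_pos.le A.α_le

theorem ε_le : ε ≤ 1 / 10 ^ 6 := by
  refine le_trans ?_ A.φ_le
  exact le_mul_of_one_le_right A.ε_pos.le (by linarith [A.l_ge])

theorem ε_sq_mul_l_le : ε ^ 2 * l ≤ ε * (1 / 10 ^ 6) := by
  have := mul_le_mul_of_nonneg_left A.φ_le A.ε_pos.le
  linarith

/-- The sample is much larger than `1 / ε`. -/
theorem le_n_mul_ε : 10 ^ 12 * Q ≤ n * ε := by
  have h1 : (n : ℝ) * (ε ^ 2 * l) ≤ n * (ε * (1 / 10 ^ 6)) := by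
    have := A.ε_sq_mul_l_le
    gcongr
  linarith [A.sample]

theorem l_le : l ≤ 1 / ε := by
  rw [← A.exp_l]
  linarith [Real.add_one_le_exp l]

theorem le_n : 10 ^ 12 * Q ≤ n := by
  refine A.le_n_mul_ε.trans ?_
  exact mul_le_of_le_one_right (Nat.cast_nonneg n) (by linarith [A.ε_le])

theorem d_le_n : d ≤ n := by
  have h1 := A.le_n
  have h2 := A.half_d_le
  have : (d : ℝ) ≤ n := by linarith [A.one_le_d]
  exact_mod_cast this

theorem eighteen_le_n : 18 ≤ n := by
  have h1 := A.le_n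
  have h2 := A.half_le_Q
  have : (18 : ℝ) ≤ n := by linarith
  exact_mod_cast this

theorem n_pos : (0 : ℝ) < n := by
  have := A.eighteen_le_n
  have : (18 : ℝ) ≤ n := by exact_mod_cast this
  linarith

theorem hundred_mul_l_le_n : 100 * l ≤ n := by
  have h1 : 100 * (1 / ε) ≤ n := by
    rw [mul_one_div, div_le_iff₀ A.ε_pos]
    linarith [A.le_n_mul_ε, A.half_le_Q]
  linarith [A.l_le]

/-- The sample size dominates both `log (1/ε)` and `d`, so `2 ^ n` exceeds any power of `1/ε` and
`d` needed by the power method. -/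
theorem d_cube_le : (d : ℝ) ^ 3 ≤ ε ^ 2 * 2 ^ n := by
  have hd := A.one_le_d
  have e1 : ε ^ 2 = Real.exp (-(2 * l)) := by
    rw [Real.exp_neg, two_mul, Real.exp_add, A.exp_l]
    have := A.ε_pos
    field_simp
  have e2 : (2 : ℝ) ^ n = Real.exp (n * Real.log 2) := by
    rw [mul_comm, Real.exp_mul, Real.exp_log (by norm_num), Real.rpow_natCast]
  have e3 : (d : ℝ) ^ 3 = Real.exp (3 * Real.log d) := by
    rw [mul_comm, Real.exp_mul, Real.exp_log (by linarith)]
    norm_cast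
  rw [e1, e2, e3, ← Real.exp_add]
  refine Real.exp_le_exp.2 ?_
  have h1 := Real.log_le_sub_one_of_pos (by linarith : (0 : ℝ) < d)
  have h2 := A.hundred_mul_l_le_n
  have h3 := A.le_n
  have h4 := A.half_d_le
  have h5 := Real.log_two_gt_d9
  have h6 : (n : ℝ) * (1 / 2) ≤ n * Real.log 2 := by gcongr; linarith
  linarith

/-- Write `log q = log d + log (q/d)` with `q = n ε² l`. The first part is covered by `d log d ≤ Q`,
and the second grows so slowly that `d log (q/d) ≤ q/100`. Hence `d log d` in the sample size can
stand for the union bound's logarithm. -/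
theorem d_log_le : d * Real.log (n * (ε ^ 2 * l)) ≤ n * (ε ^ 2 * l) / 25 := by
  set q := n * (ε ^ 2 * l) with hq
  have hd := A.one_le_d
  have hd0 : (0 : ℝ) < d := by linarith
  have h1 : 5 * 10 ^ 5 * (d : ℝ) ≤ q := by linarith [A.sample, A.half_d_le]
  have hu : 5 * 10 ^ 5 ≤ q / d := by rwa [le_div_iff₀ hd0]
  have h2 := log_le_div_hundred hu
  have h3 : Real.log q = Real.log d + Real.log (q / d) := by
    rw [← Real.log_mul hd0.ne' (by linarith)]
    congr 1
    field_simp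
  have h4 : d * Real.log (q / d) ≤ q / 100 := by
    calc d * Real.log (q / d) ≤ d * (q / d / 100) := by gcongr
      _ = q / 100 := by field_simp
  rw [h3, mul_add]
  linarith [A.d_log_d_le, A.sample, A.half_le_Q]

/-- The union bound costs `d log n`, and `log n ≤ log q + 2 l`. The quadratic statistics have tail
exponent of order `q l`, and this extra factor `l` absorbs the term `d l`. -/
theorem d_log_n_le : 5 * (d * Real.log n) + Real.log 12 + Real.log (1 / δ)
    ≤ n * (ε ^ 2 * l) * l / 40 := by
  set q := n * (ε ^ 2 * l) with hq
  have hn := A.n_pos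
  have hl := A.l_ge
  have hd := A.one_le_d
  have hε := A.ε_pos
  have hq0 : 0 < q := by positivity
  have h1 : Real.log n ≤ Real.log q + 2 * l := by
    have h2 : (n : ℝ) ≤ q * Real.exp (2 * l) := by
      rw [two_mul, Real.exp_add, A.exp_l, hq]
      have : (n : ℝ) * (ε ^ 2 * l) * (1 / ε * (1 / ε)) = n * l := by field_simp
      rw [this]
      exact le_mul_of_one_le_right hn.le (by linarith)
    have h3 := Real.log_le_log hn h2
    rwa [Real.log_mul hq0.ne' (Real.exp_pos _).ne', Real.log_exp] at h3
  have h2 : d * Real.log n ≤ q / 25 + 2 * (d * l) := by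
    have h3 : d * Real.log n ≤ d * (Real.log q + 2 * l) := by gcongr
    have h4 := A.d_log_le
    linarith
  have h3 : d * l ≤ 2 * Q * l := by
    gcongr
    linarith [A.half_d_le]
  have h4 : Q * l ≤ q / 10 ^ 6 * l := by
    gcongr
    linarith [A.sample]
  have h5 : q * 32 ≤ q * l := by gcongr
  have h6 : Real.log 12 ≤ 11 := (Real.log_le_sub_one_of_pos (by norm_num)).trans (by norm_num)
  linarith [A.log_δ_le, A.sample, A.half_le_Q]

theorem exp_linear_le : Real.exp (d * 3 - n ^ 2 * (ε ^ 2 * l) / (8 * n)) ≤ δ / 4 := by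
  refine exp_le_div_of_add_log_le A.δ_pos (by norm_num) ?_
  have hn := A.n_pos
  have e : (n : ℝ) ^ 2 * (ε ^ 2 * l) / (8 * n) = n * (ε ^ 2 * l) / 8 := by field_simp
  have h6 : Real.log 4 ≤ 3 := (Real.log_le_sub_one_of_pos (by norm_num)).trans (by norm_num)
  rw [e]
  linarith [A.log_δ_le, A.sample, A.half_le_Q, A.half_d_le]

/-- The grid parameter is `N = 4 n³`, enough for `4 d² n ≤ N` because `d ≤ n`; with `n ≥ 18` each
coordinate then has at most `n⁵` choices of pattern and grid value. -/
theorem grid_le : ((((n + 1) * (2 * (4 * n ^ 3) + 1)) ^ d : ℕ) : ℝ) ≤ Real.exp (5 * (d * Real.log n)) := by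
  have hn := A.n_pos
  have h18 := A.eighteen_le_n
  have h1 : (n + 1) * (2 * (4 * n ^ 3) + 1) ≤ n ^ 5 := by
    have h2 : n + 1 ≤ 2 * n := by omega
    have h3 : 1 ≤ n ^ 3 := Nat.one_le_pow _ _ (by omega)
    calc (n + 1) * (2 * (4 * n ^ 3) + 1) ≤ (2 * n) * (9 * n ^ 3) := Nat.mul_le_mul h2 (by omega)
      _ = 18 * n ^ 4 := by ring
      _ ≤ n * n ^ 4 := Nat.mul_le_mul_right _ h18
      _ = n ^ 5 := by ring
  have h2 : (((n + 1) * (2 * (4 * n ^ 3) + 1)) ^ d : ℕ) ≤ (n ^ 5) ^ d := Nat.pow_le_pow_left h1 d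
  have h3 : Real.exp (5 * (d * Real.log n)) = (((n ^ 5) ^ d : ℕ) : ℝ) := by
    rw [show 5 * (d * Real.log n) = Real.log n * ((5 * d : ℕ) : ℝ) by push_cast; ring,
      Real.exp_mul, Real.exp_log hn, Real.rpow_natCast]
    push_cast
    rw [pow_mul]
  rw [h3]
  exact_mod_cast h2

/-- The level `t = 8 l` makes the cost of the excess per row of order `ε²`, and `l = φ/16` is of the
order that optimises the chaos tail. Both exponents are then at most `-n φ² / 40`, and `d_log_n_le`
beats the number of choices. -/
theorem grid_mul_exp_le :
    ((((n + 1) * (2 * (4 * n ^ 3) + 1)) ^ d : ℕ) : ℝ) *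
      (Real.exp (n * Real.exp (3 / 4 - 8 * l / 4) - (n * (ε * l) - 1) / 4)
        + 2 * Real.exp (n * (8 * (ε * l / 16) ^ 2) - ε * l / 16 * (n * (ε * l) - 1))) ≤ δ / 4 := by
  have hn := A.n_pos
  have hl := A.l_ge
  have hε := A.ε_pos
  set φ := ε * l with hφdef
  have hφ0 := A.φ_pos
  have hφ1 := A.φ_le
  have hnφ : 10 ^ 5 ≤ n * φ := by
    have h1 : n * ε ≤ n * φ := by
      gcongr
      exact le_mul_of_one_le_right hε.le (by linarith)
    linarith [A.le_n_mul_ε, A.half_le_Q]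
  have e1 : Real.exp (3 / 4 - 8 * l / 4) ≤ φ / 16 := by
    have h1 : Real.exp (3 / 4 - 8 * l / 4) = Real.exp (3 / 4) * (ε * ε) := by
      rw [show 3 / 4 - 8 * l / 4 = 3 / 4 + (-l + -l) by ring, Real.exp_add, Real.exp_add,
        Real.exp_neg, A.exp_l]
      simp
    have h2 : Real.exp (3 / 4) ≤ 3 :=
      (Real.exp_le_exp.2 (by norm_num)).trans (Real.exp_one_lt_d9.le.trans (by norm_num))
    rw [h1]
    calc Real.exp (3 / 4) * (ε * ε) ≤ 3 * (ε * (1 / 10 ^ 6)) := by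
          have := A.ε_le
          gcongr
      _ ≤ ε * 32 / 16 := by linarith
      _ ≤ ε * l / 16 := by gcongr
  have hφφ : n * φ ^ 2 ≤ n * φ := by
    have : φ ^ 2 ≤ φ := by nlinarith
    gcongr
  have x1 : n * Real.exp (3 / 4 - 8 * l / 4) - (n * φ - 1) / 4 ≤ -(n * φ ^ 2 / 40) := by
    have : n * Real.exp (3 / 4 - 8 * l / 4) ≤ n * (φ / 16) := by gcongr
    linarith
  have x2 : n * (8 * (φ / 16) ^ 2) - φ / 16 * (n * φ - 1) ≤ -(n * φ ^ 2 / 40) := by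
    have : φ * 10 ≤ φ * (n * φ) := by gcongr; linarith
    linarith
  have hsum : Real.exp (n * Real.exp (3 / 4 - 8 * l / 4) - (n * φ - 1) / 4)
      + 2 * Real.exp (n * (8 * (φ / 16) ^ 2) - φ / 16 * (n * φ - 1))
      ≤ 3 * Real.exp (-(n * φ ^ 2 / 40)) := by
    have := Real.exp_le_exp.2 x1
    have := Real.exp_le_exp.2 x2
    linarith
  have hfin : Real.exp (5 * (d * Real.log n) - n * φ ^ 2 / 40) ≤ δ / 12 := by
    refine exp_le_div_of_add_log_le A.δ_pos (by norm_num) ?_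
    have h1 := A.d_log_n_le
    have h2 : n * φ ^ 2 / 40 = n * (ε ^ 2 * l) * l / 40 := by rw [hφdef]; ring
    rw [h2]
    linarith
  calc _ ≤ Real.exp (5 * (d * Real.log n)) * (3 * Real.exp (-(n * φ ^ 2 / 40))) :=
        mul_le_mul A.grid_le hsum (by positivity) (Real.exp_pos _).le
    _ = 3 * Real.exp (5 * (d * Real.log n) - n * φ ^ 2 / 40) := by
        rw [sub_eq_add_neg, Real.exp_add]; ring
    _ ≤ δ / 4 := by linarith

theorem count_le : d * Real.exp (-(2 * (α / 16) ^ 2 * n)) ≤ δ / 2 := by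
  have hd := A.one_le_d
  have hn := A.n_pos
  rw [← Real.exp_log (by linarith : (0 : ℝ) < d), ← Real.exp_add]
  refine exp_le_div_of_add_log_le A.δ_pos (by norm_num) ?_
  have h1 : 10 ^ 6 * Q ≤ α ^ 2 * n := by
    refine A.sample.trans ?_
    rw [mul_comm]
    gcongr
    have h2 := A.small
    have h3 : ε ^ 2 * l ≤ 1 * (ε * l) := by
      have := A.ε_le
      have := mul_le_mul_of_nonneg_right (by linarith : ε ≤ 1) A.φ_pos.le
      linarith
    have : 0 < α ^ 2 := by have := A.α_pos; positivity
    linarith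
  have h2 : Real.log d ≤ d * Real.log d := le_mul_of_one_le_left (Real.log_nonneg hd) hd
  have h6 : Real.log 2 ≤ 1 := (Real.log_le_sub_one_of_pos (by norm_num)).trans (by norm_num)
  have e : 2 * (α / 16) ^ 2 * (n : ℝ) = α ^ 2 * n / 128 := by ring
  rw [e]
  linarith [A.log_δ_le, A.half_le_Q, A.d_log_d_le]

/-- A power of `1 / 2` that is comparable to `ε`. -/
theorem exists_scale : ∃ k₀ : ℕ, 1 ≤ k₀ ∧ k₀ ≤ n ∧ ε ≤ (1 / 2) ^ k₀ ∧ (1 / 2) ^ k₀ ≤ 2 * ε ∧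
    ε * l ≤ k₀ * (1 / 2) ^ k₀ ∧ ∀ k : ℕ, k₀ ≤ k → k * (1 / 2) ^ k ≤ 3 * (ε * l) := by
  have hε := A.ε_pos
  have hl := A.l_ge
  -- Here `m` is the integer part of the binary logarithm of `1/ε`, so `m log 2 ≤ l ≤ (m + 1) log 2`
  -- and `m` is comparable to `l`.
  obtain ⟨m, hm1, hm2⟩ := exists_nat_pow_near (x := 1 / ε) (y := (2 : ℝ))
    (by rw [le_div_iff₀ hε]; linarith [A.ε_le]) (by norm_num)
  have hlog2 := Real.log_two_gt_d9
  have hlog2' := Real.log_two_lt_d9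
  have hll : l = Real.log (1 / ε) := by rw [← A.exp_l, Real.log_exp]
  have hlow : m * Real.log 2 ≤ l := by
    rw [hll, ← Real.log_pow]
    exact Real.log_le_log (by positivity) hm1
  have hupp : l ≤ (m + 1) * Real.log 2 := by
    have := Real.log_le_log (by positivity) hm2.le
    rw [Real.log_pow, ← hll] at this
    push_cast at this
    exact this
  have hm10 : (10 : ℝ) ≤ m := by
    by_contra h
    push Not at h
    have : (m + 1) * Real.log 2 ≤ 11 * 1 := by gcongr <;> linarith
    linarith
  have hpow : ((1 : ℝ) / 2) ^ m = 1 / 2 ^ m := by rw [div_pow, one_pow]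
  have he1 : ε ≤ (1 / 2) ^ m := by
    rw [hpow, le_div_iff₀ (by positivity), mul_comm]
    rwa [le_div_iff₀ hε] at hm1
  have he2 : (1 / 2) ^ m ≤ 2 * ε := by
    rw [hpow, div_le_iff₀ (by positivity)]
    rw [div_lt_iff₀ hε, pow_succ] at hm2
    linarith
  have hlm : l ≤ m := by
    have : ((m : ℝ) + 1) * Real.log 2 ≤ (m + 1) * (7 / 10) := by gcongr; linarith
    linarith
  have hφ2 : (m : ℝ) * (1 / 2) ^ m ≤ 3 * (ε * l) := by
    have h1 : (m : ℝ) * (2 / 3) ≤ l := by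
      refine le_trans ?_ hlow
      gcongr
      linarith
    calc (m : ℝ) * (1 / 2) ^ m ≤ m * (2 * ε) := by gcongr
      _ ≤ (3 / 2 * l) * (2 * ε) := by gcongr; linarith
      _ = 3 * (ε * l) := by ring
  have hm1' : 1 ≤ m := by
    have : (1 : ℝ) ≤ m := by linarith
    exact_mod_cast this
  refine ⟨m, hm1', ?_, he1, he2, ?_, fun k hk => ?_⟩
  · have h1 : (m : ℝ) ≤ n := by
      have h2 : (m : ℝ) * (1 / 2) ≤ m * Real.log 2 := by gcongr; linarith
      linarith [A.hundred_mul_l_le_n]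
    exact_mod_cast h1
  · rw [mul_comm]
    exact mul_le_mul hlm he1 hε.le (by linarith)
  -- The sequence `k / 2 ^ k` is nonincreasing from `k = 1` on, so all later stages inherit the
  -- bound.
  · induction k, hk using Nat.le_induction with
    | base => exact hφ2
    | succ k hk ih =>
      refine le_trans ?_ ih
      have hk1 : (1 : ℝ) ≤ k := by exact_mod_cast hm1'.trans hk
      rw [pow_succ]
      push_cast
      have : (0 : ℝ) ≤ (1 / 2) ^ k := by positivity
      nlinarith

end Admissible

/-! ### The estimator as a program -/

/-- The estimator as a program for the random access machine. -/
def estimatorProgram : RAMProgram :=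
  .seq (.setInt 2 (.lit 1)) (ArrayProgram.estimator.compile 0)

/-- The program of the estimator runs in polynomial time and computes the ArrayProgram.estimator. -/
theorem estimatorProgram_runs {n d : ℕ} (hd : d ≤ n) (hn : 1 ≤ n) (α : ℝ)
    (z : Fin n → EuclideanSpace ℝ (Fin d)) :
    ∃ T s, estimatorProgram.Runs (inputState α z) T s ∧
      (∀ a : Fin 32, s.real a =
        ArrayProgram.estimator.sem n d (fun a : Fin 32 => (inputState α z).real a) a) ∧
      T ≤ 2 + ArrayProgram.estimator.coefficient * n ^ ArrayProgram.estimator.degree := by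
  have hrep : Represents n d (fun a : Fin 32 => (inputState α z).real a)
      ((inputState α z).writeInt 2 1) := ⟨rfl, rfl, rfl, fun _ => rfl⟩
  obtain ⟨T, s, hr, hs, -, hT⟩ := ArrayProgram.runs_compile le_rfl hd hn ArrayProgram.estimator 0 _ _ hrep
  exact ⟨_, s, .seq (.setInt _ 2 (.lit 1)) hr, hs.arrays, Nat.add_le_add_left hT _⟩

/-! ### The sample is good with high probability -/

theorem IsSemiProductWithLocation.α_le_one {d : ℕ} {α ρ : ℝ} {μ : EuclideanSpace ℝ (Fin d)}
    {D : Measure (EuclideanSpace ℝ (Fin d))} (h : IsSemiProductWithLocation α ρ μ D)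
    (hd : 1 ≤ d) : α ≤ 1 := by
  have := h.isProbabilityMeasure
  have h1 := (h.small_noise ⟨0, hd⟩).trans prob_le_one
  rwa [ENNReal.ofReal_le_one] at h1

open Classical in
/-- Good samples: the noise is well spread, and all coordinates have enough small entries. -/
structure GoodSample {n d : ℕ} (α ρ ε l : ℝ) (μ : EuclideanSpace ℝ (Fin d))
    (x : Fin n → EuclideanSpace ℝ (Fin d)) : Prop where
  bounds : NoiseBounds (noise μ x) (n ^ 2 * (ε ^ 2 * l)) (8 * l) (n * (ε * l))
  count : ∀ j, 15 / 16 * α * n ≤ ((Finset.univ.filter fun i => |noise μ x i j| ≤ ρ).card : ℝ)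

-- The failure probability is split into `δ/4` for the linear statistics, `δ/4` for the quadratic
-- ones, and `δ/2` for the counts of small noise, where Hoeffding is applied with deviation `α/16`
-- in each coordinate.
open Classical in
theorem measure_not_goodSample_le {n d : ℕ} {α ρ ε δ l Q : ℝ} (A : Admissible d n α ε δ l Q)
    {μ : EuclideanSpace ℝ (Fin d)} {D : Measure (EuclideanSpace ℝ (Fin d))}
    (hD : IsSemiProductWithLocation α ρ μ D) :
    Measure.pi (fun _ : Fin n => D) {x | ¬ GoodSample α ρ ε l μ x} ≤ ENNReal.ofReal δ := by
  have := hD.isProbabilityMeasure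
  have hn : 1 ≤ n := by have := A.eighteen_le_n; omega
  set P := Measure.pi (fun _ : Fin n => D)
  set B : Fin d → Set (Fin n → EuclideanSpace ℝ (Fin d)) := fun j =>
    {x | ((Finset.univ.filter fun i => x i ∈ {y : EuclideanSpace ℝ (Fin d) |
      |y j - μ j| ≤ ρ}).card : ℝ) < (α - α / 16) * n}
  have hsub : {x | ¬ GoodSample α ρ ε l μ x} ⊆ {x | ¬ NoiseBounds (noise μ x)
      (n ^ 2 * (ε ^ 2 * l)) (8 * l) (n * (ε * l) - 1 + 1)} ∪ ⋃ j, B j := by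
    intro x hx
    by_contra hc
    simp only [Set.mem_union, Set.mem_ofPred_eq, Set.mem_iUnion, not_or, not_not, not_exists] at hc
    refine hx ⟨by simpa using hc.1, fun j => ?_⟩
    by_contra! hlt
    refine hc.2 j (lt_of_lt_of_eq hlt ?_)
    ring
  have hb (j : Fin d) : P (B j) ≤ ENNReal.ofReal (Real.exp (-(2 * (α / 16) ^ 2 * n))) :=
    measure_count_lt_le hn (measurableSet_le (by fun_prop) measurable_const) (hD.small_noise j)
      (by have := A.α_pos; positivity)
  have hN : 1 ≤ 4 * n ^ 3 := by have := Nat.one_le_pow 3 n hn; omega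
  have hNd : 4 * (d : ℝ) ^ 2 * n ≤ (4 * n ^ 3 : ℕ) := by
    have : (d : ℝ) ≤ n := by exact_mod_cast A.d_le_n
    push_cast
    calc 4 * (d : ℝ) ^ 2 * n ≤ 4 * (n : ℝ) ^ 2 * n := by gcongr
      _ = 4 * (n : ℝ) ^ 3 := by ring
  have hφ := A.φ_pos
  have hφ' := A.φ_le
  have ha := measure_not_noiseBounds_le hn hD.measurePreserving_signFlip hN hNd
    (n ^ 2 * (ε ^ 2 * l)) (8 * l) (n * (ε * l) - 1) (l := ε * l / 16) (by positivity) (by linarith)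
  have h1 := A.exp_linear_le
  have h2 := A.grid_mul_exp_le
  have h3 := A.count_le
  have hδ := A.δ_pos
  calc P {x | ¬ GoodSample α ρ ε l μ x} ≤ _ := measure_mono hsub
    _ ≤ _ := measure_union_le _ _
    _ ≤ ENNReal.ofReal (δ / 2) + ENNReal.ofReal (δ / 2) := by
        refine add_le_add (ha.trans (ENNReal.ofReal_le_ofReal (by linarith))) ?_
        calc P (⋃ j, B j) ≤ ∑ j, P (B j) := measure_iUnion_fintype_le _ _
          _ ≤ ∑ _j : Fin d, ENNReal.ofReal (Real.exp (-(2 * (α / 16) ^ 2 * n))) :=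
              Finset.sum_le_sum fun j _ => hb j
          _ = ENNReal.ofReal (d * Real.exp (-(2 * (α / 16) ^ 2 * n))) := by
              rw [Finset.sum_const, Finset.card_univ, Fintype.card_fin, nsmul_eq_mul,
                ENNReal.ofReal_mul (by positivity), ENNReal.ofReal_natCast]
          _ ≤ _ := ENNReal.ofReal_le_ofReal h3
    _ = ENNReal.ofReal δ := by
        rw [← ENNReal.ofReal_add (by positivity) (by positivity), add_halves]

/-! ### Accuracy on corrupted good samples -/

theorem GoodSample.corruptedSample {n d : ℕ} {α ρ ε δ l Q : ℝ} (A : Admissible d n α ε δ l Q)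
    (hρ : 0 < ρ) {μ : EuclideanSpace ℝ (Fin d)} {x z : Fin n → EuclideanSpace ℝ (Fin d)}
    (hx : GoodSample α ρ ε l μ x) (hz : IsCorruption ε x z) :
    ∃ G, CorruptedSample α ρ ε l (noise μ x) (fun i j => z i j) (fun j => μ j) G := by
  classical
  refine ⟨Finset.univ.filter fun i => z i = x i, ?_⟩
  refine ⟨by have := A.eighteen_le_n; omega, A.d_pos, A.α_pos, A.α_le, hρ, A.ε_pos,
    by linarith [A.l_ge], A.small, hx.bounds, fun i hi j => ?_, ?_, fun j => ?_⟩
  · rw [(Finset.mem_filter.1 hi).2, noise]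
    ring
  · have h1 : Set.ncard {i : Fin n | z i = x i} = (Finset.univ.filter fun i => z i = x i).card := by
      rw [← Set.ncard_coe_finset]
      simp
    rw [IsCorruption, h1] at hz
    rw [Finset.card_compl, Fintype.card_fin,
      Nat.cast_sub ((Finset.card_le_univ _).trans_eq (Fintype.card_fin n))]
    linarith
  · convert hx.count j

/-- Determinism identifies any halting run with the one constructed by compilation. The error
obtained is of order `ρ ε √l / α²`; since `α ≤ 1` it is below the stated `α³` form. -/
theorem norm_outputVector_sub_le {n d : ℕ} {α ρ ε δ l Q : ℝ} (A : Admissible d n α ε δ l Q)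
    (hρ : 0 < ρ) {μ : EuclideanSpace ℝ (Fin d)} {x z : Fin n → EuclideanSpace ℝ (Fin d)}
    (hx : GoodSample α ρ ε l μ x) (hz : IsCorruption ε x z) {T : ℕ}
    {v : EuclideanSpace ℝ (Fin d)} (hv : estimatorProgram.EstimatesTo α z T v) :
    ‖v - μ‖ ≤ 11200 * (ρ * (ε / α ^ 3 * Real.sqrt l)) := by
  obtain ⟨G, S⟩ := hx.corruptedSample A hρ hz
  obtain ⟨k₀, hk1, hkn, he1, he2, hφ1, hφ2⟩ := A.exists_scale
  obtain ⟨s', hs', rfl⟩ := hv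
  obtain ⟨T₁, s, hs, harr, -⟩ := estimatorProgram_runs A.d_le_n
    (by have := A.eighteen_le_n; omega) α z
  obtain ⟨-, rfl⟩ := hs'.deterministic hs
  have hacc := S.estimator_accurate A.d_cube_le hk1 hkn he1 he2 hφ1 hφ2
    (R := fun a : Fin 32 => (inputState α z).real a)
    (fun i j => by simp [inputState]) (by simp [inputState])
  have hα := A.α_pos
  have hε := A.ε_pos
  rw [EuclideanSpace.norm_eq]
  calc _ = Real.sqrt (∑ j : Fin d, (ArrayProgram.estimator.sem n d (fun a : Fin 32 => (inputState α z).real a) 2 0 j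
          - μ j) ^ 2) := by
        refine congrArg _ (Finset.sum_congr rfl fun j _ => ?_)
        rw [Real.norm_eq_abs, sq_abs, ← harr 2]
        rfl
    _ ≤ 11200 * ρ * (ε * Real.sqrt l / α ^ 2) :=
        Real.sqrt_le_iff.2 ⟨by positivity, hacc⟩
    _ = 11200 * (ρ * (ε / α ^ 2 * Real.sqrt l)) := by ring
    _ ≤ 11200 * (ρ * (ε / α ^ 3 * Real.sqrt l)) := by
        have : α ^ 3 ≤ α ^ 2 := pow_le_pow_of_le_one hα.le A.α_le (by norm_num)
        gcongr

/-! ### The theorem -/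

theorem mainTheorem1 :
    ∃ (p : RAMProgram) (C K : ℝ) (k : ℕ), 0 < C ∧ 0 < K ∧
      ∀ (d n : ℕ) (α ρ ε δ : ℝ) (μ : EuclideanSpace ℝ (Fin d))
        (D : Measure (EuclideanSpace ℝ (Fin d))),
        1 ≤ d → 0 < α → 0 < ρ → 0 < ε → 0 < δ → δ < 1 → (2 ≤ d ∨ δ ≤ 1 / 2) →
        IsSemiProductWithLocation α ρ μ D →
        ε ^ (1 / 3 : ℝ) ≤ α / C →
        C * ((d * Real.log d + Real.log (1 / δ)) / (α ^ 4 * ε ^ 2 * Real.log (1 / ε))) ≤ n →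
        -- polynomial running time on every input of this size
        (∀ z : Fin n → EuclideanSpace ℝ (Fin d), ∃ T v, p.EstimatesTo α z T v ∧ T ≤ n ^ k) ∧
        -- with probability at least `1 - δ` over the i.i.d. sample `x`, the output is accurate
        -- for every `ε`-corruption `z` of `x`
        (Measure.pi fun _ : Fin n => D)
            {x | ¬ ∀ z, IsCorruption ε x z → ∀ T v, p.EstimatesTo α z T v →
              ‖v - μ‖ ≤ K * (ρ * (Real.sqrt ((d * Real.log d + Real.log (1 / δ)) / (α ^ 4 * n))
                + ε / α ^ 3 * Real.sqrt (Real.log (1 / ε))))}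
          ≤ ENNReal.ofReal δ := by
  refine ⟨estimatorProgram, 10 ^ 6, 11200, ArrayProgram.estimator.degree + (2 + ArrayProgram.estimator.coefficient),
    by norm_num, by norm_num, ?_⟩
  intro d n α ρ ε δ μ D hd hα hρ hε hδ hδ1 hdδ hD hεα hn
  have A := admissible hd hα (hD.α_le_one hd) hε hδ hδ1 hdδ hεα hn
  have hn1 : 2 ≤ n := by have := A.eighteen_le_n; omega
  refine ⟨fun z => ?_, (measure_mono fun x hx => ?_).trans (measure_not_goodSample_le A hD)⟩
  · obtain ⟨T, s, hs, -, hT⟩ := estimatorProgram_runs A.d_le_n (by omega) α z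
    refine ⟨T, _, ⟨s, hs, rfl⟩, hT.trans ?_⟩
    have h1 : 1 ≤ n ^ ArrayProgram.estimator.degree := Nat.one_le_pow _ _ (by omega)
    -- Since `n ≥ 2`, the constant factor of the running time is absorbed into a further power of
    -- `n`.
    have h2 : 2 + ArrayProgram.estimator.coefficient ≤ n ^ (2 + ArrayProgram.estimator.coefficient) :=
      (Nat.lt_pow_self hn1).le
    calc 2 + ArrayProgram.estimator.coefficient * n ^ ArrayProgram.estimator.degree
        ≤ n ^ ArrayProgram.estimator.degree * (2 + ArrayProgram.estimator.coefficient) := by nlinarith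
      _ ≤ n ^ ArrayProgram.estimator.degree * n ^ (2 + ArrayProgram.estimator.coefficient) := Nat.mul_le_mul_left _ h2
      _ = _ := (pow_add ..).symm
  · intro hgood
    refine hx fun z hz T v hv => (norm_outputVector_sub_le A hρ hgood hz hv).trans ?_
    gcongr
    -- The corruption term alone bounds the error, since the sample is large enough for the
    -- statistical fluctuation to be dominated by it; the other term is only added.
    exact le_add_of_nonneg_left (Real.sqrt_nonneg _)
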